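/- Let $d\in\{2,3\}$ and let $\Omega\subset\mathbb R^d$ be a bounded, connected, open set with Lipschitz boundary. Write $\|\cdot\|$, $(\cdot,\cdot)$ for the $L^2(\Omega)$ norm and inner product, $X=H^1_0(\Omega)^d$, $Q=L^2_0(\Omega)$, and $b^*(u,v,w)=\tfrac12(u\cdot\nabla v,w)-\tfrac12(u\cdot\nabla w,v)$. For $j=1,\dots,J$ let $(u_j,p_j)$ solve, for every $t\in(0,T]$, $$u_{j,t}+u_j\cdot\nabla u_j-\nu\Delta u_j+\nabla p_j=f_j,\qquad \nabla\cdot u_j=0\ \text{ in }\Omega,\qquad u_j=0\ \text{ on }\partial\Omega,$$ with $\nu,T>0$, $u_j\in H^3(0,T;H^3(\Omega))$ (continuous representative; in particular $u_j\in L^\infty(0,T;H^1(\Omega))\cap H^3(0,T;H^1(\Omega))$), $p_j\in L^2(0,T;H^2(\Omega))$ and $f_j\in L^2(0,T;L^2(\Omega))$, where $p_j(t)\in H^2(\Omega)$ and $f_j(t)\in L^2(\Omega)$ are defined for every $t\in[0,T]$. Let $\mathcal T$ be a conforming triangulation ($d=2$) or tetrahedralization ($d=3$) of $\Omega$ with maximum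 element diameter $h$ in which every element $K$ contains a ball of radius $\sigma\operatorname{diam}K$. Let $X_h\subset X$ and $Q_h\subset Q$ be the P2–P1 Taylor–Hood spaces on $\mathcal T$ ($C^0$ piecewise quadratic velocities, $C^0$ piecewise linear pressures), and assume that they satisfy the inverse inequality $h\|\nabla v_h\|\le C_{\rm inv}\|v_h\|$ for $v_h\in X_h$ and the discrete inf-sup condition $\sup_{v_h\in X_h,\ \|\nabla v_h\|\le1}(q_h,\nabla\cdot v_h)\ge\beta\|q_h\|$ for $q_h\in Q_h$, where $\sigma,C_{\rm inv},\beta>0$. Let $\Delta t>0$ with $N_T\Delta t=T$, $N_T\in\mathbb N$, and $t^n=n\Delta t$. For sequences $w_j^n$ put $$\langle w\rangle^n=\frac1J\sum_{j=1}^J(3w_j^n-3w_j^{n-1}+w_j^{n-2}),\qquad w_j'^{\,n}=3w_j^n-3w_j^{n-1}+w_j^{n-2}-\langle w\rangle^n .$$ Given $u_{j,h}^0,u_{j,h}^1,u_{j,h}^2\in X_h$, let $u_{j,h}^{n+1}\in X_h$ and $p_{j,h}^{n+1}\in Q_h$ satisfy, for $2\le n\le N_T-1$, all $v_h\in X_h$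 and all $q_h\in Q_h$, $$\Big(\tfrac{10u_{j,h}^{n+1}-15u_{j,h}^n+6u_{j,h}^{n-1}-u_{j,h}^{n-2}}{6\Delta t},v_h\Big)+b^*(\langle u_h\rangle^n,u_{j,h}^{n+1},v_h)+b^*(u_{j,h}'^{\,n},3u_{j,h}^n-3u_{j,h}^{n-1}+u_{j,h}^{n-2},v_h)$$ $$-(p_{j,h}^{n+1},\nabla\cdot v_h)+\nu(\nabla u_{j,h}^{n+1},\nabla v_h)=(f_j(t^{n+1}),v_h),\qquad(\nabla\cdot u_{j,h}^{n+1},q_h)=0 .$$ Then there is a constant $C_e>0$, depending only on $\Omega$, on the shape-regularity constant $\sigma$ and on the constant $C_{\rm inv}$ of the inverse inequality, such that the following holds. For every $M$ there is a constant $C>0$, depending on $\Omega,\sigma,C_{\rm inv},\beta,J,\nu,T,u_j,p_j,f_j$ and $M$, but not on $\mathcal T$, $h$, $\Delta t$ or the discrete solution, such that, whenever $\sum_{n=0}^{N_T}\Delta t\,\|p_j(t^n)\|_{H^2(\Omega)}^2\le M$ for all $j$ and $$C_e\frac{\Delta t}{\nu h}\|\nabla u_{j,h}'^{\,n}\|^2\le1\qquad\text{for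 } j=1,\dots,J,\ 2\le n\le N_T-1,$$ the errors $e_j^n=u_j(t^n)-u_{j,h}^n$ satisfy, for all $j$ and all $2<N\le N_T$, $$\tfrac12\|e_j^N\|^2+\tfrac12\|3e_j^N-e_j^{N-1}\|^2+\tfrac12\|3e_j^N-3e_j^{N-1}+e_j^{N-2}\|^2+\tfrac{9\nu\Delta t}{16}\|\nabla e_j^N\|^2$$ $$+\tfrac14\sum_{n=2}^{N-1}\|e_j^{n+1}-3e_j^n+3e_j^{n-1}-e_j^{n-2}\|^2+\tfrac{3\nu\Delta t}{8}\|\nabla e_j^{N-1}\|^2+\tfrac{3\nu\Delta t}{16}\|\nabla e_j^{N-2}\|^2$$ $$\le C\Big(h^4+\Delta t^4+\tfrac12\|e_j^2\|^2+\tfrac12\|3e_j^2-e_j^1\|^2+\tfrac12\|3e_j^2-3e_j^1+e_j^0\|^2$$ $$+\tfrac{9\nu\Delta t}{16}\|\nabla e_j^2\|^2+\tfrac{3\nu\Delta t}{8}\|\nabla e_j^1\|^2+\tfrac{3\nu\Delta t}{16}\|\nabla e_j^0\|^2\Big).$$ -/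

import Mathlib

open MeasureTheory Set
open scoped ContDiff

noncomputable section

namespace EnsembleNSE

/-! ### Lebesgue and Sobolev spaces on a domain -/

/-- `ℝᵈ` with the Euclidean norm. -/
abbrev E (d : ℕ) : Type := EuclideanSpace ℝ (Fin d)

/-- `L²(Ω)`, real valued. -/
abbrev L2 {d : ℕ} (Ω : Set (E d)) : Type := Lp ℝ 2 (volume.restrict Ω)

/-- `L²(Ω)ᵈ`. -/
abbrev L2V {d : ℕ} (Ω : Set (E d)) : Type := PiLp 2 (fun _ : Fin d => L2 Ω)

/-- `L²(Ω)^{d×d}`. -/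
abbrev L2T {d : ℕ} (Ω : Set (E d)) : Type := PiLp 2 (fun _ : Fin d × Fin d => L2 Ω)

/-- `φ ∈ C_c^∞(Ω)`. -/
def IsTest {d : ℕ} (Ω : Set (E d)) (φ : E d → ℝ) : Prop :=
  ContDiff ℝ ∞ φ ∧ HasCompactSupport φ ∧ tsupport φ ⊆ Ω

/-- The classical partial derivative of a smooth function. -/
def pd {d : ℕ} (i : Fin d) (φ : E d → ℝ) (x : E d) : ℝ :=
  fderiv ℝ φ x (EuclideanSpace.single i 1)

/-- `g` is the weak partial derivative `∂ᵢ u` in `Ω`. -/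
def IsWeakPartial {d : ℕ} (Ω : Set (E d)) (i : Fin d) (u g : L2 Ω) : Prop :=
  ∀ φ : E d → ℝ, IsTest Ω φ →
    ∫ x in Ω, u x * pd i φ x = -∫ x in Ω, g x * φ x

theorem IsTest.memLp {d : ℕ} {Ω : Set (E d)} {φ : E d → ℝ} (h : IsTest Ω φ) :
    MemLp φ 2 (volume.restrict Ω) :=
  (h.1.continuous.memLp_of_hasCompactSupport h.2.1).restrict Ω

theorem IsTest.memLp_pd {d : ℕ} {Ω : Set (E d)} {φ : E d → ℝ} (h : IsTest Ω φ) (i : Fin d) :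
    MemLp (pd i φ) 2 (volume.restrict Ω) := by
  have h1 : Continuous (pd i φ) :=
    (h.1.continuous_fderiv (by simp)).clm_apply continuous_const
  have h2 : HasCompactSupport (pd i φ) :=
    (h.2.1.fderiv (𝕜 := ℝ)).comp_left (g := fun L : E d →L[ℝ] ℝ =>
      L (EuclideanSpace.single i 1)) (by simp)
  exact (h1.memLp_of_hasCompactSupport h2).restrict Ω

theorem integral_mul_eq_inner {d : ℕ} {Ω : Set (E d)} {ψ : E d → ℝ}
    (h : MemLp ψ 2 (volume.restrict Ω)) (u : L2 Ω) :
    ∫ x in Ω, u x * ψ x = inner ℝ (h.toLp ψ) u := by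
  rw [L2.inner_def]
  refine integral_congr_ae ?_
  filter_upwards [h.coeFn_toLp] with x hx
  simp [hx]

theorem isWeakPartial_iff {d : ℕ} {Ω : Set (E d)} {i : Fin d} {u g : L2 Ω} :
    IsWeakPartial Ω i u g ↔ ∀ (φ : E d → ℝ) (h : IsTest Ω φ),
      inner ℝ ((h.memLp_pd i).toLp _) u = -inner ℝ (h.memLp.toLp φ) g := by
  refine forall₂_congr fun φ h => ?_
  rw [integral_mul_eq_inner (h.memLp_pd i), integral_mul_eq_inner h.memLp]

/-- Multi-indices `α ∈ ℕᵈ` with `|α| ≤ m`. -/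
abbrev MultiIndex (d m : ℕ) : Type :=
  {α : Fin d → Fin (m + 1) // ∑ i, (α i : ℕ) ≤ m}

/-- Families `(u_α)_{|α| ≤ m}` of `L²(Ω)` functions, with norm `(∑ ‖u_α‖²)^{1/2}`. -/
abbrev Jet {d : ℕ} (m : ℕ) (Ω : Set (E d)) : Type :=
  PiLp 2 (fun _ : MultiIndex d m => L2 Ω)

/-- The Sobolev space `Hᵐ(Ω) = W^{m,2}(Ω)` with its usual norm. A function `u` is recorded
together with its weak derivatives `(∂^α u)_{|α| ≤ m}`, which `u` determines. -/
def H {d : ℕ} (m : ℕ) (Ω : Set (E d)) : Submodule ℝ (Jet m Ω) where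
  carrier := {U | ∀ (i : Fin d) (α β : MultiIndex d m),
    (∀ k, (β.1 k : ℕ) = (α.1 k : ℕ) + if k = i then 1 else 0) →
      IsWeakPartial Ω i (U α) (U β)}
  zero_mem' := by
    intro i α β _
    rw [isWeakPartial_iff]
    intro φ h
    simp
  add_mem' := by
    intro U V hU hV i α β hαβ
    have h1 := hU i α β hαβ
    have h2 := hV i α β hαβ
    rw [isWeakPartial_iff] at h1 h2 ⊢
    intro φ h
    simp only [PiLp.add_apply, inner_add_right, h1 φ h, h2 φ h]
    ring
  smul_mem' := by
    intro c U hU i α β hαβ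
    have h1 := hU i α β hαβ
    rw [isWeakPartial_iff] at h1 ⊢
    intro φ h
    simp only [PiLp.smul_apply, inner_smul_right, h1 φ h]
    ring

/-- `Hᵐ(Ω)` is complete, so that Bochner integrals with values in it are meaningful. -/
instance instCompleteSpaceH {d : ℕ} (m : ℕ) (Ω : Set (E d)) : CompleteSpace (H m Ω) := by
  have hc : IsClosed ((H m Ω : Submodule ℝ (Jet m Ω)) : Set (Jet m Ω)) := by
    have : ((H m Ω : Submodule ℝ (Jet m Ω)) : Set (Jet m Ω)) =
        ⋂ (i : Fin d) (α : MultiIndex d m) (β : MultiIndex d m)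
          (_ : ∀ k, (β.1 k : ℕ) = (α.1 k : ℕ) + if k = i then 1 else 0)
          (φ : E d → ℝ) (h : IsTest Ω φ),
          {U : Jet m Ω | inner ℝ ((h.memLp_pd i).toLp _) (U α) =
            -inner ℝ (h.memLp.toLp φ) (U β)} := by
      ext U
      simp only [mem_iInter, mem_ofPred_eq]
      exact forall₄_congr fun i α β _ => isWeakPartial_iff
    rw [this]
    refine isClosed_iInter fun i => isClosed_iInter fun α => isClosed_iInter fun β =>
      isClosed_iInter fun _ => isClosed_iInter fun φ => isClosed_iInter fun h => ?_
    exact isClosed_eq (by fun_prop) (by fun_prop)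
  exact hc.completeSpace_coe

/-- `Hᵐ(Ω)ᵈ`. -/
abbrev HV {d : ℕ} (m : ℕ) (Ω : Set (E d)) : Type := PiLp 2 (fun _ : Fin d => H m Ω)

/-- The multi-index `0`. -/
def idx0 (d m : ℕ) : MultiIndex d m := ⟨fun _ => 0, by simp⟩

/-- The multi-index `eₖ` (first derivative in direction `k`). -/
def idx1 {d : ℕ} (m : ℕ) (k : Fin d) : MultiIndex d (m + 1) :=
  ⟨fun j => if j = k then 1 else 0, by
    have : ∀ j : Fin d, (((if j = k then 1 else 0 : Fin (m + 2)) : ℕ)) =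
        if j = k then 1 else 0 := fun j => by split_ifs <;> simp
    simp [this]⟩

/-- The multi-index `2eₖ` (second derivative in direction `k`). -/
def idx2 {d : ℕ} (m : ℕ) (k : Fin d) : MultiIndex d (m + 2) :=
  ⟨fun j => if j = k then ⟨2, by omega⟩ else 0, by
    have : ∀ j : Fin d, (((if j = k then ⟨2, by omega⟩ else 0 : Fin (m + 3)) : ℕ)) =
        if j = k then 2 else 0 := fun j => by split_ifs <;> simp
    simp [this]⟩

/-- The function itself, as an element of `L²(Ω)`. -/
def val {d m : ℕ} {Ω : Set (E d)} (u : H m Ω) : L2 Ω := u.1 (idx0 d m)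

/-- `∂ₖ u`. -/
def D1 {d m : ℕ} {Ω : Set (E d)} (k : Fin d) (u : H (m + 1) Ω) : L2 Ω := u.1 (idx1 m k)

/-- `∂ₖ∂ₖ u`. -/
def D2 {d m : ℕ} {Ω : Set (E d)} (k : Fin d) (u : H (m + 2) Ω) : L2 Ω := u.1 (idx2 m k)

/-- A multi-index of length at most `1` is one of length at most `m + 1`. -/
def idxLift {d m : ℕ} (α : MultiIndex d 1) : MultiIndex d (m + 1) :=
  ⟨fun k => Fin.castLE (by omega) (α.1 k), by
    have h : ∑ i, (α.1 i : ℕ) ≤ 1 := α.2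
    simp only [Fin.val_castLE]
    omega⟩

/-- The inclusion `H^{m+1}(Ω) ⊆ H¹(Ω)`. -/
def toH1 {d m : ℕ} {Ω : Set (E d)} (u : H (m + 1) Ω) : H 1 Ω :=
  ⟨WithLp.toLp 2 fun α => u.1 (idxLift α), fun i α β hαβ =>
    u.2 i (idxLift α) (idxLift β) (by simpa [idxLift] using hαβ)⟩

/-- The inclusion `H^{m+1}(Ω)ᵈ ⊆ H¹(Ω)ᵈ`. -/
def toHV1 {d m : ℕ} {Ω : Set (E d)} (u : HV (m + 1) Ω) : HV 1 Ω :=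
  WithLp.toLp 2 fun i => toH1 (u i)

/-- A vector field as an element of `L²(Ω)ᵈ`. -/
def valV {d m : ℕ} {Ω : Set (E d)} (u : HV m Ω) : L2V Ω := WithLp.toLp 2 fun i => val (u i)

/-- `∇u`, with entries `∂ₖ uᵢ` at `(i, k)`. -/
def grad {d m : ℕ} {Ω : Set (E d)} (u : HV (m + 1) Ω) : L2T Ω :=
  WithLp.toLp 2 fun ik => D1 ik.2 (u ik.1)

/-- `∇ · u`. -/
def dvg {d m : ℕ} {Ω : Set (E d)} (u : HV (m + 1) Ω) : L2 Ω := ∑ i, D1 i (u i)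

/-- `H₀¹(Ω)`: the closure of `C_c^∞(Ω)` in `H¹(Ω)`. -/
def H10 {d : ℕ} (Ω : Set (E d)) : Submodule ℝ (H 1 Ω) :=
  (Submodule.span ℝ {v : H 1 Ω | ∃ φ : E d → ℝ, IsTest Ω φ ∧
    (val v : E d → ℝ) =ᵐ[volume.restrict Ω] φ}).topologicalClosure

/-- `X = H₀¹(Ω)ᵈ`. -/
def X {d : ℕ} (Ω : Set (E d)) : Set (HV 1 Ω) := {v | ∀ i, v i ∈ H10 Ω}

/-- `(u · ∇v, w)`. -/
def conv {d : ℕ} {Ω : Set (E d)} (u v w : HV 1 Ω) : ℝ :=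
  ∫ x in Ω, ∑ i, ∑ k, val (u k) x * D1 k (v i) x * val (w i) x

/-- The skew-symmetric trilinear form `b*`. -/
def bstar {d : ℕ} {Ω : Set (E d)} (u v w : HV 1 Ω) : ℝ :=
  (1 / 2) * conv u v w - (1 / 2) * conv u w v

/-- A bounded, connected, open set whose boundary is locally the graph of a Lipschitz function
of the variables orthogonal to some direction `a`, with the set on one side of it. -/
structure IsLipschitzDomain {d : ℕ} (Ω : Set (E d)) : Prop where
  isOpen : IsOpen Ω
  isConnected : IsConnected Ω
  isBounded : Bornology.IsBounded Ω
  lipschitz : ∀ x ∈ frontier Ω, ∃ (r : ℝ) (a : E d) (K : NNReal) (g : E d → ℝ),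
    0 < r ∧ ‖a‖ = 1 ∧ LipschitzWith K g ∧ (∀ y (t : ℝ), g (y + t • a) = g y) ∧
      Ω ∩ Metric.ball x r = {y ∈ Metric.ball x r | inner ℝ a y < g y}

/-! ### Triangulations and Taylor–Hood spaces -/

/-- A simplicial complex in `ℝᵈ`: any two simplices meet in a common face, or not at all. -/
abbrev Mesh (d : ℕ) : Type := Geometry.SimplicialComplex ℝ (E d)

/-- The elements (`d`-dimensional simplices) of a mesh, given by their vertices. -/
def elements {d : ℕ} (𝒯 : Mesh d) : Set (Finset (E d)) := {s ∈ 𝒯.faces | s.card = d + 1}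

/-- The closed simplex with the given vertices. -/
def cell {d : ℕ} (s : Finset (E d)) : Set (E d) := convexHull ℝ (s : Set (E d))

/-- A conforming triangulation of `Ω`. -/
structure IsTriangulation {d : ℕ} (Ω : Set (E d)) (𝒯 : Mesh d) : Prop where
  finite : 𝒯.faces.Finite
  pure : ∀ s ∈ 𝒯.faces, ∃ t ∈ elements 𝒯, s ⊆ t
  covers : ⋃ s ∈ elements 𝒯, cell s = closure Ω

/-- The mesh size: the maximum element diameter. -/
def meshSize {d : ℕ} (𝒯 : Mesh d) : ℝ :=
  sSup ((fun s => Metric.diam (cell s)) '' elements 𝒯)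

/-- Shape regularity (a minimum angle condition): every element contains a ball of radius at
least `σ` times its diameter. -/
def IsShapeRegular {d : ℕ} (σ : ℝ) (𝒯 : Mesh d) : Prop :=
  ∀ s ∈ elements 𝒯, ∃ c : E d, Metric.closedBall c (σ * Metric.diam (cell s)) ⊆ cell s

/-- `w` is continuous on `Ω̄` and a polynomial of degree at most `k` on every closed element. -/
def IsPiecewisePoly {d : ℕ} (Ω : Set (E d)) (𝒯 : Mesh d) (k : ℕ) (w : E d → ℝ) : Prop :=
  ContinuousOn w (closure Ω) ∧ ∀ s ∈ elements 𝒯, ∃ P : MvPolynomial (Fin d) ℝ,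
    P.totalDegree ≤ k ∧ ∀ x ∈ cell s, w x = MvPolynomial.eval (fun i => x i) P

/-- The `L²(Ω)` functions that have a `C⁰` piecewise `Pₖ` representative. -/
def FE {d : ℕ} (Ω : Set (E d)) (𝒯 : Mesh d) (k : ℕ) : Set (L2 Ω) :=
  {q | ∃ w : E d → ℝ, IsPiecewisePoly Ω 𝒯 k w ∧ (q : E d → ℝ) =ᵐ[volume.restrict Ω] w}

/-- The velocity space `X_h ⊆ X`: continuous piecewise quadratics. -/
def Xh {d : ℕ} (Ω : Set (E d)) (𝒯 : Mesh d) : Set (HV 1 Ω) :=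
  {v | v ∈ X Ω ∧ ∀ i, val (v i) ∈ FE Ω 𝒯 2}

/-- The pressure space `Q_h ⊆ Q = L²₀(Ω)`: continuous piecewise linears of mean zero. -/
def Qh {d : ℕ} (Ω : Set (E d)) (𝒯 : Mesh d) : Set (L2 Ω) :=
  {q | q ∈ FE Ω 𝒯 1 ∧ ∫ x in Ω, q x = 0}

/-- The discrete inf-sup condition with constant `β`:
`sup_{v ∈ X_h, ‖∇v‖ ≤ 1} (q, ∇·v) ≥ β ‖q‖` for `q ∈ Q_h` (the supremum is attained, as `X_h` is
finite dimensional). -/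
def LBB {d : ℕ} (Ω : Set (E d)) (𝒯 : Mesh d) (β : ℝ) : Prop :=
  ∀ q ∈ Qh Ω 𝒯, ∃ v ∈ Xh Ω 𝒯, ‖grad v‖ ≤ 1 ∧ β * ‖q‖ ≤ inner ℝ q (dvg v)

/-- The inverse inequality with constant `Cinv`. -/
def InverseInequality {d : ℕ} (Ω : Set (E d)) (𝒯 : Mesh d) (Cinv : ℝ) : Prop :=
  ∀ v ∈ Xh Ω 𝒯, meshSize 𝒯 * ‖grad v‖ ≤ Cinv * ‖valV v‖

/-! ### The Navier–Stokes ensemble -/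

/-- `u' ∈ L¹(0,T;F)` is the time derivative of the absolutely continuous `u : [0,T] → F`. -/
def IsTimeDeriv {F : Type*} [NormedAddCommGroup F] [NormedSpace ℝ F] (T : ℝ)
    (u u' : ℝ → F) : Prop :=
  IntegrableOn u' (Ioc 0 T) ∧ ∀ t ∈ Icc 0 T, u t = u 0 + ∫ s in (0 : ℝ)..t, u' s

/-- `u ∈ L²(0,T;F)`. -/
def MemL2Time {F : Type*} [NormedAddCommGroup F] (T : ℝ) (u : ℝ → F) : Prop :=
  MemLp u 2 (volume.restrict (Ioc 0 T))

/-- `u ∈ H³(0,T;F)` (continuous representative), with first time derivative `ut`. -/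
def MemH3Time {F : Type*} [NormedAddCommGroup F] [NormedSpace ℝ F] (T : ℝ)
    (u ut : ℝ → F) : Prop :=
  ∃ utt uttt : ℝ → F, IsTimeDeriv T u ut ∧ IsTimeDeriv T ut utt ∧ IsTimeDeriv T utt uttt ∧
    MemL2Time T uttt

/-- `(u, p)` solves the incompressible Navier–Stokes equations on `Ω × (0,T]` with viscosity `ν`,
body force `f` and homogeneous Dirichlet boundary condition, and has the regularity
`u ∈ H³(0,T;H³(Ω))`, `p ∈ L²(0,T;H²(Ω))`, `f ∈ L²(0,T;L²(Ω))`; `ut` is the time derivative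
of `u`. -/
structure IsNSESolution {d : ℕ} (Ω : Set (E d)) (ν T : ℝ) (u ut : ℝ → HV 3 Ω)
    (p : ℝ → H 2 Ω) (f : ℝ → L2V Ω) : Prop where
  reg_u : MemH3Time T u ut
  reg_p : MemL2Time T p
  reg_f : MemL2Time T f
  momentum : ∀ t ∈ Ioc 0 T, ∀ i : Fin d, ∀ᵐ x ∂(volume.restrict Ω),
    val (ut t i) x + ∑ k, val (u t k) x * D1 k (u t i) x
      - ν * ∑ k, D2 k (u t i) x + D1 i (p t) x = f t i x
  incompressible : ∀ t ∈ Icc 0 T, dvg (u t) = 0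
  boundary : ∀ t ∈ Icc 0 T, toHV1 (u t) ∈ X Ω

/-! ### The discrete method -/

/-- `3wⁿ - 3wⁿ⁻¹ + wⁿ⁻²` (used for `n ≥ 2`). -/
def extrap {d : ℕ} {Ω : Set (E d)} (w : ℕ → HV 1 Ω) (n : ℕ) : HV 1 Ω :=
  (3 : ℝ) • w n - (3 : ℝ) • w (n - 1) + w (n - 2)

/-- The ensemble mean `⟨w⟩ⁿ`. -/
def mean {d J : ℕ} {Ω : Set (E d)} (w : Fin J → ℕ → HV 1 Ω) (n : ℕ) : HV 1 Ω :=
  (1 / (J : ℝ)) • ∑ j, extrap (w j) n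

/-- The fluctuation `w_j'ⁿ`. -/
def fluct {d J : ℕ} {Ω : Set (E d)} (w : Fin J → ℕ → HV 1 Ω) (j : Fin J) (n : ℕ) : HV 1 Ω :=
  extrap (w j) n - mean w n

/-- `(uh, ph)` is produced by the fully discrete ensemble method with time step `Δt` up to time
level `NT`, from starting values `uh j 0`, `uh j 1`, `uh j 2`. -/
structure IsDiscreteSolution {d J : ℕ} (Ω : Set (E d)) (𝒯 : Mesh d) (ν Δt : ℝ) (NT : ℕ)
    (f : Fin J → ℝ → L2V Ω) (uh : Fin J → ℕ → HV 1 Ω) (ph : Fin J → ℕ → L2 Ω) : Prop where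
  mem_Xh : ∀ j, ∀ n ≤ NT, uh j n ∈ Xh Ω 𝒯
  mem_Qh : ∀ j, ∀ n, 3 ≤ n → n ≤ NT → ph j n ∈ Qh Ω 𝒯
  momentum : ∀ j, ∀ n, 2 ≤ n → n + 1 ≤ NT → ∀ v ∈ Xh Ω 𝒯,
    inner ℝ (valV ((1 / (6 * Δt)) • ((10 : ℝ) • uh j (n + 1) - (15 : ℝ) • uh j n
        + (6 : ℝ) • uh j (n - 1) - uh j (n - 2)))) (valV v)
      + bstar (mean uh n) (uh j (n + 1)) v
      + bstar (fluct uh j n) (extrap (uh j) n) v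
      - inner ℝ (ph j (n + 1)) (dvg v)
      + ν * inner ℝ (grad (uh j (n + 1))) (grad v)
      = inner ℝ (f j (((n + 1 : ℕ) : ℝ) * Δt)) (valV v)
  incompressible : ∀ j, ∀ n, 2 ≤ n → n + 1 ≤ NT → ∀ q ∈ Qh Ω 𝒯,
    inner ℝ (dvg (uh j (n + 1))) q = 0

/-- The error `eⁿ = u(tⁿ) - u_hⁿ`, `tⁿ = nΔt`. -/
def err {d : ℕ} {Ω : Set (E d)} (Δt : ℝ) (u : ℝ → HV 3 Ω) (uh : ℕ → HV 1 Ω) (n : ℕ) : HV 1 Ω :=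
  toHV1 (u ((n : ℝ) * Δt)) - uh n

/-- The square of the discrete norm `|||p|||_{2,2}`. -/
def discreteNormSq {d : ℕ} {Ω : Set (E d)} (Δt : ℝ) (NT : ℕ) (p : ℝ → H 2 Ω) : ℝ :=
  ∑ n ∈ Finset.range (NT + 1), ‖p ((n : ℝ) * Δt)‖ ^ 2 * Δt

/-- The part of the energy that depends on the time levels `n`, `n - 1`, `n - 2` (for `n ≥ 2`). -/
def energy {d : ℕ} {Ω : Set (E d)} (ν Δt : ℝ) (e : ℕ → HV 1 Ω) (n : ℕ) : ℝ :=
  1 / 2 * ‖valV (e n)‖ ^ 2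
    + 1 / 2 * ‖valV ((3 : ℝ) • e n - e (n - 1))‖ ^ 2
    + 1 / 2 * ‖valV ((3 : ℝ) • e n - (3 : ℝ) • e (n - 1) + e (n - 2))‖ ^ 2
    + 9 * ν * Δt / 16 * ‖grad (e n)‖ ^ 2
    + 3 * ν * Δt / 8 * ‖grad (e (n - 1))‖ ^ 2
    + 3 * ν * Δt / 16 * ‖grad (e (n - 2))‖ ^ 2

end EnsembleNSE

end

open EnsembleNSE

noncomputable section

namespace EnsembleNSE
open MeasureTheory Set Filter Topology
open scoped ContDiff NNReal ENNReal

/-! ### Linear structure of the Sobolev spaces -/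

section Linear

variable {d m : ℕ} {Ω : Set (E d)}

/-! Let R u be a discretely divergence-free function whose gradient is the L² projection of ∇u onto
the gradients of all such functions. The error is split as e = η − ξ with η = u − R u and ξ = u_h −
R u. The bounds on η are approximation theory; ξ is controlled by testing the error equation with
ξ^{n+1}.

The difference quotient satisfies a discrete energy identity (`inner_dt4_self`): 6Δt times its
product with ξ^{n+1} is the increment of a sum of three squares plus ½‖δξ‖², where δ is the third
difference. Together with the viscous term this supplies two positive quantities, 6νΔt‖∇ξ^{n+1}‖²
and ½‖δξ‖². The ensemble mean is the extrapolation minus the fluctuation u', and the new level minus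
the extrapolation is δu_h. So the two nonlinear terms combine into convection by the extrapolated
velocity minus b*(u', δu_h, ·): treating the fluctuation explicitly costs only a third difference
(`error_identity`).

The dangerous piece is b*(u', δξ, ξ^{n+1}). Interpolating L³ between L² and L⁶ bounds it by ‖∇u'‖
(‖δξ‖‖∇δξ‖)^{1/2} ‖∇ξ^{n+1}‖, and the inverse inequality turns the half power of ‖∇δξ‖ into
h^{-1/2}. The time step condition says exactly that the result is absorbed by half of ½‖δξ‖² and
half of the viscous term (`young_absorb`). This gives C_e = 12K²C_inv, where K is the constant of
the trilinear estimates and depends on Ω only. Convection by the extrapolated error leaves a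
multiple of the energy at the old levels (`error_step`), so an explicit Grönwall inequality
(`discrete_gronwall`) closes the estimate without any smallness of Δt.

The sources are of three kinds. Consistency errors in time are Taylor remainders, and u_ttt ∈ L² in
time yields Δt⁴ after summation (`exists_time_bounds`). Discretely divergence-free functions
annihilate the discrete pressures, so only the distance of p to the piecewise linears is felt.
Finally, the projection is linear on gradients, so a time difference of η is the projection error of
the same time difference of u, and no negative power of Δt appears.

There remains the approximation property, of order h² (`exists_approxBound`); the inf-sup condition
transfers it from X_h to the discretely divergence-free functions (`exists_mem_Vhsub`). It is
obtained by Lagrange interpolation, compared on each element with averaged Taylor polynomials. These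
approximate H² functions pointwise when d ≤ 3 (`abs_sub_affApprox_le`). Nodal values must make sense
up to the boundary: for the pressure this follows from cones inside a Lipschitz domain
(`exists_tendsto_closure`), for the velocity from a Lipschitz representative on the whole space
(`exists_lipschitz_rep`). The quadratic interpolant must moreover lie in H₀¹: it vanishes outside Ω
(`pq_eq_zero`), and Lipschitz functions with this property belong to H₀¹
(`exists_H10_of_lipschitz`). -/

@[simp] theorem val_add (u v : H m Ω) : val (u + v) = val u + val v := rfl
@[simp] theorem val_sub (u v : H m Ω) : val (u - v) = val u - val v := rfl
@[simp] theorem val_smul (c : ℝ) (u : H m Ω) : val (c • u) = c • val u := rfl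
@[simp] theorem D1_add (k : Fin d) (u v : H (m + 1) Ω) : D1 k (u + v) = D1 k u + D1 k v := rfl
@[simp] theorem D1_sub (k : Fin d) (u v : H (m + 1) Ω) : D1 k (u - v) = D1 k u - D1 k v := rfl
@[simp] theorem D1_smul (k : Fin d) (c : ℝ) (u : H (m + 1) Ω) : D1 k (c • u) = c • D1 k u := rfl
@[simp] theorem D1_zero (k : Fin d) : D1 k (0 : H (m + 1) Ω) = 0 := rfl

/-- `val` as a linear map. -/
def valₗ (m : ℕ) (Ω : Set (E d)) : H m Ω →ₗ[ℝ] L2 Ω where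
  toFun := val
  map_add' := val_add
  map_smul' := val_smul

/-- `valV` as a linear map. -/
def valVₗ (m : ℕ) (Ω : Set (E d)) : HV m Ω →ₗ[ℝ] L2V Ω where
  toFun := valV
  map_add' _ _ := rfl
  map_smul' _ _ := rfl

/-- `grad` as a linear map. -/
def gradₗ (m : ℕ) (Ω : Set (E d)) : HV (m + 1) Ω →ₗ[ℝ] L2T Ω where
  toFun := grad
  map_add' _ _ := rfl
  map_smul' _ _ := rfl

/-- `dvg` as a linear map. -/
def dvgₗ (m : ℕ) (Ω : Set (E d)) : HV (m + 1) Ω →ₗ[ℝ] L2 Ω where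
  toFun := dvg
  map_add' u v := by simp [dvg, Finset.sum_add_distrib]
  map_smul' c u := by simp [dvg, Finset.smul_sum]

/-- `toHV1` as a linear map. -/
def toHV1ₗ (m : ℕ) (Ω : Set (E d)) : HV (m + 1) Ω →ₗ[ℝ] HV 1 Ω where
  toFun := toHV1
  map_add' _ _ := rfl
  map_smul' _ _ := rfl

theorem valV_add (u v : HV m Ω) : valV (u + v) = valV u + valV v := rfl
theorem valV_sub (u v : HV m Ω) : valV (u - v) = valV u - valV v := rfl
theorem valV_smul (c : ℝ) (u : HV m Ω) : valV (c • u) = c • valV u := rfl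
theorem grad_add (u v : HV (m + 1) Ω) : grad (u + v) = grad u + grad v := rfl
theorem grad_sub (u v : HV (m + 1) Ω) : grad (u - v) = grad u - grad v := rfl
theorem dvg_add (u v : HV (m + 1) Ω) : dvg (u + v) = dvg u + dvg v := (dvgₗ m Ω).map_add u v
theorem dvg_sub (u v : HV (m + 1) Ω) : dvg (u - v) = dvg u - dvg v := (dvgₗ m Ω).map_sub u v
theorem dvg_smul (c : ℝ) (u : HV (m + 1) Ω) : dvg (c • u) = c • dvg u := (dvgₗ m Ω).map_smul c u
theorem idxLift_idx0 : idxLift (m := m) (idx0 d 1) = idx0 d (m + 1) := by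
  ext k; simp [idxLift, idx0]

theorem idxLift_idx1 (k : Fin d) : idxLift (m := m) (idx1 0 k) = idx1 m k := by
  ext j; simp only [idxLift, idx1]; split_ifs <;> simp

@[simp] theorem val_toH1 (u : H (m + 1) Ω) : val (toH1 u) = val u := by
  simp [val, toH1, idxLift_idx0]

@[simp] theorem D1_toH1 (k : Fin d) (u : H (m + 1) Ω) : D1 k (toH1 u) = D1 k u := by
  simp [D1, toH1, idxLift_idx1]

theorem grad_toHV1 (u : HV (m + 1) Ω) : grad (toHV1 u) = grad u := by
  ext1 ik
  simp [grad, toHV1]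

theorem valV_toHV1 (u : HV (m + 1) Ω) : valV (toHV1 u) = valV u := by
  ext1 i
  simp [valV, toHV1]

theorem dvg_toHV1 (u : HV (m + 1) Ω) : dvg (toHV1 u) = dvg u := by
  simp [dvg, toHV1]

theorem norm_sq_valV (v : HV m Ω) : ‖valV v‖ ^ 2 = ∑ i, ‖val (v i)‖ ^ 2 := by
  rw [PiLp.norm_sq_eq_of_L2]; rfl

theorem norm_sq_grad (v : HV (m + 1) Ω) :
    ‖grad v‖ ^ 2 = ∑ i, ∑ k, ‖D1 k (v i)‖ ^ 2 := by
  rw [PiLp.norm_sq_eq_of_L2, Fintype.sum_prod_type]; rfl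

theorem norm_sq_H (u : H m Ω) : ‖u‖ ^ 2 = ∑ α, ‖u.1 α‖ ^ 2 := by
  rw [← Submodule.norm_coe, PiLp.norm_sq_eq_of_L2]

theorem idx1_injective : Function.Injective (idx1 m : Fin d → MultiIndex d (m + 1)) := by
  intro k l h
  have h2 := congrFun (congrArg Subtype.val h) k
  by_contra hne
  simp [idx1, hne] at h2

theorem norm_val_le (u : H m Ω) : ‖val u‖ ≤ ‖u‖ := by
  refine le_of_sq_le_sq ?_ (norm_nonneg _)
  rw [norm_sq_H]
  exact Finset.single_le_sum (f := fun α => ‖u.1 α‖ ^ 2) (fun _ _ => sq_nonneg _)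
    (Finset.mem_univ (idx0 d m))

theorem sum_norm_sq_D1_le (u : H (m + 1) Ω) : ∑ k, ‖D1 k u‖ ^ 2 ≤ ‖u‖ ^ 2 := by
  rw [norm_sq_H]
  have h : ∑ k, ‖D1 k u‖ ^ 2 = ∑ α ∈ Finset.univ.image (idx1 m), ‖u.1 α‖ ^ 2 := by
    rw [Finset.sum_image fun a _ b _ h => idx1_injective h]; rfl
  rw [h]
  exact Finset.sum_le_sum_of_subset_of_nonneg (Finset.subset_univ _) fun _ _ _ => sq_nonneg _

theorem norm_valV_le (u : HV m Ω) : ‖valV u‖ ≤ ‖u‖ := by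
  refine le_of_sq_le_sq ?_ (norm_nonneg _)
  rw [norm_sq_valV, PiLp.norm_sq_eq_of_L2]
  exact Finset.sum_le_sum fun i _ => pow_le_pow_left₀ (norm_nonneg _) (norm_val_le _) 2

theorem norm_grad_le (u : HV (m + 1) Ω) : ‖grad u‖ ≤ ‖u‖ := by
  refine le_of_sq_le_sq ?_ (norm_nonneg _)
  rw [norm_sq_grad, PiLp.norm_sq_eq_of_L2]
  exact Finset.sum_le_sum fun i _ => sum_norm_sq_D1_le _

theorem norm_D1_le_grad (u : HV (m + 1) Ω) (i k : Fin d) : ‖D1 k (u i)‖ ≤ ‖grad u‖ := by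
  refine le_of_sq_le_sq ?_ (norm_nonneg _)
  rw [norm_sq_grad]
  exact (Finset.single_le_sum (f := fun k => ‖D1 k (u i)‖ ^ 2) (fun _ _ => sq_nonneg _)
    (Finset.mem_univ k)).trans (Finset.single_le_sum (f := fun i => ∑ k, ‖D1 k (u i)‖ ^ 2)
      (fun _ _ => Finset.sum_nonneg fun _ _ => sq_nonneg _) (Finset.mem_univ i))

theorem norm_val_le_valV (u : HV m Ω) (i : Fin d) : ‖val (u i)‖ ≤ ‖valV u‖ :=
  PiLp.norm_apply_le (valV u) i

theorem norm_dvg_le (u : HV (m + 1) Ω) : ‖dvg u‖ ≤ d * ‖grad u‖ := by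
  refine (norm_sum_le _ _).trans ?_
  refine (Finset.sum_le_sum fun i _ => norm_D1_le_grad u i i).trans ?_
  simp

/-- One nonzero exponent already exhausts the length, so a jet of order one is just the value and
the `d` first derivatives. `norm_sq_H1`, `H1_ext` and `mkH1` rest on this. -/
theorem multiIndex_one_cases (α : MultiIndex d 1) : α = idx0 d 1 ∨ ∃ k, α = idx1 0 k := by
  by_cases h : ∀ k, α.1 k = 0
  · left; ext k; simp [h k, idx0]
  · right
    push Not at h
    obtain ⟨k, hk⟩ := h
    refine ⟨k, ?_⟩
    have hk1 : (α.1 k : ℕ) = 1 := by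
      have := (α.1 k).2
      have : (α.1 k : ℕ) ≠ 0 := fun h => hk (Fin.ext h)
      omega
    ext j
    by_cases hj : j = k
    · subst hj; simp [idx1, hk1]
    · have h2 := α.2
      have h3 : (α.1 j : ℕ) + (α.1 k : ℕ) ≤ ∑ i, (α.1 i : ℕ) := by
        rw [← Finset.sum_pair hj (f := fun i => (α.1 i : ℕ))]
        exact Finset.sum_le_sum_of_subset (Finset.subset_univ _)
      simp [idx1, hj]; omega

theorem isWeakPartial_val_D1 (k : Fin d) (u : H (m + 1) Ω) : IsWeakPartial Ω k (val u) (D1 k u) := by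
  refine u.2 k (idx0 d _) (idx1 m k) fun j => ?_
  simp only [idx0, idx1]; split_ifs <;> simp

theorem norm_sq_H1 (u : H 1 Ω) : ‖u‖ ^ 2 = ‖val u‖ ^ 2 + ∑ k, ‖D1 k u‖ ^ 2 := by
  classical
  rw [norm_sq_H]
  have huniv : (Finset.univ : Finset (MultiIndex d 1)) =
      insert (idx0 d 1) (Finset.univ.image (idx1 0)) := by
    ext α
    simp only [Finset.mem_univ, Finset.mem_insert, Finset.mem_image, true_and, true_iff]
    rcases multiIndex_one_cases α with h | ⟨k, h⟩
    · exact Or.inl h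
    · exact Or.inr ⟨k, h.symm⟩
  have hnot : idx0 d 1 ∉ Finset.univ.image (idx1 (d := d) 0) := by
    simp only [Finset.mem_image, Finset.mem_univ, true_and, not_exists]
    intro k h
    have h2 := congrFun (congrArg Subtype.val h) k
    simp [idx1, idx0] at h2
  rw [huniv, Finset.sum_insert hnot, Finset.sum_image fun a _ b _ h => idx1_injective h]
  rfl

end Linear

/-! ### Weak derivatives -/

section Weak

variable {d : ℕ} {Ω : Set (E d)}

/-- The fundamental lemma of the calculus of variations. Test functions vanish off Ω, which lets the
integral be taken over the whole space. -/
theorem eq_zero_of_forall_isTest (hΩ : IsOpen Ω) {g : L2 Ω}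
    (h : ∀ φ, IsTest Ω φ → ∫ x in Ω, g x * φ x = 0) : g = 0 := by
  have hloc : LocallyIntegrableOn (fun x => g x) Ω volume :=
    locallyIntegrableOn_of_locallyIntegrable_restrict
      ((Lp.memLp g).locallyIntegrable (by norm_num))
  have key := hΩ.ae_eq_zero_of_integral_contDiff_smul_eq_zero hloc (fun φ h1 h2 h3 => by
    have h4 := h φ ⟨h1, h2, h3⟩
    rw [setIntegral_eq_integral_of_forall_compl_eq_zero] at h4
    · simpa [mul_comm] using h4
    · intro x hx
      have : φ x = 0 := image_eq_zero_of_notMem_tsupport fun h => hx (h3 h)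
      simp [this])
  refine Lp.ext ?_
  have h2 := (ae_restrict_iff' hΩ.measurableSet).2 key
  filter_upwards [h2, Lp.coeFn_zero ℝ 2 (volume.restrict Ω)] with x hx h0
  rw [hx, h0]; rfl

theorem IsWeakPartial.unique (hΩ : IsOpen Ω) {i : Fin d} {u g g' : L2 Ω}
    (h : IsWeakPartial Ω i u g) (h' : IsWeakPartial Ω i u g') : g = g' := by
  rw [← sub_eq_zero]
  refine eq_zero_of_forall_isTest hΩ fun φ hφ => ?_
  rw [isWeakPartial_iff] at h h'
  have h1 := h φ hφ
  have h2 := h' φ hφ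
  rw [integral_mul_eq_inner hφ.memLp, inner_sub_right]
  linarith

/-- An element of `H 1 Ω` carries its derivatives as data; on an open set weak derivatives are
unique, so the value alone determines the element. -/
theorem H1_ext (hΩ : IsOpen Ω) {u v : H 1 Ω} (h : val u = val v) : u = v := by
  apply Subtype.ext
  ext1 α
  rcases multiIndex_one_cases α with rfl | ⟨k, rfl⟩
  · exact h
  · have h1 := isWeakPartial_val_D1 k u
    rw [h] at h1
    exact h1.unique hΩ (isWeakPartial_val_D1 k v)

/-- The element of `H¹(Ω)` with given function and weak partial derivatives. -/
def mkH1 (u : L2 Ω) (g : Fin d → L2 Ω) (h : ∀ i, IsWeakPartial Ω i u (g i)) : H 1 Ω :=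
  ⟨WithLp.toLp 2 fun α => if hα : ∃ k, α = idx1 0 k then g hα.choose else u, by
    intro i α β hαβ
    have h0 : ∀ k : Fin d, idx1 0 k ≠ idx0 d 1 := fun k h => by
      have h2 := congrFun (congrArg Subtype.val h) k
      simp [idx1, idx0] at h2
    rcases multiIndex_one_cases α with rfl | ⟨k, rfl⟩
    · have hβ : β = idx1 0 i := by
        ext k
        rw [hαβ k]
        simp only [idx0, idx1]; split_ifs <;> simp
      subst hβ
      have hu : ¬ ∃ k, idx0 d 1 = idx1 0 k := fun ⟨k, hk⟩ => h0 k hk.symm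
      have hex : ∃ k, idx1 (d := d) 0 i = idx1 0 k := ⟨i, rfl⟩
      have hi : hex.choose = i := (idx1_injective hex.choose_spec).symm
      simp only [hu, hex, dite_true, dite_false]
      rw [hi]
      exact h i
    -- For α = eₖ the condition is vacuous: β would have length two.
    · exfalso
      have hs : ∑ j, (β.1 j : ℕ) = ∑ j, ((idx1 0 k).1 j : ℕ) + 1 := by
        simp_rw [hαβ]
        rw [Finset.sum_add_distrib]; simp
      have h1 : 1 ≤ ∑ j, ((idx1 (d := d) 0 k).1 j : ℕ) := by
        refine le_trans ?_ (Finset.single_le_sum (fun _ _ => Nat.zero_le _) (Finset.mem_univ k))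
        simp [idx1]
      have := β.2
      omega⟩

theorem val_mkH1 {u : L2 Ω} {g : Fin d → L2 Ω} (h : ∀ i, IsWeakPartial Ω i u (g i)) :
    val (mkH1 u g h) = u := by
  have hu : ¬ ∃ k, idx0 d 1 = idx1 0 k := fun ⟨k, hk⟩ => by
    have h2 := congrFun (congrArg Subtype.val hk) k
    simp [idx1, idx0] at h2
  simp [val, mkH1, hu]

theorem D1_mkH1 {u : L2 Ω} {g : Fin d → L2 Ω} (h : ∀ i, IsWeakPartial Ω i u (g i)) (k : Fin d) :
    D1 k (mkH1 u g h) = g k := by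
  have hex : ∃ l, idx1 (d := d) 0 k = idx1 0 l := ⟨k, rfl⟩
  have hi : hex.choose = k := (idx1_injective hex.choose_spec).symm
  simp only [D1, mkH1, hex, dite_true]
  rw [hi]

/-- Polarisation of `norm_sq_H1`. -/
theorem inner_H1 (u v : H 1 Ω) :
    inner ℝ u v = inner ℝ (val u) (val v) + ∑ k, inner ℝ (D1 k u) (D1 k v) := by
  have h1 := norm_sq_H1 (u + v)
  have h2 : ∀ k, ‖D1 k (u + v)‖ ^ 2 =
      ‖D1 k u‖ ^ 2 + 2 * inner ℝ (D1 k u) (D1 k v) + ‖D1 k v‖ ^ 2 := fun k =>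
    norm_add_sq_real (D1 k u) (D1 k v)
  simp_rw [h2, Finset.sum_add_distrib, ← Finset.mul_sum] at h1
  rw [norm_add_sq_real, val_add, norm_add_sq_real, norm_sq_H1 u, norm_sq_H1 v] at h1
  linarith

end Weak

/-! ### Test functions and `H₀¹` -/

section Test

variable {d : ℕ} {Ω : Set (E d)}

theorem lineDeriv_single_eq_pd {φ : E d → ℝ} (h : Differentiable ℝ φ) (i : Fin d) (x : E d) :
    lineDeriv ℝ φ x (EuclideanSpace.single i 1) = pd i φ x :=
  (h x).lineDeriv_eq_fderiv

theorem IsTest.lipschitz {φ : E d → ℝ} (h : IsTest Ω φ) : ∃ C, LipschitzWith C φ :=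
  (h.1.of_le (by simp)).lipschitzWith_of_hasCompactSupport h.2.1 one_ne_zero

/-- Integration by parts of a Lipschitz function against a test function. -/
theorem LipschitzWith.setIntegral_mul_pd {f φ : E d → ℝ} {C : ℝ≥0} (hf : LipschitzWith C f)
    (hφ : IsTest Ω φ) (i : Fin d) :
    ∫ x in Ω, f x * pd i φ x =
      -∫ x in Ω, lineDeriv ℝ f x (EuclideanSpace.single i 1) * φ x := by
  obtain ⟨D, hD⟩ := hφ.lipschitz
  have h0 : ∀ x, x ∉ Ω → φ x = 0 := fun x hx =>
    image_eq_zero_of_notMem_tsupport fun h => hx (hφ.2.2 h)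
  have h1 : ∀ x, x ∉ Ω → pd i φ x = 0 := fun x hx => by
    have : fderiv ℝ φ x = 0 := image_eq_zero_of_notMem_tsupport fun h =>
      hx (hφ.2.2 (tsupport_fderiv_subset ℝ h))
    simp [pd, this]
  -- The test function and its derivatives vanish off Ω, so both integrals extend to the whole space
  -- and the boundary of Ω plays no role.
  rw [setIntegral_eq_integral_of_forall_compl_eq_zero (fun x hx => by simp [h1 x hx]),
    setIntegral_eq_integral_of_forall_compl_eq_zero (fun x hx => by simp [h0 x hx])]
  have key := hf.integral_lineDeriv_mul_eq (μ := volume) hD hφ.2.1 (EuclideanSpace.single i 1)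
  rw [key, ← integral_neg]
  refine integral_congr_ae (Eventually.of_forall fun x => ?_)
  have hd : Differentiable ℝ φ := hφ.1.differentiable (by simp)
  simp only
  rw [(hd x).lineDeriv_eq_fderiv, map_neg]
  simp only [pd]; ring

/-- A test function as an element of `H¹(Ω)`. -/
def IsTest.toH {φ : E d → ℝ} (h : IsTest Ω φ) : H 1 Ω :=
  mkH1 (h.memLp.toLp φ) (fun i => (h.memLp_pd i).toLp (pd i φ)) (by
    intro i ψ hψ
    obtain ⟨C, hC⟩ := h.lipschitz
    have key := LipschitzWith.setIntegral_mul_pd hC hψ i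
    have hd : Differentiable ℝ φ := h.1.differentiable (by simp)
    simp_rw [lineDeriv_single_eq_pd hd] at key
    rw [← (integral_congr_ae (h.memLp.coeFn_toLp.mono fun x hx => by simp only [hx]) :
      ∫ x in Ω, h.memLp.toLp φ x * pd i ψ x = _)] at key
    rw [key]
    congr 1
    exact integral_congr_ae ((h.memLp_pd i).coeFn_toLp.mono fun x hx => by simp only [hx]))

theorem IsTest.val_toH {φ : E d → ℝ} (h : IsTest Ω φ) : val h.toH = h.memLp.toLp φ := val_mkH1 _

theorem IsTest.D1_toH {φ : E d → ℝ} (h : IsTest Ω φ) (k : Fin d) :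
    D1 k h.toH = (h.memLp_pd k).toLp (pd k φ) := D1_mkH1 _ k

theorem IsTest.add {φ ψ : E d → ℝ} (h : IsTest Ω φ) (h' : IsTest Ω ψ) : IsTest Ω (φ + ψ) :=
  ⟨h.1.add h'.1, h.2.1.add h'.2.1, (tsupport_add φ ψ).trans (union_subset h.2.2 h'.2.2)⟩

theorem IsTest.const_smul {φ : E d → ℝ} (h : IsTest Ω φ) (c : ℝ) : IsTest Ω (c • φ) :=
  ⟨h.1.const_smul c, h.2.1.smul_left (f := fun _ => c),
    (tsupport_smul_subset_right (fun _ => c) φ).trans h.2.2⟩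

theorem IsTest.mul {φ ψ : E d → ℝ} (h : IsTest Ω φ) (h' : IsTest Ω ψ) : IsTest Ω (φ * ψ) :=
  ⟨h.1.mul h'.1, h.2.1.mul_right, (tsupport_mul_subset_left).trans h.2.2⟩

theorem isTest_zero : IsTest Ω (0 : E d → ℝ) :=
  ⟨contDiff_const, HasCompactSupport.zero, by simp [tsupport]⟩

/-- The elements of `H¹(Ω)` given by test functions. -/
def testSubmodule (Ω : Set (E d)) : Submodule ℝ (H 1 Ω) where
  carrier := {v : H 1 Ω | ∃ φ : E d → ℝ, IsTest Ω φ ∧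
    (val v : E d → ℝ) =ᵐ[volume.restrict Ω] φ}
  add_mem' := by
    rintro u v ⟨φ, hφ, h1⟩ ⟨ψ, hψ, h2⟩
    refine ⟨_, hφ.add hψ, ?_⟩
    rw [val_add]
    exact (Lp.coeFn_add _ _).trans (h1.add h2)
  zero_mem' := ⟨0, isTest_zero, Lp.coeFn_zero _ _ _⟩
  smul_mem' := by
    rintro c u ⟨φ, hφ, h1⟩
    refine ⟨_, hφ.const_smul c, ?_⟩
    rw [val_smul]
    exact (Lp.coeFn_smul _ _).trans (h1.const_smul c)

/-- Test functions already form a subspace, so the span in `H10` is superfluous and every element is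
a limit of single test functions. -/
theorem H10_eq_closure : H10 Ω = (testSubmodule Ω).topologicalClosure := by
  have : Submodule.span ℝ {v : H 1 Ω | ∃ φ : E d → ℝ, IsTest Ω φ ∧
    (val v : E d → ℝ) =ᵐ[volume.restrict Ω] φ} = testSubmodule Ω :=
    Submodule.span_eq (testSubmodule Ω)
  rw [H10, this]

theorem IsTest.toH_mem {φ : E d → ℝ} (h : IsTest Ω φ) : h.toH ∈ H10 Ω := by
  rw [H10_eq_closure]
  refine subset_closure ⟨φ, h, ?_⟩
  rw [h.val_toH]
  exact h.memLp.coeFn_toLp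

theorem mem_testSubmodule_iff (hΩ : IsOpen Ω) {v : H 1 Ω} :
    v ∈ testSubmodule Ω ↔ ∃ (φ : E d → ℝ) (h : IsTest Ω φ), v = h.toH := by
  constructor
  · rintro ⟨φ, h, hv⟩
    refine ⟨φ, h, H1_ext hΩ ?_⟩
    rw [h.val_toH]
    exact Lp.ext (hv.trans h.memLp.coeFn_toLp.symm)
  · rintro ⟨φ, h, rfl⟩
    exact ⟨φ, h, by rw [h.val_toH]; exact h.memLp.coeFn_toLp⟩

/-- A closed property that holds for test functions holds on `H₀¹`. -/
theorem H10_induction (hΩ : IsOpen Ω) {P : H 1 Ω → Prop} (hc : IsClosed {v | P v})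
    (h : ∀ φ (hφ : IsTest Ω φ), P hφ.toH) {v : H 1 Ω} (hv : v ∈ H10 Ω) : P v := by
  rw [H10_eq_closure] at hv
  refine closure_minimal (t := {v | P v}) ?_ hc hv
  intro w hw
  obtain ⟨φ, hφ, rfl⟩ := (mem_testSubmodule_iff hΩ).1 hw
  exact h φ hφ

/-- Every element of `H₀¹` is the limit of a sequence of test functions. -/
theorem exists_seq_isTest (hΩ : IsOpen Ω) {v : H 1 Ω} (hv : v ∈ H10 Ω) :
    ∃ (φ : ℕ → E d → ℝ) (hφ : ∀ n, IsTest Ω (φ n)),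
      Tendsto (fun n => (hφ n).toH) atTop (𝓝 v) := by
  rw [H10_eq_closure] at hv
  obtain ⟨w, hw, hlim⟩ := mem_closure_iff_seq_limit.1 (show v ∈ closure (testSubmodule Ω : Set _) from hv)
  choose φ hφ hw using fun n => (mem_testSubmodule_iff hΩ).1 (hw n)
  refine ⟨φ, hφ, ?_⟩
  simpa only [← hw] using hlim

end Test
end EnsembleNSE
end


noncomputable section

namespace EnsembleNSE
open MeasureTheory Set Filter Topology
open scoped ContDiff NNReal ENNReal

/-! ### Hölder inequalities -/

section Holder

variable {α : Type*} {mα : MeasurableSpace α} {μ : Measure α}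

/-- Write |g| = |g|^{1/2}|g|^{1/2} and apply Hölder with 1/4 + 1/12 = 1/3; the L⁴ and L¹² norms of
|g|^{1/2} are square roots of the L² and L⁶ norms of g. -/
theorem eLpNorm_three_le (g : α → ℝ) (hg : AEStronglyMeasurable g μ) :
    eLpNorm g 3 μ ≤ eLpNorm g 2 μ ^ (1 / 2 : ℝ) * eLpNorm g 6 μ ^ (1 / 2 : ℝ) := by
  have hm : AEStronglyMeasurable (fun x => ‖g x‖ ^ (1 / 2 : ℝ)) μ :=
    (Real.continuous_rpow_const (by norm_num)).comp_aestronglyMeasurable hg.norm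
  have : ENNReal.HolderTriple 4 12 3 := ⟨by
    have h : ((4 : ℝ≥0) : ℝ≥0∞)⁻¹ + ((12 : ℝ≥0) : ℝ≥0∞)⁻¹ = ((3 : ℝ≥0) : ℝ≥0∞)⁻¹ := by
      rw [← ENNReal.coe_inv (by norm_num), ← ENNReal.coe_inv (by norm_num),
        ← ENNReal.coe_inv (by norm_num), ← ENNReal.coe_add]
      congr 1
      rw [← NNReal.coe_inj]; push_cast; norm_num
    simpa using h⟩
  have h1 := eLpNorm_smul_le_mul_eLpNorm (p := 4) (q := 12) (r := 3) hm hm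
  have h2 : eLpNorm ((fun x => ‖g x‖ ^ (1 / 2 : ℝ)) • fun x => ‖g x‖ ^ (1 / 2 : ℝ)) 3 μ =
      eLpNorm g 3 μ := by
    refine eLpNorm_congr_norm_ae (Eventually.of_forall fun x => ?_)
    simp only [Pi.smul_apply', smul_eq_mul]
    rw [← Real.rpow_add' (norm_nonneg _) (by norm_num)]
    norm_num
  rw [h2, eLpNorm_norm_rpow g (by norm_num), eLpNorm_norm_rpow g (by norm_num)] at h1
  have e1 : (4 : ℝ≥0∞) * ENNReal.ofReal (1 / 2) = 2 := by
    rw [show (4 : ℝ≥0∞) = ENNReal.ofReal 4 by norm_num, ← ENNReal.ofReal_mul (by norm_num)]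
    norm_num
  have e2 : (12 : ℝ≥0∞) * ENNReal.ofReal (1 / 2) = 6 := by
    rw [show (12 : ℝ≥0∞) = ENNReal.ofReal 12 by norm_num, ← ENNReal.ofReal_mul (by norm_num)]
    norm_num
  rwa [e1, e2] at h1

theorem holderTriple_six_three_two : ENNReal.HolderTriple 6 3 2 := ⟨by
  have h : ((6 : ℝ≥0) : ℝ≥0∞)⁻¹ + ((3 : ℝ≥0) : ℝ≥0∞)⁻¹ = ((2 : ℝ≥0) : ℝ≥0∞)⁻¹ := by
    rw [← ENNReal.coe_inv (by norm_num), ← ENNReal.coe_inv (by norm_num),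
      ← ENNReal.coe_inv (by norm_num), ← ENNReal.coe_add]
    congr 1
    rw [← NNReal.coe_inj]; push_cast; norm_num
  simpa using h⟩

/-- The product of two `L⁶` functions is in `L²`, with a bound on its norm. -/
theorem memLp_mul_of_six [IsFiniteMeasure μ] {f g : α → ℝ} (hf : MemLp f 6 μ) (hg : MemLp g 6 μ) :
    MemLp (fun x => f x * g x) 2 μ ∧ (eLpNorm (fun x => f x * g x) 2 μ).toReal ≤
      (eLpNorm f 6 μ).toReal *
        Real.sqrt ((eLpNorm g 2 μ).toReal * (eLpNorm g 6 μ).toReal) := by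
  have := holderTriple_six_three_two
  have hg2 : MemLp g 2 μ := hg.mono_exponent (by norm_num)
  have hg3 : MemLp g 3 μ := hg.mono_exponent (by norm_num)
  have h1 := eLpNorm_smul_le_mul_eLpNorm (p := 6) (q := 3) (r := 2) hg.1 hf.1
  have h2 : MemLp (f • g) 2 μ := hg3.smul hf
  refine ⟨h2, ?_⟩
  have h3 := h1.trans (mul_le_mul_right (eLpNorm_three_le g hg.1) (eLpNorm f 6 μ))
  have h4 := ENNReal.toReal_mono (by
    have := hf.2.ne; have := hg.2.ne; have := hg2.2.ne
    finiteness) h3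
  refine h4.trans (le_of_eq ?_)
  rw [ENNReal.toReal_mul, ENNReal.toReal_mul, ← ENNReal.toReal_rpow, ← ENNReal.toReal_rpow,
    Real.sqrt_eq_rpow, Real.mul_rpow ENNReal.toReal_nonneg ENNReal.toReal_nonneg]

/-- Hölder with exponents 6, 2, 3, the L³ norm being interpolated. That only half a power of the L⁶
norm of g occurs is what later makes the time step condition scale like Δt/h. -/
theorem integral_mul_mul_le [IsFiniteMeasure μ] {f g : α → ℝ} (hf : MemLp f 6 μ)
    (hg : MemLp g 6 μ) (G : Lp ℝ 2 μ) :
    Integrable (fun x => f x * G x * g x) μ ∧ |∫ x, f x * G x * g x ∂μ| ≤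
      (eLpNorm f 6 μ).toReal * ‖G‖ *
        Real.sqrt ((eLpNorm g 2 μ).toReal * (eLpNorm g 6 μ).toReal) := by
  obtain ⟨h1, h2⟩ := memLp_mul_of_six hf hg
  have h3 : Integrable (fun x => f x * G x * g x) μ := by
    have := h1.integrable_mul (Lp.memLp G)
    refine this.congr (Eventually.of_forall fun x => ?_)
    simp only [Pi.mul_apply]; ring
  refine ⟨h3, ?_⟩
  have h4 : ∫ x, f x * G x * g x ∂μ = inner ℝ (h1.toLp _) G := by
    rw [L2.inner_def]
    refine integral_congr_ae ?_
    filter_upwards [h1.coeFn_toLp] with x hx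
    simp only [hx, RCLike.inner_apply, conj_trivial]; ring
  rw [h4]
  refine (abs_real_inner_le_norm _ _).trans ?_
  rw [Lp.norm_toLp, mul_right_comm]
  exact mul_le_mul_of_nonneg_right h2 (norm_nonneg _)

end Holder

/-! ### The Sobolev inequality on `H₀¹` -/

section Sobolev

variable {d : ℕ} {Ω : Set (E d)}

/-- The gradient seminorm of a scalar function, up to equivalence. -/
def gsum (v : H 1 Ω) : ℝ := ∑ k, ‖D1 k v‖

theorem gsum_nonneg (v : H 1 Ω) : 0 ≤ gsum v := Finset.sum_nonneg fun _ _ => norm_nonneg _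

theorem continuous_val {m : ℕ} : Continuous (val : H m Ω → L2 Ω) :=
  (PiLp.continuous_apply 2 _ (idx0 d m)).comp continuous_subtype_val

theorem continuous_D1 {m : ℕ} (k : Fin d) : Continuous (D1 k : H (m + 1) Ω → L2 Ω) :=
  (PiLp.continuous_apply 2 _ (idx1 m k)).comp continuous_subtype_val

theorem continuous_gsum : Continuous (gsum : H 1 Ω → ℝ) :=
  continuous_finsetSum _ fun k _ => (continuous_D1 k).norm

theorem norm_fderiv_le_sum_pd (φ : E d → ℝ) (x : E d) : ‖fderiv ℝ φ x‖ ≤ ∑ k, ‖pd k φ x‖ := by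
  refine ContinuousLinearMap.opNorm_le_bound _ (Finset.sum_nonneg fun _ _ => norm_nonneg _) ?_
  intro y
  have hy : y = ∑ k, y k • EuclideanSpace.single k (1 : ℝ) := by
    have := (EuclideanSpace.basisFun (Fin d) ℝ).sum_repr y
    simpa using this.symm
  conv_lhs => rw [hy]
  rw [map_sum, Finset.sum_mul]
  refine (norm_sum_le _ _).trans (Finset.sum_le_sum fun k _ => ?_)
  rw [map_smul, norm_smul, mul_comm]
  exact mul_le_mul_of_nonneg_left (PiLp.norm_apply_le y k) (norm_nonneg _)

theorem IsTest.eLpNorm_norm_fderiv_restrict {φ : E d → ℝ} (h : IsTest Ω φ) (p : ℝ≥0∞) :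
    eLpNorm (fun x => ‖fderiv ℝ φ x‖) p (volume.restrict Ω) =
      eLpNorm (fun x => ‖fderiv ℝ φ x‖) p volume := by
  refine eLpNorm_restrict_eq_of_support_subset fun x hx => ?_
  by_contra hn
  refine hx ?_
  have : fderiv ℝ φ x = 0 :=
    image_eq_zero_of_notMem_tsupport fun h' => hn (h.2.2 (tsupport_fderiv_subset ℝ h'))
  simp [this]

theorem IsTest.eLpNorm_fderiv_le {φ : E d → ℝ} (h : IsTest Ω φ) :
    eLpNorm (fun x => ‖fderiv ℝ φ x‖) 2 volume ≤ ENNReal.ofReal (gsum h.toH) := by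
  rw [← h.eLpNorm_norm_fderiv_restrict]
  have h1 : eLpNorm (fun x => ‖fderiv ℝ φ x‖) 2 (volume.restrict Ω) ≤
      eLpNorm (∑ k, fun x => ‖pd k φ x‖) 2 (volume.restrict Ω) := by
    refine eLpNorm_mono_real fun x => ?_
    rw [Finset.sum_apply, norm_norm]
    exact norm_fderiv_le_sum_pd φ x
  refine h1.trans ((eLpNorm_sum_le (fun k _ => (h.memLp_pd k).1.norm) (by norm_num)).trans ?_)
  rw [gsum, ENNReal.ofReal_sum_of_nonneg fun _ _ => norm_nonneg _]
  refine Finset.sum_le_sum fun k _ => ?_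
  rw [h.D1_toH, Lp.norm_toLp, ENNReal.ofReal_toReal (h.memLp_pd k).2.ne, eLpNorm_norm]

/-- For d = 3 the exponent 6 is critical for gradients in L². For d = 2 the gradient exponent 2 is
the borderline case, so 3/2 is used instead, whose critical exponent is again 6; Hölder on the
bounded set Ω returns to L². -/
theorem exists_sobolev_test (hd : d = 2 ∨ d = 3) (hb : Bornology.IsBounded Ω) :
    ∃ C : ℝ≥0, ∀ φ (h : IsTest Ω φ),
      eLpNorm φ 6 (volume.restrict Ω) ≤ C * ENNReal.ofReal (gsum h.toH) := by
  have hsupp : ∀ φ, IsTest Ω φ → Function.support φ ⊆ Ω := fun φ h =>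
    (subset_tsupport φ).trans h.2.2
  rcases hd with rfl | rfl
  · have hfin : volume Ω < ⊤ := hb.measure_lt_top
    refine ⟨eLpNormLESNormFDerivOfLeConst ℝ (volume : Measure (E 2)) Ω (3 / 2) 6 *
      (volume Ω ^ (1 / (3 / 2 : ℝ) - 1 / 2)).toNNReal, fun φ h => ?_⟩
    have key := eLpNorm_le_eLpNorm_fderiv_of_le (p := 3 / 2) (q := 6) volume
      (h.1.of_le (by simp)) (hsupp φ h) (by
        rw [← NNReal.coe_le_coe]; push_cast; norm_num) (by
        rw [← NNReal.coe_lt_coe]; push_cast; simp; norm_num) (by simp; norm_num) hb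
    rw [← eLpNorm_norm (fderiv ℝ φ)] at key
    have h2 : eLpNorm (fun x => ‖fderiv ℝ φ x‖) ((3 / 2 : ℝ≥0) : ℝ≥0∞) volume ≤
        eLpNorm (fun x => ‖fderiv ℝ φ x‖) 2 volume * volume Ω ^ (1 / (3 / 2 : ℝ) - 1 / 2) := by
      rw [← h.eLpNorm_norm_fderiv_restrict, ← h.eLpNorm_norm_fderiv_restrict]
      have := eLpNorm_le_eLpNorm_mul_rpow_measure_univ (p := ((3 / 2 : ℝ≥0) : ℝ≥0∞)) (q := 2)
        (μ := volume.restrict Ω) (f := fun x => ‖fderiv ℝ φ x‖) (by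
          rw [show (2 : ℝ≥0∞) = ((2 : ℝ≥0) : ℝ≥0∞) by simp, ENNReal.coe_le_coe,
            ← NNReal.coe_le_coe]; push_cast; norm_num)
          (h.1.continuous_fderiv (by simp)).norm.aestronglyMeasurable
      simpa using this
    rw [eLpNorm_restrict_eq_of_support_subset (hsupp φ h)]
    refine key.trans ?_
    rw [ENNReal.coe_mul, mul_assoc, ENNReal.coe_toNNReal (by
      apply (ENNReal.rpow_lt_top_of_nonneg (by norm_num) hfin.ne).ne)]
    refine mul_le_mul_right (h2.trans ?_) _
    rw [mul_comm]
    exact mul_le_mul_right h.eLpNorm_fderiv_le _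
  · refine ⟨eLpNormLESNormFDerivOfLeConst ℝ (volume : Measure (E 3)) Ω 2 6, fun φ h => ?_⟩
    have key := eLpNorm_le_eLpNorm_fderiv_of_le (p := 2) (q := 6) volume
      (h.1.of_le (by simp)) (hsupp φ h) (by norm_num) (by
        rw [← NNReal.coe_lt_coe]; push_cast; simp; norm_num) (by simp; norm_num) hb
    rw [← eLpNorm_norm (fderiv ℝ φ)] at key
    rw [eLpNorm_restrict_eq_of_support_subset (hsupp φ h)]
    exact key.trans (mul_le_mul_right h.eLpNorm_fderiv_le _)

/-- The Sobolev inequality `‖v‖_{L⁶} ≤ C ‖∇v‖` on `H₀¹(Ω)`. -/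
theorem exists_sobolev (hd : d = 2 ∨ d = 3) (hΩ : IsOpen Ω) (hb : Bornology.IsBounded Ω) :
    ∃ C : ℝ, 0 < C ∧ ∀ v ∈ H10 Ω, MemLp (val v) 6 (volume.restrict Ω) ∧
      (eLpNorm (val v) 6 (volume.restrict Ω)).toReal ≤ C * gsum v := by
  obtain ⟨C, hC⟩ := exists_sobolev_test hd hb
  have key : ∀ v ∈ H10 Ω, eLpNorm (val v) 6 (volume.restrict Ω) ≤ C * ENNReal.ofReal (gsum v) := by
    intro v hv
    obtain ⟨φ, hφ, hlim⟩ := exists_seq_isTest hΩ hv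
    have h1 : Tendsto (fun n => val (hφ n).toH) atTop (𝓝 (val v)) :=
      (continuous_val.tendsto v).comp hlim
    -- L² convergence gives convergence in measure, under which the L⁶ norm is lower semicontinuous;
    -- so the bound passes from test functions to their limits.
    have h2 := tendstoInMeasure_of_tendsto_Lp h1
    have h3 : Tendsto (fun n => (C : ℝ≥0∞) * ENNReal.ofReal (gsum (hφ n).toH)) atTop
        (𝓝 (C * ENNReal.ofReal (gsum v))) :=
      ENNReal.Tendsto.const_mul (ENNReal.tendsto_ofReal ((continuous_gsum.tendsto v).comp hlim))
        (Or.inr ENNReal.coe_ne_top)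
    refine le_of_forall_gt_imp_ge_of_dense fun a ha => ?_
    refine eLpNorm_le_of_tendstoInMeasure ?_ h2 fun n => Lp.aestronglyMeasurable _
    filter_upwards [h3.eventually_lt_const ha] with n hn
    refine le_trans (le_of_eq ?_) ((hC _ (hφ n)).trans hn.le)
    rw [(hφ n).val_toH]
    exact eLpNorm_congr_ae (hφ n).memLp.coeFn_toLp
  refine ⟨C + 1, by positivity, fun v hv => ?_⟩
  have h1 := key v hv
  refine ⟨⟨Lp.aestronglyMeasurable _, h1.trans_lt (by finiteness)⟩, ?_⟩
  have h2 := ENNReal.toReal_mono (by finiteness) h1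
  rw [ENNReal.toReal_mul, ENNReal.toReal_ofReal (gsum_nonneg v)] at h2
  refine h2.trans (mul_le_mul_of_nonneg_right ?_ (gsum_nonneg v))
  simp

/-- Poincaré from Sobolev: on a set of finite measure the L⁶ norm dominates the L² norm. -/
theorem exists_poincare (hd : d = 2 ∨ d = 3) (hΩ : IsOpen Ω) (hb : Bornology.IsBounded Ω) :
    ∃ C : ℝ, 0 < C ∧ ∀ v ∈ H10 Ω, ‖val v‖ ≤ C * gsum v := by
  obtain ⟨C, hC0, hC⟩ := exists_sobolev hd hΩ hb
  have : IsFiniteMeasure (volume.restrict Ω) := ⟨by simpa using hb.measure_lt_top⟩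
  set V := (volume.restrict Ω univ ^ (1 / (2 : ℝ≥0∞).toReal - 1 / (6 : ℝ≥0∞).toReal)) with hV
  have hVfin : V ≠ ⊤ := (ENNReal.rpow_lt_top_of_nonneg (by norm_num) (by finiteness)).ne
  refine ⟨C * (V.toReal + 1), by positivity, fun v hv => ?_⟩
  obtain ⟨h6, h7⟩ := hC v hv
  have h1 := eLpNorm_le_eLpNorm_mul_rpow_measure_univ (p := 2) (q := 6)
    (μ := volume.restrict Ω) (f := val v) (by norm_num) (Lp.aestronglyMeasurable _)
  have h2 := ENNReal.toReal_mono (by have := h6.2.ne; finiteness) h1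
  rw [ENNReal.toReal_mul] at h2
  rw [Lp.norm_def]
  refine h2.trans ?_
  have := gsum_nonneg v
  have hV0 : 0 ≤ V.toReal := ENNReal.toReal_nonneg
  calc _ ≤ (C * gsum v) * V.toReal := mul_le_mul_of_nonneg_right h7 hV0
    _ ≤ C * (V.toReal + 1) * gsum v := by nlinarith [mul_nonneg hC0.le this]

/-- The basic trilinear estimate. -/
theorem exists_trilinear (hd : d = 2 ∨ d = 3) (hΩ : IsOpen Ω) (hb : Bornology.IsBounded Ω) :
    ∃ C : ℝ, 0 < C ∧ ∀ u ∈ H10 Ω, ∀ w ∈ H10 Ω, ∀ G : L2 Ω,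
      Integrable (fun x => val u x * G x * val w x) (volume.restrict Ω) ∧
      |∫ x in Ω, val u x * G x * val w x| ≤
        C * gsum u * ‖G‖ * Real.sqrt (‖val w‖ * gsum w) := by
  obtain ⟨C, hC0, hC⟩ := exists_sobolev hd hΩ hb
  have : IsFiniteMeasure (volume.restrict Ω) := ⟨by simpa using hb.measure_lt_top⟩
  refine ⟨C * Real.sqrt C, by positivity, fun u hu w hw G => ?_⟩
  obtain ⟨h1, h2⟩ := hC u hu
  obtain ⟨h3, h4⟩ := hC w hw
  obtain ⟨h5, h6⟩ := integral_mul_mul_le h1 h3 G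
  refine ⟨h5, h6.trans ?_⟩
  have hs : Real.sqrt ((eLpNorm (val w) 2 (volume.restrict Ω)).toReal *
      (eLpNorm (val w) 6 (volume.restrict Ω)).toReal) ≤
      Real.sqrt C * Real.sqrt (‖val w‖ * gsum w) := by
    rw [← Real.sqrt_mul hC0.le]
    refine Real.sqrt_le_sqrt ?_
    rw [← Lp.norm_def]
    nlinarith [norm_nonneg (val w)]
  calc _ ≤ (C * gsum u * ‖G‖) * (Real.sqrt C * Real.sqrt (‖val w‖ * gsum w)) := by
        have := gsum_nonneg u
        gcongr
    _ = _ := by ring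

end Sobolev
end EnsembleNSE
end


noncomputable section

namespace EnsembleNSE
open MeasureTheory Set Filter Topology
open scoped ContDiff NNReal ENNReal

/-! ### The trilinear form -/

section Tri

variable {d : ℕ} {Ω : Set (E d)}

/-- `∫ f G g`. -/
def tri (f : H 1 Ω) (G : L2 Ω) (g : H 1 Ω) : ℝ := ∫ x in Ω, val f x * G x * val g x

/-- The integrals `∫ f G g` with `f, g ∈ H₀¹` and `G ∈ L²` converge, with the constant `C` in the
trilinear estimate. -/
def TriBound (Ω : Set (E d)) (C : ℝ) : Prop :=
  ∀ u ∈ H10 Ω, ∀ w ∈ H10 Ω, ∀ G : L2 Ω,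
      Integrable (fun x => val u x * G x * val w x) (volume.restrict Ω) ∧
      |tri u G w| ≤ C * gsum u * ‖G‖ * Real.sqrt (‖val w‖ * gsum w)

theorem tri_comm (f : H 1 Ω) (G : L2 Ω) (g : H 1 Ω) : tri f G g = tri g G f := by
  unfold tri; congr 1; ext x; ring


theorem tri_add_left {C : ℝ} (hC : TriBound Ω C) {f f' g : H 1 Ω} (G : L2 Ω) (hf : f ∈ H10 Ω) (hf' : f' ∈ H10 Ω)
    (hg : g ∈ H10 Ω) : tri (f + f') G g = tri f G g + tri f' G g := by
  unfold tri
  rw [← integral_add (hC f hf g hg G).1 (hC f' hf' g hg G).1]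
  refine integral_congr_ae ?_
  rw [val_add]
  filter_upwards [Lp.coeFn_add (val f) (val f')] with x hx
  rw [hx, Pi.add_apply]; ring

theorem tri_add_mid {C : ℝ} (hC : TriBound Ω C) {f g : H 1 Ω} (G G' : L2 Ω) (hf : f ∈ H10 Ω)
    (hg : g ∈ H10 Ω) : tri f (G + G') g = tri f G g + tri f G' g := by
  unfold tri
  rw [← integral_add (hC f hf g hg G).1 (hC f hf g hg G').1]
  refine integral_congr_ae ?_
  filter_upwards [Lp.coeFn_add G G'] with x hx
  rw [hx, Pi.add_apply]; ring

theorem tri_add_right {C : ℝ} (hC : TriBound Ω C) {f g g' : H 1 Ω} (G : L2 Ω) (hf : f ∈ H10 Ω) (hg : g ∈ H10 Ω)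
    (hg' : g' ∈ H10 Ω) : tri f G (g + g') = tri f G g + tri f G g' := by
  rw [tri_comm f, tri_comm f, tri_comm f, tri_add_left hC G hg hg' hf]

theorem tri_smul_mid (c : ℝ) (f g : H 1 Ω) (G : L2 Ω) : tri f (c • G) g = c * tri f G g := by
  unfold tri
  rw [← integral_const_mul]
  refine integral_congr_ae ?_
  filter_upwards [Lp.coeFn_smul c G] with x hx
  rw [hx, Pi.smul_apply, smul_eq_mul]; ring

theorem gsum_le (v : H 1 Ω) : gsum v ≤ d * ‖v‖ := by
  have : ∀ k, ‖D1 k v‖ ≤ ‖v‖ := fun k => by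
    refine le_of_sq_le_sq ?_ (norm_nonneg _)
    exact (Finset.single_le_sum (f := fun k => ‖D1 k v‖ ^ 2) (fun _ _ => sq_nonneg _)
      (Finset.mem_univ k)).trans (sum_norm_sq_D1_le v)
  refine (Finset.sum_le_sum fun k _ => this k).trans ?_
  simp

/-- A cruder bound by full norms; it serves only the continuity of `tri` in density arguments. -/
theorem abs_tri_le {C : ℝ} (hC : TriBound Ω C) (hC0 : 0 ≤ C) {f g : H 1 Ω} (G : L2 Ω)
    (hf : f ∈ H10 Ω) (hg : g ∈ H10 Ω) :
    |tri f G g| ≤ C * d * Real.sqrt d * ‖f‖ * ‖G‖ * ‖g‖ := by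
  refine (hC f hf g hg G).2.trans ?_
  have h1 : Real.sqrt (‖val g‖ * gsum g) ≤ Real.sqrt d * ‖g‖ := by
    rw [← Real.sqrt_sq (norm_nonneg g), ← Real.sqrt_mul (Nat.cast_nonneg d)]
    refine Real.sqrt_le_sqrt ?_
    calc ‖val g‖ * gsum g ≤ ‖g‖ * (d * ‖g‖) :=
          mul_le_mul (norm_val_le g) (gsum_le g) (gsum_nonneg g) (norm_nonneg g)
      _ = _ := by ring
  calc _ ≤ C * (d * ‖f‖) * ‖G‖ * (Real.sqrt d * ‖g‖) := by
        have := gsum_le f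
        gcongr
    _ = _ := by ring

/-- Change one argument at a time and bound each of the three differences by `abs_tri_le`. -/
theorem tendsto_tri {C : ℝ} (hC : TriBound Ω C) (hC0 : 0 ≤ C) {f g : ℕ → H 1 Ω}
    {G : ℕ → L2 Ω} {f' g' : H 1 Ω} {G' : L2 Ω}
    (hf : ∀ n, f n ∈ H10 Ω) (hg : ∀ n, g n ∈ H10 Ω) (hf' : f' ∈ H10 Ω) (hg' : g' ∈ H10 Ω)
    (hfl : Tendsto f atTop (𝓝 f')) (hgl : Tendsto g atTop (𝓝 g')) (hGl : Tendsto G atTop (𝓝 G')) :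
    Tendsto (fun n => tri (f n) (G n) (g n)) atTop (𝓝 (tri f' G' g')) := by
  rw [tendsto_iff_norm_sub_tendsto_zero]
  set K := C * d * Real.sqrt d
  have h1 : ∀ n, ‖tri (f n) (G n) (g n) - tri f' G' g'‖ ≤
      K * ‖f n - f'‖ * ‖G n‖ * ‖g n‖ + K * ‖f'‖ * ‖G n - G'‖ * ‖g n‖ +
        K * ‖f'‖ * ‖G'‖ * ‖g n - g'‖ := by
    intro n
    have e1 : tri (f n) (G n) (g n) = tri (f n - f') (G n) (g n) + tri f' (G n) (g n) := by
      rw [← tri_add_left hC _ (sub_mem (hf n) hf') hf' (hg n), sub_add_cancel]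
    have e2 : tri f' (G n) (g n) = tri f' (G n - G') (g n) + tri f' G' (g n) := by
      rw [← tri_add_mid hC _ _ hf' (hg n), sub_add_cancel]
    have e3 : tri f' G' (g n) = tri f' G' (g n - g') + tri f' G' g' := by
      rw [← tri_add_right hC _ hf' (sub_mem (hg n) hg') hg', sub_add_cancel]
    rw [e1, e2, e3, Real.norm_eq_abs]
    have b1 := abs_tri_le hC hC0 (G n) (sub_mem (hf n) hf') (hg n)
    have b2 := abs_tri_le hC hC0 (G n - G') hf' (hg n)
    have b3 := abs_tri_le hC hC0 G' hf' (sub_mem (hg n) hg')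
    have : tri (f n - f') (G n) (g n) + (tri f' (G n - G') (g n) + (tri f' G' (g n - g') +
      tri f' G' g')) - tri f' G' g' = tri (f n - f') (G n) (g n) + tri f' (G n - G') (g n) +
        tri f' G' (g n - g') := by ring
    rw [this]
    exact (abs_add_three _ _ _).trans (add_le_add (add_le_add b1 b2) b3)
  refine squeeze_zero (fun n => norm_nonneg _) h1 ?_
  have a1 := tendsto_iff_norm_sub_tendsto_zero.1 hfl
  have a2 := tendsto_iff_norm_sub_tendsto_zero.1 hgl
  have a3 := tendsto_iff_norm_sub_tendsto_zero.1 hGl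
  have := ((((a1.const_mul K).mul hGl.norm).mul hgl.norm).add
    ((a3.const_mul (K * ‖f'‖)).mul hgl.norm)).add (a2.const_mul (K * ‖f'‖ * ‖G'‖))
  simpa using this

/-- Integration by parts in `∫ f g h`. -/
theorem tri_leibniz {C : ℝ} (hC : TriBound Ω C) (hΩ : IsOpen Ω) (hC0 : 0 ≤ C) {f g h : H 1 Ω} (hf : f ∈ H10 Ω)
    (hg : g ∈ H10 Ω) (hh : h ∈ H10 Ω) (k : Fin d) :
    tri f (D1 k g) h + tri f (D1 k h) g + tri g (D1 k f) h = 0 := by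
  -- By `tendsto_tri` the left side is a limit of the same expression for test functions, where it
  -- is zero by classical integration by parts.
  obtain ⟨φ, hφ, lf⟩ := exists_seq_isTest hΩ hf
  obtain ⟨ψ, hψ, lg⟩ := exists_seq_isTest hΩ hg
  obtain ⟨χ, hχ, lh⟩ := exists_seq_isTest hΩ hh
  have mf := fun n => (hφ n).toH_mem
  have mg := fun n => (hψ n).toH_mem
  have mh := fun n => (hχ n).toH_mem
  have cD : ∀ {w : ℕ → H 1 Ω} {v : H 1 Ω}, Tendsto w atTop (𝓝 v) →
      Tendsto (fun n => D1 k (w n)) atTop (𝓝 (D1 k v)) := fun hw =>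
    ((continuous_D1 k).tendsto _).comp hw
  have lim := ((tendsto_tri hC hC0 mf mh hf hh lf lh (cD lg)).add
    (tendsto_tri hC hC0 mf mg hf hg lf lg (cD lh))).add
    (tendsto_tri hC hC0 mg mh hg hh lg lh (cD lf))
  refine tendsto_nhds_unique lim ?_
  convert tendsto_const_nhds (α := ℕ) (f := atTop) (x := (0 : ℝ)) using 1
  ext n
  have test3 : ∀ {a b c : E d → ℝ} (ha : IsTest Ω a) (hb : IsTest Ω b) (hc : IsTest Ω c),
      tri ha.toH (D1 k hb.toH) hc.toH = ∫ x in Ω, a x * pd k b x * c x := by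
    intro a b c ha hb hc
    unfold tri
    rw [ha.val_toH, hc.val_toH, hb.D1_toH]
    refine integral_congr_ae ?_
    filter_upwards [ha.memLp.coeFn_toLp, hc.memLp.coeFn_toLp, (hb.memLp_pd k).coeFn_toLp]
      with x h1 h2 h3
    rw [h1, h2, h3]
  have intg : ∀ {a b c : E d → ℝ} (ha : IsTest Ω a) (hb : IsTest Ω b) (hc : IsTest Ω c),
      Integrable (fun x => a x * pd k b x * c x) (volume.restrict Ω) := by
    intro a b c ha hb hc
    have := (hC _ ha.toH_mem _ hc.toH_mem (D1 k hb.toH)).1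
    rw [ha.val_toH, hc.val_toH, hb.D1_toH] at this
    refine this.congr ?_
    filter_upwards [ha.memLp.coeFn_toLp, hc.memLp.coeFn_toLp, (hb.memLp_pd k).coeFn_toLp]
      with x h1 h2 h3
    rw [h1, h2, h3]
  rw [test3 (hφ n) (hψ n) (hχ n), test3 (hφ n) (hχ n) (hψ n), test3 (hψ n) (hφ n) (hχ n)]
  obtain ⟨L, hL⟩ := (hφ n).lipschitz
  -- The product of two test functions is again a test function; φₙ is integrated by parts against
  -- it.
  have key := LipschitzWith.setIntegral_mul_pd hL ((hψ n).mul (hχ n)) k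
  have dφ : Differentiable ℝ (φ n) := (hφ n).1.differentiable (by simp)
  have dψ : Differentiable ℝ (ψ n) := (hψ n).1.differentiable (by simp)
  have dχ : Differentiable ℝ (χ n) := (hχ n).1.differentiable (by simp)
  simp_rw [lineDeriv_single_eq_pd dφ] at key
  have hm : ∀ x, pd k (ψ n * χ n) x = ψ n x * pd k (χ n) x + χ n x * pd k (ψ n) x := by
    intro x
    unfold pd
    rw [fderiv_mul (dψ x) (dχ x)]
    simp
  rw [← integral_add (intg (hφ n) (hψ n) (hχ n)) (intg (hφ n) (hχ n) (hψ n))]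
  have e1 : ∫ x in Ω, (φ n x * pd k (ψ n) x * χ n x + φ n x * pd k (χ n) x * ψ n x) =
      ∫ x in Ω, φ n x * pd k (ψ n * χ n) x := by
    congr 1; ext x; rw [hm]; ring
  have e2 : ∫ x in Ω, ψ n x * pd k (φ n) x * χ n x =
      ∫ x in Ω, pd k (φ n) x * (ψ n * χ n) x := by
    congr 1; ext x; simp only [Pi.mul_apply]; ring
  rw [e1, e2, key]; ring

end Tri

/-! ### The convective form and its skew-symmetric version: multilinearity and bounds. -/

section Conv

variable {d : ℕ} {Ω : Set (E d)}

/-- `X = H₀¹(Ω)ᵈ` as a submodule. -/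
def Xsub (Ω : Set (E d)) : Submodule ℝ (HV 1 Ω) where
  carrier := X Ω
  add_mem' ha hb i := add_mem (ha i) (hb i)
  zero_mem' _ := zero_mem _
  smul_mem' c _ h i := Submodule.smul_mem _ c (h i)

theorem gsum_le_grad (u : HV 1 Ω) (i : Fin d) : gsum (u i) ≤ d * ‖grad u‖ := by
  refine (Finset.sum_le_sum fun k _ => norm_D1_le_grad u i k).trans ?_
  simp


theorem conv_eq {C : ℝ} (hC : TriBound Ω C) {u w : HV 1 Ω} (v : HV 1 Ω) (hu : u ∈ Xsub Ω) (hw : w ∈ Xsub Ω) :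
    conv u v w = ∑ i, ∑ k, tri (u k) (D1 k (v i)) (w i) := by
  unfold conv tri
  rw [integral_finsetSum _ fun i _ => integrable_finsetSum _ fun k _ =>
    (hC _ (hu k) _ (hw i) (D1 k (v i))).1]
  refine Finset.sum_congr rfl fun i _ => ?_
  rw [integral_finsetSum _ fun k _ => (hC _ (hu k) _ (hw i) (D1 k (v i))).1]

theorem conv_add_left {C : ℝ} (hC : TriBound Ω C) {u u' w : HV 1 Ω} (v : HV 1 Ω) (hu : u ∈ Xsub Ω) (hu' : u' ∈ Xsub Ω)
    (hw : w ∈ Xsub Ω) : conv (u + u') v w = conv u v w + conv u' v w := by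
  rw [conv_eq hC v hu hw, conv_eq hC v hu' hw, conv_eq hC v (add_mem hu hu') hw,
    ← Finset.sum_add_distrib]
  refine Finset.sum_congr rfl fun i _ => ?_
  rw [← Finset.sum_add_distrib]
  exact Finset.sum_congr rfl fun k _ => tri_add_left hC _ (hu k) (hu' k) (hw i)

theorem conv_add_mid {C : ℝ} (hC : TriBound Ω C) {u w : HV 1 Ω} (v v' : HV 1 Ω) (hu : u ∈ Xsub Ω)
    (hw : w ∈ Xsub Ω) : conv u (v + v') w = conv u v w + conv u v' w := by
  rw [conv_eq hC v hu hw, conv_eq hC v' hu hw, conv_eq hC (v + v') hu hw,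
    ← Finset.sum_add_distrib]
  refine Finset.sum_congr rfl fun i _ => ?_
  rw [← Finset.sum_add_distrib]
  exact Finset.sum_congr rfl fun k _ => tri_add_mid hC _ _ (hu k) (hw i)

theorem conv_add_right {C : ℝ} (hC : TriBound Ω C) {u w w' : HV 1 Ω} (v : HV 1 Ω) (hu : u ∈ Xsub Ω)
    (hw : w ∈ Xsub Ω) (hw' : w' ∈ Xsub Ω) : conv u v (w + w') = conv u v w + conv u v w' := by
  rw [conv_eq hC v hu hw, conv_eq hC v hu hw', conv_eq hC v hu (add_mem hw hw'),
    ← Finset.sum_add_distrib]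
  refine Finset.sum_congr rfl fun i _ => ?_
  rw [← Finset.sum_add_distrib]
  exact Finset.sum_congr rfl fun k _ => tri_add_right hC _ (hu k) (hw i) (hw' i)

theorem bstar_add_left {C : ℝ} (hC : TriBound Ω C) {u u' v w : HV 1 Ω} (hu : u ∈ Xsub Ω) (hu' : u' ∈ Xsub Ω)
    (hv : v ∈ Xsub Ω) (hw : w ∈ Xsub Ω) : bstar (u + u') v w = bstar u v w + bstar u' v w := by
  unfold bstar
  rw [conv_add_left hC v hu hu' hw, conv_add_left hC w hu hu' hv]; ring

theorem bstar_add_mid {C : ℝ} (hC : TriBound Ω C) {u v v' w : HV 1 Ω} (hu : u ∈ Xsub Ω) (hv : v ∈ Xsub Ω)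
    (hv' : v' ∈ Xsub Ω) (hw : w ∈ Xsub Ω) : bstar u (v + v') w = bstar u v w + bstar u v' w := by
  unfold bstar
  rw [conv_add_mid hC v v' hu hw, conv_add_right hC w hu hv hv']; ring

theorem bstar_sub_left {C : ℝ} (hC : TriBound Ω C) {u u' v w : HV 1 Ω} (hu : u ∈ Xsub Ω) (hu' : u' ∈ Xsub Ω)
    (hv : v ∈ Xsub Ω) (hw : w ∈ Xsub Ω) : bstar (u - u') v w = bstar u v w - bstar u' v w := by
  have := bstar_add_left hC (sub_mem hu hu') hu' hv hw
  rw [sub_add_cancel] at this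
  linarith

theorem bstar_sub_mid {C : ℝ} (hC : TriBound Ω C) {u v v' w : HV 1 Ω} (hu : u ∈ Xsub Ω) (hv : v ∈ Xsub Ω)
    (hv' : v' ∈ Xsub Ω) (hw : w ∈ Xsub Ω) : bstar u (v - v') w = bstar u v w - bstar u v' w := by
  have := bstar_add_mid hC hu (sub_mem hv hv') hv' hw
  rw [sub_add_cancel] at this
  linarith

theorem bstar_self (u v : HV 1 Ω) : bstar u v v = 0 := by unfold bstar; ring

/-- `tri_leibniz` for each pair of components; summed over k, the derivatives falling on uₖ form the
divergence. Hence `bstar` equals `conv` for solenoidal u, and a derivative can be moved off v in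
`abs_bstar_le_mid`. -/
theorem conv_add_conv_swap {C : ℝ} (hC : TriBound Ω C) (hΩ : IsOpen Ω) (hC0 : 0 ≤ C) {u v w : HV 1 Ω} (hu : u ∈ Xsub Ω)
    (hv : v ∈ Xsub Ω) (hw : w ∈ Xsub Ω) :
    conv u v w + conv u w v = -∑ i, tri (v i) (dvg u) (w i) := by
  have hdv : ∀ i, tri (v i) (dvg u) (w i) = ∑ k, tri (v i) (D1 k (u k)) (w i) := by
    intro i
    have : ∀ s : Finset (Fin d), tri (v i) (∑ k ∈ s, D1 k (u k)) (w i) =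
        ∑ k ∈ s, tri (v i) (D1 k (u k)) (w i) := by
      intro s
      classical
      induction s using Finset.induction_on with
      | empty =>
        simp only [Finset.sum_empty]
        have := tri_smul_mid 0 (v i) (w i) (0 : L2 Ω)
        simpa using this
      | insert a s ha ih =>
        rw [Finset.sum_insert ha, Finset.sum_insert ha, tri_add_mid hC _ _ (hv i) (hw i), ih]
    exact this Finset.univ
  rw [conv_eq hC v hu hw, conv_eq hC w hu hv, eq_neg_iff_add_eq_zero, ← Finset.sum_add_distrib,
    ← Finset.sum_add_distrib]
  refine Finset.sum_eq_zero fun i _ => ?_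
  rw [hdv, ← Finset.sum_add_distrib, ← Finset.sum_add_distrib]
  exact Finset.sum_eq_zero fun k _ => tri_leibniz hC hΩ hC0 (hu k) (hv i) (hw i) k

theorem bstar_eq_conv {C : ℝ} (hC : TriBound Ω C) (hΩ : IsOpen Ω) (hC0 : 0 ≤ C) {u v w : HV 1 Ω} (hu : u ∈ Xsub Ω)
    (hv : v ∈ Xsub Ω) (hw : w ∈ Xsub Ω) (hdiv : dvg u = 0) : bstar u v w = conv u v w := by
  have h := conv_add_conv_swap hC hΩ hC0 hu hv hw
  have h0 : ∀ i, tri (v i) (dvg u) (w i) = 0 := fun i => by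
    have := tri_smul_mid 0 (v i) (w i) (0 : L2 Ω)
    rw [hdiv]; simpa using this
  simp only [h0, Finset.sum_const_zero, neg_zero] at h
  unfold bstar
  linarith

/-- The outer factors of `tri` may be exchanged, so the half powers can be placed on u here and on w
in `abs_conv_le_right`. -/
theorem abs_conv_le_left {C : ℝ} (hC : TriBound Ω C) (hC0 : 0 ≤ C) {u w : HV 1 Ω} (v : HV 1 Ω) (hu : u ∈ Xsub Ω)
    (hw : w ∈ Xsub Ω) : |conv u v w| ≤
      d ^ 2 * (C * d * Real.sqrt d) * Real.sqrt (‖valV u‖ * ‖grad u‖) * ‖grad v‖ * ‖grad w‖ := by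
  rw [conv_eq hC v hu hw]
  have h1 : ∀ i k, |tri (u k) (D1 k (v i)) (w i)| ≤
      C * d * Real.sqrt d * Real.sqrt (‖valV u‖ * ‖grad u‖) * ‖grad v‖ * ‖grad w‖ := by
    intro i k
    rw [tri_comm]
    refine (hC _ (hw i) _ (hu k) _).2.trans ?_
    have h2 : Real.sqrt (‖val (u k)‖ * gsum (u k)) ≤
        Real.sqrt d * Real.sqrt (‖valV u‖ * ‖grad u‖) := by
      rw [← Real.sqrt_mul (Nat.cast_nonneg d)]
      refine Real.sqrt_le_sqrt ?_
      calc _ ≤ ‖valV u‖ * (d * ‖grad u‖) := mul_le_mul (norm_val_le_valV u k) (gsum_le_grad u k)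
            (gsum_nonneg _) (norm_nonneg _)
        _ = _ := by ring
    calc _ ≤ C * (d * ‖grad w‖) * ‖grad v‖ * (Real.sqrt d * Real.sqrt (‖valV u‖ * ‖grad u‖)) := by
          have a1 := gsum_le_grad w i
          have a2 := norm_D1_le_grad v i k
          have a3 := gsum_nonneg (w i)
          gcongr
      _ = _ := by ring
  refine (Finset.abs_sum_le_sum_abs _ _).trans ?_
  refine (Finset.sum_le_sum fun i _ => (Finset.abs_sum_le_sum_abs _ _).trans
    (Finset.sum_le_sum fun k _ => h1 i k)).trans (le_of_eq ?_)
  simp only [Finset.sum_const, Finset.card_univ, Fintype.card_fin, nsmul_eq_mul]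
  ring

theorem abs_conv_le_right {C : ℝ} (hC : TriBound Ω C) (hC0 : 0 ≤ C) {u w : HV 1 Ω} (v : HV 1 Ω) (hu : u ∈ Xsub Ω)
    (hw : w ∈ Xsub Ω) : |conv u v w| ≤
      d ^ 2 * (C * d * Real.sqrt d) * ‖grad u‖ * ‖grad v‖ * Real.sqrt (‖valV w‖ * ‖grad w‖) := by
  rw [conv_eq hC v hu hw]
  have h1 : ∀ i k, |tri (u k) (D1 k (v i)) (w i)| ≤
      C * d * Real.sqrt d * ‖grad u‖ * ‖grad v‖ * Real.sqrt (‖valV w‖ * ‖grad w‖) := by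
    intro i k
    refine (hC _ (hu k) _ (hw i) _).2.trans ?_
    have h2 : Real.sqrt (‖val (w i)‖ * gsum (w i)) ≤
        Real.sqrt d * Real.sqrt (‖valV w‖ * ‖grad w‖) := by
      rw [← Real.sqrt_mul (Nat.cast_nonneg d)]
      refine Real.sqrt_le_sqrt ?_
      calc _ ≤ ‖valV w‖ * (d * ‖grad w‖) := mul_le_mul (norm_val_le_valV w i) (gsum_le_grad w i)
            (gsum_nonneg _) (norm_nonneg _)
        _ = _ := by ring
    calc _ ≤ C * (d * ‖grad u‖) * ‖grad v‖ * (Real.sqrt d * Real.sqrt (‖valV w‖ * ‖grad w‖)) := by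
          have a1 := gsum_le_grad u k
          have a2 := norm_D1_le_grad v i k
          have a3 := gsum_nonneg (u k)
          gcongr
      _ = _ := by ring
  refine (Finset.abs_sum_le_sum_abs _ _).trans ?_
  refine (Finset.sum_le_sum fun i _ => (Finset.abs_sum_le_sum_abs _ _).trans
    (Finset.sum_le_sum fun k _ => h1 i k)).trans (le_of_eq ?_)
  simp only [Finset.sum_const, Finset.card_univ, Fintype.card_fin, nsmul_eq_mul]
  ring

/-- Used when u is the extrapolated discrete error: half of it is measured in L² and can be left to
Grönwall. -/
theorem abs_bstar_le_left {C : ℝ} (hC : TriBound Ω C) (hC0 : 0 ≤ C) {u v w : HV 1 Ω} (hu : u ∈ Xsub Ω) (hv : v ∈ Xsub Ω)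
    (hw : w ∈ Xsub Ω) : |bstar u v w| ≤
      d ^ 2 * (C * d * Real.sqrt d) * Real.sqrt (‖valV u‖ * ‖grad u‖) * ‖grad v‖ * ‖grad w‖ := by
  have h1 := abs_conv_le_left hC hC0 v hu hw
  have h2 := abs_conv_le_left hC hC0 w hu hv
  rw [mul_right_comm] at h2
  unfold bstar
  rw [abs_le] at *
  constructor <;> linarith [h1.1, h1.2, h2.1, h2.2]

/-- Used when v is the third difference of the discrete error. The term `conv u v w` contains all of
∇v, so the derivative is first moved to w; what is left, `conv u w v` and a term with ∇·u, contains
v undifferentiated. -/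
theorem abs_bstar_le_mid {C : ℝ} (hC : TriBound Ω C) (hΩ : IsOpen Ω) (hC0 : 0 ≤ C) {u v w : HV 1 Ω} (hu : u ∈ Xsub Ω)
    (hv : v ∈ Xsub Ω) (hw : w ∈ Xsub Ω) : |bstar u v w| ≤
      2 * d ^ 2 * (C * d * Real.sqrt d) * ‖grad u‖ * Real.sqrt (‖valV v‖ * ‖grad v‖) * ‖grad w‖ := by
  have h1 := abs_conv_le_right hC hC0 w hu hv
  have h2 := conv_add_conv_swap hC hΩ hC0 hu hv hw
  have h3 : |∑ i, tri (v i) (dvg u) (w i)| ≤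
      d ^ 2 * (C * d * Real.sqrt d) * ‖grad u‖ * ‖grad w‖ * Real.sqrt (‖valV v‖ * ‖grad v‖) := by
    have h4 : ∀ i, |tri (v i) (dvg u) (w i)| ≤
        d * (C * d * Real.sqrt d) * ‖grad u‖ * ‖grad w‖ * Real.sqrt (‖valV v‖ * ‖grad v‖) := by
      intro i
      rw [tri_comm]
      refine (hC _ (hw i) _ (hv i) _).2.trans ?_
      have h5 : Real.sqrt (‖val (v i)‖ * gsum (v i)) ≤
          Real.sqrt d * Real.sqrt (‖valV v‖ * ‖grad v‖) := by
        rw [← Real.sqrt_mul (Nat.cast_nonneg d)]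
        refine Real.sqrt_le_sqrt ?_
        calc _ ≤ ‖valV v‖ * (d * ‖grad v‖) := mul_le_mul (norm_val_le_valV v i) (gsum_le_grad v i)
              (gsum_nonneg _) (norm_nonneg _)
          _ = _ := by ring
      calc _ ≤ C * (d * ‖grad w‖) * (d * ‖grad u‖) *
            (Real.sqrt d * Real.sqrt (‖valV v‖ * ‖grad v‖)) := by
            have a1 := gsum_le_grad w i
            have a2 := norm_dvg_le u
            have a3 := gsum_nonneg (w i)
            gcongr
        _ = _ := by ring
    refine (Finset.abs_sum_le_sum_abs _ _).trans
      ((Finset.sum_le_sum fun i _ => h4 i).trans (le_of_eq ?_))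
    simp only [Finset.sum_const, Finset.card_univ, Fintype.card_fin, nsmul_eq_mul]
    ring
  have h4 : bstar u v w = -conv u w v - 1 / 2 * ∑ i, tri (v i) (dvg u) (w i) := by
    unfold bstar; linarith
  rw [h4]
  have h0 : 0 ≤ d ^ 2 * (C * d * Real.sqrt d) * ‖grad u‖ * ‖grad w‖ *
    Real.sqrt (‖valV v‖ * ‖grad v‖) := by positivity
  have h6 : 2 * d ^ 2 * (C * d * Real.sqrt d) * ‖grad u‖ * Real.sqrt (‖valV v‖ * ‖grad v‖) *
    ‖grad w‖ = 2 * (d ^ 2 * (C * d * Real.sqrt d) * ‖grad u‖ * ‖grad w‖ *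
      Real.sqrt (‖valV v‖ * ‖grad v‖)) := by ring
  rw [h6]
  rw [abs_le] at *
  constructor <;> linarith [h1.1, h1.2, h3.1, h3.2]

end Conv

/-! ### The weak formulation -/

section WeakForm

variable {d : ℕ} {Ω : Set (E d)}

/-- Both sides are continuous in v, so the defining identity of the weak derivative extends from
test functions to their closure. -/
theorem IsWeakPartial.inner_H10 (hΩ : IsOpen Ω) {k : Fin d} {f g : L2 Ω}
    (h : IsWeakPartial Ω k f g) {v : H 1 Ω} (hv : v ∈ H10 Ω) :
    inner ℝ g (val v) = -inner ℝ f (D1 k v) := by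
  refine H10_induction hΩ (P := fun v => inner ℝ g (val v) = -inner ℝ f (D1 k v)) ?_ ?_ hv
  · exact isClosed_eq (continuous_const.inner continuous_val)
      (continuous_const.inner (continuous_D1 k)).neg
  · intro φ hφ
    rw [isWeakPartial_iff] at h
    have := h φ hφ
    rw [hφ.val_toH, hφ.D1_toH, real_inner_comm, real_inner_comm _ f]
    linarith

theorem isWeakPartial_D1_D2 {m : ℕ} (k : Fin d) (u : H (m + 2) Ω) :
    IsWeakPartial Ω k (D1 k u) (D2 k u) := by
  refine u.2 k (idx1 (m + 1) k) (idx2 m k) fun j => ?_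
  simp only [idx1, idx2]; split_ifs <;> simp

theorem inner_grad {m n : ℕ} (u : HV (m + 1) Ω) (v : HV (n + 1) Ω) :
    inner ℝ (grad u) (grad v) = ∑ i, ∑ k, inner ℝ (D1 k (u i)) (D1 k (v i)) := by
  rw [PiLp.inner_apply, Fintype.sum_prod_type]; rfl

/-- The weak form of the Navier–Stokes equations. -/
theorem IsNSESolution.weak {C : ℝ} (hC : TriBound Ω C) (hΩ : IsOpen Ω) (hC0 : 0 ≤ C) {ν T : ℝ}
    {u ut : ℝ → HV 3 Ω} {p : ℝ → H 2 Ω} {f : ℝ → L2V Ω} (h : IsNSESolution Ω ν T u ut p f)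
    {t : ℝ} (ht : t ∈ Ioc 0 T) {v : HV 1 Ω} (hv : v ∈ Xsub Ω) :
    inner ℝ (valV (ut t)) (valV v) + bstar (toHV1 (u t)) (toHV1 (u t)) v
      - inner ℝ (val (p t)) (dvg v) + ν * inner ℝ (grad (u t)) (grad v)
      = inner ℝ (f t) (valV v) := by
  have ht' : t ∈ Icc 0 T := ⟨ht.1.le, ht.2⟩
  have hu : toHV1 (u t) ∈ Xsub Ω := h.boundary t ht'
  -- As u(t) is divergence-free, the skew-symmetric form is the convective term of the strong
  -- equation.
  rw [bstar_eq_conv hC hΩ hC0 hu hu hv (by rw [dvg_toHV1, h.incompressible t ht']),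
    conv_eq hC _ hu hv, inner_grad]
  have e1 : inner ℝ (valV (ut t)) (valV v) = ∑ i, inner ℝ (val (ut t i)) (val (v i)) :=
    PiLp.inner_apply _ _
  have e2 : inner ℝ (f t) (valV v) = ∑ i, inner ℝ (f t i) (val (v i)) := PiLp.inner_apply _ _
  have e3 : inner ℝ (val (p t)) (dvg v) = ∑ i, inner ℝ (val (p t)) (D1 i (v i)) := inner_sum _ _ _
  rw [e1, e2, e3, Finset.mul_sum, ← Finset.sum_add_distrib, ← Finset.sum_sub_distrib,
    ← Finset.sum_add_distrib]
  refine Finset.sum_congr rfl fun i _ => ?_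
  have mom := h.momentum t ht i
  have w1 : ∀ k, inner ℝ (D1 k (u t i)) (D1 k (v i)) = -inner ℝ (D2 k (u t i)) (val (v i)) :=
    fun k => by rw [(isWeakPartial_D1_D2 k (u t i)).inner_H10 hΩ (hv i), neg_neg]
  have w2 : inner ℝ (val (p t)) (D1 i (v i)) = -inner ℝ (D1 i (p t)) (val (v i)) := by
    rw [(isWeakPartial_val_D1 i (p t)).inner_H10 hΩ (hv i), neg_neg]
  simp_rw [w1, w2]
  have h_int : ∀ F : L2 Ω, Integrable (fun x => F x * val (v i) x) (volume.restrict Ω) := fun F =>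
    (Lp.memLp F).integrable_mul (Lp.memLp (val (v i)))
  have hin : ∀ F : L2 Ω, inner ℝ F (val (v i)) = ∫ x in Ω, F x * val (v i) x := fun F => by
    rw [L2.inner_def]
    congr 1; ext x; simp [mul_comm]
  have htri : ∀ k, Integrable (fun x => val (u t k) x * D1 k (u t i) x * val (v i) x)
      (volume.restrict Ω) := fun k => by
    have := (hC _ (hu k) _ (hv i) (D1 k (u t i))).1
    simpa [toHV1] using this
  have e4 : ∀ k, tri (toHV1 (u t) k) (D1 k (toHV1 (u t) i)) (v i) =
      ∫ x in Ω, val (u t k) x * D1 k (u t i) x * val (v i) x := fun k => by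
    simp [tri, toHV1]
  simp_rw [e4, hin]
  have key : ∫ x in Ω, f t i x * val (v i) x = ∫ x in Ω, (val (ut t i) x * val (v i) x +
      ∑ k, val (u t k) x * D1 k (u t i) x * val (v i) x
      - ν * ∑ k, D2 k (u t i) x * val (v i) x + D1 i (p t) x * val (v i) x) := by
    refine integral_congr_ae ?_
    filter_upwards [mom] with x hx
    rw [← hx, add_mul, sub_mul, add_mul, Finset.sum_mul, mul_assoc, Finset.sum_mul]
  have i1 : Integrable (fun x => ∑ k, val (u t k) x * D1 k (u t i) x * val (v i) x)
      (volume.restrict Ω) := integrable_finsetSum _ fun k _ => htri k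
  have i2 : Integrable (fun x => ∑ k, D2 k (u t i) x * val (v i) x)
      (volume.restrict Ω) := integrable_finsetSum _ fun k _ => h_int _
  have i3 : Integrable (fun x => val (ut t i) x * val (v i) x +
      ∑ k, val (u t k) x * D1 k (u t i) x * val (v i) x) (volume.restrict Ω) := (h_int _).add i1
  have i4 : Integrable (fun x => val (ut t i) x * val (v i) x +
      ∑ k, val (u t k) x * D1 k (u t i) x * val (v i) x
      - ν * ∑ k, D2 k (u t i) x * val (v i) x) (volume.restrict Ω) := i3.sub (i2.const_mul ν)
  rw [key, integral_add i4 (h_int _), integral_sub i3 (i2.const_mul ν), integral_add (h_int _) i1,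
    integral_const_mul, integral_finsetSum _ fun k _ => htri k,
    integral_finsetSum _ fun k _ => h_int _, Finset.sum_neg_distrib]
  ring

end WeakForm
end EnsembleNSE
end


noncomputable section

namespace EnsembleNSE
open MeasureTheory Set Filter Topology
open scoped ContDiff NNReal ENNReal

/-! ### Finite element spaces -/

section FiniteElements

variable {d : ℕ} {Ω : Set (E d)} {𝒯 : Mesh d}

theorem IsPiecewisePoly.add {k : ℕ} {v w : E d → ℝ} (hv : IsPiecewisePoly Ω 𝒯 k v)
    (hw : IsPiecewisePoly Ω 𝒯 k w) : IsPiecewisePoly Ω 𝒯 k (v + w) := by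
  refine ⟨hv.1.add hw.1, fun s hs => ?_⟩
  obtain ⟨P, hP, h1⟩ := hv.2 s hs
  obtain ⟨Q, hQ, h2⟩ := hw.2 s hs
  refine ⟨P + Q, (MvPolynomial.totalDegree_add P Q).trans (max_le hP hQ), fun x hx => ?_⟩
  simp [h1 x hx, h2 x hx]

theorem IsPiecewisePoly.const_smul {k : ℕ} {v : E d → ℝ} (hv : IsPiecewisePoly Ω 𝒯 k v) (c : ℝ) :
    IsPiecewisePoly Ω 𝒯 k (c • v) := by
  refine ⟨hv.1.const_smul c, fun s hs => ?_⟩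
  obtain ⟨P, hP, h1⟩ := hv.2 s hs
  refine ⟨c • P, (MvPolynomial.totalDegree_smul_le c P).trans hP, fun x hx => ?_⟩
  simp [h1 x hx]

theorem isPiecewisePoly_const (k : ℕ) (c : ℝ) : IsPiecewisePoly Ω 𝒯 k fun _ => c :=
  ⟨continuousOn_const, fun _ _ => ⟨MvPolynomial.C c, by simp, fun x _ => by simp⟩⟩

/-- The finite element space as a submodule of `L²(Ω)`. -/
def FEsub (Ω : Set (E d)) (𝒯 : Mesh d) (k : ℕ) : Submodule ℝ (L2 Ω) where
  carrier := FE Ω 𝒯 k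
  add_mem' := by
    rintro p q ⟨v, hv, h1⟩ ⟨w, hw, h2⟩
    exact ⟨v + w, hv.add hw, (Lp.coeFn_add p q).trans (h1.add h2)⟩
  zero_mem' := ⟨fun _ => 0, isPiecewisePoly_const k 0, Lp.coeFn_zero _ _ _⟩
  smul_mem' := by
    rintro c p ⟨v, hv, h1⟩
    exact ⟨c • v, hv.const_smul c, (Lp.coeFn_smul c p).trans (h1.const_smul c)⟩

/-- Fix for each point of the closure one element containing it. A tuple of polynomials, one per
element, then determines a function linearly, and each finite element function agrees almost
everywhere with one obtained in this way. Finite dimension makes the orthogonal projections below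
available. -/
theorem finiteDimensional_FEsub (h𝒯 : IsTriangulation Ω 𝒯) (hΩ : MeasurableSet Ω) (k : ℕ) :
    FiniteDimensional ℝ (FEsub Ω 𝒯 k) := by
  classical
  have : Finite (elements 𝒯) := (h𝒯.finite.subset fun s hs => hs.1).to_subtype
  have hsel : ∀ x ∈ closure Ω, ∃ s : elements 𝒯, x ∈ cell s.1 := fun x hx => by
    rw [← h𝒯.covers] at hx
    simp only [mem_iUnion] at hx
    obtain ⟨s, hs, hx⟩ := hx
    exact ⟨⟨s, hs⟩, hx⟩
  let Ψ : (elements 𝒯 → MvPolynomial.restrictTotalDegree (Fin d) ℝ k) →ₗ[ℝ] (E d → ℝ) :=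
    { toFun := fun P x => if hx : x ∈ closure Ω then
        MvPolynomial.eval (fun i => x i) (P (hsel x hx).choose).1 else 0
      map_add' := fun P Q => by ext x; by_cases hx : x ∈ closure Ω <;> simp [hx]
      map_smul' := fun c P => by ext x; by_cases hx : x ∈ closure Ω <;> simp [hx] }
  -- The selection of elements is arbitrary, so functions in the range of Ψ need not be measurable;
  -- `R` keeps those that define elements of L².
  let R : Submodule ℝ (E d → ℝ) :=
    { carrier := {w | w ∈ LinearMap.range Ψ ∧ MemLp w 2 (volume.restrict Ω)}
      add_mem' := fun h h' => ⟨add_mem h.1 h'.1, h.2.add h'.2⟩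
      zero_mem' := ⟨zero_mem _, MemLp.zero⟩
      smul_mem' := fun c w h => ⟨Submodule.smul_mem _ c h.1, h.2.const_smul c⟩ }
  have hR : FiniteDimensional ℝ R :=
    Submodule.finiteDimensional_of_le (show R ≤ LinearMap.range Ψ from fun w hw => hw.1)
  let Φ : R →ₗ[ℝ] L2 Ω :=
    { toFun := fun w => w.2.2.toLp w.1
      map_add' := fun v w => MemLp.toLp_add v.2.2 w.2.2
      map_smul' := fun c v => MemLp.toLp_const_smul c v.2.2 }
  refine Submodule.finiteDimensional_of_le (S₂ := LinearMap.range Φ) ?_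
  rintro q ⟨w, hw, hq⟩
  choose! P hPdeg hP using hw.2
  let PP : elements 𝒯 → MvPolynomial.restrictTotalDegree (Fin d) ℝ k := fun s =>
    ⟨P s.1, (MvPolynomial.mem_restrictTotalDegree _ _ _).2 (hPdeg s.1 s.2)⟩
  have hae : (q : E d → ℝ) =ᵐ[volume.restrict Ω] Ψ PP := by
    filter_upwards [hq, ae_restrict_mem hΩ] with x hx hxΩ
    have hxc : x ∈ closure Ω := subset_closure hxΩ
    have hval : Ψ PP x = MvPolynomial.eval (fun i => x i) (P (hsel x hxc).choose.1) := by
      simp [Ψ, PP, hxc]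
    rw [hx, hval]
    exact hP _ (hsel x hxc).choose.2 x (hsel x hxc).choose_spec
  have hmem : MemLp (Ψ PP) 2 (volume.restrict Ω) := (memLp_congr_ae hae).1 (Lp.memLp q)
  exact ⟨⟨Ψ PP, ⟨⟨PP, rfl⟩, hmem⟩⟩, Lp.ext (hmem.coeFn_toLp.trans hae.symm)⟩

/-- `X_h` as a submodule. -/
def Xhsub (Ω : Set (E d)) (𝒯 : Mesh d) : Submodule ℝ (HV 1 Ω) where
  carrier := Xh Ω 𝒯
  add_mem' ha hb := ⟨(Xsub Ω).add_mem ha.1 hb.1, fun i => (FEsub Ω 𝒯 2).add_mem (ha.2 i) (hb.2 i)⟩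
  zero_mem' := ⟨(Xsub Ω).zero_mem, fun _ => (FEsub Ω 𝒯 2).zero_mem⟩
  smul_mem' c _ h := ⟨(Xsub Ω).smul_mem c h.1, fun i => (FEsub Ω 𝒯 2).smul_mem c (h.2 i)⟩

theorem Xhsub_le : Xhsub Ω 𝒯 ≤ Xsub Ω := fun _ h => h.1

theorem finiteDimensional_Xhsub (h𝒯 : IsTriangulation Ω 𝒯) (hΩ : IsOpen Ω) :
    FiniteDimensional ℝ (Xhsub Ω 𝒯) := by
  have := finiteDimensional_FEsub h𝒯 hΩ.measurableSet 2
  let Φ : Xhsub Ω 𝒯 →ₗ[ℝ] (Fin d → FEsub Ω 𝒯 2) :=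
    { toFun := fun v i => ⟨val (v.1 i), v.2.2 i⟩
      map_add' := fun _ _ => rfl
      map_smul' := fun _ _ => rfl }
  refine Module.Finite.of_injective Φ fun v w h => Subtype.ext ?_
  ext1 i
  exact H1_ext hΩ (congrArg Subtype.val (congrFun h i))

theorem integrable_coe (hb : Bornology.IsBounded Ω) (q : L2 Ω) :
    Integrable q (volume.restrict Ω) := by
  have : IsFiniteMeasure (volume.restrict Ω) := ⟨by simpa using hb.measure_lt_top⟩
  exact (Lp.memLp q).integrable (by norm_num)

/-- `Q_h` as a submodule. -/
def Qhsub (hb : Bornology.IsBounded Ω) (𝒯 : Mesh d) : Submodule ℝ (L2 Ω) where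
  carrier := Qh Ω 𝒯
  add_mem' := by
    rintro p q ⟨h1, h2⟩ ⟨h3, h4⟩
    refine ⟨(FEsub Ω 𝒯 1).add_mem h1 h3, ?_⟩
    rw [integral_congr_ae (Lp.coeFn_add p q)]
    simp only [Pi.add_apply]
    rw [integral_add (integrable_coe hb p) (integrable_coe hb q), h2, h4, add_zero]
  zero_mem' := by
    refine ⟨(FEsub Ω 𝒯 1).zero_mem, ?_⟩
    rw [integral_congr_ae (Lp.coeFn_zero ℝ 2 (volume.restrict Ω))]
    simp
  smul_mem' := by
    rintro c q ⟨h1, h2⟩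
    refine ⟨(FEsub Ω 𝒯 1).smul_mem c h1, ?_⟩
    rw [integral_congr_ae (Lp.coeFn_smul c q)]
    simp only [Pi.smul_apply, smul_eq_mul]
    rw [integral_const_mul, h2, mul_zero]

/-- The discretely divergence-free functions. -/
def Vhsub (Ω : Set (E d)) (𝒯 : Mesh d) : Submodule ℝ (HV 1 Ω) where
  carrier := {v | v ∈ Xhsub Ω 𝒯 ∧ ∀ q ∈ Qh Ω 𝒯, inner ℝ q (dvg v) = 0}
  add_mem' ha hb := ⟨add_mem ha.1 hb.1, fun q hq => by
    rw [dvg_add, inner_add_right, ha.2 q hq, hb.2 q hq, add_zero]⟩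
  zero_mem' := ⟨zero_mem _, fun q _ => by simp [dvg]⟩
  smul_mem' c _ h := ⟨Submodule.smul_mem _ c h.1, fun q hq => by
    rw [dvg_smul, inner_smul_right, h.2 q hq, mul_zero]⟩

/-- The tensor `q I`. -/
def diagT (Ω : Set (E d)) : L2 Ω →ₗ[ℝ] L2T Ω where
  toFun q := WithLp.toLp 2 fun ik => if ik.1 = ik.2 then q else 0
  map_add' p q := by
    ext1 ik
    by_cases h : ik.1 = ik.2 <;> simp [h]
  map_smul' c q := by
    ext1 ik
    by_cases h : ik.1 = ik.2 <;> simp [h]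

theorem inner_diagT_grad (q : L2 Ω) (v : HV 1 Ω) :
    inner ℝ (diagT Ω q) (grad v) = inner ℝ q (dvg v) := by
  rw [PiLp.inner_apply, Fintype.sum_prod_type, dvg, inner_sum]
  refine Finset.sum_congr rfl fun i _ => ?_
  rw [Finset.sum_eq_single i]
  · simp [diagT, grad]
  · intro k _ hk
    simp [diagT, Ne.symm hk]
  · simp

/-- The approximant v is corrected by some r ∈ X_h having the same divergence as v against Q_h, and
r is chosen with ∇r the gradient of a discrete pressure s, in the sense of the projection of sI to
∇X_h. The inf-sup condition gives β‖s‖ ≤ ‖∇r‖. As u is solenoidal, ‖∇r‖² = (s, ∇·(v − u)). Together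
these give β‖∇r‖ ≤ d‖∇(u − v)‖. -/
theorem exists_mem_Vhsub (hΩ : IsOpen Ω) (hb : Bornology.IsBounded Ω) (h𝒯 : IsTriangulation Ω 𝒯)
    {β : ℝ} (hβ : 0 < β) (hLBB : LBB Ω 𝒯 β) {u v : HV 1 Ω} (hu : dvg u = 0)
    (hv : v ∈ Xhsub Ω 𝒯) :
    ∃ w ∈ Vhsub Ω 𝒯, ‖grad (u - w)‖ ≤ (1 + d / β) * ‖grad (u - v)‖ := by
  have := finiteDimensional_Xhsub h𝒯 hΩ
  have hQ : FiniteDimensional ℝ (Qhsub hb 𝒯) := by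
    have := finiteDimensional_FEsub h𝒯 hΩ.measurableSet 1
    exact Submodule.finiteDimensional_of_le
      (show Qhsub hb 𝒯 ≤ FEsub Ω 𝒯 1 from fun q hq => hq.1)
  let G : Submodule ℝ (L2T Ω) := (Xhsub Ω 𝒯).map (gradₗ 0 Ω)
  -- The discrete pressure gradients inside ∇X_h: orthogonality to `S` within ∇X_h is discrete
  -- solenoidality, so removing the `S`-component of ∇v makes v discretely divergence-free.
  let S : Submodule ℝ (L2T Ω) := (Qhsub hb 𝒯).map (G.starProjection.toLinearMap ∘ₗ diagT Ω)
  have hSG : S ≤ G := by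
    rintro _ ⟨q, -, rfl⟩
    exact G.starProjection_apply_mem _
  have hG : ∀ {w : HV 1 Ω}, w ∈ Xhsub Ω 𝒯 → ∀ q : L2 Ω,
      inner ℝ (G.starProjection (diagT Ω q)) (grad w) = inner ℝ q (dvg w) := by
    intro w hw q
    have h1 := G.starProjection_inner_eq_zero (diagT Ω q) (grad w) ⟨w, hw, rfl⟩
    rw [inner_sub_left] at h1
    rw [← inner_diagT_grad]
    linarith
  obtain ⟨r, hr, hrS⟩ := hSG (S.starProjection_apply_mem (grad v))
  obtain ⟨s, hs, hsS⟩ := S.starProjection_apply_mem (grad v)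
  have hrS' : grad r = S.starProjection (grad v) := hrS
  have hsS' : G.starProjection (diagT Ω s) = grad r := by rw [hrS']; exact hsS
  have hort : ∀ q ∈ Qh Ω 𝒯, inner ℝ q (dvg r) = inner ℝ q (dvg v) := by
    intro q hq
    rw [← hG hr, ← hG hv, hrS']
    have h1 := S.starProjection_inner_eq_zero (grad v) (G.starProjection (diagT Ω q))
      ⟨q, hq, rfl⟩
    rw [inner_sub_left, real_inner_comm, real_inner_comm _ (S.starProjection _)] at h1
    linarith
  refine ⟨v - r, ⟨sub_mem hv hr, fun q hq => ?_⟩, ?_⟩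
  · rw [dvg_sub, inner_sub_right, hort q hq, sub_self]
  have hb1 : β * ‖s‖ ≤ ‖grad r‖ := by
    obtain ⟨z, hz, hz1, hz2⟩ := hLBB s hs
    refine hz2.trans ?_
    rw [← hG hz, hsS']
    exact (real_inner_le_norm _ _).trans (mul_le_of_le_one_right (norm_nonneg _) hz1)
  have hb2 : ‖grad r‖ ^ 2 ≤ ‖s‖ * (d * ‖grad (u - v)‖) := by
    have h1 : ‖grad r‖ ^ 2 = inner ℝ s (dvg (v - u)) := by
      rw [dvg_sub, hu, sub_zero, ← hort s hs, ← hG hr, hsS', real_inner_self_eq_norm_sq]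
    rw [h1]
    refine (real_inner_le_norm _ _).trans (mul_le_mul_of_nonneg_left ?_ (norm_nonneg _))
    refine (norm_dvg_le _).trans (le_of_eq ?_)
    rw [grad_sub, grad_sub, norm_sub_rev]
  have hb3 : ‖grad r‖ ≤ d / β * ‖grad (u - v)‖ := by
    rw [div_mul_eq_mul_div, le_div_iff₀ hβ]
    rcases (norm_nonneg (grad r)).eq_or_lt with h0 | h0
    · rw [← h0, zero_mul]; positivity
    · refine le_of_mul_le_mul_left ?_ h0
      calc ‖grad r‖ * (‖grad r‖ * β) = β * ‖grad r‖ ^ 2 := by ring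
        _ ≤ β * (‖s‖ * (d * ‖grad (u - v)‖)) := mul_le_mul_of_nonneg_left hb2 hβ.le
        _ = (β * ‖s‖) * (d * ‖grad (u - v)‖) := by ring
        _ ≤ ‖grad r‖ * (d * ‖grad (u - v)‖) := mul_le_mul_of_nonneg_right hb1 (by positivity)
  have : grad (u - (v - r)) = grad (u - v) + grad r := by
    rw [← grad_add]; congr 1; abel
  rw [this]
  refine (norm_add_le _ _).trans ?_
  linarith

/-- The projection onto the discretely divergence-free functions in the energy inner product. -/
theorem exists_ritz (hΩ : IsOpen Ω) (h𝒯 : IsTriangulation Ω 𝒯) :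
    ∃ R : HV 1 Ω → HV 1 Ω, (∀ u, R u ∈ Vhsub Ω 𝒯) ∧
      ∃ P : L2T Ω →L[ℝ] L2T Ω, (∀ u, grad (R u) = P (grad u)) ∧ (∀ x, ‖P x‖ ≤ ‖x‖) ∧
        (∀ x, ∀ v ∈ Vhsub Ω 𝒯, inner ℝ (x - P x) (grad v) = 0) ∧
        ∀ x, ∀ v ∈ Vhsub Ω 𝒯, ‖x - P x‖ ≤ ‖x - grad v‖ := by
  have := finiteDimensional_Xhsub h𝒯 hΩ
  have : FiniteDimensional ℝ (Vhsub Ω 𝒯) :=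
    Submodule.finiteDimensional_of_le (show Vhsub Ω 𝒯 ≤ Xhsub Ω 𝒯 from fun v hv => hv.1)
  -- `R` is chosen point by point and no linearity is claimed for it; the linear object is the
  -- projection `P` acting on gradients, through which time differences are taken.
  let G : Submodule ℝ (L2T Ω) := (Vhsub Ω 𝒯).map (gradₗ 0 Ω)
  choose R hR hP using fun u : HV 1 Ω => G.starProjection_apply_mem (grad u)
  refine ⟨R, hR, G.starProjection, hP, G.norm_starProjection_apply_le,
    fun x v hv => G.starProjection_inner_eq_zero x _ ⟨v, hv, rfl⟩, fun x v hv => ?_⟩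
  rw [G.starProjection_minimal]
  exact ciInf_le ⟨0, by rintro _ ⟨y, rfl⟩; exact norm_nonneg _⟩ (⟨grad v, ⟨v, hv, rfl⟩⟩ : G)

end FiniteElements
end EnsembleNSE
end


noncomputable section

namespace EnsembleNSE
open MeasureTheory Set Filter Topology
open scoped ContDiff NNReal ENNReal

/-! ### Finite differences of functions of time -/

section Time

variable {F : Type*} [NormedAddCommGroup F] [NormedSpace ℝ F] {T : ℝ} {u u' : ℝ → F}

theorem IsTimeDeriv.intervalIntegrable (h : IsTimeDeriv T u u') {a b : ℝ} (ha : a ∈ Icc 0 T)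
    (hb : b ∈ Icc 0 T) : IntervalIntegrable u' volume a b := by
  rw [intervalIntegrable_iff]
  refine h.1.mono_set ?_
  rw [uIoc]
  exact Ioc_subset_Ioc (le_min ha.1 hb.1) (max_le ha.2 hb.2)

theorem IsTimeDeriv.sub_eq (h : IsTimeDeriv T u u') {a b : ℝ} (ha : a ∈ Icc 0 T)
    (hb : b ∈ Icc 0 T) : u b - u a = ∫ s in a..b, u' s := by
  have h0 : (0 : ℝ) ∈ Icc 0 T := ⟨le_rfl, ha.1.trans ha.2⟩
  rw [h.2 a ha, h.2 b hb, add_sub_add_left_eq_sub,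
    intervalIntegral.integral_interval_sub_left (h.intervalIntegrable h0 hb)
      (h.intervalIntegrable h0 ha)]

theorem IsTimeDeriv.norm_sub_le (h : IsTimeDeriv T u u') {a b : ℝ} (ha : a ∈ Icc 0 T)
    (hb : b ∈ Icc 0 T) (hab : a ≤ b) : ‖u b - u a‖ ≤ ∫ s in a..b, ‖u' s‖ := by
  rw [h.sub_eq ha hb]
  exact intervalIntegral.norm_integral_le_integral_norm hab

theorem IsTimeDeriv.bounded (hT : 0 ≤ T) (h : IsTimeDeriv T u u') :
    ∃ M, 0 ≤ M ∧ ∀ t ∈ Icc 0 T, ‖u t‖ ≤ M := by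
  refine ⟨‖u 0‖ + ∫ s in (0 : ℝ)..T, ‖u' s‖, add_nonneg (norm_nonneg _)
    (intervalIntegral.integral_nonneg hT fun _ _ => norm_nonneg _), fun t ht => ?_⟩
  have h0 : (0 : ℝ) ∈ Icc 0 T := ⟨le_rfl, hT⟩
  have h1 := h.norm_sub_le h0 ht ht.1
  have h2 : ∫ s in (0 : ℝ)..t, ‖u' s‖ ≤ ∫ s in (0 : ℝ)..T, ‖u' s‖ :=
    intervalIntegral.integral_mono_interval le_rfl ht.1 ht.2
      (Eventually.of_forall fun _ => norm_nonneg _)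
      (h.intervalIntegrable h0 ⟨hT, le_rfl⟩).norm
  have h3 : ‖u t‖ ≤ ‖u 0‖ + ‖u t - u 0‖ := by
    have := norm_add_le (u 0) (u t - u 0)
    rwa [add_sub_cancel] at this
  linarith

theorem IsTimeDeriv.norm_sub_le_mul (h : IsTimeDeriv T u u') {M : ℝ}
    (hM : ∀ t ∈ Icc 0 T, ‖u' t‖ ≤ M) {a b : ℝ} (ha : a ∈ Icc 0 T)
    (hb : b ∈ Icc 0 T) : ‖u b - u a‖ ≤ M * |b - a| := by
  rw [h.sub_eq ha hb]
  refine intervalIntegral.norm_integral_le_of_norm_le_const fun s hs => hM s ?_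
  rw [uIoc] at hs
  exact ⟨(le_min ha.1 hb.1).trans hs.1.le, hs.2.trans (max_le ha.2 hb.2)⟩

/-- Integrate back from t three times. On [t − s, t] the function u_tt varies by at most A =
∫‖u_ttt‖, so u_t deviates from its tangent at t by at most As, and u from its Taylor polynomial by
at most As². Only integrability of u_ttt is needed. -/
theorem norm_taylor_remainder_le [CompleteSpace F] {ut utt uttt : ℝ → F} (h1 : IsTimeDeriv T u ut)
    (h2 : IsTimeDeriv T ut utt) (h3 : IsTimeDeriv T utt uttt) {t s : ℝ} (ht : t ≤ T) (hs : 0 ≤ s)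
    (hst : s ≤ t) :
    ‖u (t - s) - u t + s • ut t - (s ^ 2 / 2) • utt t‖ ≤
      s ^ 2 * ∫ τ in (t - s)..t, ‖uttt τ‖ := by
  have htm : t ∈ Icc 0 T := ⟨hs.trans hst, ht⟩
  have hsm : t - s ∈ Icc 0 T := ⟨by linarith, by linarith⟩
  set A := ∫ τ in (t - s)..t, ‖uttt τ‖ with hA
  have hsub : ∀ {τ}, τ ∈ Icc (t - s) t → τ ∈ Icc 0 T := fun hτ =>
    ⟨hsm.1.trans hτ.1, hτ.2.trans ht⟩
  have b1 : ∀ τ ∈ Icc (t - s) t, ‖utt τ - utt t‖ ≤ A := by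
    intro τ hτ
    rw [norm_sub_rev]
    refine (h3.norm_sub_le (hsub hτ) htm hτ.2).trans ?_
    exact intervalIntegral.integral_mono_interval hτ.1 hτ.2 le_rfl
      (Eventually.of_forall fun _ => norm_nonneg _) (h3.intervalIntegrable hsm htm).norm
  have hA0 : 0 ≤ A := (norm_nonneg _).trans (b1 t ⟨by linarith, le_rfl⟩)
  have mem_uIoc : ∀ {τ r}, τ ∈ Icc (t - s) t → r ∈ uIoc t τ → r ∈ Icc (t - s) t := by
    intro τ r hτ hr
    rw [uIoc_of_ge hτ.2] at hr
    exact ⟨hτ.1.trans hr.1.le, hr.2⟩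
  have b2 : ∀ τ ∈ Icc (t - s) t, ‖ut τ - ut t - (τ - t) • utt t‖ ≤ A * s := by
    intro τ hτ
    have : ut τ - ut t - (τ - t) • utt t = ∫ r in t..τ, (utt r - utt t) := by
      rw [intervalIntegral.integral_sub (h2.intervalIntegrable htm (hsub hτ))
        intervalIntegrable_const, intervalIntegral.integral_const, h2.sub_eq htm (hsub hτ)]
    rw [this]
    refine (intervalIntegral.norm_integral_le_of_norm_le_const
      fun r hr => b1 r (mem_uIoc hτ hr)).trans ?_
    refine mul_le_mul_of_nonneg_left ?_ hA0
    rw [abs_le]; constructor <;> linarith [hτ.1, hτ.2]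
  have hmem : t - s ∈ Icc (t - s) t := ⟨le_rfl, by linarith⟩
  have e : u (t - s) - u t + s • ut t - (s ^ 2 / 2) • utt t =
      ∫ r in t..(t - s), (ut r - ut t - (r - t) • utt t) := by
    have i1 : IntervalIntegrable ut volume t (t - s) := h1.intervalIntegrable htm hsm
    have i2 : IntervalIntegrable (fun r => (r - t) • utt t) volume t (t - s) :=
      (by fun_prop : Continuous fun r : ℝ => (r - t) • utt t).intervalIntegrable _ _
    have e1 : ∫ r in t..(t - s), (r - t) = s ^ 2 / 2 := by
      rw [intervalIntegral.integral_sub (by simp) (by simp), integral_id,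
        intervalIntegral.integral_const, smul_eq_mul]
      ring
    rw [intervalIntegral.integral_sub (i1.sub intervalIntegrable_const) i2,
      intervalIntegral.integral_sub i1 intervalIntegrable_const, intervalIntegral.integral_const,
      intervalIntegral.integral_smul_const, e1, ← h1.sub_eq htm hsm]
    have : (t - s - t) • ut t = -(s • ut t) := by rw [← neg_smul]; congr 1; ring
    rw [this]; abel
  rw [e]
  refine (intervalIntegral.norm_integral_le_of_norm_le_const
    fun r hr => b2 r (mem_uIoc hmem hr)).trans (le_of_eq ?_)
  rw [show t - s - t = -s by ring, abs_neg, abs_of_nonneg hs]; ring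

theorem sq_integral_norm_le {F : Type*} [NormedAddCommGroup F] {T : ℝ} {g : ℝ → F}
    (hg : MemL2Time T g) {a b : ℝ} (ha : 0 ≤ a) (hab : a ≤ b)
    (hb : b ≤ T) :
    IntervalIntegrable (fun s => ‖g s‖ ^ 2) volume a b ∧
    (∫ s in a..b, ‖g s‖) ^ 2 ≤ (b - a) * ∫ s in a..b, ‖g s‖ ^ 2 := by
  have hsub : Ioc a b ⊆ Ioc 0 T := Ioc_subset_Ioc ha hb
  have h1 : MemLp (fun s => ‖g s‖) 2 (volume.restrict (Ioc a b)) :=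
    (hg.mono_measure (Measure.restrict_mono hsub le_rfl)).norm
  have h2 : MemLp (fun _ : ℝ => (1 : ℝ)) 2 (volume.restrict (Ioc a b)) := memLp_const 1
  refine ⟨by rw [intervalIntegrable_iff_integrableOn_Ioc_of_le hab]; exact h1.integrable_sq, ?_⟩
  rw [intervalIntegral.integral_of_le hab, intervalIntegral.integral_of_le hab]
  have h3 : ∫ s in Ioc a b, ‖g s‖ = inner ℝ (h2.toLp _) (h1.toLp _) := by
    rw [L2.inner_def]
    refine integral_congr_ae ?_
    filter_upwards [h1.coeFn_toLp, h2.coeFn_toLp] with x e1 e2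
    simp only [e1, e2, RCLike.inner_apply, conj_trivial, mul_one]
  have h4 : ‖h1.toLp _‖ ^ 2 = ∫ s in Ioc a b, ‖g s‖ ^ 2 := by
    rw [← real_inner_self_eq_norm_sq, L2.inner_def]
    refine integral_congr_ae ?_
    filter_upwards [h1.coeFn_toLp] with x e1
    simp [e1, sq]
  have h5 : ‖h2.toLp _‖ ^ 2 = b - a := by
    rw [← real_inner_self_eq_norm_sq, L2.inner_def]
    have : ∫ x in Ioc a b, inner ℝ (h2.toLp _ x) (h2.toLp _ x) = ∫ x in Ioc a b, (1 : ℝ) := by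
      refine integral_congr_ae ?_
      filter_upwards [h2.coeFn_toLp] with x e1
      simp only [e1, RCLike.inner_apply, conj_trivial, mul_one]
    rw [this]
    simp [hab]
  rw [h3, ← h4, ← h5, ← mul_pow]
  have := abs_real_inner_le_norm (h2.toLp _) (h1.toLp _)
  exact sq_le_sq' (abs_le.1 this).1 (abs_le.1 this).2

/-- Truncation errors of the third-order difference and of the time discretization. -/
theorem exists_time_bounds [CompleteSpace F] (hT : 0 < T) {ut : ℝ → F} (h : MemH3Time T u ut) :
    ∃ M : ℝ, 0 ≤ M ∧ (∀ t ∈ Icc 0 T, ‖u t‖ ≤ M) ∧ ∀ (NT : ℕ) (Δt : ℝ), 0 < Δt → (NT : ℝ) * Δt = T →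
      ∃ B : ℕ → ℝ, (∀ n, 0 ≤ B n) ∧ (∑ n ∈ Finset.Ico 2 NT, B n ≤ M) ∧
      ∀ n, 2 ≤ n → n + 1 ≤ NT →
        ‖u (((n + 1 : ℕ) : ℝ) * Δt) - (3 : ℝ) • u ((n : ℝ) * Δt)
          + (3 : ℝ) • u (((n - 1 : ℕ) : ℝ) * Δt) - u (((n - 2 : ℕ) : ℝ) * Δt)‖ ^ 2
          ≤ Δt ^ 5 * B n ∧
        ‖u (((n + 1 : ℕ) : ℝ) * Δt) - (3 : ℝ) • u ((n : ℝ) * Δt)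
          + (3 : ℝ) • u (((n - 1 : ℕ) : ℝ) * Δt) - u (((n - 2 : ℕ) : ℝ) * Δt)‖ ≤ M * Δt ∧
        ‖(1 / (6 * Δt)) • ((10 : ℝ) • u (((n + 1 : ℕ) : ℝ) * Δt) - (15 : ℝ) • u ((n : ℝ) * Δt)
          + (6 : ℝ) • u (((n - 1 : ℕ) : ℝ) * Δt) - u (((n - 2 : ℕ) : ℝ) * Δt))‖ ≤ M ∧
        ‖(1 / (6 * Δt)) • ((10 : ℝ) • u (((n + 1 : ℕ) : ℝ) * Δt) - (15 : ℝ) • u ((n : ℝ) * Δt)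
          + (6 : ℝ) • u (((n - 1 : ℕ) : ℝ) * Δt) - u (((n - 2 : ℕ) : ℝ) * Δt))
          - ut (((n + 1 : ℕ) : ℝ) * Δt)‖ ^ 2 ≤ Δt ^ 3 * B n := by
  obtain ⟨utt, uttt, h1, h2, h3, h4⟩ := h
  obtain ⟨M0, hM0, hu⟩ := h1.bounded hT.le
  obtain ⟨M1, hM1, hut⟩ := h2.bounded hT.le
  set I := ∫ s in (0 : ℝ)..T, ‖uttt s‖ ^ 2 with hI
  have hI0 : 0 ≤ I := intervalIntegral.integral_nonneg hT.le fun _ _ => sq_nonneg _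
  -- `M0` bounds u. The third difference is a combination of first differences with weights 1, −2,
  -- 1, each at most `M1 * Δt`, whence 4. Each integral `b m` occurs in at most three of the `B n`,
  -- whence 5184 = 3 · 1728.
  refine ⟨M0 + 4 * M1 + 5184 * I, by positivity,
    fun t ht => (hu t ht).trans (by linarith), fun NT Δt hΔ hNT => ?_⟩
  let b : ℕ → ℝ := fun m => ∫ s in ((m : ℝ) * Δt)..(((m + 1 : ℕ) : ℝ) * Δt), ‖uttt s‖ ^ 2
  have hle : ∀ m : ℕ, (m : ℝ) * Δt ≤ ((m + 1 : ℕ) : ℝ) * Δt := fun m => by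
    push_cast; nlinarith
  have hb0 : ∀ m, 0 ≤ b m := fun m =>
    intervalIntegral.integral_nonneg (hle m) fun _ _ => sq_nonneg _
  have hmem : ∀ m : ℕ, m ≤ NT → (m : ℝ) * Δt ∈ Icc 0 T := fun m hm => by
    refine ⟨by positivity, ?_⟩
    rw [← hNT]
    have : (m : ℝ) ≤ NT := by exact_mod_cast hm
    nlinarith
  have hbI : ∀ m : ℕ, m < NT → IntervalIntegrable (fun s => ‖uttt s‖ ^ 2) volume
      ((m : ℝ) * Δt) (((m + 1 : ℕ) : ℝ) * Δt) := fun m hm =>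
    (sq_integral_norm_le h4 (hmem m hm.le).1 (hle m) (hmem (m + 1) hm).2).1
  have hsum : ∑ m ∈ Finset.range NT, b m = I := by
    have := intervalIntegral.sum_integral_adjacent_intervals (μ := volume)
      (a := fun m : ℕ => (m : ℝ) * Δt) (n := NT) (f := fun s => ‖uttt s‖ ^ 2) hbI
    rw [hI, ← hNT]
    simpa [b] using this
  -- 1728 = 3 · 24²: below, the third difference is at most 24Δt²A, and A² ≤ 3Δt(b(n−2) + b(n−1) +
  -- b(n)) by Cauchy–Schwarz over three time steps.
  refine ⟨fun n => 1728 * (b (n - 2) + b (n - 1) + b n), fun n => by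
    have := hb0 (n - 2); have := hb0 (n - 1); have := hb0 n; positivity, ?_, ?_⟩
  · rw [← Finset.mul_sum, Finset.sum_add_distrib, Finset.sum_add_distrib]
    have s0 : ∑ n ∈ Finset.Ico 2 NT, b n ≤ I := by
      rw [← hsum]
      refine Finset.sum_le_sum_of_subset_of_nonneg (fun n hn => ?_) fun n _ _ => hb0 n
      rw [Finset.mem_range]; exact (Finset.mem_Ico.1 hn).2
    have sk : ∀ k, k ≤ 2 → ∑ n ∈ Finset.Ico 2 NT, b (n - k) ≤ I := by
      intro k hk
      have hinj : Set.InjOn (fun n => n - k) (Finset.Ico 2 NT : Set ℕ) := by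
        intro x hx y hy hxy
        simp only [Finset.coe_Ico, mem_Ico] at hx hy hxy
        omega
      rw [← Finset.sum_image (f := b) (g := fun n => n - k) hinj, ← hsum]
      refine Finset.sum_le_sum_of_subset_of_nonneg (fun n hn => ?_) fun n _ _ => hb0 n
      obtain ⟨m, hm, rfl⟩ := Finset.mem_image.1 hn
      rw [Finset.mem_Ico] at hm
      rw [Finset.mem_range]; omega
    linarith [sk 1 (by norm_num), sk 2 le_rfl]
  intro n hn hn1
  obtain ⟨m, rfl⟩ : ∃ m, n = m + 2 := ⟨n - 2, by omega⟩
  set t := ((m + 2 + 1 : ℕ) : ℝ) * Δt with ht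
  have ht1 : ((m + 2 : ℕ) : ℝ) * Δt = t - Δt := by rw [ht]; push_cast; ring
  have ht2 : ((m + 2 - 1 : ℕ) : ℝ) * Δt = t - 2 * Δt := by
    rw [show m + 2 - 1 = m + 1 by omega, ht]; push_cast; ring
  have ht3 : ((m + 2 - 2 : ℕ) : ℝ) * Δt = t - 3 * Δt := by
    rw [show m + 2 - 2 = m by omega, ht]; push_cast; ring
  have htT : t ∈ Icc 0 T := hmem _ hn1
  have h3t : 3 * Δt ≤ t := by
    have := (hmem m (by omega)).1
    have e : (m : ℝ) * Δt = t - 3 * Δt := by rw [ht]; push_cast; ring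
    linarith
  rw [ht1, ht2, ht3]
  set A := ∫ τ in (t - 3 * Δt)..t, ‖uttt τ‖ with hA
  have hA0 : 0 ≤ A := intervalIntegral.integral_nonneg (by linarith) fun _ _ => norm_nonneg _
  have hii : IntervalIntegrable (fun τ => ‖uttt τ‖) volume (t - 3 * Δt) t :=
    (h3.intervalIntegrable ⟨by linarith, by linarith [htT.2]⟩ htT).norm
  have hAB : A ^ 2 ≤ 3 * Δt * (b m + b (m + 1) + b (m + 2)) := by
    have e1 := (sq_integral_norm_le h4 (a := t - 3 * Δt) (b := t) (by linarith) (by linarith)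
      htT.2).2
    have e2 : ∫ s in (t - 3 * Δt)..t, ‖uttt s‖ ^ 2 = b m + b (m + 1) + b (m + 2) := by
      simp only [b]
      rw [intervalIntegral.integral_add_adjacent_intervals (hbI m (by omega))
        (hbI (m + 1) (by omega)), intervalIntegral.integral_add_adjacent_intervals
        ((hbI m (by omega)).trans (hbI (m + 1) (by omega))) (hbI (m + 2) (by omega))]
      congr 1
      rw [ht]; push_cast; ring
    rw [e2] at e1
    linarith
  set R : ℝ → F := fun s => u (t - s) - u t + s • ut t - (s ^ 2 / 2) • utt t with hR
  have hRb : ∀ s, 0 ≤ s → s ≤ 3 * Δt → ‖R s‖ ≤ s ^ 2 * A := by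
    intro s hs hs3
    refine (norm_taylor_remainder_le h1 h2 h3 htT.2 hs (hs3.trans h3t)).trans ?_
    refine mul_le_mul_of_nonneg_left ?_ (sq_nonneg s)
    exact intervalIntegral.integral_mono_interval (by linarith) (by linarith) le_rfl
      (Eventually.of_forall fun _ => norm_nonneg _) hii
  have r1 := hRb Δt hΔ.le (by linarith)
  have r2 := hRb (2 * Δt) (by linarith) (by linarith)
  have r3 := hRb (3 * Δt) (by linarith) le_rfl
  have tm : ∀ c : ℝ, 0 ≤ c → c ≤ 3 → t - c * Δt ∈ Icc 0 T := fun c h0 h3 =>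
    ⟨by nlinarith, by nlinarith [htT.2]⟩
  have d1 := h1.norm_sub_le_mul hut (tm 1 (by norm_num) (by norm_num)) htT
  have d2 := h1.norm_sub_le_mul hut (tm 2 (by norm_num) (by norm_num)) (tm 1 (by norm_num) (by norm_num))
  have d3 := h1.norm_sub_le_mul hut (tm 3 (by norm_num) (by norm_num)) (tm 2 (by norm_num) (by norm_num))
  rw [show t - (t - 1 * Δt) = Δt by ring, abs_of_pos hΔ, one_mul] at d1
  rw [show t - 1 * Δt - (t - 2 * Δt) = Δt by ring, abs_of_pos hΔ, one_mul] at d2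
  rw [show t - 2 * Δt - (t - 3 * Δt) = Δt by ring, abs_of_pos hΔ] at d3
  -- The third difference annihilates quadratics, so only Taylor remainders survive; their bounds
  -- add up to (3·1 + 3·4 + 9)Δt²A = 24Δt²A.
  have eδ : u t - (3 : ℝ) • u (t - Δt) + (3 : ℝ) • u (t - 2 * Δt) - u (t - 3 * Δt) =
      (-3 : ℝ) • R Δt + (3 : ℝ) • R (2 * Δt) + (-1 : ℝ) • R (3 * Δt) := by
    simp only [hR]; module
  have bδ : ‖u t - (3 : ℝ) • u (t - Δt) + (3 : ℝ) • u (t - 2 * Δt) - u (t - 3 * Δt)‖ ≤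
      24 * Δt ^ 2 * A := by
    rw [eδ]
    refine (norm_add₃_le).trans ?_
    rw [norm_smul, norm_smul, norm_smul]
    norm_num
    linarith
  -- The quotient differentiates quadratics exactly at t, so again only remainders are left: (15·1 +
  -- 6·4 + 9)/6 = 8.
  have edt : (1 / (6 * Δt)) • ((10 : ℝ) • u t - (15 : ℝ) • u (t - Δt)
        + (6 : ℝ) • u (t - 2 * Δt) - u (t - 3 * Δt)) - ut t =
      (1 / (6 * Δt)) • ((-15 : ℝ) • R Δt + (6 : ℝ) • R (2 * Δt) + (-1 : ℝ) • R (3 * Δt)) := by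
    have hut' : ut t = (1 / (6 * Δt)) • ((6 * Δt) • ut t) := by
      rw [smul_smul, one_div_mul_cancel (by positivity), one_smul]
    conv_lhs => rw [hut']
    rw [← smul_sub]
    congr 1
    simp only [hR]; module
  have bdt : ‖(1 / (6 * Δt)) • ((10 : ℝ) • u t - (15 : ℝ) • u (t - Δt)
        + (6 : ℝ) • u (t - 2 * Δt) - u (t - 3 * Δt)) - ut t‖ ≤ 8 * Δt * A := by
    rw [edt, norm_smul, Real.norm_of_nonneg (by positivity), one_div, inv_mul_le_iff₀ (by positivity)]
    refine (norm_add₃_le).trans ?_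
    rw [norm_smul, norm_smul, norm_smul]
    norm_num
    linarith
  refine ⟨?_, ?_, ?_, ?_⟩
  · change _ ≤ Δt ^ 5 * (1728 * (b m + b (m + 1) + b (m + 2)))
    calc _ ≤ (24 * Δt ^ 2 * A) ^ 2 := pow_le_pow_left₀ (norm_nonneg _) bδ 2
      _ = 576 * Δt ^ 4 * A ^ 2 := by ring
      _ ≤ 576 * Δt ^ 4 * (3 * Δt * (b m + b (m + 1) + b (m + 2))) := by gcongr
      _ = _ := by ring
  · have e : u t - (3 : ℝ) • u (t - Δt) + (3 : ℝ) • u (t - 2 * Δt) - u (t - 3 * Δt) =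
        (u t - u (t - Δt)) + (-2 : ℝ) • (u (t - Δt) - u (t - 2 * Δt)) +
          (u (t - 2 * Δt) - u (t - 3 * Δt)) := by module
    rw [e]
    refine (norm_add₃_le).trans ?_
    rw [norm_smul]
    norm_num
    linarith [mul_nonneg hM0 hΔ.le, mul_nonneg hI0 hΔ.le, mul_nonneg hM1 hΔ.le]
  · have e : (10 : ℝ) • u t - (15 : ℝ) • u (t - Δt) + (6 : ℝ) • u (t - 2 * Δt) - u (t - 3 * Δt) =
        (10 : ℝ) • (u t - u (t - Δt)) + (-5 : ℝ) • (u (t - Δt) - u (t - 2 * Δt)) +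
          (u (t - 2 * Δt) - u (t - 3 * Δt)) := by module
    rw [e, norm_smul, Real.norm_of_nonneg (by positivity), one_div, inv_mul_le_iff₀ (by positivity)]
    refine (norm_add₃_le).trans ?_
    rw [norm_smul, norm_smul]
    norm_num
    linarith [mul_nonneg hM0 hΔ.le, mul_nonneg hI0 hΔ.le, mul_nonneg hM1 hΔ.le]
  · change _ ≤ Δt ^ 3 * (1728 * (b m + b (m + 1) + b (m + 2)))
    have := hb0 m; have := hb0 (m + 1); have := hb0 (m + 2)
    calc _ ≤ (8 * Δt * A) ^ 2 := pow_le_pow_left₀ (norm_nonneg _) bdt 2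
      _ = 64 * Δt ^ 2 * A ^ 2 := by ring
      _ ≤ 64 * Δt ^ 2 * (3 * Δt * (b m + b (m + 1) + b (m + 2))) := by gcongr
      _ = Δt ^ 3 * (192 * (b m + b (m + 1) + b (m + 2))) := by ring
      _ ≤ _ := by gcongr; norm_num

end Time
end EnsembleNSE
end


noncomputable section

namespace EnsembleNSE
open MeasureTheory Set Filter Topology
open scoped ContDiff NNReal ENNReal

/-! ### Multistep operators -/

section Multistep

variable {V W : Type*} [AddCommGroup V] [Module ℝ V] [AddCommGroup W] [Module ℝ W]

/-- Second-order extrapolation. -/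
def ext3 (x₂ x₁ x₀ : V) : V := (3 : ℝ) • x₂ - (3 : ℝ) • x₁ + x₀

/-- The third-order difference. -/
def del4 (x₃ x₂ x₁ x₀ : V) : V := x₃ - (3 : ℝ) • x₂ + (3 : ℝ) • x₁ - x₀

/-- The time difference quotient of the method. -/
def dt4 (Δt : ℝ) (x₃ x₂ x₁ x₀ : V) : V :=
  (1 / (6 * Δt)) • ((10 : ℝ) • x₃ - (15 : ℝ) • x₂ + (6 : ℝ) • x₁ - x₀)

theorem map_ext3 (L : V →ₗ[ℝ] W) (x₂ x₁ x₀ : V) :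
    L (ext3 x₂ x₁ x₀) = ext3 (L x₂) (L x₁) (L x₀) := by simp [ext3]

theorem map_del4 (L : V →ₗ[ℝ] W) (x₃ x₂ x₁ x₀ : V) :
    L (del4 x₃ x₂ x₁ x₀) = del4 (L x₃) (L x₂) (L x₁) (L x₀) := by simp [del4]

theorem map_dt4 (L : V →ₗ[ℝ] W) (Δt : ℝ) (x₃ x₂ x₁ x₀ : V) :
    L (dt4 Δt x₃ x₂ x₁ x₀) = dt4 Δt (L x₃) (L x₂) (L x₁) (L x₀) := by simp [dt4]

theorem ext3_mem {S : Submodule ℝ V} {x₂ x₁ x₀ : V} (h2 : x₂ ∈ S) (h1 : x₁ ∈ S) (h0 : x₀ ∈ S) :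
    ext3 x₂ x₁ x₀ ∈ S :=
  add_mem (sub_mem (S.smul_mem _ h2) (S.smul_mem _ h1)) h0

theorem del4_mem {S : Submodule ℝ V} {x₃ x₂ x₁ x₀ : V} (h3 : x₃ ∈ S) (h2 : x₂ ∈ S) (h1 : x₁ ∈ S)
    (h0 : x₀ ∈ S) : del4 x₃ x₂ x₁ x₀ ∈ S :=
  sub_mem (add_mem (sub_mem h3 (S.smul_mem _ h2)) (S.smul_mem _ h1)) h0

theorem dt4_mem {S : Submodule ℝ V} (Δt : ℝ) {x₃ x₂ x₁ x₀ : V} (h3 : x₃ ∈ S) (h2 : x₂ ∈ S)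
    (h1 : x₁ ∈ S) (h0 : x₀ ∈ S) : dt4 Δt x₃ x₂ x₁ x₀ ∈ S :=
  S.smul_mem _ (sub_mem (add_mem (sub_mem (S.smul_mem _ h3) (S.smul_mem _ h2))
    (S.smul_mem _ h1)) h0)

end Multistep

/-- The discrete energy identity of the method. -/
theorem inner_dt4_self {V : Type*} [NormedAddCommGroup V] [InnerProductSpace ℝ V] {Δt : ℝ}
    (hΔ : 0 < Δt) (a b c e : V) :
    6 * Δt * inner ℝ (dt4 Δt a b c e) a =
      1 / 2 * (‖a‖ ^ 2 + ‖(3 : ℝ) • a - b‖ ^ 2 + ‖ext3 a b c‖ ^ 2)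
        - 1 / 2 * (‖b‖ ^ 2 + ‖(3 : ℝ) • b - c‖ ^ 2 + ‖ext3 b c e‖ ^ 2)
        + 1 / 2 * ‖del4 a b c e‖ ^ 2 := by
  have h : 6 * Δt * inner ℝ (dt4 Δt a b c e) a =
      inner ℝ ((10 : ℝ) • a - (15 : ℝ) • b + (6 : ℝ) • c - e) a := by
    rw [dt4, inner_smul_left]
    simp only [conj_trivial]
    field_simp
  rw [h]
  simp only [ext3, del4, ← real_inner_self_eq_norm_sq, inner_add_left, inner_sub_left,
    inner_add_right, inner_sub_right, inner_smul_left, inner_smul_right, conj_trivial]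
  rw [real_inner_comm a b, real_inner_comm a c, real_inner_comm a e, real_inner_comm b c,
    real_inner_comm b e, real_inner_comm c e]
  ring

/-- The discrete Grönwall inequality, with dissipation terms `D`. -/
theorem discrete_gronwall {a : ℕ → ℝ} {D F : ℕ → ℝ} {c : ℝ} (hc : 0 ≤ c) (hD : ∀ n, 0 ≤ D n)
    (hF : ∀ n, 0 ≤ F n) {N : ℕ} (hN : 2 ≤ N)
    (h : ∀ n, 2 ≤ n → n < N → a (n + 1) + D n ≤ (1 + c) * a n + F n) :
    a N + ∑ n ∈ Finset.Ico 2 N, D n ≤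
      Real.exp (c * N) * (|a 2| + ∑ n ∈ Finset.Ico 2 N, F n) := by
  -- The factor 1 + c multiplies the old value only, so the recursion iterates directly and c need
  -- not be small.
  have key : ∀ m, 2 ≤ m → m ≤ N → a m + ∑ n ∈ Finset.Ico 2 m, D n ≤
      (1 + c) ^ m * (|a 2| + ∑ n ∈ Finset.Ico 2 m, F n) := by
    intro m hm
    induction m, hm using Nat.le_induction with
    | base =>
      intro _
      simp only [Finset.Ico_self, Finset.sum_empty, add_zero]
      have h1 : (1 : ℝ) ≤ (1 + c) ^ 2 := one_le_pow₀ (by linarith)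
      nlinarith [le_abs_self (a 2), abs_nonneg (a 2)]
    | succ m hm ih =>
      intro hmN
      have h1 := ih (by omega)
      have h2 := h m hm (by omega)
      rw [Finset.sum_Ico_succ_top hm, Finset.sum_Ico_succ_top hm]
      have h3 : 0 ≤ ∑ n ∈ Finset.Ico 2 m, D n := Finset.sum_nonneg fun n _ => hD n
      have h4 : (1 : ℝ) ≤ (1 + c) ^ (m + 1) := one_le_pow₀ (by linarith)
      have h5 := mul_le_mul_of_nonneg_left h1 (by linarith : (0 : ℝ) ≤ 1 + c)
      have h6 : F m ≤ (1 + c) ^ (m + 1) * F m := le_mul_of_one_le_left (hF m) h4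
      have h7 : (1 + c) ^ (m + 1) = (1 + c) * (1 + c) ^ m := pow_succ' _ _
      calc _ = (a (m + 1) + D m) + ∑ n ∈ Finset.Ico 2 m, D n := by ring
        _ ≤ (1 + c) * a m + F m + (1 + c) * ∑ n ∈ Finset.Ico 2 m, D n := by nlinarith
        _ = (1 + c) * (a m + ∑ n ∈ Finset.Ico 2 m, D n) + F m := by ring
        _ ≤ (1 + c) * ((1 + c) ^ m * (|a 2| + ∑ n ∈ Finset.Ico 2 m, F n)) +
            (1 + c) ^ (m + 1) * F m := add_le_add h5 h6
        _ = _ := by rw [h7]; ring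
  refine (key N hN le_rfl).trans (mul_le_mul_of_nonneg_right ?_
    (add_nonneg (abs_nonneg _) (Finset.sum_nonneg fun n _ => hF n)))
  calc (1 + c) ^ N ≤ (Real.exp c) ^ N := by
        refine pow_le_pow_left₀ (by linarith) ?_ N
        linarith [Real.add_one_le_exp c]
    _ = Real.exp (c * N) := by rw [← Real.exp_nat_mul]; ring_nf

/-- Absorption of the right-hand side of the error equation. -/
theorem young_absorb {Δt ν h K Cinv U R g x y z zg fl : ℝ} (hΔ : 0 < Δt) (hν : 0 < ν) (hh : 0 < h)
    (hx : 0 ≤ x) (hy : 0 ≤ y) (hz : 0 ≤ z)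
    (hzg0 : 0 ≤ zg) (hzg : h * zg ≤ Cinv * z)
    (hCFL : 12 * K ^ 2 * Cinv * (Δt / (ν * h)) * fl ^ 2 ≤ 1) :
    6 * Δt * (R * g + K * Real.sqrt (x * y) * U * g + K * fl * Real.sqrt (z * zg) * g) ≤
      21 / 4 * Δt * ν * g ^ 2 + 1 / 4 * z ^ 2 + Δt * (6 / ν * R ^ 2)
        + Δt * (3 / 16 * ν / 19 * y ^ 2) + Δt * (3648 * K ^ 4 * U ^ 4 / ν ^ 3 * x ^ 2) := by
  set q := Real.sqrt (x * y) with hq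
  have hq2 : q ^ 2 = x * y := Real.sq_sqrt (mul_nonneg hx hy)
  set s := Real.sqrt (z * zg) with hs
  have hs2 : s ^ 2 = z * zg := Real.sq_sqrt (mul_nonneg hz hzg0)
  -- The viscosity provides 6νΔt g². Of this 3/2 goes to the residual, 3/4 to the extrapolated error
  -- and 3 to the fluctuation, 21/4 in all; the remaining 3/4 feeds the gradient part of the energy.
  have t1 : 6 * R * g ≤ 3 / 2 * ν * g ^ 2 + 6 / ν * R ^ 2 := by
    have : 3 / 2 * ν * g ^ 2 + 6 / ν * R ^ 2 - 6 * R * g = 3 / 2 / ν * (ν * g - 2 * R) ^ 2 := by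
      field_simp; ring
    have h2 : 0 ≤ 3 / 2 / ν * (ν * g - 2 * R) ^ 2 := by positivity
    linarith
  have t2 : 6 * K * q * U * g ≤ 3 / 4 * ν * g ^ 2 + 12 * K ^ 2 * U ^ 2 / ν * (x * y) := by
    have : 3 / 4 * ν * g ^ 2 + 12 * K ^ 2 * U ^ 2 / ν * q ^ 2 - 6 * K * q * U * g =
        3 / 4 / ν * (ν * g - 4 * K * U * q) ^ 2 := by
      field_simp; ring
    have h2 : 0 ≤ 3 / 4 / ν * (ν * g - 4 * K * U * q) ^ 2 := by positivity
    rw [← hq2]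
    linarith
  -- The weight (3/16)/19 on y² is what the gradient terms at the old levels can pay for, see
  -- `norm_ext3_sq_le`; the x² part is left to Grönwall.
  have t3 : 12 * K ^ 2 * U ^ 2 / ν * (x * y) ≤
      3 / 16 * ν / 19 * y ^ 2 + 3648 * K ^ 4 * U ^ 4 / ν ^ 3 * x ^ 2 := by
    have : 3 / 16 * ν / 19 * y ^ 2 + 3648 * K ^ 4 * U ^ 4 / ν ^ 3 * x ^ 2
        - 12 * K ^ 2 * U ^ 2 / ν * (x * y) =
        3 / 304 / ν ^ 3 * (ν ^ 2 * y - 608 * K ^ 2 * U ^ 2 * x) ^ 2 := by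
      field_simp; ring
    have h2 : 0 ≤ 3 / 304 / ν ^ 3 * (ν ^ 2 * y - 608 * K ^ 2 * U ^ 2 * x) ^ 2 := by positivity
    linarith
  -- Compare squares. The inverse inequality gives zg ≤ Cinv z/h, and the time step condition
  -- reduces the left side to 3Δtν z²g²; here 36 = 12 · 3 explains the 12 in the condition. The
  -- arithmetic-geometric mean inequality for z²/4 and 3Δtν g² finishes.
  have t4 : 6 * Δt * (K * fl * s * g) ≤ 1 / 4 * z ^ 2 + 3 * Δt * ν * g ^ 2 := by
    refine le_of_sq_le_sq ?_ (by positivity)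
    have e1 : (6 * Δt * (K * fl * s * g)) ^ 2 = 36 * Δt ^ 2 * K ^ 2 * fl ^ 2 * (z * zg) * g ^ 2 := by
      rw [← hs2]; ring
    have e2 : zg ≤ Cinv * z / h := by rw [le_div_iff₀ hh]; linarith
    have e3 : 36 * Δt ^ 2 * K ^ 2 * fl ^ 2 * (z * zg) * g ^ 2 ≤
        36 * Δt ^ 2 * K ^ 2 * fl ^ 2 * (z * (Cinv * z / h)) * g ^ 2 := by gcongr
    have e4 : 36 * Δt ^ 2 * K ^ 2 * fl ^ 2 * (z * (Cinv * z / h)) * g ^ 2 =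
        (12 * K ^ 2 * Cinv * (Δt / (ν * h)) * fl ^ 2) * (3 * Δt * ν * z ^ 2 * g ^ 2) := by
      field_simp; ring
    have e5 : (12 * K ^ 2 * Cinv * (Δt / (ν * h)) * fl ^ 2) * (3 * Δt * ν * z ^ 2 * g ^ 2) ≤
        3 * Δt * ν * z ^ 2 * g ^ 2 := mul_le_of_le_one_left (by positivity) hCFL
    nlinarith [sq_nonneg (1 / 4 * z ^ 2 - 3 * Δt * ν * g ^ 2)]
  nlinarith [mul_le_mul_of_nonneg_left t1 hΔ.le, mul_le_mul_of_nonneg_left t2 hΔ.le,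
    mul_le_mul_of_nonneg_left t3 hΔ.le]

/-! ### The three-level energy as a quadratic functional. -/

section Energy

variable {d : ℕ} {Ω : Set (E d)}

/-- `energy` as a function of three time levels. -/
def en3 (ν Δt : ℝ) (x₂ x₁ x₀ : HV 1 Ω) : ℝ :=
  1 / 2 * ‖valV x₂‖ ^ 2
    + 1 / 2 * ‖valV ((3 : ℝ) • x₂ - x₁)‖ ^ 2
    + 1 / 2 * ‖valV (ext3 x₂ x₁ x₀)‖ ^ 2
    + 9 * ν * Δt / 16 * ‖grad x₂‖ ^ 2
    + 3 * ν * Δt / 8 * ‖grad x₁‖ ^ 2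
    + 3 * ν * Δt / 16 * ‖grad x₀‖ ^ 2

theorem energy_eq_en3 (ν Δt : ℝ) (e : ℕ → HV 1 Ω) (n : ℕ) :
    energy ν Δt e n = en3 ν Δt (e n) (e (n - 1)) (e (n - 2)) := rfl

theorem norm_sub_sq_le {V : Type*} [SeminormedAddCommGroup V] (a b : V) :
    ‖a - b‖ ^ 2 ≤ 2 * ‖a‖ ^ 2 + 2 * ‖b‖ ^ 2 := by
  have h := norm_sub_le a b
  have h1 := pow_le_pow_left₀ (norm_nonneg _) h 2
  nlinarith [sq_nonneg (‖a‖ - ‖b‖)]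

theorem en3_nonneg {ν Δt : ℝ} (hν : 0 ≤ ν) (hΔ : 0 ≤ Δt) (x₂ x₁ x₀ : HV 1 Ω) :
    0 ≤ en3 ν Δt x₂ x₁ x₀ := by
  unfold en3; positivity

/-- The energy is a sum of squared seminorms of linear expressions. Used in both directions: from ξ
to e at the final level, and from e to ξ at the initial one. -/
theorem en3_sub_le {ν Δt : ℝ} (hν : 0 ≤ ν) (hΔ : 0 ≤ Δt) (x₂ x₁ x₀ y₂ y₁ y₀ : HV 1 Ω) :
    en3 ν Δt (x₂ - y₂) (x₁ - y₁) (x₀ - y₀) ≤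
      2 * en3 ν Δt x₂ x₁ x₀ + 2 * en3 ν Δt y₂ y₁ y₀ := by
  unfold en3
  have e1 : valV ((3 : ℝ) • (x₂ - y₂) - (x₁ - y₁)) =
      valV ((3 : ℝ) • x₂ - x₁) - valV ((3 : ℝ) • y₂ - y₁) := by
    rw [← valV_sub]; congr 1; module
  have e2 : valV (ext3 (x₂ - y₂) (x₁ - y₁) (x₀ - y₀)) =
      valV (ext3 x₂ x₁ x₀) - valV (ext3 y₂ y₁ y₀) := by
    rw [← valV_sub]; congr 1; unfold ext3; module
  rw [e1, e2, valV_sub, grad_sub, grad_sub, grad_sub]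
  have a1 := norm_sub_sq_le (valV x₂) (valV y₂)
  have a2 := norm_sub_sq_le (valV ((3 : ℝ) • x₂ - x₁)) (valV ((3 : ℝ) • y₂ - y₁))
  have a3 := norm_sub_sq_le (valV (ext3 x₂ x₁ x₀)) (valV (ext3 y₂ y₁ y₀))
  have c : 0 ≤ ν * Δt := mul_nonneg hν hΔ
  have a4 := mul_le_mul_of_nonneg_left (norm_sub_sq_le (grad x₂) (grad y₂)) c
  have a5 := mul_le_mul_of_nonneg_left (norm_sub_sq_le (grad x₁) (grad y₁)) c
  have a6 := mul_le_mul_of_nonneg_left (norm_sub_sq_le (grad x₀) (grad y₀)) c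
  linarith

theorem norm_ext3_le {V : Type*} [SeminormedAddCommGroup V] [NormedSpace ℝ V] (a b c : V) :
    ‖ext3 a b c‖ ≤ 3 * ‖a‖ + 3 * ‖b‖ + ‖c‖ := by
  unfold ext3
  refine (norm_add_le _ _).trans (add_le_add_left ((norm_sub_le _ _).trans ?_) _)
  rw [norm_smul, norm_smul]; norm_num

/-- Cauchy–Schwarz with 3² + 3² + 1² = 19. -/
theorem norm_ext3_sq_le {V : Type*} [SeminormedAddCommGroup V] [NormedSpace ℝ V] (a b c : V) :
    ‖ext3 a b c‖ ^ 2 ≤ 19 * (‖a‖ ^ 2 + ‖b‖ ^ 2 + ‖c‖ ^ 2) := by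
  have h1 := pow_le_pow_left₀ (norm_nonneg _) (norm_ext3_le a b c) 2
  nlinarith [sq_nonneg (‖a‖ - ‖b‖), sq_nonneg (‖a‖ - 3 * ‖c‖), sq_nonneg (‖b‖ - 3 * ‖c‖)]

/-- Meant for the projection error, with ε of order h². The L² terms contribute ½(1² + 4² + 7²) =
33, and the gradient weights 9/16 + 3/8 + 3/16 are below 2. -/
theorem en3_le {ν Δt CP ε : ℝ} (hν : 0 ≤ ν) (hΔ : 0 ≤ Δt) (hCP : 0 ≤ CP) {x₂ x₁ x₀ : HV 1 Ω}
    (h2 : ‖valV x₂‖ ≤ CP * ‖grad x₂‖) (h1 : ‖valV x₁‖ ≤ CP * ‖grad x₁‖)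
    (h0 : ‖valV x₀‖ ≤ CP * ‖grad x₀‖) (g2 : ‖grad x₂‖ ≤ ε) (g1 : ‖grad x₁‖ ≤ ε)
    (g0 : ‖grad x₀‖ ≤ ε) :
    en3 ν Δt x₂ x₁ x₀ ≤ (33 * CP ^ 2 + 2 * (ν * Δt)) * ε ^ 2 := by
  have k2 := h2.trans (mul_le_mul_of_nonneg_left g2 hCP)
  have k1 := h1.trans (mul_le_mul_of_nonneg_left g1 hCP)
  have k0 := h0.trans (mul_le_mul_of_nonneg_left g0 hCP)
  have b1 : ‖valV ((3 : ℝ) • x₂ - x₁)‖ ≤ 4 * (CP * ε) := by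
    rw [valV_sub, valV_smul]
    refine (norm_sub_le _ _).trans ?_
    rw [norm_smul]; norm_num; linarith
  have b2 : ‖valV (ext3 x₂ x₁ x₀)‖ ≤ 7 * (CP * ε) := by
    have : valV (ext3 x₂ x₁ x₀) = ext3 (valV x₂) (valV x₁) (valV x₀) := map_ext3 (valVₗ 1 Ω) _ _ _
    rw [this]
    refine (norm_ext3_le _ _ _).trans ?_
    linarith
  have s0 := pow_le_pow_left₀ (norm_nonneg _) k2 2
  have s1 := pow_le_pow_left₀ (norm_nonneg _) b1 2
  have s2 := pow_le_pow_left₀ (norm_nonneg _) b2 2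
  have c : 0 ≤ ν * Δt := mul_nonneg hν hΔ
  have s3 := mul_le_mul_of_nonneg_left (pow_le_pow_left₀ (norm_nonneg _) g2 2) c
  have s4 := mul_le_mul_of_nonneg_left (pow_le_pow_left₀ (norm_nonneg _) g1 2) c
  have s5 := mul_le_mul_of_nonneg_left (pow_le_pow_left₀ (norm_nonneg _) g0 2) c
  have s6 : 0 ≤ ν * Δt * ε ^ 2 := by positivity
  unfold en3
  nlinarith

end Energy
end EnsembleNSE
end


noncomputable section

namespace EnsembleNSE
open MeasureTheory Set Filter Topology
open scoped ContDiff NNReal ENNReal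

/-! ### The error equation -/

section ErrorEquation

variable {d : ℕ} {Ω : Set (E d)} {𝒯 : Mesh d}

/-- The three bounds on the trilinear form that the error analysis uses. -/
structure BstarBound (Ω : Set (E d)) (K : ℝ) : Prop where
  left : ∀ u ∈ Xsub Ω, ∀ v ∈ Xsub Ω, ∀ w ∈ Xsub Ω,
    |bstar u v w| ≤ K * Real.sqrt (‖valV u‖ * ‖grad u‖) * ‖grad v‖ * ‖grad w‖
  mid : ∀ u ∈ Xsub Ω, ∀ v ∈ Xsub Ω, ∀ w ∈ Xsub Ω,
    |bstar u v w| ≤ K * ‖grad u‖ * Real.sqrt (‖valV v‖ * ‖grad v‖) * ‖grad w‖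
  full : ∀ u ∈ Xsub Ω, ∀ v ∈ Xsub Ω, ∀ w ∈ Xsub Ω,
    |bstar u v w| ≤ K * ‖grad u‖ * ‖grad v‖ * ‖grad w‖

theorem exists_poincare_vector (hd : d = 2 ∨ d = 3) (hΩ : IsOpen Ω) (hb : Bornology.IsBounded Ω) :
    ∃ C : ℝ, 0 < C ∧ ∀ v ∈ Xsub Ω, ‖valV v‖ ≤ C * ‖grad v‖ := by
  obtain ⟨C, hC0, hC⟩ := exists_poincare hd hΩ hb
  have hd0 : 0 < (d : ℝ) := by rcases hd with rfl | rfl <;> norm_num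
  refine ⟨d * (C * d), by positivity, fun v hv => ?_⟩
  have h1 : ∀ i, ‖val (v i)‖ ≤ C * d * ‖grad v‖ := fun i =>
    (hC _ (hv i)).trans (by
      have := mul_le_mul_of_nonneg_left (gsum_le_grad v i) hC0.le
      linarith)
  refine le_of_sq_le_sq ?_ (by positivity)
  rw [norm_sq_valV]
  calc ∑ i, ‖val (v i)‖ ^ 2 ≤ ∑ _i : Fin d, (C * d * ‖grad v‖) ^ 2 :=
        Finset.sum_le_sum fun i _ => pow_le_pow_left₀ (norm_nonneg _) (h1 i) 2
    _ = d * (C * d * ‖grad v‖) ^ 2 := by simp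
    _ ≤ d ^ 2 * (C * d * ‖grad v‖) ^ 2 := by
        have : (d : ℝ) ≤ d ^ 2 := by rcases hd with rfl | rfl <;> norm_num
        gcongr
    _ = _ := by ring

/-- The constants come from the Sobolev and Poincaré inequalities on Ω, so K involves neither mesh
nor data, as C_e requires. The bound `full` is `left` followed by Poincaré. -/
theorem exists_bstarBound (hd : d = 2 ∨ d = 3) (hΩ : IsOpen Ω) (hb : Bornology.IsBounded Ω) :
    ∃ Ct, 0 ≤ Ct ∧ TriBound Ω Ct ∧ ∃ K, 0 < K ∧ BstarBound Ω K := by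
  obtain ⟨Ct, hCt0, hCt⟩ := exists_trilinear hd hΩ hb
  obtain ⟨CP, hCP0, hCP⟩ := exists_poincare_vector hd hΩ hb
  refine ⟨Ct, hCt0.le, hCt, ?_⟩
  set K0 := 2 * d ^ 2 * (Ct * d * Real.sqrt d) with hK0
  have hK00 : 0 ≤ K0 := by positivity
  have hle : (d : ℝ) ^ 2 * (Ct * d * Real.sqrt d) ≤ K0 := by
    have : 0 ≤ (d : ℝ) ^ 2 * (Ct * d * Real.sqrt d) := by positivity
    rw [hK0]; linarith
  have hleft : ∀ u ∈ Xsub Ω, ∀ v ∈ Xsub Ω, ∀ w ∈ Xsub Ω,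
      |bstar u v w| ≤ K0 * Real.sqrt (‖valV u‖ * ‖grad u‖) * ‖grad v‖ * ‖grad w‖ :=
    fun u hu v hv w hw => (abs_bstar_le_left hCt hCt0.le hu hv hw).trans (by gcongr)
  refine ⟨K0 * (1 + Real.sqrt CP) + 1, by positivity, ⟨fun u hu v hv w hw => ?_,
    fun u hu v hv w hw => ?_, fun u hu v hv w hw => ?_⟩⟩
  · refine (hleft u hu v hv w hw).trans ?_
    have : K0 ≤ K0 * (1 + Real.sqrt CP) + 1 := by nlinarith [Real.sqrt_nonneg CP]
    gcongr
  · refine (abs_bstar_le_mid hCt hΩ hCt0.le hu hv hw).trans ?_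
    have : K0 ≤ K0 * (1 + Real.sqrt CP) + 1 := by nlinarith [Real.sqrt_nonneg CP]
    gcongr
  · refine (hleft u hu v hv w hw).trans ?_
    have h1 : Real.sqrt (‖valV u‖ * ‖grad u‖) ≤ Real.sqrt CP * ‖grad u‖ := by
      rw [← Real.sqrt_sq (norm_nonneg (grad u)), ← Real.sqrt_mul hCP0.le]
      refine Real.sqrt_le_sqrt ?_
      rw [Real.sqrt_sq (norm_nonneg _)]
      nlinarith [hCP u hu, norm_nonneg (grad u)]
    have h2 : K0 * Real.sqrt CP ≤ K0 * (1 + Real.sqrt CP) + 1 := by nlinarith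
    calc _ ≤ K0 * (Real.sqrt CP * ‖grad u‖) * ‖grad v‖ * ‖grad w‖ := by gcongr
      _ = (K0 * Real.sqrt CP) * ‖grad u‖ * ‖grad v‖ * ‖grad w‖ := by ring
      _ ≤ _ := by gcongr

/-- The error equation, tested with the discrete error. -/
theorem error_identity {Ct : ℝ} (hCt : TriBound Ω Ct) {ν Δt : ℝ}
    {w₃ w₂ w₁ w₀ u₃ u₂ u₁ u₀ r₃ r₂ r₁ r₀ fl : HV 1 Ω} {ut f : L2V Ω} {p pl : L2 Ω}
    (hw3 : w₃ ∈ Xsub Ω) (hw2 : w₂ ∈ Xsub Ω) (hw1 : w₁ ∈ Xsub Ω) (hw0 : w₀ ∈ Xsub Ω)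
    (hu3 : u₃ ∈ Xsub Ω)
    (hr3 : r₃ ∈ Xsub Ω) (hr2 : r₂ ∈ Xsub Ω) (hr1 : r₁ ∈ Xsub Ω) (hr0 : r₀ ∈ Xsub Ω)
    (hfl : fl ∈ Xsub Ω)
    (hdisc : inner ℝ (valV (dt4 Δt w₃ w₂ w₁ w₀)) (valV (w₃ - r₃))
      + bstar (ext3 w₂ w₁ w₀ - fl) w₃ (w₃ - r₃) + bstar fl (ext3 w₂ w₁ w₀) (w₃ - r₃)
      + ν * inner ℝ (grad w₃) (grad (w₃ - r₃)) = inner ℝ f (valV (w₃ - r₃)))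
    (hex : inner ℝ ut (valV (w₃ - r₃)) + bstar u₃ u₃ (w₃ - r₃)
      - inner ℝ p (dvg (w₃ - r₃)) + ν * inner ℝ (grad u₃) (grad (w₃ - r₃))
      = inner ℝ f (valV (w₃ - r₃)))
    (hort : inner ℝ (grad u₃ - grad r₃) (grad (w₃ - r₃)) = 0)
    (hpl : inner ℝ pl (dvg (w₃ - r₃)) = 0) :
    inner ℝ (dt4 Δt (valV (w₃ - r₃)) (valV (w₂ - r₂)) (valV (w₁ - r₁)) (valV (w₀ - r₀)))
        (valV (w₃ - r₃)) + ν * ‖grad (w₃ - r₃)‖ ^ 2 =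
      - inner ℝ (valV (dt4 Δt u₃ u₂ u₁ u₀) - ut) (valV (w₃ - r₃))
      + inner ℝ (valV (dt4 Δt (u₃ - r₃) (u₂ - r₂) (u₁ - r₁) (u₀ - r₀))) (valV (w₃ - r₃))
      - inner ℝ (p - pl) (dvg (w₃ - r₃))
      - bstar (ext3 (w₂ - r₂) (w₁ - r₁) (w₀ - r₀)) r₃ (w₃ - r₃)
      - bstar (ext3 r₂ r₁ r₀ - u₃) r₃ (w₃ - r₃)
      - bstar u₃ (r₃ - u₃) (w₃ - r₃)
      + bstar fl (del4 (w₃ - r₃) (w₂ - r₂) (w₁ - r₁) (w₀ - r₀)) (w₃ - r₃)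
      + bstar fl (del4 r₃ r₂ r₁ r₀) (w₃ - r₃) := by
  set ξ := w₃ - r₃ with hξ
  have hξX : ξ ∈ Xsub Ω := sub_mem hw3 hr3
  have hEw : ext3 w₂ w₁ w₀ ∈ Xsub Ω := ext3_mem hw2 hw1 hw0
  have hEr : ext3 r₂ r₁ r₀ ∈ Xsub Ω := ext3_mem hr2 hr1 hr0
  have hEx : ext3 (w₂ - r₂) (w₁ - r₁) (w₀ - r₀) ∈ Xsub Ω :=
    ext3_mem (sub_mem hw2 hr2) (sub_mem hw1 hr1) (sub_mem hw0 hr0)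
  have hDx : del4 ξ (w₂ - r₂) (w₁ - r₁) (w₀ - r₀) ∈ Xsub Ω :=
    del4_mem hξX (sub_mem hw2 hr2) (sub_mem hw1 hr1) (sub_mem hw0 hr0)
  have hDr : del4 r₃ r₂ r₁ r₀ ∈ Xsub Ω := del4_mem hr3 hr2 hr1 hr0
  have e1 : ext3 w₂ w₁ w₀ = ext3 (w₂ - r₂) (w₁ - r₁) (w₀ - r₀) + ext3 r₂ r₁ r₀ := by
    unfold ext3; module
  have e2 : w₃ = ξ + r₃ := by rw [hξ]; abel
  -- Extrapolation is the new level minus the third difference. Hence `bstar fl w₃ ξ` from `b1` and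
  -- `b2` cancels, and the fluctuation acts on third differences only.
  have e3 : ext3 w₂ w₁ w₀ = w₃ - (del4 ξ (w₂ - r₂) (w₁ - r₁) (w₀ - r₀) + del4 r₃ r₂ r₁ r₀) := by
    unfold ext3 del4; rw [hξ]; module
  -- The discrete velocity w₃ = ξ + r₃ enters through r₃ alone, because skew symmetry removes ξ; so
  -- no bound on the discrete solution is needed here.
  have b1 : bstar (ext3 w₂ w₁ w₀ - fl) w₃ ξ =
      bstar (ext3 (w₂ - r₂) (w₁ - r₁) (w₀ - r₀)) r₃ ξ + bstar (ext3 r₂ r₁ r₀) r₃ ξ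
        - bstar fl w₃ ξ := by
    rw [bstar_sub_left hCt hEw hfl hw3 hξX]
    congr 1
    conv_lhs => rw [e2]
    rw [bstar_add_mid hCt hEw hξX hr3 hξX, bstar_self, zero_add, e1,
      bstar_add_left hCt hEx hEr hr3 hξX]
  have b2 : bstar fl (ext3 w₂ w₁ w₀) ξ = bstar fl w₃ ξ
      - (bstar fl (del4 ξ (w₂ - r₂) (w₁ - r₁) (w₀ - r₀)) ξ + bstar fl (del4 r₃ r₂ r₁ r₀) ξ) := by
    rw [e3, bstar_sub_mid hCt hfl hw3 (add_mem hDx hDr) hξX, bstar_add_mid hCt hfl hDx hDr hξX]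
  have b3 : bstar (ext3 r₂ r₁ r₀ - u₃) r₃ ξ = bstar (ext3 r₂ r₁ r₀) r₃ ξ - bstar u₃ r₃ ξ :=
    bstar_sub_left hCt hEr hu3 hr3 hξX
  have b4 : bstar u₃ (r₃ - u₃) ξ = bstar u₃ r₃ ξ - bstar u₃ u₃ ξ :=
    bstar_sub_mid hCt hu3 hr3 hu3 hξX
  have i1 : inner ℝ (valV (dt4 Δt w₃ w₂ w₁ w₀)) (valV ξ) =
      inner ℝ (dt4 Δt (valV ξ) (valV (w₂ - r₂)) (valV (w₁ - r₁)) (valV (w₀ - r₀))) (valV ξ)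
      + inner ℝ (valV (dt4 Δt u₃ u₂ u₁ u₀)) (valV ξ)
      - inner ℝ (valV (dt4 Δt (u₃ - r₃) (u₂ - r₂) (u₁ - r₁) (u₀ - r₀))) (valV ξ) := by
    have : dt4 Δt (valV ξ) (valV (w₂ - r₂)) (valV (w₁ - r₁)) (valV (w₀ - r₀)) =
      valV (dt4 Δt ξ (w₂ - r₂) (w₁ - r₁) (w₀ - r₀)) := (map_dt4 (valVₗ 1 Ω) _ _ _ _ _).symm
    rw [this, ← inner_add_left, ← inner_sub_left, ← valV_add, ← valV_sub]
    congr 2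
    unfold dt4; rw [hξ]; module
  have i2 : inner ℝ (grad w₃) (grad ξ) = ‖grad ξ‖ ^ 2 + inner ℝ (grad r₃) (grad ξ) := by
    conv_lhs => rw [e2]
    rw [grad_add, inner_add_left, real_inner_self_eq_norm_sq]
  rw [inner_sub_left] at hort
  rw [b3, b4, inner_sub_left, inner_sub_left]
  rw [b1, b2, i1, i2] at hdisc
  linear_combination hdisc - hex - hpl + ν * hort

set_option maxHeartbeats 1000000 in
/-- One step of the error estimate. -/
theorem error_step {Ct K CP Cinv : ℝ} (hCt : TriBound Ω Ct) (hK : 0 < K) (hKb : BstarBound Ω K)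
    (hCP : 0 < CP) (hP : ∀ v ∈ Xsub Ω, ‖valV v‖ ≤ CP * ‖grad v‖)
    {ν Δt h : ℝ} (hν : 0 < ν) (hΔ : 0 < Δt) (hh : 0 < h)
    (hinv : ∀ v ∈ Xhsub Ω 𝒯, h * ‖grad v‖ ≤ Cinv * ‖valV v‖)
    {w₃ w₂ w₁ w₀ u₃ u₂ u₁ u₀ r₃ r₂ r₁ r₀ fl : HV 1 Ω} {ut f : L2V Ω} {p pl : L2 Ω}
    (hw3 : w₃ ∈ Xhsub Ω 𝒯) (hw2 : w₂ ∈ Xhsub Ω 𝒯) (hw1 : w₁ ∈ Xhsub Ω 𝒯) (hw0 : w₀ ∈ Xhsub Ω 𝒯)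
    (hu3 : u₃ ∈ Xsub Ω) (hu2 : u₂ ∈ Xsub Ω) (hu1 : u₁ ∈ Xsub Ω) (hu0 : u₀ ∈ Xsub Ω)
    (hr3 : r₃ ∈ Xhsub Ω 𝒯) (hr2 : r₂ ∈ Xhsub Ω 𝒯) (hr1 : r₁ ∈ Xhsub Ω 𝒯) (hr0 : r₀ ∈ Xhsub Ω 𝒯)
    (hfl : fl ∈ Xsub Ω)
    (hdisc : inner ℝ (valV (dt4 Δt w₃ w₂ w₁ w₀)) (valV (w₃ - r₃))
      + bstar (ext3 w₂ w₁ w₀ - fl) w₃ (w₃ - r₃) + bstar fl (ext3 w₂ w₁ w₀) (w₃ - r₃)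
      + ν * inner ℝ (grad w₃) (grad (w₃ - r₃)) = inner ℝ f (valV (w₃ - r₃)))
    (hex : inner ℝ ut (valV (w₃ - r₃)) + bstar u₃ u₃ (w₃ - r₃)
      - inner ℝ p (dvg (w₃ - r₃)) + ν * inner ℝ (grad u₃) (grad (w₃ - r₃))
      = inner ℝ f (valV (w₃ - r₃)))
    (hort : inner ℝ (grad u₃ - grad r₃) (grad (w₃ - r₃)) = 0)
    (hpl : inner ℝ pl (dvg (w₃ - r₃)) = 0)
    (hCFL : 12 * K ^ 2 * Cinv * (Δt / (ν * h)) * ‖grad fl‖ ^ 2 ≤ 1)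
    {U ρ₁ ρ₂ ρ₃ δ η : ℝ} (hU : 0 ≤ U) (hrU : ‖grad r₃‖ ≤ U) (huU : ‖grad u₃‖ ≤ U)
    (hρ1 : ‖valV (dt4 Δt u₃ u₂ u₁ u₀) - ut‖ ≤ ρ₁)
    (hρ2 : ‖grad (dt4 Δt (u₃ - r₃) (u₂ - r₂) (u₁ - r₁) (u₀ - r₀))‖ ≤ ρ₂)
    (hρ3 : ‖p - pl‖ ≤ ρ₃) (hδ : ‖grad (del4 r₃ r₂ r₁ r₀)‖ ≤ δ) (hη : ‖grad (u₃ - r₃)‖ ≤ η) :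
    en3 ν Δt (w₃ - r₃) (w₂ - r₂) (w₁ - r₁)
        + 1 / 4 * ‖valV (del4 (w₃ - r₃) (w₂ - r₂) (w₁ - r₁) (w₀ - r₀))‖ ^ 2 ≤
      (1 + Δt * (7296 * K ^ 4 * U ^ 4 / ν ^ 3)) * en3 ν Δt (w₂ - r₂) (w₁ - r₁) (w₀ - r₀)
        + Δt * (6 / ν * (CP * ρ₁ + CP ^ 2 * ρ₂ + d * ρ₃ + K * U * (δ + 2 * η)
          + K * ‖grad fl‖ * δ) ^ 2) := by
  have hid := error_identity hCt (u₂ := u₂) (u₁ := u₁) (u₀ := u₀) hw3.1 hw2.1 hw1.1 hw0.1 hu3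
    hr3.1 hr2.1 hr1.1 hr0.1 hfl hdisc hex hort hpl
  have hx3 : w₃ - r₃ ∈ Xhsub Ω 𝒯 := sub_mem hw3 hr3
  have hx2 : w₂ - r₂ ∈ Xhsub Ω 𝒯 := sub_mem hw2 hr2
  have hx1 : w₁ - r₁ ∈ Xhsub Ω 𝒯 := sub_mem hw1 hr1
  have hx0 : w₀ - r₀ ∈ Xhsub Ω 𝒯 := sub_mem hw0 hr0
  have hdη : dt4 Δt (u₃ - r₃) (u₂ - r₂) (u₁ - r₁) (u₀ - r₀) ∈ Xsub Ω :=
    dt4_mem Δt (sub_mem hu3 hr3.1) (sub_mem hu2 hr2.1) (sub_mem hu1 hr1.1) (sub_mem hu0 hr0.1)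
  generalize w₃ - r₃ = ξ₃ at *
  generalize w₂ - r₂ = ξ₂ at *
  generalize w₁ - r₁ = ξ₁ at *
  generalize w₀ - r₀ = ξ₀ at *
  set g := ‖grad ξ₃‖ with hg
  have hg0 : 0 ≤ g := norm_nonneg _
  have hvξ : ‖valV ξ₃‖ ≤ CP * g := hP _ hx3.1
  have hEx : ext3 ξ₂ ξ₁ ξ₀ ∈ Xhsub Ω 𝒯 := ext3_mem hx2 hx1 hx0
  have hDx : del4 ξ₃ ξ₂ ξ₁ ξ₀ ∈ Xhsub Ω 𝒯 := del4_mem hx3 hx2 hx1 hx0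
  have hDr : del4 r₃ r₂ r₁ r₀ ∈ Xhsub Ω 𝒯 := del4_mem hr3 hr2 hr1 hr0
  have hEr : ext3 r₂ r₁ r₀ - u₃ ∈ Xsub Ω := sub_mem (ext3_mem hr2.1 hr1.1 hr0.1) hu3
  have hδ0 : 0 ≤ δ := (norm_nonneg _).trans hδ
  have hη0 : 0 ≤ η := (norm_nonneg _).trans hη
  have hρ10 : 0 ≤ ρ₁ := (norm_nonneg _).trans hρ1
  have hρ20 : 0 ≤ ρ₂ := (norm_nonneg _).trans hρ2
  have hρ30 : 0 ≤ ρ₃ := (norm_nonneg _).trans hρ3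
  have t1 : -inner ℝ (valV (dt4 Δt u₃ u₂ u₁ u₀) - ut) (valV ξ₃) ≤ CP * ρ₁ * g := by
    have := abs_real_inner_le_norm (valV (dt4 Δt u₃ u₂ u₁ u₀) - ut) (valV ξ₃)
    calc _ ≤ ‖valV (dt4 Δt u₃ u₂ u₁ u₀) - ut‖ * ‖valV ξ₃‖ := (neg_le_abs _).trans this
      _ ≤ ρ₁ * (CP * g) := by gcongr
      _ = _ := by ring
  have t2 : inner ℝ (valV (dt4 Δt (u₃ - r₃) (u₂ - r₂) (u₁ - r₁) (u₀ - r₀))) (valV ξ₃) ≤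
      CP ^ 2 * ρ₂ * g := by
    refine (real_inner_le_norm _ _).trans ?_
    have := (hP _ hdη).trans (mul_le_mul_of_nonneg_left hρ2 hCP.le)
    calc _ ≤ (CP * ρ₂) * (CP * g) := by gcongr
      _ = _ := by ring
  have t3 : -inner ℝ (p - pl) (dvg ξ₃) ≤ d * ρ₃ * g := by
    have := abs_real_inner_le_norm (p - pl) (dvg ξ₃)
    have h2 := norm_dvg_le ξ₃
    calc _ ≤ ‖p - pl‖ * ‖dvg ξ₃‖ := (neg_le_abs _).trans this
      _ ≤ ρ₃ * (d * g) := by gcongr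
      _ = _ := by ring
  have t4 : -bstar (ext3 ξ₂ ξ₁ ξ₀) r₃ ξ₃ ≤
      K * Real.sqrt (‖valV (ext3 ξ₂ ξ₁ ξ₀)‖ * ‖grad (ext3 ξ₂ ξ₁ ξ₀)‖) * U * g := by
    refine (neg_le_abs _).trans ((hKb.left _ hEx.1 _ hr3.1 _ hx3.1).trans ?_)
    gcongr
  have t5 : -bstar (ext3 r₂ r₁ r₀ - u₃) r₃ ξ₃ ≤ K * (δ + η) * U * g := by
    refine (neg_le_abs _).trans ((hKb.full _ hEr _ hr3.1 _ hx3.1).trans ?_)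
    have : ‖grad (ext3 r₂ r₁ r₀ - u₃)‖ ≤ δ + η := by
      have e : ext3 r₂ r₁ r₀ - u₃ = -del4 r₃ r₂ r₁ r₀ - (u₃ - r₃) := by
        unfold ext3 del4; module
      rw [e, grad_sub]
      refine (norm_sub_le _ _).trans (add_le_add ?_ hη)
      have : grad (-del4 r₃ r₂ r₁ r₀) = -grad (del4 r₃ r₂ r₁ r₀) := (gradₗ 0 Ω).map_neg _
      rwa [this, norm_neg]
    gcongr
  have t6 : -bstar u₃ (r₃ - u₃) ξ₃ ≤ K * U * η * g := by
    refine (neg_le_abs _).trans ((hKb.full _ hu3 _ (sub_mem hr3.1 hu3) _ hx3.1).trans ?_)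
    have : ‖grad (r₃ - u₃)‖ ≤ η := by rw [grad_sub, norm_sub_rev, ← grad_sub]; exact hη
    gcongr
  have t7 : bstar fl (del4 ξ₃ ξ₂ ξ₁ ξ₀) ξ₃ ≤ K * ‖grad fl‖ *
      Real.sqrt (‖valV (del4 ξ₃ ξ₂ ξ₁ ξ₀)‖ * ‖grad (del4 ξ₃ ξ₂ ξ₁ ξ₀)‖) * g :=
    (le_abs_self _).trans (hKb.mid _ hfl _ hDx.1 _ hx3.1)
  have t8 : bstar fl (del4 r₃ r₂ r₁ r₀) ξ₃ ≤ K * ‖grad fl‖ * δ * g := by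
    refine (le_abs_self _).trans ((hKb.full _ hfl _ hDr.1 _ hx3.1).trans ?_)
    gcongr
  set R := CP * ρ₁ + CP ^ 2 * ρ₂ + d * ρ₃ + K * U * (δ + 2 * η) + K * ‖grad fl‖ * δ with hR
  have hy := young_absorb (R := R) (U := U) (g := g) hΔ hν hh
    (norm_nonneg (valV (ext3 ξ₂ ξ₁ ξ₀))) (norm_nonneg (grad (ext3 ξ₂ ξ₁ ξ₀)))
    (norm_nonneg (valV (del4 ξ₃ ξ₂ ξ₁ ξ₀))) (norm_nonneg (grad (del4 ξ₃ ξ₂ ξ₁ ξ₀)))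
    (hinv _ hDx) hCFL
  have hsum : inner ℝ (dt4 Δt (valV ξ₃) (valV ξ₂) (valV ξ₁) (valV ξ₀)) (valV ξ₃) + ν * g ^ 2 ≤
      R * g + K * Real.sqrt (‖valV (ext3 ξ₂ ξ₁ ξ₀)‖ * ‖grad (ext3 ξ₂ ξ₁ ξ₀)‖) * U * g +
        K * ‖grad fl‖ * Real.sqrt (‖valV (del4 ξ₃ ξ₂ ξ₁ ξ₀)‖ * ‖grad (del4 ξ₃ ξ₂ ξ₁ ξ₀)‖) * g := by
    rw [hid, hR]
    linarith only [t1, t2, t3, t4, t5, t6, t7, t8]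
  have hsum' := mul_le_mul_of_nonneg_left hsum (by positivity : (0 : ℝ) ≤ 6 * Δt)
  rw [mul_add, inner_dt4_self hΔ] at hsum'
  have hE1 : ext3 (valV ξ₃) (valV ξ₂) (valV ξ₁) = valV (ext3 ξ₃ ξ₂ ξ₁) :=
    (map_ext3 (valVₗ 1 Ω) _ _ _).symm
  have hE2 : ext3 (valV ξ₂) (valV ξ₁) (valV ξ₀) = valV (ext3 ξ₂ ξ₁ ξ₀) :=
    (map_ext3 (valVₗ 1 Ω) _ _ _).symm
  have hE3 : del4 (valV ξ₃) (valV ξ₂) (valV ξ₁) (valV ξ₀) = valV (del4 ξ₃ ξ₂ ξ₁ ξ₀) :=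
    (map_del4 (valVₗ 1 Ω) _ _ _ _).symm
  rw [hE1, hE2, hE3] at hsum'
  rw [← valV_smul, ← valV_sub, ← valV_smul, ← valV_sub] at hsum'
  -- From old to new levels the gradient part of `en3` changes by νΔt(9/16 g² − 3/16(‖∇ξ₂‖² + ‖∇ξ₁‖²
  -- + ‖∇ξ₀‖²)). The weights are made for this: the loss pays for the extrapolated gradient, and
  -- 9/16 is less than the 3/4 of viscosity still available.
  have hyb : ‖grad (ext3 ξ₂ ξ₁ ξ₀)‖ ^ 2 ≤ 19 * (‖grad ξ₂‖ ^ 2 + ‖grad ξ₁‖ ^ 2 + ‖grad ξ₀‖ ^ 2) := by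
    have : grad (ext3 ξ₂ ξ₁ ξ₀) = ext3 (grad ξ₂) (grad ξ₁) (grad ξ₀) := map_ext3 (gradₗ 0 Ω) _ _ _
    rw [this]; exact norm_ext3_sq_le _ _ _
  have hyb' := mul_le_mul_of_nonneg_left hyb (by positivity : 0 ≤ Δt * (3 / 16 * ν / 19))
  set c := 3648 * K ^ 4 * U ^ 4 / ν ^ 3 with hc
  have hc0 : 0 ≤ c := by positivity
  have hc2 : 7296 * K ^ 4 * U ^ 4 / ν ^ 3 = 2 * c := by rw [hc]; ring
  -- The extrapolation is itself one of the three squares in the energy, so its L² norm is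
  -- controlled by the old level; the factor 2 turns 3648 into 7296.
  have hxe : ‖valV (ext3 ξ₂ ξ₁ ξ₀)‖ ^ 2 ≤ 2 * en3 ν Δt ξ₂ ξ₁ ξ₀ := by
    unfold en3
    have : 0 ≤ 9 * ν * Δt / 16 * ‖grad ξ₂‖ ^ 2 + 3 * ν * Δt / 8 * ‖grad ξ₁‖ ^ 2
      + 3 * ν * Δt / 16 * ‖grad ξ₀‖ ^ 2 := by positivity
    linarith only [this, sq_nonneg ‖valV ξ₂‖, sq_nonneg ‖valV ((3 : ℝ) • ξ₂ - ξ₁)‖]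
  have hxe' := mul_le_mul_of_nonneg_left hxe (by positivity : 0 ≤ Δt * c)
  rw [hc2]
  have hgg : 0 ≤ Δt * ν * g ^ 2 := by positivity
  have e3 : en3 ν Δt ξ₃ ξ₂ ξ₁ = 1 / 2 * (‖valV ξ₃‖ ^ 2 + ‖valV ((3 : ℝ) • ξ₃ - ξ₂)‖ ^ 2 +
      ‖valV (ext3 ξ₃ ξ₂ ξ₁)‖ ^ 2) + 9 * ν * Δt / 16 * g ^ 2 + 3 * ν * Δt / 8 * ‖grad ξ₂‖ ^ 2
      + 3 * ν * Δt / 16 * ‖grad ξ₁‖ ^ 2 := by unfold en3; ring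
  have e2 : en3 ν Δt ξ₂ ξ₁ ξ₀ = 1 / 2 * (‖valV ξ₂‖ ^ 2 + ‖valV ((3 : ℝ) • ξ₂ - ξ₁)‖ ^ 2 +
      ‖valV (ext3 ξ₂ ξ₁ ξ₀)‖ ^ 2) + 9 * ν * Δt / 16 * ‖grad ξ₂‖ ^ 2
      + 3 * ν * Δt / 8 * ‖grad ξ₁‖ ^ 2 + 3 * ν * Δt / 16 * ‖grad ξ₀‖ ^ 2 := by unfold en3; ring
  have e4 : (1 + Δt * (2 * c)) * en3 ν Δt ξ₂ ξ₁ ξ₀ =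
      en3 ν Δt ξ₂ ξ₁ ξ₀ + Δt * c * (2 * en3 ν Δt ξ₂ ξ₁ ξ₀) := by ring
  rw [e4]
  linarith only [hsum', hy, hyb', hxe', hgg, e3, e2]

end ErrorEquation
end EnsembleNSE
end


noncomputable section

namespace EnsembleNSE
open MeasureTheory Set Filter Topology
open scoped ContDiff NNReal ENNReal

/-! ### The error estimate, given the approximation property -/

section Convergence

variable {d : ℕ} {Ω : Set (E d)} {𝒯 : Mesh d}

/-- The approximation property of the finite element spaces on shape-regular meshes. -/
def ApproxBound (Ω : Set (E d)) (σ CA : ℝ) : Prop :=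
  ∀ 𝒯 : Mesh d, IsTriangulation Ω 𝒯 → IsShapeRegular σ 𝒯 →
    (∀ u : HV 3 Ω, toHV1 u ∈ X Ω →
      ∃ v ∈ Xh Ω 𝒯, ‖grad (toHV1 u - v)‖ ≤ CA * meshSize 𝒯 ^ 2 * ‖u‖) ∧
    ∀ p : H 2 Ω, ∃ q ∈ FE Ω 𝒯 1, ‖val p - q‖ ≤ CA * meshSize 𝒯 ^ 2 * ‖p‖

theorem elements_finite (h𝒯 : IsTriangulation Ω 𝒯) : (elements 𝒯).Finite :=
  h𝒯.finite.subset fun _ hs => hs.1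

theorem cell_subset_closure (h𝒯 : IsTriangulation Ω 𝒯) {s : Finset (E d)} (hs : s ∈ elements 𝒯) :
    cell s ⊆ closure Ω := by
  rw [← h𝒯.covers]
  exact subset_biUnion_of_mem (u := fun s => cell s) hs

theorem exists_mem_cell (h𝒯 : IsTriangulation Ω 𝒯) {x : E d} (hx : x ∈ closure Ω) :
    ∃ s ∈ elements 𝒯, x ∈ cell s := by
  rw [← h𝒯.covers] at hx
  simpa only [mem_iUnion, exists_prop] using hx

theorem isBounded_cell (s : Finset (E d)) : Bornology.IsBounded (cell s) :=
  isBounded_convexHull.2 s.finite_toSet.isBounded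

theorem diam_cell_pos (hd : 0 < d) {s : Finset (E d)} (hs : s ∈ elements 𝒯) :
    0 < Metric.diam (cell s) := by
  have h1 : 1 < s.card := by rw [hs.2]; omega
  obtain ⟨a, ha, b, hb, hab⟩ := Finset.one_lt_card.1 h1
  exact Metric.diam_pos ⟨a, subset_convexHull ℝ _ ha, b, subset_convexHull ℝ _ hb, hab⟩
    (isBounded_cell s)

theorem diam_cell_le_meshSize (h𝒯 : IsTriangulation Ω 𝒯) {s : Finset (E d)}
    (hs : s ∈ elements 𝒯) : Metric.diam (cell s) ≤ meshSize 𝒯 :=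
  le_csSup ((elements_finite h𝒯).image _).bddAbove (mem_image_of_mem _ hs)

theorem meshSize_pos (hd : 0 < d) (h0 : Ω.Nonempty) (h𝒯 : IsTriangulation Ω 𝒯) :
    0 < meshSize 𝒯 := by
  obtain ⟨x, hx⟩ := h0
  obtain ⟨s, hs, _⟩ := exists_mem_cell h𝒯 (subset_closure hx)
  exact (diam_cell_pos hd hs).trans_le (diam_cell_le_meshSize h𝒯 hs)

theorem meshSize_le (hb : Bornology.IsBounded Ω) (h𝒯 : IsTriangulation Ω 𝒯) :
    meshSize 𝒯 ≤ Metric.diam Ω := by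
  refine Real.sSup_le ?_ Metric.diam_nonneg
  rintro _ ⟨s, hs, rfl⟩
  rw [← Metric.diam_closure]
  exact Metric.diam_mono (cell_subset_closure h𝒯 hs) hb.closure

/-- The constant function in `L²(Ω)`. -/
def constL2 (hb : Bornology.IsBounded Ω) (c : ℝ) : L2 Ω :=
  (show MemLp (fun _ : E d => c) 2 (volume.restrict Ω) from by
    have : IsFiniteMeasure (volume.restrict Ω) := ⟨by simpa using hb.measure_lt_top⟩
    exact memLp_const c).toLp _

theorem coeFn_constL2 (hb : Bornology.IsBounded Ω) (c : ℝ) :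
    (constL2 hb c : E d → ℝ) =ᵐ[volume.restrict Ω] fun _ => c := MemLp.coeFn_toLp _

theorem isWeakPartial_constL2 (hb : Bornology.IsBounded Ω) (c : ℝ) (i : Fin d) :
    IsWeakPartial Ω i (constL2 hb c) 0 := by
  intro φ hφ
  have h := LipschitzWith.setIntegral_mul_pd (LipschitzWith.const (α := E d) c) hφ i
  have e1 : ∫ x in Ω, constL2 hb c x * pd i φ x = ∫ x in Ω, c * pd i φ x := by
    refine integral_congr_ae ?_
    filter_upwards [coeFn_constL2 hb c] with x hx
    rw [hx]
  have e2 : ∫ x in Ω, (0 : L2 Ω) x * φ x = 0 := by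
    rw [integral_eq_zero_of_ae]
    filter_upwards [Lp.coeFn_zero ℝ 2 (volume.restrict Ω)] with x hx
    rw [hx]; simp
  rw [e1, e2, h]
  simp [lineDeriv]

theorem inner_constL2_dvg (hΩ : IsOpen Ω) (hb : Bornology.IsBounded Ω) (c : ℝ) {v : HV 1 Ω}
    (hv : v ∈ Xsub Ω) : inner ℝ (constL2 hb c) (dvg v) = 0 := by
  rw [dvg, inner_sum]
  refine Finset.sum_eq_zero fun i _ => ?_
  have := (isWeakPartial_constL2 hb c i).inner_H10 hΩ (hv i)
  rw [inner_zero_left] at this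
  linarith

/-- Discrete solenoidality tests against mean-zero pressures only, but constants are orthogonal to
∇·v for v in H₀¹. So the approximation of p need not be normalised to mean zero. -/
theorem inner_FE_dvg (hΩ : IsOpen Ω) (h0 : Ω.Nonempty) (hb : Bornology.IsBounded Ω) {q : L2 Ω}
    (hq : q ∈ FE Ω 𝒯 1) {v : HV 1 Ω} (hv : v ∈ Vhsub Ω 𝒯) : inner ℝ q (dvg v) = 0 := by
  set c := (volume.real Ω)⁻¹ * ∫ x in Ω, q x with hc
  have hpos : 0 < volume.real Ω :=
    ENNReal.toReal_pos (hΩ.measure_pos volume h0).ne' hb.measure_lt_top.ne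
  have hmem : q - constL2 hb c ∈ Qh Ω 𝒯 := by
    refine ⟨(FEsub Ω 𝒯 1).sub_mem hq ⟨fun _ => c, isPiecewisePoly_const 1 c, coeFn_constL2 hb c⟩, ?_⟩
    rw [integral_congr_ae (Lp.coeFn_sub q (constL2 hb c))]
    simp only [Pi.sub_apply]
    rw [integral_sub (integrable_coe hb q) (integrable_coe hb _),
      integral_congr_ae (coeFn_constL2 hb c)]
    simp only [integral_const, smul_eq_mul, MeasureTheory.measureReal_restrict_apply_univ]
    rw [hc]; field_simp; simp
  have h1 := hv.2 _ hmem
  rw [inner_sub_left, inner_constL2_dvg hΩ hb c hv.1.1, sub_zero] at h1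
  exact h1

theorem five_sq_le (a b c e f : ℝ) :
    (a + b + c + e + f) ^ 2 ≤ 5 * (a ^ 2 + b ^ 2 + c ^ 2 + e ^ 2 + f ^ 2) := by
  nlinarith [sq_nonneg (a - b), sq_nonneg (a - c), sq_nonneg (a - e), sq_nonneg (a - f),
    sq_nonneg (b - c), sq_nonneg (b - e), sq_nonneg (b - f), sq_nonneg (c - e), sq_nonneg (c - f),
    sq_nonneg (e - f)]

/-- The size of the consistency error of one step. -/
theorem residual_le {Δt ν K CP Cinv CV CA U h δ ρ₁ B P fl D T d' : ℝ} (hΔ : 0 < Δt) (hν : 0 < ν)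
    (hCinv : 0 < Cinv) (hh : 0 < h) (hhD : h ≤ D) (hΔT : Δt ≤ T) (hB : 0 ≤ B)
    (hρ : ρ₁ ^ 2 ≤ Δt ^ 3 * B) (hδ : δ ^ 2 ≤ Δt ^ 5 * B)
    (hCFL : 12 * K ^ 2 * Cinv * (Δt / (ν * h)) * fl ^ 2 ≤ 1) :
    Δt * (6 / ν * (CP * ρ₁ + CP ^ 2 * (CV * h ^ 2 * U) + d' * (CA * h ^ 2 * P)
        + K * U * (δ + 2 * (CV * h ^ 2 * U)) + K * fl * δ) ^ 2) ≤
      30 / ν * ((CP ^ 2 + 2 * (K * U) ^ 2 * T ^ 2 + ν * D * T / (12 * Cinv)) * Δt ^ 4 * B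
        + (CP ^ 4 + 8 * (K * U) ^ 2) * (CV * U) ^ 2 * h ^ 4 * Δt
        + (d' * CA) ^ 2 * h ^ 4 * (P ^ 2 * Δt)) := by
  -- Nothing bounds the fluctuation a priori; the time step condition is used a second time, now as
  -- a bound on its size. The factor h it yields is estimated by the diameter of Ω.
  have hfl : K ^ 2 * fl ^ 2 * Δt ≤ ν * h / (12 * Cinv) := by
    rw [le_div_iff₀ (by positivity)]
    have e : 12 * K ^ 2 * Cinv * (Δt / (ν * h)) * fl ^ 2 =
      (K ^ 2 * fl ^ 2 * Δt * (12 * Cinv)) / (ν * h) := by ring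
    rw [e, div_le_one (by positivity)] at hCFL
    exact hCFL
  have h1 := five_sq_le (CP * ρ₁) (CP ^ 2 * (CV * h ^ 2 * U)) (d' * (CA * h ^ 2 * P))
    (K * U * (δ + 2 * (CV * h ^ 2 * U))) (K * fl * δ)
  have a1 : (CP * ρ₁) ^ 2 * Δt ≤ CP ^ 2 * (Δt ^ 4 * B) := by
    calc (CP * ρ₁) ^ 2 * Δt = CP ^ 2 * Δt * ρ₁ ^ 2 := by ring
      _ ≤ CP ^ 2 * Δt * (Δt ^ 3 * B) := by gcongr
      _ = _ := by ring
  have hΔ2 : Δt ^ 2 ≤ T ^ 2 := by gcongr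
  have a4 : (K * U * (δ + 2 * (CV * h ^ 2 * U))) ^ 2 * Δt ≤
      2 * (K * U) ^ 2 * T ^ 2 * (Δt ^ 4 * B) + 8 * (K * U) ^ 2 * (CV * U) ^ 2 * h ^ 4 * Δt := by
    have hs : (δ + 2 * (CV * h ^ 2 * U)) ^ 2 ≤ 2 * δ ^ 2 + 8 * (CV * h ^ 2 * U) ^ 2 := by
      nlinarith [sq_nonneg (δ - 2 * (CV * h ^ 2 * U))]
    have hs2 : Δt * δ ^ 2 ≤ T ^ 2 * (Δt ^ 4 * B) := by
      calc Δt * δ ^ 2 ≤ Δt * (Δt ^ 5 * B) := by gcongr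
        _ = Δt ^ 2 * (Δt ^ 4 * B) := by ring
        _ ≤ _ := by gcongr
    calc _ = (K * U) ^ 2 * Δt * (δ + 2 * (CV * h ^ 2 * U)) ^ 2 := by ring
      _ ≤ (K * U) ^ 2 * Δt * (2 * δ ^ 2 + 8 * (CV * h ^ 2 * U) ^ 2) := by gcongr
      _ = 2 * (K * U) ^ 2 * (Δt * δ ^ 2) + 8 * (K * U) ^ 2 * (CV * U) ^ 2 * h ^ 4 * Δt := by ring
      _ ≤ 2 * (K * U) ^ 2 * (T ^ 2 * (Δt ^ 4 * B)) + 8 * (K * U) ^ 2 * (CV * U) ^ 2 * h ^ 4 * Δt := by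
          gcongr
      _ = _ := by ring
  have a5 : (K * fl * δ) ^ 2 * Δt ≤ ν * D * T / (12 * Cinv) * (Δt ^ 4 * B) := by
    have hD : 0 < D := hh.trans_le hhD
    calc (K * fl * δ) ^ 2 * Δt = K ^ 2 * fl ^ 2 * Δt * δ ^ 2 := by ring
      _ ≤ ν * h / (12 * Cinv) * (Δt ^ 5 * B) := by gcongr
      _ = ν * h * Δt / (12 * Cinv) * (Δt ^ 4 * B) := by ring
      _ ≤ _ := by gcongr
  have h2 := mul_le_mul_of_nonneg_left h1 (by positivity : 0 ≤ Δt * (6 / ν))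
  have h3 : 0 ≤ 30 / ν := by positivity
  calc _ = Δt * (6 / ν) * (CP * ρ₁ + CP ^ 2 * (CV * h ^ 2 * U) + d' * (CA * h ^ 2 * P)
        + K * U * (δ + 2 * (CV * h ^ 2 * U)) + K * fl * δ) ^ 2 := by ring
    _ ≤ _ := h2
    _ = 30 / ν * ((CP * ρ₁) ^ 2 * Δt + (CP ^ 2 * (CV * h ^ 2 * U)) ^ 2 * Δt
        + (d' * (CA * h ^ 2 * P)) ^ 2 * Δt
        + (K * U * (δ + 2 * (CV * h ^ 2 * U))) ^ 2 * Δt + (K * fl * δ) ^ 2 * Δt) := by ring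
    _ ≤ _ := by
      refine mul_le_mul_of_nonneg_left ?_ h3
      linarith only [a1, a4, a5]

/-- The approximation error of the energy projection. -/
theorem norm_grad_sub_ritz_le {σ CA β : ℝ} (hA : ApproxBound Ω σ CA) (hΩ : IsOpen Ω)
    (hb : Bornology.IsBounded Ω) (h𝒯 : IsTriangulation Ω 𝒯) (hreg : IsShapeRegular σ 𝒯)
    (hβ : 0 < β) (hLBB : LBB Ω 𝒯 β) {P : L2T Ω →L[ℝ] L2T Ω}
    (hP : ∀ x, ∀ v ∈ Vhsub Ω 𝒯, ‖x - P x‖ ≤ ‖x - grad v‖) {u : HV 3 Ω}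
    (hu : toHV1 u ∈ Xsub Ω) (hdiv : dvg u = 0) :
    ‖grad u - P (grad u)‖ ≤ (1 + d / β) * CA * meshSize 𝒯 ^ 2 * ‖u‖ := by
  obtain ⟨v, hv, hvb⟩ := (hA 𝒯 h𝒯 hreg).1 u hu
  obtain ⟨w, hw, hwb⟩ := exists_mem_Vhsub hΩ hb h𝒯 hβ hLBB (u := toHV1 u) (v := v)
    (by rw [dvg_toHV1, hdiv]) hv
  refine (hP _ w hw).trans ?_
  rw [← grad_toHV1, ← grad_sub]
  refine hwb.trans ((mul_le_mul_of_nonneg_left hvb (by positivity)).trans_eq ?_)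
  ring

set_option maxHeartbeats 1000000 in
/-- The error estimate for one ensemble member, for a discrete solution with an arbitrary
fluctuation. -/
theorem exists_error_constant {σ CA Ct K CP Cinv β ν T M : ℝ} (hd : 0 < d)
    (hΩ : IsOpen Ω) (h0 : Ω.Nonempty) (hb : Bornology.IsBounded Ω) (hA : ApproxBound Ω σ CA)
    (hCA : 0 ≤ CA) (hCt0 : 0 ≤ Ct) (hCt : TriBound Ω Ct) (hK : 0 < K) (hKb : BstarBound Ω K)
    (hCP : 0 < CP) (hPoin : ∀ v ∈ Xsub Ω, ‖valV v‖ ≤ CP * ‖grad v‖) (hCinv : 0 < Cinv)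
    (hβ : 0 < β) (hν : 0 < ν) (hT : 0 < T) {u ut : ℝ → HV 3 Ω} {p : ℝ → H 2 Ω} {f : ℝ → L2V Ω}
    (hsol : IsNSESolution Ω ν T u ut p f) :
    ∃ C : ℝ, 0 < C ∧ ∀ (𝒯 : Mesh d), IsTriangulation Ω 𝒯 → IsShapeRegular σ 𝒯 →
      InverseInequality Ω 𝒯 Cinv → LBB Ω 𝒯 β →
      ∀ (NT : ℕ) (Δt : ℝ), 0 < Δt → (NT : ℝ) * Δt = T → discreteNormSq Δt NT p ≤ M →
      ∀ (w fl : ℕ → HV 1 Ω) (ph : ℕ → L2 Ω), (∀ n ≤ NT, w n ∈ Xh Ω 𝒯) →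
        (∀ n, 3 ≤ n → n ≤ NT → ph n ∈ Qh Ω 𝒯) → (∀ n, 2 ≤ n → n + 1 ≤ NT → fl n ∈ Xsub Ω) →
        (∀ n, 2 ≤ n → n + 1 ≤ NT → ∀ v ∈ Xh Ω 𝒯,
          inner ℝ (valV (dt4 Δt (w (n + 1)) (w n) (w (n - 1)) (w (n - 2)))) (valV v)
            + bstar (extrap w n - fl n) (w (n + 1)) v + bstar (fl n) (extrap w n) v
            - inner ℝ (ph (n + 1)) (dvg v) + ν * inner ℝ (grad (w (n + 1))) (grad v)
            = inner ℝ (f (((n + 1 : ℕ) : ℝ) * Δt)) (valV v)) →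
        (∀ n, 2 ≤ n → n + 1 ≤ NT → ∀ q ∈ Qh Ω 𝒯, inner ℝ (dvg (w (n + 1))) q = 0) →
        (∀ n, 2 ≤ n → n + 1 ≤ NT →
          12 * K ^ 2 * Cinv * (Δt / (ν * meshSize 𝒯)) * ‖grad (fl n)‖ ^ 2 ≤ 1) →
        ∀ N, 2 < N → N ≤ NT →
          energy ν Δt (err Δt u w) N + 1 / 4 * ∑ n ∈ Finset.Ico 2 N,
            ‖valV (del4 (err Δt u w (n + 1)) (err Δt u w n) (err Δt u w (n - 1))
              (err Δt u w (n - 2)))‖ ^ 2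
          ≤ C * (meshSize 𝒯 ^ 4 + Δt ^ 4 + energy ν Δt (err Δt u w) 2) := by
  obtain ⟨U, hU0, hU, htime⟩ := exists_time_bounds hT hsol.reg_u
  set CV := (1 + d / β) * CA with hCV
  have hCV0 : 0 ≤ CV := by positivity
  set D := Metric.diam Ω with hD
  have hD0 : 0 ≤ D := Metric.diam_nonneg
  set c := 7296 * K ^ 4 * U ^ 4 / ν ^ 3 with hc
  have hc0 : 0 ≤ c := by positivity
  -- `G1` and `G2` are the coefficients of Δt⁴ and h⁴ in the summed residuals, with 30 = 5 · 6 from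
  -- the square of five terms and Young. The time truncation is summed by ∑ B ≤ U, the rest by ∑ Δt
  -- ≤ T and the bound M on the pressures; |M| only ensures a nonnegative constant.
  set G1 := 30 / ν * ((CP ^ 2 + 2 * (K * U) ^ 2 * T ^ 2 + ν * D * T / (12 * Cinv)) * U) with hG1
  set G2 := 30 / ν * ((CP ^ 4 + 8 * (K * U) ^ 2) * (CV * U) ^ 2 * T + (d * CA) ^ 2 * |M|) with hG2
  have hG10 : 0 ≤ G1 := by positivity
  have hG20 : 0 ≤ G2 := by positivity
  set A := (33 * CP ^ 2 + 2 * (ν * T)) * (CV * U) ^ 2 with hAdef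
  have hA0 : 0 ≤ A := by positivity
  set X1 := Real.exp (c * T) with hX1
  have hX10 : 0 < X1 := Real.exp_pos _
  refine ⟨2 * A + 2 * (X1 * (2 * A + 2 + G1 + G2)) + CP ^ 2 * (CV * U) ^ 2 * T ^ 2 + 1,
    by positivity, ?_⟩
  intro 𝒯 h𝒯 hreg hinv hLBB NT Δt hΔ hNT hp w fl ph hw hph hfl hmom hdiv hCFL N hN2 hNN
  set h := meshSize 𝒯 with hh
  have hh0 : 0 < h := meshSize_pos hd h0 h𝒯
  have hhD : h ≤ D := meshSize_le hb h𝒯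
  have hNT1 : (1 : ℝ) ≤ NT := by
    have : 1 ≤ NT := by omega
    exact_mod_cast this
  have hΔT : Δt ≤ T := by rw [← hNT]; nlinarith
  have htn : ∀ n ≤ NT, (n : ℝ) * Δt ∈ Icc 0 T := fun n hn => by
    refine ⟨by positivity, ?_⟩
    rw [← hNT]
    have : (n : ℝ) ≤ NT := by exact_mod_cast hn
    gcongr
  obtain ⟨B, hB0, hBs, hB⟩ := htime NT Δt hΔ hNT
  obtain ⟨R, hR, P, hRP, hPle, hPort, hPbest⟩ := exists_ritz hΩ h𝒯
  set un : ℕ → HV 3 Ω := fun n => u ((n : ℝ) * Δt) with hun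
  -- The fields to which the projection estimate applies. Being a subspace, it contains the time
  -- differences of the exact solution, so `hS` bounds the projection error of a difference quotient
  -- by the quotient itself.
  let S : Submodule ℝ (HV 3 Ω) := (Xsub Ω).comap (toHV1ₗ 2 Ω) ⊓ LinearMap.ker (dvgₗ 2 Ω)
  have hS : ∀ v ∈ S, ‖grad v - P (grad v)‖ ≤ CV * h ^ 2 * ‖v‖ := fun v hv =>
    norm_grad_sub_ritz_le hA hΩ hb h𝒯 hreg hβ hLBB hPbest hv.1 hv.2
  have hunS : ∀ n ≤ NT, un n ∈ S := fun n hn =>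
    ⟨hsol.boundary _ (htn n hn), hsol.incompressible _ (htn n hn)⟩
  have hunX : ∀ n ≤ NT, toHV1 (un n) ∈ Xsub Ω := fun n hn => (hunS n hn).1
  set r : ℕ → HV 1 Ω := fun n => R (toHV1 (un n)) with hr
  have hrV : ∀ n, r n ∈ Vhsub Ω 𝒯 := fun n => hR _
  have hgr : ∀ n, grad (r n) = P (grad (un n)) := fun n => by rw [hr]; simp only; rw [hRP, grad_toHV1]
  have hunU : ∀ n ≤ NT, ‖un n‖ ≤ U := fun n hn => hU _ (htn n hn)
  have hηn : ∀ n ≤ NT, ‖grad (toHV1 (un n) - r n)‖ ≤ CV * h ^ 2 * U := fun n hn => by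
    rw [grad_sub, grad_toHV1, hgr]
    exact (hS _ (hunS n hn)).trans (mul_le_mul_of_nonneg_left (hunU n hn) (by positivity))
  have hηX : ∀ n ≤ NT, toHV1 (un n) - r n ∈ Xsub Ω := fun n hn => sub_mem (hunX n hn) (hrV n).1.1
  have hwX : ∀ n ≤ NT, w n ∈ Xhsub Ω 𝒯 := hw
  -- one step
  set a : ℕ → ℝ := fun n => en3 ν Δt (w n - r n) (w (n - 1) - r (n - 1)) (w (n - 2) - r (n - 2))
    with ha
  set Dn : ℕ → ℝ := fun n => 1 / 4 * ‖valV (del4 (w (n + 1) - r (n + 1)) (w n - r n)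
    (w (n - 1) - r (n - 1)) (w (n - 2) - r (n - 2)))‖ ^ 2 with hDn
  set F : ℕ → ℝ := fun n => 30 / ν * ((CP ^ 2 + 2 * (K * U) ^ 2 * T ^ 2 + ν * D * T / (12 * Cinv))
        * Δt ^ 4 * B n + (CP ^ 4 + 8 * (K * U) ^ 2) * (CV * U) ^ 2 * h ^ 4 * Δt
        + (d * CA) ^ 2 * h ^ 4 * (‖p (((n + 1 : ℕ) : ℝ) * Δt)‖ ^ 2 * Δt)) with hF
  have hF0 : ∀ n, 0 ≤ F n := fun n => by
    have := hB0 n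
    simp only [hF]; positivity
  have hstep : ∀ n, 2 ≤ n → n < N → a (n + 1) + Dn n ≤ (1 + Δt * c) * a n + F n := by
    intro n hn2 hnN
    have hn1 : n + 1 ≤ NT := by omega
    have hnN : n ≤ NT := by omega
    have hn' : n - 1 ≤ NT := by omega
    have hn'' : n - 2 ≤ NT := by omega
    obtain ⟨b1, -, b3, b4⟩ := hB n hn2 hn1
    have ht : (((n + 1 : ℕ) : ℝ) * Δt) ∈ Ioc 0 T := ⟨by positivity, (htn (n + 1) hn1).2⟩
    -- Only the new level is known to be discretely divergence-free, since the starting values are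
    -- arbitrary in X_h. That is enough, because the test function is the new level.
    have hξV : w (n + 1) - r (n + 1) ∈ Vhsub Ω 𝒯 := by
      refine sub_mem ⟨hwX _ hn1, fun q hq => ?_⟩ (hrV _)
      rw [real_inner_comm]; exact hdiv n hn2 hn1 q hq
    obtain ⟨pl, hpl, hplb⟩ := (hA 𝒯 h𝒯 hreg).2 (p (((n + 1 : ℕ) : ℝ) * Δt))
    have hm := hmom n hn2 hn1 _ hξV.1
    rw [hξV.2 _ (hph (n + 1) (by omega) hn1), sub_zero] at hm
    have hex := hsol.weak hCt hΩ hCt0 ht hξV.1.1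
    rw [← grad_toHV1] at hex
    have hdtη : dt4 Δt (toHV1 (un (n + 1)) - r (n + 1)) (toHV1 (un n) - r n)
        (toHV1 (un (n - 1)) - r (n - 1)) (toHV1 (un (n - 2)) - r (n - 2)) =
        toHV1 (dt4 Δt (un (n + 1)) (un n) (un (n - 1)) (un (n - 2))) -
          dt4 Δt (r (n + 1)) (r n) (r (n - 1)) (r (n - 2)) := by
      have := map_dt4 (toHV1ₗ 2 Ω) Δt (un (n + 1)) (un n) (un (n - 1)) (un (n - 2))
      change toHV1 _ = dt4 Δt (toHV1 _) (toHV1 _) (toHV1 _) (toHV1 _) at this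
      rw [this]; unfold dt4; module
    have hρ1 : ‖valV (dt4 Δt (toHV1 (un (n + 1))) (toHV1 (un n)) (toHV1 (un (n - 1)))
        (toHV1 (un (n - 2)))) - valV (ut (((n + 1 : ℕ) : ℝ) * Δt))‖ ^ 2 ≤ Δt ^ 3 * B n := by
      refine le_trans ?_ b4
      have := map_dt4 (toHV1ₗ 2 Ω) Δt (un (n + 1)) (un n) (un (n - 1)) (un (n - 2))
      change toHV1 _ = dt4 Δt (toHV1 _) (toHV1 _) (toHV1 _) (toHV1 _) at this
      rw [← this, valV_toHV1, ← valV_sub]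
      exact pow_le_pow_left₀ (norm_nonneg _) (norm_valV_le _) 2
    have hρ2 : ‖grad (dt4 Δt (toHV1 (un (n + 1)) - r (n + 1)) (toHV1 (un n) - r n)
        (toHV1 (un (n - 1)) - r (n - 1)) (toHV1 (un (n - 2)) - r (n - 2)))‖ ≤ CV * h ^ 2 * U := by
      have e1 : grad (dt4 Δt (r (n + 1)) (r n) (r (n - 1)) (r (n - 2))) =
          P (grad (dt4 Δt (un (n + 1)) (un n) (un (n - 1)) (un (n - 2)))) := by
        have e2 := map_dt4 (gradₗ 0 Ω) Δt (r (n + 1)) (r n) (r (n - 1)) (r (n - 2))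
        have e3 := map_dt4 (P.toLinearMap ∘ₗ gradₗ 2 Ω) Δt (un (n + 1)) (un n) (un (n - 1)) (un (n - 2))
        change grad _ = dt4 Δt (grad _) (grad _) (grad _) (grad _) at e2
        change P (grad _) = dt4 Δt (P (grad _)) (P (grad _)) (P (grad _)) (P (grad _)) at e3
        rw [e2, e3, hgr, hgr, hgr, hgr]
      rw [hdtη, grad_sub, grad_toHV1, e1]
      refine (hS _ (dt4_mem Δt (hunS _ hn1) (hunS _ hnN) (hunS _ hn') (hunS _ hn''))).trans ?_
      exact mul_le_mul_of_nonneg_left b3 (by positivity)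
    have hδ : ‖grad (del4 (r (n + 1)) (r n) (r (n - 1)) (r (n - 2)))‖ ^ 2 ≤ Δt ^ 5 * B n := by
      refine le_trans ?_ b1
      have e2 := map_del4 (gradₗ 0 Ω) (r (n + 1)) (r n) (r (n - 1)) (r (n - 2))
      have e3 := map_del4 (P.toLinearMap ∘ₗ gradₗ 2 Ω) (un (n + 1)) (un n) (un (n - 1)) (un (n - 2))
      change grad _ = del4 (grad _) (grad _) (grad _) (grad _) at e2
      change P (grad _) = del4 (P (grad _)) (P (grad _)) (P (grad _)) (P (grad _)) at e3
      rw [e2, hgr, hgr, hgr, hgr, ← e3]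
      exact pow_le_pow_left₀ (norm_nonneg _) ((hPle _).trans (norm_grad_le _)) 2
    have hgu : ‖grad (toHV1 (un (n + 1)))‖ ≤ U := by
      rw [grad_toHV1]; exact (norm_grad_le _).trans (hunU _ hn1)
    have hgrU : ‖grad (r (n + 1))‖ ≤ U := by
      rw [hgr]; exact (hPle _).trans ((norm_grad_le _).trans (hunU _ hn1))
    have hstep := error_step hCt hK hKb hCP hPoin hν hΔ hh0 hinv (hwX _ hn1) (hwX _ hnN)
      (hwX _ hn') (hwX _ hn'') (hunX _ hn1) (hunX _ hnN) (hunX _ hn') (hunX _ hn'')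
      (hrV _).1 (hrV _).1 (hrV _).1 (hrV _).1 (hfl n hn2 hn1) hm hex
      (by rw [grad_toHV1, hgr]; exact hPort _ _ hξV) (inner_FE_dvg hΩ h0 hb hpl hξV)
      (hCFL n hn2 hn1) hU0 hgrU hgu le_rfl hρ2 hplb le_rfl (hηn _ hn1)
    refine hstep.trans (add_le_add le_rfl ?_)
    exact residual_le hΔ hν hCinv hh0 hhD hΔT (hB0 n) hρ1 hδ (hCFL n hn2 hn1)
  have hgron := discrete_gronwall (mul_nonneg hΔ.le hc0) (D := Dn)
    (fun n => by simp only [hDn]; positivity) hF0 hN2.le hstep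
  have hexp : Real.exp (Δt * c * N) ≤ X1 := by
    refine Real.exp_le_exp.2 ?_
    have := (htn N hNN).2
    nlinarith
  have hsub : Finset.Ico 2 N ⊆ Finset.Ico 2 NT := Finset.Ico_subset_Ico le_rfl hNN
  have hBN : ∑ n ∈ Finset.Ico 2 N, B n ≤ U :=
    (Finset.sum_le_sum_of_subset_of_nonneg hsub fun n _ _ => hB0 n).trans hBs
  have hcardN : ((N - 2 : ℕ) : ℝ) * Δt ≤ T := (htn (N - 2) (by omega)).2
  have hpN : ∑ n ∈ Finset.Ico 2 N, ‖p (((n + 1 : ℕ) : ℝ) * Δt)‖ ^ 2 * Δt ≤ |M| := by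
    refine le_trans ?_ (hp.trans (le_abs_self M))
    rw [Finset.sum_Ico_add' (fun n : ℕ => ‖p ((n : ℝ) * Δt)‖ ^ 2 * Δt) 2 N 1]
    refine Finset.sum_le_sum_of_subset_of_nonneg (fun n hn => ?_) fun n _ _ => by positivity
    simp only [Finset.mem_Ico, Finset.mem_range] at hn ⊢
    omega
  have hFs : ∑ n ∈ Finset.Ico 2 N, F n ≤ G1 * Δt ^ 4 + G2 * h ^ 4 := by
    simp only [hF, ← Finset.mul_sum, Finset.sum_add_distrib]
    rw [Finset.sum_const, Nat.card_Ico, nsmul_eq_mul]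
    have q1 : 0 ≤ 30 / ν * (CP ^ 2 + 2 * (K * U) ^ 2 * T ^ 2 + ν * D * T / (12 * Cinv)) * Δt ^ 4 := by
      positivity
    have q2 : 0 ≤ 30 / ν * (CP ^ 4 + 8 * (K * U) ^ 2) * (CV * U) ^ 2 * h ^ 4 := by positivity
    have q3 : 0 ≤ 30 / ν * (d * CA) ^ 2 * h ^ 4 := by positivity
    have s1 := mul_le_mul_of_nonneg_left hBN q1
    have s2 := mul_le_mul_of_nonneg_left hcardN q2
    have s3 := mul_le_mul_of_nonneg_left hpN q3
    rw [hG1, hG2]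
    linarith only [s1, s2, s3]
  have hηe : ∀ n, 2 ≤ n → n ≤ NT → en3 ν Δt (toHV1 (un n) - r n) (toHV1 (un (n - 1)) - r (n - 1))
      (toHV1 (un (n - 2)) - r (n - 2)) ≤ A * h ^ 4 := by
    intro n _ hn
    refine (en3_le hν.le hΔ.le hCP.le (hPoin _ (hηX n hn)) (hPoin _ (hηX (n - 1) (by omega)))
      (hPoin _ (hηX (n - 2) (by omega))) (hηn n hn) (hηn (n - 1) (by omega))
      (hηn (n - 2) (by omega))).trans ?_
    calc _ = (33 * CP ^ 2 + 2 * (ν * Δt)) * (CV * U) ^ 2 * h ^ 4 := by ring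
      _ ≤ _ := by rw [hAdef]; gcongr
  have herr : ∀ n, err Δt u w n = (toHV1 (un n) - r n) - (w n - r n) := fun n => by
    simp only [err, hun]; abel
  have hEN : energy ν Δt (err Δt u w) N ≤ 2 * (A * h ^ 4) + 2 * a N := by
    rw [energy_eq_en3, herr, herr, herr]
    exact (en3_sub_le hν.le hΔ.le _ _ _ _ _ _).trans
      (add_le_add (mul_le_mul_of_nonneg_left (hηe N hN2.le hNN) (by norm_num)) le_rfl)
  have ha2 : |a 2| ≤ 2 * (A * h ^ 4) + 2 * energy ν Δt (err Δt u w) 2 := by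
    rw [abs_of_nonneg (en3_nonneg hν.le hΔ.le _ _ _), energy_eq_en3]
    have e : ∀ n, w n - r n = (toHV1 (un n) - r n) - err Δt u w n := fun n => by rw [herr]; abel
    rw [e, e, e]
    exact (en3_sub_le hν.le hΔ.le _ _ _ _ _ _).trans
      (add_le_add (mul_le_mul_of_nonneg_left (hηe 2 le_rfl (by omega)) (by norm_num)) le_rfl)
  -- In each step the third difference of η is of order h²Δt, since that of u is of order Δt. There
  -- are at most T/Δt steps, so the squares sum to order h⁴Δt.
  have hδe : ∀ n ∈ Finset.Ico 2 N, 1 / 4 * ‖valV (del4 (err Δt u w (n + 1)) (err Δt u w n)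
      (err Δt u w (n - 1)) (err Δt u w (n - 2)))‖ ^ 2 ≤
      1 / 2 * (CP * (CV * h ^ 2 * (U * Δt))) ^ 2 + 2 * Dn n := by
    intro n hn
    rw [Finset.mem_Ico] at hn
    have hn1 : n + 1 ≤ NT := by omega
    obtain ⟨-, b2, -, -⟩ := hB n hn.1 hn1
    set η4 := del4 (toHV1 (un (n + 1)) - r (n + 1)) (toHV1 (un n) - r n)
        (toHV1 (un (n - 1)) - r (n - 1)) (toHV1 (un (n - 2)) - r (n - 2)) with hη4
    have e0 : del4 (err Δt u w (n + 1)) (err Δt u w n)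
      (err Δt u w (n - 1)) (err Δt u w (n - 2)) = η4 -
        del4 (w (n + 1) - r (n + 1)) (w n - r n) (w (n - 1) - r (n - 1)) (w (n - 2) - r (n - 2)) := by
      rw [herr, herr, herr, herr, hη4]; unfold del4; module
    have hη4X : η4 ∈ Xsub Ω := del4_mem (hηX _ hn1) (hηX _ (by omega)) (hηX _ (by omega))
      (hηX _ (by omega))
    have hη4b : ‖valV η4‖ ≤ CP * (CV * h ^ 2 * (U * Δt)) := by
      refine (hPoin _ hη4X).trans (mul_le_mul_of_nonneg_left ?_ hCP.le)
      have e1 := map_del4 (toHV1ₗ 2 Ω) (un (n + 1)) (un n) (un (n - 1)) (un (n - 2))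
      change toHV1 _ = del4 (toHV1 _) (toHV1 _) (toHV1 _) (toHV1 _) at e1
      have e4 : η4 = toHV1 (del4 (un (n + 1)) (un n) (un (n - 1)) (un (n - 2))) -
          del4 (r (n + 1)) (r n) (r (n - 1)) (r (n - 2)) := by
        rw [e1, hη4]; unfold del4; module
      have e2 := map_del4 (gradₗ 0 Ω) (r (n + 1)) (r n) (r (n - 1)) (r (n - 2))
      have e3 := map_del4 (P.toLinearMap ∘ₗ gradₗ 2 Ω) (un (n + 1)) (un n) (un (n - 1)) (un (n - 2))
      change grad _ = del4 (grad _) (grad _) (grad _) (grad _) at e2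
      change P (grad _) = del4 (P (grad _)) (P (grad _)) (P (grad _)) (P (grad _)) at e3
      rw [e4, grad_sub, grad_toHV1, e2, hgr, hgr, hgr, hgr, ← e3]
      refine (hS _ (del4_mem (hunS _ hn1) (hunS _ (by omega)) (hunS _ (by omega))
        (hunS _ (by omega)))).trans ?_
      exact mul_le_mul_of_nonneg_left b2 (by positivity)
    rw [e0, valV_sub]
    have k1 := norm_sub_sq_le (valV η4) (valV (del4 (w (n + 1) - r (n + 1)) (w n - r n)
      (w (n - 1) - r (n - 1)) (w (n - 2) - r (n - 2))))
    have k2 := pow_le_pow_left₀ (norm_nonneg _) hη4b 2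
    simp only [hDn]
    linarith only [k1, k2]
  have hδs := Finset.sum_le_sum hδe
  rw [← Finset.mul_sum, Finset.sum_add_distrib, Finset.sum_const, Nat.card_Ico, nsmul_eq_mul,
    ← Finset.mul_sum] at hδs
  have hcard2 : ((N - 2 : ℕ) : ℝ) * (1 / 2 * (CP * (CV * h ^ 2 * (U * Δt))) ^ 2) ≤
      CP ^ 2 * (CV * U) ^ 2 * T ^ 2 * h ^ 4 := by
    have q : 0 ≤ 1 / 2 * CP ^ 2 * (CV * U) ^ 2 * h ^ 4 := by positivity
    calc _ = 1 / 2 * CP ^ 2 * (CV * U) ^ 2 * h ^ 4 * ((((N - 2 : ℕ) : ℝ) * Δt) * Δt) := by ring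
      _ ≤ 1 / 2 * CP ^ 2 * (CV * U) ^ 2 * h ^ 4 * (T * T) := by gcongr
      _ ≤ _ := by
        have : 0 ≤ CP ^ 2 * (CV * U) ^ 2 * h ^ 4 * (T * T) := by positivity
        linarith only [this]
  have hE20 : 0 ≤ energy ν Δt (err Δt u w) 2 := by
    rw [energy_eq_en3]; exact en3_nonneg hν.le hΔ.le _ _ _
  set E2 := energy ν Δt (err Δt u w) 2 with hE2
  have hh4 : 0 ≤ h ^ 4 := by positivity
  have hΔ4 : 0 ≤ Δt ^ 4 := by positivity
  have hsum0 : 0 ≤ ∑ n ∈ Finset.Ico 2 N, F n := Finset.sum_nonneg fun n _ => hF0 n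
  have hg2 : a N + ∑ n ∈ Finset.Ico 2 N, Dn n ≤
      X1 * (2 * (A * h ^ 4) + 2 * E2 + (G1 * Δt ^ 4 + G2 * h ^ 4)) := by
    refine hgron.trans ?_
    gcongr
  have hg3 : X1 * (2 * (A * h ^ 4) + 2 * E2 + (G1 * Δt ^ 4 + G2 * h ^ 4)) ≤
      X1 * ((2 * A + 2 + G1 + G2) * (h ^ 4 + Δt ^ 4 + E2)) := by
    refine mul_le_mul_of_nonneg_left ?_ hX10.le
    have q1 : 0 ≤ A * (Δt ^ 4 + E2) := by positivity
    have q2 : 0 ≤ G1 * (h ^ 4 + E2) := by positivity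
    have q3 : 0 ≤ G2 * (Δt ^ 4 + E2) := by positivity
    linarith only [q1, q2, q3, hh4, hΔ4]
  have q4 : 0 ≤ A * (Δt ^ 4 + E2) := by positivity
  have q5 : 0 ≤ CP ^ 2 * (CV * U) ^ 2 * T ^ 2 * (Δt ^ 4 + E2) := by positivity
  linarith only [hEN, hδs, hcard2, hg2, hg3, q4, q5, hh4, hΔ4, hE20]

end Convergence
end EnsembleNSE
end


noncomputable section

namespace EnsembleNSE
open MeasureTheory Set Filter Topology
open scoped ContDiff NNReal ENNReal

/-! ### Mollification -/

section Mollification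

variable {d : ℕ} {Ω : Set (E d)}

/-- The bump function of radius `1 / (n + 1)`. -/
def bump (d n : ℕ) : ContDiffBump (0 : E d) where
  rIn := 1 / (2 * ((n : ℝ) + 1))
  rOut := 1 / ((n : ℝ) + 1)
  rIn_pos := by positivity
  rIn_lt_rOut := by
    refine one_div_lt_one_div_of_lt (by positivity) ?_
    have : (0 : ℝ) ≤ n := Nat.cast_nonneg n
    linarith

/-- The mollifying kernel. -/
def ker (d n : ℕ) : E d → ℝ := (bump d n).normed volume

/-- Mollification at scale `1 / (n + 1)`. -/
def mol (n : ℕ) (G : E d → ℝ) : E d → ℝ :=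
  convolution (ker d n) G (ContinuousLinearMap.lsmul ℝ ℝ) volume

theorem mol_apply (n : ℕ) (G : E d → ℝ) (x : E d) : mol n G x = ∫ y, ker d n (x - y) * G y := by
  simp [mol, convolution_eq_swap]

theorem ker_nonneg (n : ℕ) (x : E d) : 0 ≤ ker d n x := (bump d n).nonneg_normed x

theorem ker_sub_comm (n : ℕ) (x y : E d) : ker d n (x - y) = ker d n (y - x) := by
  rw [← neg_sub]; exact (bump d n).normed_neg _

theorem integral_ker_sub (n : ℕ) (x : E d) : ∫ y, ker d n (x - y) = 1 := by
  rw [integral_sub_left_eq_self (ker d n) volume x]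
  exact (bump d n).integral_normed

theorem contDiff_ker (n : ℕ) : ContDiff ℝ (⊤ : ℕ∞) (ker d n) := (bump d n).contDiff_normed

theorem hasCompactSupport_ker (n : ℕ) : HasCompactSupport (ker d n) :=
  (bump d n).hasCompactSupport_normed

theorem integrable_ker_sub (n : ℕ) (x : E d) : Integrable fun y => ker d n (x - y) :=
  ((contDiff_ker n).continuous.integrable_of_hasCompactSupport (hasCompactSupport_ker n)).comp_sub_left x

theorem ker_eq_zero {n : ℕ} {x y : E d} (h : y ∉ Metric.ball x (1 / ((n : ℝ) + 1))) :
    ker d n (x - y) = 0 := by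
  have hs : Function.support (ker d n) = Metric.ball 0 (1 / ((n : ℝ) + 1)) :=
    (bump d n).support_normed_eq
  by_contra h2
  refine h ?_
  have : x - y ∈ Function.support (ker d n) := h2
  rw [hs, mem_ball_zero_iff] at this
  rw [mem_ball_iff_norm']; exact this

theorem tendsto_bump : Tendsto (fun n : ℕ => (bump d n).rOut) atTop (𝓝 0) :=
  tendsto_one_div_add_atTop_nhds_zero_nat

/-- Lebesgue differentiation for kernels shrinking to a point; it requires the ratio of outer to
inner radius to stay bounded, and `bump` keeps it equal to 2. -/
theorem ae_tendsto_mol {G : E d → ℝ} (hG : LocallyIntegrable G) :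
    ∀ᵐ x, Tendsto (fun n => mol n G x) atTop (𝓝 (G x)) := by
  refine ContDiffBump.ae_convolution_tendsto_right_of_locallyIntegrable (K := 2) tendsto_bump
    (Eventually.of_forall fun n => ?_) hG
  simp only [bump]
  rw [← mul_div_assoc, mul_one, ← div_div, div_self two_ne_zero]

theorem contDiff_mol (n : ℕ) {G : E d → ℝ} (hG : LocallyIntegrable G) :
    ContDiff ℝ (⊤ : ℕ∞) (mol n G) :=
  (hasCompactSupport_ker n).contDiff_convolution_left _ (contDiff_ker n) hG

theorem abs_mol_le {n : ℕ} {G : E d → ℝ} {x : E d} {c : ℝ}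
    (h : ∀ᵐ y, y ∈ Metric.ball x (1 / ((n : ℝ) + 1)) → |G y| ≤ c) : |mol n G x| ≤ c := by
  rw [mol_apply]
  have h1 : ∫ y, ker d n (x - y) * c = c := by
    rw [integral_mul_const, integral_ker_sub, one_mul]
  rw [← h1, ← Real.norm_eq_abs]
  refine norm_integral_le_of_norm_le ((integrable_ker_sub n x).mul_const c) ?_
  filter_upwards [h] with y hy
  rw [norm_mul, Real.norm_of_nonneg (ker_nonneg n _), Real.norm_eq_abs]
  by_cases hb : y ∈ Metric.ball x (1 / ((n : ℝ) + 1))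
  · exact mul_le_mul_of_nonneg_left (hy hb) (ker_nonneg n _)
  · rw [ker_eq_zero hb]; simp

theorem lintegral_ker_sub (n : ℕ) (x : E d) : ∫⁻ y, ENNReal.ofReal (ker d n (x - y)) = 1 := by
  rw [← ofReal_integral_eq_lintegral_ofReal (integrable_ker_sub n x)
    (Eventually.of_forall fun y => ker_nonneg n _), integral_ker_sub]
  simp

theorem measurable_ker (n : ℕ) : Measurable (ker d n) := (contDiff_ker n).continuous.measurable

/-- Mollification does not increase the local `L²` norm. -/
theorem lintegral_mol_sq_le {n : ℕ} {G : E d → ℝ} (hG : AEMeasurable G) {A K : Set (E d)}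
    (hA : MeasurableSet A) (hK : MeasurableSet K)
    (h : ∀ x ∈ A, Metric.ball x (1 / ((n : ℝ) + 1)) ⊆ K) :
    ∫⁻ x in A, ‖mol n G x‖ₑ ^ 2 ≤ ∫⁻ x in K, ‖G x‖ₑ ^ 2 := by
  have key : ∀ x ∈ A, ‖mol n G x‖ₑ ^ 2 ≤
      ∫⁻ y, ENNReal.ofReal (ker d n (x - y)) * (K.indicator (fun y => ‖G y‖ₑ ^ 2) y) := by
    intro x hx
    have hk : AEMeasurable fun y => ENNReal.ofReal (ker d n (x - y)) :=
      ((measurable_ker n).comp (measurable_const.sub measurable_id)).ennreal_ofReal.aemeasurable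
    set k : E d → ℝ≥0∞ := fun y => ENNReal.ofReal (ker d n (x - y)) with hkdef
    -- Split the kernel into two square roots: Cauchy–Schwarz and ∫k = 1 give |mol G|² ≤ mol |G|²,
    -- after which Tonelli integrates the kernel away in x.
    have h1 : ‖mol n G x‖ₑ ≤ ∫⁻ y, k y ^ (1 / 2 : ℝ) * (k y ^ (1 / 2 : ℝ) * ‖G y‖ₑ) := by
      rw [mol_apply]
      refine (enorm_integral_le_lintegral_enorm _).trans (lintegral_mono fun y => ?_)
      rw [enorm_mul, Real.enorm_of_nonneg (ker_nonneg n _), ← mul_assoc,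
        ← ENNReal.rpow_add_of_nonneg _ _ (by norm_num) (by norm_num)]
      norm_num [hkdef]
    have h2 := ENNReal.lintegral_mul_le_Lp_mul_Lq volume Real.HolderConjugate.two_two
      (f := fun y => k y ^ (1 / 2 : ℝ)) (g := fun y => k y ^ (1 / 2 : ℝ) * ‖G y‖ₑ)
      (hk.pow_const _) ((hk.pow_const _).mul hG.enorm)
    have e1 : ∀ y, (k y ^ (1 / 2 : ℝ)) ^ (2 : ℝ) = k y := fun y => by
      rw [← ENNReal.rpow_mul]; norm_num
    have e2 : ∀ y, (k y ^ (1 / 2 : ℝ) * ‖G y‖ₑ) ^ (2 : ℝ) = k y * ‖G y‖ₑ ^ 2 := fun y => by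
      rw [ENNReal.mul_rpow_of_nonneg _ _ (by norm_num), e1]; norm_num
    simp only [Pi.mul_apply] at h2
    simp_rw [e1, e2] at h2
    rw [lintegral_ker_sub, ENNReal.one_rpow, one_mul] at h2
    have h3 := pow_le_pow_left₀ zero_le (h1.trans h2) 2
    refine h3.trans (le_of_eq ?_)
    rw [← ENNReal.rpow_natCast, ← ENNReal.rpow_mul]
    norm_num
    refine lintegral_congr fun y => ?_
    by_cases hy : y ∈ K
    · rw [indicator_of_mem hy]
    · rw [indicator_of_notMem hy, mul_zero]
      have : k y = 0 := by
        rw [hkdef]; simp only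
        rw [ker_eq_zero fun hb => hy (h x hx hb)]; simp
      rw [this, zero_mul]
  have hind : AEMeasurable (K.indicator fun y => ‖G y‖ₑ ^ 2) :=
    (hG.enorm.pow_const 2).indicator hK
  calc ∫⁻ x in A, ‖mol n G x‖ₑ ^ 2
      ≤ ∫⁻ x in A, ∫⁻ y, ENNReal.ofReal (ker d n (x - y)) * (K.indicator (fun y => ‖G y‖ₑ ^ 2) y) :=
        setLIntegral_mono' hA key
    _ ≤ ∫⁻ x, ∫⁻ y, ENNReal.ofReal (ker d n (x - y)) * (K.indicator (fun y => ‖G y‖ₑ ^ 2) y) :=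
        setLIntegral_le_lintegral _ _
    _ = ∫⁻ y, ∫⁻ x, ENNReal.ofReal (ker d n (x - y)) * (K.indicator (fun y => ‖G y‖ₑ ^ 2) y) := by
        refine lintegral_lintegral_swap ?_
        refine AEMeasurable.mul ?_ hind.comp_snd
        exact ((measurable_ker n).comp (measurable_fst.sub measurable_snd)).ennreal_ofReal.aemeasurable
    _ = ∫⁻ y, K.indicator (fun y => ‖G y‖ₑ ^ 2) y := by
        refine lintegral_congr fun y => ?_
        rw [lintegral_mul_const _
          (show Measurable fun x => ENNReal.ofReal (ker d n (x - y)) from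
            ((measurable_ker n).comp (measurable_id.sub measurable_const)).ennreal_ofReal)]
        have : ∫⁻ x, ENNReal.ofReal (ker d n (x - y)) = 1 := by
          simp_rw [ker_sub_comm n _ y]; exact lintegral_ker_sub n y
        rw [this, one_mul]
    _ = _ := lintegral_indicator hK _

/-- The kernel is even, so mollification is symmetric. It can be moved from the merely integrable G
to the bounded ψ, where dominated convergence applies. -/
theorem integral_mul_mol {n : ℕ} {G ψ : E d → ℝ} (hG : Integrable G) (hψ : Integrable ψ)
    {c : ℝ} (hc : ∀ x, |ψ x| ≤ c) : ∫ x, ψ x * mol n G x = ∫ y, G y * mol n ψ y := by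
  have hker : Integrable (ker d n) :=
    (contDiff_ker n).continuous.integrable_of_hasCompactSupport (hasCompactSupport_ker n)
  simp_rw [mol_apply, ← integral_const_mul]
  have h_int : Integrable (Function.uncurry fun x y => ψ x * (ker d n (x - y) * G y))
      (volume.prod volume) := by
    have h1 : Integrable (fun p : E d × E d => G p.2 * ker d n (p.1 - p.2))
        (volume.prod volume) := hG.convolution_integrand (ContinuousLinearMap.mul ℝ ℝ) hker
    refine (h1.bdd_mul (f := fun p : E d × E d => ψ p.1) (c := c)
      hψ.aestronglyMeasurable.comp_fst
      (Eventually.of_forall fun p => hc _)).congr (Eventually.of_forall fun p => ?_)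
    simp only [Function.uncurry]; ring
  rw [integral_integral_swap h_int]
  refine integral_congr_ae (Eventually.of_forall fun y => integral_congr_ae
    (Eventually.of_forall fun x => ?_))
  simp only
  rw [ker_sub_comm]; ring

/-- Weak convergence of mollifications. -/
theorem tendsto_integral_mul_mol {G ψ : E d → ℝ} (hG : Integrable G) (hψ : Integrable ψ)
    {c : ℝ} (hc : ∀ x, |ψ x| ≤ c) :
    Tendsto (fun n => ∫ x, ψ x * mol n G x) atTop (𝓝 (∫ x, ψ x * G x)) := by
  simp_rw [fun n => integral_mul_mol (n := n) hG hψ hc, fun x => mul_comm (ψ x) (G x)]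
  refine tendsto_integral_of_dominated_convergence (fun y => |G y| * c) (fun n => ?_)
    (hG.abs.mul_const c) (fun n => ?_) ?_
  · exact hG.aestronglyMeasurable.mul
      (contDiff_mol n hψ.locallyIntegrable).continuous.aestronglyMeasurable
  · refine Eventually.of_forall fun y => ?_
    rw [norm_mul, Real.norm_eq_abs, Real.norm_eq_abs]
    exact mul_le_mul_of_nonneg_left (abs_mol_le (Eventually.of_forall fun y _ => hc y)) (abs_nonneg _)
  · filter_upwards [ae_tendsto_mol hψ.locallyIntegrable] with y hy
    exact hy.const_mul _

/-- The second function is the weak `i`-th derivative of the first in the open set `O`. -/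
def WeakDeriv (O : Set (E d)) (i : Fin d) (G G' : E d → ℝ) : Prop :=
  ∀ φ : E d → ℝ, IsTest O φ → ∫ x, G x * pd i φ x = -∫ x, G' x * φ x

theorem isTest_ker_sub {O : Set (E d)} {n : ℕ} {x : E d}
    (h : Metric.closedBall x (1 / ((n : ℝ) + 1)) ⊆ O) : IsTest O fun y => ker d n (x - y) := by
  have hs : tsupport (fun y => ker d n (x - y)) ⊆ Metric.closedBall x (1 / ((n : ℝ) + 1)) := by
    refine closure_minimal (fun y hy => ?_) Metric.isClosed_closedBall
    by_contra hb
    exact hy (ker_eq_zero fun hb' => hb (Metric.ball_subset_closedBall hb'))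
  refine ⟨(contDiff_ker n).comp (contDiff_const.sub contDiff_id), ?_, hs.trans h⟩
  exact HasCompactSupport.of_support_subset_isCompact (isCompact_closedBall x _)
    (subset_closure.trans hs)

/-- The derivative of a mollification is the mollification of the weak derivative. -/
theorem pd_mol {O : Set (E d)} {i : Fin d} {G G' : E d → ℝ} (hG : LocallyIntegrable G)
    (h : WeakDeriv O i G G') {n : ℕ} {x : E d}
    (hx : Metric.closedBall x (1 / ((n : ℝ) + 1)) ⊆ O) : pd i (mol n G) x = mol n G' x := by
  have h1 := (hasCompactSupport_ker (d := d) n).hasFDerivAt_convolution_left (μ := volume)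
    (ContinuousLinearMap.lsmul ℝ ℝ) ((contDiff_ker n).of_le (by simp)) hG x
  have h2 : pd i (mol n G) x = ∫ y, pd i (ker d n) (x - y) * G y := by
    unfold pd mol
    rw [h1.fderiv, convolution_eq_swap, ContinuousLinearMap.integral_apply]
    · simp
    · have := ((hasCompactSupport_ker (d := d) n).fderiv (𝕜 := ℝ)).convolutionExists_left
        ((ContinuousLinearMap.lsmul ℝ ℝ).precompL (E d))
        ((contDiff_ker n).continuous_fderiv (by simp)) hG x
      exact this.integrable_swap
  have h3 : ∀ y, pd i (fun y => ker d n (x - y)) y = -pd i (ker d n) (x - y) := by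
    intro y
    unfold pd
    have hd : DifferentiableAt ℝ (ker d n) (x - y) :=
      ((contDiff_ker n).differentiable (by simp)).differentiableAt
    have := hd.hasFDerivAt.comp y ((hasFDerivAt_id y).const_sub x)
    have e : (fun y => ker d n (x - y)) = ker d n ∘ HSub.hSub x := rfl
    rw [e, this.fderiv]
    simp
  -- The reflected kernel centred at x is itself an admissible test function in O; the two signs,
  -- from reflection and from the weak derivative, cancel.
  have h4 := h _ (isTest_ker_sub hx)
  simp_rw [h3] at h4
  rw [h2, mol_apply]
  have e1 : ∫ y, G y * -pd i (ker d n) (x - y) = -∫ y, pd i (ker d n) (x - y) * G y := by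
    rw [← integral_neg]; congr 1; ext y; ring
  have e2 : ∫ y, G' y * ker d n (x - y) = ∫ y, ker d n (x - y) * G' y := by
    congr 1; ext y; ring
  rw [e1, e2] at h4
  linarith

/-- Extension by zero. -/
def ext0 (g : L2 Ω) : E d → ℝ := Ω.indicator g

theorem memLp_ext0 (hΩ : MeasurableSet Ω) (g : L2 Ω) : MemLp (ext0 g) 2 volume :=
  (memLp_indicator_iff_restrict hΩ).2 (Lp.memLp g)

theorem integrable_ext0 (hΩ : MeasurableSet Ω) (hb : Bornology.IsBounded Ω) (g : L2 Ω) :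
    Integrable (ext0 g) := (integrable_indicator_iff hΩ).2 (integrable_coe hb g)

theorem ext0_mul (hΩ : MeasurableSet Ω) (g : L2 Ω) (φ : E d → ℝ) :
    ∫ x, ext0 g x * φ x = ∫ x in Ω, g x * φ x := by
  rw [← integral_indicator hΩ]
  congr 1; ext x
  by_cases hx : x ∈ Ω <;> simp [ext0, hx]

theorem IsWeakPartial.weakDeriv (hΩ : MeasurableSet Ω) {i : Fin d} {g g' : L2 Ω}
    (h : IsWeakPartial Ω i g g') : WeakDeriv Ω i (ext0 g) (ext0 g') := fun φ hφ => by
  rw [ext0_mul hΩ, ext0_mul hΩ]; exact h φ hφ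

end Mollification
end EnsembleNSE
end


noncomputable section

namespace EnsembleNSE
open MeasureTheory Set Filter Topology
open scoped ContDiff NNReal ENNReal

/-! ### Averaged Taylor polynomials -/

section Taylor

variable {d : ℕ} {Ω : Set (E d)}

theorem fderiv_apply_eq_sum_pd (f : E d → ℝ) (x v : E d) :
    fderiv ℝ f x v = ∑ i, v i * pd i f x := by
  have hv : v = ∑ i, v i • EuclideanSpace.single i (1 : ℝ) := by
    have := (EuclideanSpace.basisFun (Fin d) ℝ).sum_repr v
    simpa using this.symm
  conv_lhs => rw [hv]
  simp [map_sum, pd]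

theorem contDiff_pd {f : E d → ℝ} (hf : ContDiff ℝ (⊤ : ℕ∞) f) (i : Fin d) :
    ContDiff ℝ (⊤ : ℕ∞) (pd i f) :=
  (hf.fderiv_right (m := (⊤ : ℕ∞)) (by simp)).clm_apply contDiff_const

theorem hasDerivAt_line {f : E d → ℝ} (hf : ContDiff ℝ (⊤ : ℕ∞) f) (y v : E d) (s : ℝ) :
    HasDerivAt (fun s : ℝ => f (y + s • v)) (∑ i, v i * pd i f (y + s • v)) s := by
  rw [← fderiv_apply_eq_sum_pd]
  have h1 : HasFDerivAt f (fderiv ℝ f (y + s • v)) (y + s • v) :=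
    ((hf.differentiable (by simp)).differentiableAt).hasFDerivAt
  have h2 : HasDerivAt (fun s : ℝ => y + s • v) v s := by
    simpa using ((hasDerivAt_id s).smul_const v).const_add y
  exact h1.comp_hasDerivAt s h2

/-- Taylor's formula of second order with integral remainder. -/
theorem taylor_two {f : E d → ℝ} (hf : ContDiff ℝ (⊤ : ℕ∞) f) (x y : E d) :
    f x - f y - ∑ i, (x - y) i * pd i f y =
      ∫ s in (0 : ℝ)..1, (1 - s) *
        ∑ i, ∑ j, (x - y) i * (x - y) j * pd j (pd i f) (y + s • (x - y)) := by
  set v := x - y with hv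
  have hD : ∀ s : ℝ, HasDerivAt (fun s : ℝ => f (y + s • v) +
      (1 - s) * ∑ i, v i * pd i f (y + s • v))
      ((1 - s) * ∑ i, ∑ j, v i * v j * pd j (pd i f) (y + s • v)) s := by
    intro s
    have h1 := hasDerivAt_line hf y v s
    have h2 : HasDerivAt (fun s : ℝ => ∑ i, v i * pd i f (y + s • v))
        (∑ i, v i * ∑ j, v j * pd j (pd i f) (y + s • v)) s :=
      HasDerivAt.fun_sum fun i _ => (hasDerivAt_line (contDiff_pd hf i) y v s).const_mul (v i)
    have h3 : HasDerivAt (fun s : ℝ => 1 - s) (-1) s := (hasDerivAt_id s).const_sub 1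
    refine (h1.add (h3.mul h2)).congr_deriv ?_
    have e : ∑ i, ∑ j, v i * v j * pd j (pd i f) (y + s • v) =
        ∑ i, v i * ∑ j, v j * pd j (pd i f) (y + s • v) :=
      Finset.sum_congr rfl fun i _ => by rw [Finset.mul_sum]; simp only [mul_assoc]
    rw [e]; ring
  have hcont : Continuous fun s : ℝ => (1 - s) *
      ∑ i, ∑ j, v i * v j * pd j (pd i f) (y + s • v) := by
    refine (continuous_const.sub continuous_id).mul (continuous_finsetSum _ fun i _ =>
      continuous_finsetSum _ fun j _ => continuous_const.mul ?_)
    exact (contDiff_pd (contDiff_pd hf i) j).continuous.comp (by fun_prop)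
  rw [intervalIntegral.integral_eq_sub_of_hasDerivAt (fun s _ => hD s) (hcont.intervalIntegrable _ _)]
  have : y + v = x := by rw [hv]; abel
  simp [this]
  ring

theorem lintegral_comp_smul_add {r : ℝ} (hr : 0 < r) (a : E d) {F : E d → ℝ≥0∞}
    (hF : Measurable F) :
    ∫⁻ y, F (r • y + a) = ENNReal.ofReal ((r ^ d)⁻¹) * ∫⁻ y, F y := by
  have h1 : ∫⁻ y, F (r • y + a) = ∫⁻ y, F (y + a) ∂(Measure.map (r • ·) (volume : Measure (E d))) := by
    rw [lintegral_map (f := fun y => F (y + a)) (hF.comp (measurable_id.add_const a))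
      (measurable_const_smul r)]
  rw [h1, Measure.map_addHaar_smul _ hr.ne', lintegral_smul_measure, finrank_euclideanSpace_fin,
    abs_of_nonneg (by positivity), smul_eq_mul]
  congr 1
  exact lintegral_add_right_eq_self F a

/-- For fixed s the map y ↦ y + s(x − y) is a dilation by 1 − s followed by a translation, with
Jacobian (1 − s)^d. -/
theorem setLIntegral_segment_le {B A : Set (E d)} (hB : MeasurableSet B) (hA : MeasurableSet A)
    {x : E d} {s : ℝ} (hs : s < 1) (hBA : ∀ y ∈ B, y + s • (x - y) ∈ A) {F : E d → ℝ≥0∞}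
    (hF : Measurable F) :
    ∫⁻ y in B, F (y + s • (x - y)) ≤ ENNReal.ofReal (((1 - s) ^ d)⁻¹) * ∫⁻ z in A, F z := by
  rw [← lintegral_indicator hA, ← lintegral_comp_smul_add (sub_pos.2 hs) (s • x)
    (hF.indicator hA), ← lintegral_indicator hB]
  refine lintegral_mono fun y => ?_
  by_cases hy : y ∈ B
  · have e : (1 - s) • y + s • x = y + s • (x - y) := by module
    rw [indicator_of_mem hy, e, indicator_of_mem (hBA y hy)]
  · rw [indicator_of_notMem hy]; exact zero_le

/-- Cauchy–Schwarz for the dilated second derivatives. -/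
theorem setLIntegral_segment_enorm_le {B A : Set (E d)} (hB : MeasurableSet B)
    (hA : MeasurableSet A) {x : E d} {s : ℝ} (hs : s < 1) (hBA : ∀ y ∈ B, y + s • (x - y) ∈ A)
    {g : E d → ℝ} (hg : Continuous g) {V N : ℝ} (hV : 0 ≤ V) (hN : 0 ≤ N)
    (hBV : volume B ≤ ENNReal.ofReal (V ^ 2))
    (hgN : ∫⁻ z in A, ‖g z‖ₑ ^ 2 ≤ ENNReal.ofReal (N ^ 2)) :
    ∫⁻ y in B, ‖g (y + s • (x - y))‖ₑ ≤
      ENNReal.ofReal (V * (Real.sqrt ((1 - s) ^ d))⁻¹ * N) := by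
  have h1s : 0 < 1 - s := sub_pos.2 hs
  have hc : Continuous fun y : E d => g (y + s • (x - y)) := hg.comp (by fun_prop)
  have h2 := ENNReal.lintegral_mul_le_Lp_mul_Lq (volume.restrict B) Real.HolderConjugate.two_two
    (f := fun _ => 1) (g := fun y => ‖g (y + s • (x - y))‖ₑ) aemeasurable_const
    hc.measurable.enorm.aemeasurable
  have h3 := setLIntegral_segment_le hB hA hs hBA (F := fun z => ‖g z‖ₑ ^ 2)
    (hg.measurable.enorm.pow_const 2)
  simp only [Pi.mul_apply, lintegral_const,
    Measure.restrict_apply MeasurableSet.univ, univ_inter, ENNReal.rpow_two, one_pow, one_mul] at h2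
  refine h2.trans ?_
  have h4 : ∫⁻ y in B, ‖g (y + s • (x - y))‖ₑ ^ 2 ≤
      ENNReal.ofReal (((Real.sqrt ((1 - s) ^ d))⁻¹ * N) ^ 2) := by
    refine h3.trans ?_
    rw [mul_pow, inv_pow, Real.sq_sqrt (by positivity), ENNReal.ofReal_mul (by positivity)]
    gcongr
  have hsq : ∀ a : ℝ, 0 ≤ a → ENNReal.ofReal (a ^ 2) ^ (1 / 2 : ℝ) = ENNReal.ofReal a := by
    intro a ha
    rw [ENNReal.ofReal_rpow_of_nonneg (sq_nonneg a) (by norm_num), ← Real.sqrt_eq_rpow,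
      Real.sqrt_sq ha]
  calc _ ≤ ENNReal.ofReal (V ^ 2) ^ (1 / 2 : ℝ) *
        ENNReal.ofReal (((Real.sqrt ((1 - s) ^ d))⁻¹ * N) ^ 2) ^ (1 / 2 : ℝ) := by gcongr
    _ = _ := by
      rw [hsq V hV, hsq _ (by positivity), ← ENNReal.ofReal_mul hV, mul_assoc]

/-- Here d ≤ 3 is essential: the integrand (1 − s)^{1−d/2} is at most (1 − s)^{−1/2}, whose integral
is 2. It is the reason why H² functions are controlled pointwise. -/
theorem lintegral_one_sub_rpow_le (hd : d ≤ 3) :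
    ∫⁻ s in Ioo (0 : ℝ) 1, ENNReal.ofReal ((1 - s) * (Real.sqrt ((1 - s) ^ d))⁻¹) ≤ 2 := by
  have hle : ∀ s ∈ Ioo (0 : ℝ) 1, ENNReal.ofReal ((1 - s) * (Real.sqrt ((1 - s) ^ d))⁻¹) ≤
      ENNReal.ofReal ((1 - s) ^ (-(1 / 2) : ℝ)) := by
    intro s hs
    have h1 : 0 < 1 - s := sub_pos.2 hs.2
    have h2 : 1 - s ≤ 1 := by linarith [hs.1]
    refine ENNReal.ofReal_le_ofReal ?_
    have h3 : Real.sqrt ((1 - s) ^ 3) ≤ Real.sqrt ((1 - s) ^ d) :=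
      Real.sqrt_le_sqrt (pow_le_pow_of_le_one h1.le h2 hd)
    have h4 : Real.sqrt ((1 - s) ^ 3) = (1 - s) * Real.sqrt (1 - s) := by
      rw [show (1 - s) ^ 3 = (1 - s) ^ 2 * (1 - s) by ring, Real.sqrt_mul (sq_nonneg _),
        Real.sqrt_sq h1.le]
    have h5 : 0 < Real.sqrt (1 - s) := Real.sqrt_pos.2 h1
    rw [Real.rpow_neg h1.le, ← Real.sqrt_eq_rpow]
    calc (1 - s) * (Real.sqrt ((1 - s) ^ d))⁻¹ ≤ (1 - s) * ((1 - s) * Real.sqrt (1 - s))⁻¹ := by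
          rw [← h4]
          have : 0 < Real.sqrt ((1 - s) ^ 3) := by rw [h4]; positivity
          gcongr
      _ = _ := by field_simp
  refine (setLIntegral_mono' measurableSet_Ioo hle).trans ?_
  have hii : IntervalIntegrable (fun s : ℝ => (1 - s) ^ (-(1 / 2) : ℝ)) volume 0 1 := by
    have := (intervalIntegral.intervalIntegrable_rpow' (a := 1) (b := 0) (r := -(1 / 2))
      (by norm_num)).comp_sub_left 1
    simpa using this
  have hval : ∫ s in (0 : ℝ)..1, (1 - s) ^ (-(1 / 2) : ℝ) = 2 := by
    rw [intervalIntegral.integral_comp_sub_left (fun t : ℝ => t ^ (-(1 / 2) : ℝ)) 1]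
    rw [integral_rpow (Or.inl (by norm_num))]
    norm_num
  rw [intervalIntegral.integral_of_le zero_le_one, integral_Ioc_eq_integral_Ioo] at hval
  have hio : IntegrableOn (fun s : ℝ => (1 - s) ^ (-(1 / 2) : ℝ)) (Ioo 0 1) :=
    ((intervalIntegrable_iff_integrableOn_Ioc_of_le zero_le_one).1 hii).mono_set Ioo_subset_Ioc_self
  rw [← ofReal_integral_eq_lintegral_ofReal hio, hval]
  · norm_num
  · refine (ae_restrict_mem measurableSet_Ioo).mono fun s hs => ?_
    exact Real.rpow_nonneg (sub_nonneg.2 hs.2.le) _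

/-- The averaged Taylor remainder of a smooth function. -/
theorem abs_integral_taylor_le (hd : d ≤ 3) {f : E d → ℝ} (hf : ContDiff ℝ (⊤ : ℕ∞) f)
    {B A : Set (E d)} (hB : MeasurableSet B) (hA : MeasurableSet A) {x : E d} {h V : ℝ}
    {N : Fin d → Fin d → ℝ} (hBA : ∀ y ∈ B, ∀ s ∈ Ioo (0 : ℝ) 1, y + s • (x - y) ∈ A)
    (hh : ∀ y ∈ B, ‖x - y‖ ≤ h) (hh0 : 0 ≤ h) (hV : 0 ≤ V) (hN : ∀ i j, 0 ≤ N i j)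
    (hBV : volume B ≤ ENNReal.ofReal (V ^ 2))
    (hfN : ∀ i j, ∫⁻ z in A, ‖pd j (pd i f) z‖ₑ ^ 2 ≤ ENNReal.ofReal (N i j ^ 2)) :
    |∫ y in B, (f x - f y - ∑ i, (x - y) i * pd i f y)| ≤ 2 * h ^ 2 * V * ∑ i, ∑ j, N i j := by
  have hcont : ∀ i j, Continuous (pd j (pd i f)) := fun i j =>
    (contDiff_pd (contDiff_pd hf i) j).continuous
  have hpt : ∀ y ∈ B, ‖f x - f y - ∑ i, (x - y) i * pd i f y‖ₑ ≤
      ∫⁻ s in Ioo (0 : ℝ) 1, ∑ i, ∑ j, ENNReal.ofReal ((1 - s) * h ^ 2) *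
        ‖pd j (pd i f) (y + s • (x - y))‖ₑ := by
    intro y hy
    rw [taylor_two hf, intervalIntegral.integral_of_le zero_le_one, integral_Ioc_eq_integral_Ioo]
    refine (enorm_integral_le_lintegral_enorm _).trans (setLIntegral_mono' measurableSet_Ioo ?_)
    intro s hs
    have h1s : 0 ≤ 1 - s := sub_nonneg.2 hs.2.le
    rw [Finset.mul_sum]
    refine (enorm_sum_le _ _).trans (Finset.sum_le_sum fun i _ => ?_)
    rw [Finset.mul_sum]
    refine (enorm_sum_le _ _).trans (Finset.sum_le_sum fun j _ => ?_)
    rw [← mul_assoc, enorm_mul]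
    gcongr
    rw [Real.enorm_eq_ofReal_abs]
    refine ENNReal.ofReal_le_ofReal ?_
    rw [abs_mul, abs_of_nonneg h1s, abs_mul]
    have hi : ∀ i, |(x - y) i| ≤ h := fun i => (PiLp.norm_apply_le (x - y) i).trans (hh y hy)
    have := mul_le_mul (hi i) (hi j) (abs_nonneg _) hh0
    calc (1 - s) * (|(x - y) i| * |(x - y) j|) ≤ (1 - s) * (h * h) := by gcongr
      _ = _ := by ring
  have hmeas : ∀ i j, Measurable fun p : E d × ℝ => ENNReal.ofReal ((1 - p.2) * h ^ 2) *
      ‖pd j (pd i f) (p.1 + p.2 • (x - p.1))‖ₑ := by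
    intro i j
    have : Continuous fun p : E d × ℝ => pd j (pd i f) (p.1 + p.2 • (x - p.1)) :=
      (hcont i j).comp (by fun_prop)
    exact (by fun_prop : Measurable fun p : E d × ℝ => ENNReal.ofReal ((1 - p.2) * h ^ 2)).mul
      this.measurable.enorm
  have hsum0 : 0 ≤ ∑ i, ∑ j, N i j := Finset.sum_nonneg fun i _ => Finset.sum_nonneg fun j _ => hN i j
  -- Tonelli puts s outside. At fixed s, Cauchy–Schwarz and the change of variables bound the
  -- integral over y by V(1 − s)^{−d/2}N; the weight 1 − s of the Taylor remainder makes this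
  -- integrable in s.
  have hmain : ‖∫ y in B, (f x - f y - ∑ i, (x - y) i * pd i f y)‖ₑ ≤
      ENNReal.ofReal (2 * h ^ 2 * V * ∑ i, ∑ j, N i j) := by
    calc _ ≤ ∫⁻ y in B, ‖f x - f y - ∑ i, (x - y) i * pd i f y‖ₑ :=
          enorm_integral_le_lintegral_enorm _
      _ ≤ ∫⁻ y in B, ∫⁻ s in Ioo (0 : ℝ) 1, ∑ i, ∑ j, ENNReal.ofReal ((1 - s) * h ^ 2) *
        ‖pd j (pd i f) (y + s • (x - y))‖ₑ := setLIntegral_mono' hB hpt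
      _ = ∫⁻ s in Ioo (0 : ℝ) 1, ∫⁻ y in B, ∑ i, ∑ j, ENNReal.ofReal ((1 - s) * h ^ 2) *
        ‖pd j (pd i f) (y + s • (x - y))‖ₑ := by
          refine lintegral_lintegral_swap (Measurable.aemeasurable ?_)
          exact Finset.measurable_fun_sum _ fun i _ => Finset.measurable_fun_sum _ fun j _ => hmeas i j
      _ ≤ ∫⁻ s in Ioo (0 : ℝ) 1, ENNReal.ofReal ((1 - s) * (Real.sqrt ((1 - s) ^ d))⁻¹) *
          ENNReal.ofReal (h ^ 2 * V * ∑ i, ∑ j, N i j) := by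
          refine setLIntegral_mono' measurableSet_Ioo fun s hs => ?_
          have h1s : 0 ≤ 1 - s := sub_nonneg.2 hs.2.le
          have hm : ∀ i j, Measurable fun y : E d => ENNReal.ofReal ((1 - s) * h ^ 2) *
              ‖pd j (pd i f) (y + s • (x - y))‖ₑ := fun i j =>
            (hmeas i j).comp (measurable_id.prodMk measurable_const)
          rw [lintegral_finsetSum _ fun i _ => Finset.measurable_fun_sum _ fun j _ => hm i j]
          have hterm : ∀ i j, ∫⁻ y in B, ENNReal.ofReal ((1 - s) * h ^ 2) *
              ‖pd j (pd i f) (y + s • (x - y))‖ₑ ≤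
              ENNReal.ofReal ((1 - s) * (Real.sqrt ((1 - s) ^ d))⁻¹ * (h ^ 2 * V * N i j)) := by
            intro i j
            have hc : Continuous fun y : E d => pd j (pd i f) (y + s • (x - y)) :=
              (hcont i j).comp (by fun_prop)
            rw [lintegral_const_mul _ hc.measurable.enorm]
            refine (mul_le_mul_right (setLIntegral_segment_enorm_le hB hA hs.2
              (fun y hy => hBA y hy s hs) (hcont i j) hV (hN i j) hBV (hfN i j)) _).trans ?_
            rw [← ENNReal.ofReal_mul (by positivity)]
            refine ENNReal.ofReal_le_ofReal (le_of_eq ?_)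
            ring
          have hnn : ∀ i j, 0 ≤ (1 - s) * (Real.sqrt ((1 - s) ^ d))⁻¹ * (h ^ 2 * V * N i j) :=
            fun i j => by have := hN i j; positivity
          calc _ ≤ ∑ i, ∑ j, ENNReal.ofReal
                ((1 - s) * (Real.sqrt ((1 - s) ^ d))⁻¹ * (h ^ 2 * V * N i j)) := by
                refine Finset.sum_le_sum fun i _ => ?_
                rw [lintegral_finsetSum _ fun j _ => hm i j]
                exact Finset.sum_le_sum fun j _ => hterm i j
            _ = _ := by
                rw [← ENNReal.ofReal_mul (by positivity)]
                simp_rw [← ENNReal.ofReal_sum_of_nonneg fun j _ => hnn _ j]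
                rw [← ENNReal.ofReal_sum_of_nonneg fun i _ => Finset.sum_nonneg fun j _ => hnn i j]
                simp_rw [Finset.mul_sum]
      _ = (∫⁻ s in Ioo (0 : ℝ) 1, ENNReal.ofReal ((1 - s) * (Real.sqrt ((1 - s) ^ d))⁻¹)) *
          ENNReal.ofReal (h ^ 2 * V * ∑ i, ∑ j, N i j) := lintegral_mul_const _ (by fun_prop)
      _ ≤ 2 * ENNReal.ofReal (h ^ 2 * V * ∑ i, ∑ j, N i j) := by
          gcongr; exact lintegral_one_sub_rpow_le hd
      _ = _ := by
          rw [show (2 : ℝ≥0∞) = ENNReal.ofReal 2 by simp, ← ENNReal.ofReal_mul (by norm_num)]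
          congr 1; ring
  rw [Real.enorm_eq_ofReal_abs] at hmain
  exact (ENNReal.ofReal_le_ofReal_iff (by positivity)).1 hmain

end Taylor
end EnsembleNSE
end


noncomputable section

namespace EnsembleNSE
open MeasureTheory Set Filter Topology
open scoped ContDiff NNReal ENNReal

/-! ### Local approximation of `H²` functions by affine functions -/

section LocalAffine

variable {d m : ℕ} {Ω : Set (E d)}

/-- The multi-index `α + eₖ`. -/
def idxAdd (k : Fin d) (α : MultiIndex d m) : MultiIndex d (m + 1) :=
  ⟨fun j => ⟨(α.1 j : ℕ) + if j = k then 1 else 0, by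
    have := (α.1 j).2; split_ifs <;> omega⟩, by
    have h : ∑ i, (α.1 i : ℕ) ≤ m := α.2
    simp only [Finset.sum_add_distrib]
    simp
    exact h⟩

theorem idxAdd_injective (k : Fin d) : Function.Injective (idxAdd (m := m) k) := by
  intro α β h
  refine Subtype.ext (funext fun j => Fin.ext ?_)
  have := congrArg (fun γ : MultiIndex d (m + 1) => (γ.1 j : ℕ)) h
  simpa [idxAdd] using this

/-- `∂ₖ u` as an element of `Hᵐ(Ω)`, for `u ∈ H^{m+1}(Ω)`. -/
def DH (k : Fin d) (u : H (m + 1) Ω) : H m Ω :=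
  ⟨WithLp.toLp 2 fun α => u.1 (idxAdd k α), fun i α β hαβ =>
    u.2 i (idxAdd k α) (idxAdd k β) fun j => by simp only [idxAdd, hαβ j]; ring⟩

theorem val_DH (k : Fin d) (u : H (m + 1) Ω) : val (DH k u) = D1 k u := by
  refine congrArg (fun α => u.1 α) ?_
  refine Subtype.ext (funext fun j => Fin.ext ?_)
  simp only [idxAdd, idx0, idx1]
  split_ifs <;> simp

/-- Both are the same entry of the jet. This makes the averaged second derivatives symmetric, so
that they are the Hessian of a quadratic polynomial in `exists_quad`. -/
theorem D1_DH_comm (k l : Fin d) (u : H (m + 2) Ω) : D1 k (DH l u) = D1 l (DH k u) := by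
  refine congrArg (fun α => u.1 α) ?_
  refine Subtype.ext (funext fun j => Fin.ext ?_)
  simp only [idxAdd, idx1]
  split_ifs <;> simp

theorem norm_DH_le (k : Fin d) (u : H (m + 1) Ω) : ‖DH k u‖ ≤ ‖u‖ := by
  refine le_of_sq_le_sq ?_ (norm_nonneg _)
  rw [norm_sq_H, norm_sq_H]
  calc ∑ α, ‖(DH k u).1 α‖ ^ 2 = ∑ α ∈ Finset.univ.image (idxAdd (m := m) k), ‖u.1 α‖ ^ 2 := by
        rw [Finset.sum_image fun a _ b _ h => idxAdd_injective k h]; rfl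
    _ ≤ _ := Finset.sum_le_sum_of_subset_of_nonneg (Finset.subset_univ _) fun _ _ _ => sq_nonneg _

theorem norm_D1_le (k : Fin d) (u : H (m + 1) Ω) : ‖D1 k u‖ ≤ ‖u‖ := by
  rw [← val_DH]; exact (norm_val_le _).trans (norm_DH_le k u)

/-- The `L²(K)` norm. -/
def lnorm (K : Set (E d)) (G : E d → ℝ) : ℝ := Real.sqrt (∫ x in K, G x ^ 2)

theorem lnorm_nonneg (K : Set (E d)) (G : E d → ℝ) : 0 ≤ lnorm K G := Real.sqrt_nonneg _

theorem lintegral_sq_eq_lnorm {K : Set (E d)} {G : E d → ℝ} (hG : MemLp G 2 volume) :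
    ∫⁻ x in K, ‖G x‖ₑ ^ 2 = ENNReal.ofReal (lnorm K G ^ 2) := by
  rw [lnorm, Real.sq_sqrt (integral_nonneg fun _ => sq_nonneg _),
    ofReal_integral_eq_lintegral_ofReal (hG.integrable_sq.integrableOn)
      (Eventually.of_forall fun x => sq_nonneg _)]
  refine lintegral_congr fun x => ?_
  rw [Real.enorm_eq_ofReal_abs, ← ENNReal.ofReal_pow (abs_nonneg _), sq_abs]

theorem sq_lnorm (K : Set (E d)) (G : E d → ℝ) : lnorm K G ^ 2 = ∫ x in K, G x ^ 2 :=
  Real.sq_sqrt (integral_nonneg fun _ => sq_nonneg _)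

/-- The sum of the `L²(K)` norms of the second derivatives. -/
def hess (K : Set (E d)) (u : H 2 Ω) : ℝ := ∑ i, ∑ j, lnorm K (ext0 (D1 j (DH i u)))

/-- The points at which the mollifications of `u` converge to `u`. -/
def convSet (G : E d → ℝ) : Set (E d) := {x | Tendsto (fun n => mol n G x) atTop (𝓝 (G x))}

theorem ae_mem_convSet {G : E d → ℝ} (hG : LocallyIntegrable G) : ∀ᵐ x, x ∈ convSet G :=
  ae_tendsto_mol hG

/-- The slope of the averaged Taylor polynomial. -/
def slope (B : Set (E d)) (u : H 2 Ω) (i : Fin d) : ℝ :=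
  (volume.real B)⁻¹ * ∫ y in B, ext0 (D1 i u) y

/-- The averaged Taylor polynomial of first order. -/
def affApprox (B : Set (E d)) (u : H 2 Ω) (x : E d) : ℝ :=
  (volume.real B)⁻¹ * (∫ y in B, (ext0 (val u) y - ∑ i, y i * ext0 (D1 i u) y)) +
    ∑ i, slope B u i * x i

theorem tendsto_setIntegral_mul_mol {G ψ : E d → ℝ} (hG : Integrable G) {B : Set (E d)}
    (hB : MeasurableSet B) (hψ : IntegrableOn ψ B) {c : ℝ} (hc : ∀ x ∈ B, |ψ x| ≤ c)
    (hc0 : 0 ≤ c) :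
    Tendsto (fun n => ∫ x in B, ψ x * mol n G x) atTop (𝓝 (∫ x in B, ψ x * G x)) := by
  have h := tendsto_integral_mul_mol hG ((integrable_indicator_iff hB).2 hψ) (c := c) (fun x => by
    by_cases hx : x ∈ B
    · rw [indicator_of_mem hx]; exact hc x hx
    · rw [indicator_of_notMem hx]; simpa using hc0)
  have e : ∀ F : E d → ℝ, ∫ x, B.indicator ψ x * F x = ∫ x in B, ψ x * F x := by
    intro F
    rw [← integral_indicator hB]
    congr 1; ext x
    by_cases hx : x ∈ B <;> simp [hx]
  simpa only [e] using h

/-- An `H²` function is close to its averaged Taylor polynomial on a convex set, pointwise. -/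
theorem abs_sub_affApprox_le (hd : d ≤ 3) (hΩ : MeasurableSet Ω) (hb : Bornology.IsBounded Ω)
    (u : H 2 Ω) {K : Set (E d)} (hK : IsOpen K) (hKc : Convex ℝ K) (hKΩ : K ⊆ Ω) {c : E d}
    {ρ h : ℝ} (hρ : 0 < ρ) (hB : Metric.closedBall c ρ ⊆ K)
    (hh : ∀ x ∈ K, ∀ y ∈ K, ‖x - y‖ ≤ h) {x : E d} (hx : x ∈ K)
    (hxc : x ∈ convSet (ext0 (val u))) :
    |ext0 (val u) x - affApprox (Metric.ball c ρ) u x| ≤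
      2 * h ^ 2 * (Real.sqrt (volume.real (Metric.ball c ρ)))⁻¹ * hess K u := by
  set B := Metric.ball c ρ with hBdef
  have hBm : MeasurableSet B := Metric.isOpen_ball.measurableSet
  have hBK : B ⊆ K := Metric.ball_subset_closedBall.trans hB
  have hfinB : IsFiniteMeasure (volume.restrict B) := ⟨by
    rw [Measure.restrict_apply_univ]; exact measure_ball_lt_top⟩
  set V := volume.real B with hV
  have hV0 : 0 < V := ENNReal.toReal_pos (Metric.measure_ball_pos volume c hρ).ne'
    measure_ball_lt_top.ne
  have hh0 : 0 ≤ h := (norm_nonneg _).trans (hh x hx x hx)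
  set U := ext0 (val u) with hU
  have hUi : Integrable U := integrable_ext0 hΩ hb _
  have hU1 : ∀ i, Integrable (ext0 (D1 i u)) := fun i => integrable_ext0 hΩ hb _
  -- the compact convex set swept by the segments
  set A := (fun p : ℝ × E d => p.2 + p.1 • (x - p.2)) '' (Icc 0 1 ×ˢ Metric.closedBall c ρ) with hA
  have hAc : IsCompact A := (isCompact_Icc.prod (isCompact_closedBall c ρ)).image (by fun_prop)
  have hAK : A ⊆ K := by
    rintro _ ⟨⟨s, y⟩, ⟨hs, hy⟩, rfl⟩
    exact hKc.add_smul_sub_mem (hB hy) hx hs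
  obtain ⟨δ, hδ, hδK⟩ := hAc.exists_cthickening_subset_open hK hAK
  have hlarge : ∀ᶠ n : ℕ in atTop, 1 / ((n : ℝ) + 1) < δ / 2 :=
    (tendsto_one_div_add_atTop_nhds_zero_nat (𝕜 := ℝ)).eventually_lt_const (by linarith)
  have hball : ∀ {n : ℕ}, 1 / ((n : ℝ) + 1) < δ / 2 → ∀ z ∈ A, ∀ z' ∈ Metric.ball z (δ / 2),
      Metric.closedBall z' (1 / ((n : ℝ) + 1)) ⊆ K := by
    intro n hn z hz z' hz' w hw
    refine hδK (Metric.mem_cthickening_of_dist_le w z δ A hz ?_)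
    have h1 := Metric.mem_closedBall.1 hw
    have h2 := Metric.mem_ball.1 hz'
    have := dist_triangle w z' z
    linarith
  -- The compact set A stays at distance δ from the complement of K. So for small radii
  -- mollification commutes with the first and second derivatives on A, and its L²(A) norm involves
  -- only values in K.
  have hbound : ∀ᶠ n : ℕ in atTop,
      |∫ y in B, (mol n U x - mol n U y - ∑ i, (x - y) i * mol n (ext0 (D1 i u)) y)| ≤
        2 * h ^ 2 * Real.sqrt V * hess K u := by
    filter_upwards [hlarge] with n hn
    have hp1 : ∀ z ∈ A, ∀ z' ∈ Metric.ball z (δ / 2), ∀ i,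
        pd i (mol n U) z' = mol n (ext0 (D1 i u)) z' := fun z hz z' hz' i =>
      pd_mol hUi.locallyIntegrable ((isWeakPartial_val_D1 i u).weakDeriv hΩ)
        ((hball hn z hz z' hz').trans hKΩ)
    have hp2 : ∀ z ∈ A, ∀ i j, pd j (pd i (mol n U)) z = mol n (ext0 (D1 j (DH i u))) z := by
      intro z hz i j
      have hev : pd i (mol n U) =ᶠ[𝓝 z] mol n (ext0 (D1 i u)) := by
        filter_upwards [Metric.ball_mem_nhds z (half_pos hδ)] with z' hz'
        exact hp1 z hz z' hz' i
      have e1 : pd j (pd i (mol n U)) z = pd j (mol n (ext0 (D1 i u))) z := by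
        unfold pd at hev ⊢
        rw [hev.fderiv_eq]
      rw [e1]
      have hw := (isWeakPartial_val_D1 j (DH i u)).weakDeriv hΩ
      rw [val_DH] at hw
      exact pd_mol (hU1 i).locallyIntegrable hw
        ((hball hn z hz z (Metric.mem_ball_self (half_pos hδ))).trans hKΩ)
    have hBA : B ⊆ A := fun y hy =>
      ⟨(0, y), ⟨left_mem_Icc.2 zero_le_one, Metric.ball_subset_closedBall hy⟩, by simp⟩
    have key := abs_integral_taylor_le hd (contDiff_mol n hUi.locallyIntegrable) hBm
      hAc.isClosed.measurableSet (x := x) (h := h) (V := Real.sqrt V)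
      (N := fun i j => lnorm K (ext0 (D1 j (DH i u)))) (fun y hy s hs =>
        ⟨(s, y), ⟨⟨hs.1.le, hs.2.le⟩, Metric.ball_subset_closedBall hy⟩, rfl⟩)
      (fun y hy => hh x hx y (hBK hy)) hh0 (Real.sqrt_nonneg _) (fun i j => lnorm_nonneg _ _)
      (by rw [Real.sq_sqrt hV0.le, hV, Measure.real, ENNReal.ofReal_toReal measure_ball_lt_top.ne])
      (fun i j => by
        rw [setLIntegral_congr_fun hAc.isClosed.measurableSet
          (fun z hz => by simp only; rw [hp2 z hz i j] :
            EqOn (fun z => ‖pd j (pd i (mol n U)) z‖ₑ ^ 2)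
              (fun z => ‖mol n (ext0 (D1 j (DH i u))) z‖ₑ ^ 2) A)]
        rw [← lintegral_sq_eq_lnorm (memLp_ext0 hΩ _)]
        exact lintegral_mol_sq_le (memLp_ext0 hΩ _).aestronglyMeasurable.aemeasurable
          hAc.isClosed.measurableSet hK.measurableSet fun z hz =>
          Metric.ball_subset_closedBall.trans
            (hball hn z hz z (Metric.mem_ball_self (half_pos hδ))))
    refine le_trans (le_of_eq ?_) key
    congr 1
    refine setIntegral_congr_fun hBm fun y hy => ?_
    simp only
    congr 1
    refine Finset.sum_congr rfl fun i _ => ?_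
    rw [hp1 y (hBA hy) y (Metric.mem_ball_self (half_pos hδ)) i]
  -- passage to the limit
  have hmc : ∀ n (G : E d → ℝ), Integrable G → Continuous (mol n G) := fun n G hG =>
    (contDiff_mol n hG.locallyIntegrable).continuous
  have hcB : ∀ F : E d → ℝ, Continuous F → IntegrableOn F B := fun F hF =>
    (hF.continuousOn.integrableOn_compact (isCompact_closedBall c ρ)).mono_set
      Metric.ball_subset_closedBall
  have hψc : ∀ i, Continuous fun y : E d => (x - y) i := fun i => by fun_prop
  have hexp : ∀ n, ∫ y in B, (mol n U x - mol n U y - ∑ i, (x - y) i * mol n (ext0 (D1 i u)) y) =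
      V * mol n U x - (∫ y in B, 1 * mol n U y) -
        ∑ i, ∫ y in B, (x - y) i * mol n (ext0 (D1 i u)) y := by
    intro n
    have i1 := hcB (fun y => mol n U y) (hmc n U hUi)
    have i2 : ∀ i, IntegrableOn (fun y => (x - y) i * mol n (ext0 (D1 i u)) y) B := fun i =>
      hcB _ ((hψc i).mul (hmc n _ (hU1 i)))
    have i0 : IntegrableOn (fun _ : E d => mol n U x) B := integrable_const _
    have i3 : IntegrableOn (fun y => mol n U x - mol n U y) B := Integrable.sub i0 i1
    have i4 : IntegrableOn (fun y => ∑ i, (x - y) i * mol n (ext0 (D1 i u)) y) B :=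
      integrable_finsetSum _ fun i _ => i2 i
    rw [integral_sub i3 i4, integral_sub i0 i1, integral_finsetSum _ fun i _ => i2 i]
    simp [V]
  have hlim : Tendsto (fun n => ∫ y in B,
      (mol n U x - mol n U y - ∑ i, (x - y) i * mol n (ext0 (D1 i u)) y)) atTop
      (𝓝 (V * U x - (∫ y in B, 1 * U y) - ∑ i, ∫ y in B, (x - y) i * ext0 (D1 i u) y)) := by
    simp_rw [hexp]
    refine ((Tendsto.const_mul V hxc).sub (tendsto_setIntegral_mul_mol hUi hBm
      (integrable_const _) (c := 1) (fun y _ => by simp) zero_le_one)).sub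
      (tendsto_finsetSum _ fun i _ => ?_)
    refine tendsto_setIntegral_mul_mol (hU1 i) hBm (hcB _ (hψc i)) (c := h) (fun y hy => ?_) hh0
    exact (PiLp.norm_apply_le (x - y) i).trans (hh x hx y (hBK hy))
  have hle := le_of_tendsto (hlim.abs) hbound
  have hid : V * U x - (∫ y in B, 1 * U y) - ∑ i, ∫ y in B, (x - y) i * ext0 (D1 i u) y =
      V * (U x - affApprox B u x) := by
    have j0 : IntegrableOn U B := hUi.integrableOn
    have j1 : ∀ i, IntegrableOn (ext0 (D1 i u)) B := fun i => (hU1 i).integrableOn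
    have j2 : ∀ i, IntegrableOn (fun y : E d => y i * ext0 (D1 i u) y) B := by
      intro i
      have : IntegrableOn (fun y : E d => y i * ext0 (D1 i u) y) (Metric.closedBall c ρ) := by
        refine (hU1 i).integrableOn.continuousOn_mul ?_ (isCompact_closedBall c ρ)
        exact Continuous.continuousOn (by fun_prop)
      exact this.mono_set Metric.ball_subset_closedBall
    have e1 : ∀ i, ∫ y in B, (x - y) i * ext0 (D1 i u) y =
        x i * (∫ y in B, ext0 (D1 i u) y) - ∫ y in B, y i * ext0 (D1 i u) y := by
      intro i
      rw [← integral_const_mul, ← integral_sub ((j1 i).const_mul _) (j2 i)]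
      congr 1; ext y; simp; ring
    simp only [affApprox, slope]
    rw [← hV, integral_sub j0 (integrable_finsetSum _ fun i _ => j2 i),
      integral_finsetSum _ fun i _ => j2 i, Finset.sum_congr rfl fun i _ => e1 i,
      Finset.sum_sub_distrib]
    have e2 : ∑ i, V⁻¹ * (∫ y in B, ext0 (D1 i u) y) * x i =
        V⁻¹ * ∑ i, x i * ∫ y in B, ext0 (D1 i u) y := by
      rw [Finset.mul_sum]; exact Finset.sum_congr rfl fun i _ => by ring
    rw [e2]
    simp only [one_mul]
    field_simp
    ring
  rw [hid, abs_mul, abs_of_pos hV0] at hle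
  have hsV : 0 < Real.sqrt V := Real.sqrt_pos.2 hV0
  have hVV : Real.sqrt V * Real.sqrt V = V := Real.mul_self_sqrt hV0.le
  rw [← mul_le_mul_iff_right₀ hV0]
  refine hle.trans (le_of_eq ?_)
  conv_rhs => rw [← hVV, Real.sqrt_mul_self hsV.le]
  field_simp

end LocalAffine
end EnsembleNSE
end


noncomputable section

namespace EnsembleNSE
open MeasureTheory Set Filter Topology
open scoped ContDiff NNReal ENNReal

/-! ### Lipschitz representatives -/

section LipschitzRep

variable {d m : ℕ} {Ω : Set (E d)}

theorem abs_mol_sub_le {n : ℕ} {G : E d → ℝ} (hG : LocallyIntegrable G) {x : E d} {a c : ℝ}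
    (h : ∀ᵐ y, y ∈ Metric.ball x (1 / ((n : ℝ) + 1)) → |G y - a| ≤ c) : |mol n G x - a| ≤ c := by
  have e : mol n G x - a = mol n (fun y => G y - a) x := by
    have hi : Integrable fun y => ker d n (x - y) * G y := by
      have := (hasCompactSupport_ker (d := d) n).convolutionExists_left
        (ContinuousLinearMap.lsmul ℝ ℝ) (contDiff_ker n).continuous hG x
      simpa using this.integrable_swap
    simp only [mol_apply, mul_sub]
    rw [integral_sub hi ((integrable_ker_sub n x).mul_const a), integral_mul_const,
      integral_ker_sub, one_mul]
  rw [e]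
  exact abs_mol_le h

theorem sum_abs_le_norm (v : E d) : ∑ k, |v k| ≤ d * ‖v‖ := by
  refine (Finset.sum_le_sum fun k _ => (PiLp.norm_apply_le v k : |v k| ≤ ‖v‖)).trans ?_
  simp

/-- A function whose weak gradient is close to that of a smooth function `Q` on a convex set differs
from `Q` by a Lipschitz function. -/
theorem abs_sub_sub_le_of_weakDeriv {O K : Set (E d)} {G Q : E d → ℝ} {G' : Fin d → E d → ℝ}
    (hG : LocallyIntegrable G) (hG' : ∀ k, LocallyIntegrable (G' k))
    (hw : ∀ k, WeakDeriv O k G (G' k)) (hK : IsOpen K) (hKc : Convex ℝ K) (hKO : K ⊆ O)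
    (hQ : ContDiff ℝ (⊤ : ℕ∞) Q) {η : ℝ}
    (hη : ∀ k, ∀ᵐ y, y ∈ K → |G' k y - pd k Q y| ≤ η) {x y : E d} (hx : x ∈ K) (hy : y ∈ K)
    (hxc : x ∈ convSet G) (hyc : y ∈ convSet G) :
    |(G x - Q x) - (G y - Q y)| ≤ d * η * ‖x - y‖ := by
  set A := segment ℝ y x with hA
  have hAc : IsCompact A := by
    rw [hA, segment_eq_image_lineMap]
    exact isCompact_Icc.image AffineMap.lineMap_continuous
  have hAK : A ⊆ K := hKc.segment_subset hy hx
  obtain ⟨δ, hδ, hδK⟩ := hAc.exists_cthickening_subset_open hK hAK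
  have hAδ : IsCompact (Metric.cthickening δ A) := hAc.cthickening
  have hbound : ∀ ε > 0, |(G x - Q x) - (G y - Q y)| ≤ d * (η + ε) * ‖x - y‖ := by
    intro ε hε
    -- A mollified derivative at z averages G' over a small ball, while Q is differentiated at z
    -- itself; uniform continuity of ∂ₖQ makes the discrepancy at most ε.
    have huc : ∀ k, ∃ r > 0, ∀ z ∈ Metric.cthickening δ A, ∀ z' ∈ Metric.cthickening δ A,
        dist z z' < r → |pd k Q z - pd k Q z'| < ε := by
      intro k
      have := hAδ.uniformContinuousOn_of_continuous (contDiff_pd hQ k).continuous.continuousOn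
      rw [Metric.uniformContinuousOn_iff] at this
      exact this ε hε
    choose r hr hrQ using huc
    have hlarge : ∀ᶠ n : ℕ in atTop, 1 / ((n : ℝ) + 1) < δ ∧ ∀ k, 1 / ((n : ℝ) + 1) < r k := by
      have ht := tendsto_one_div_add_atTop_nhds_zero_nat (𝕜 := ℝ)
      exact (ht.eventually_lt_const hδ).and (eventually_all.2 fun k =>
        ht.eventually_lt_const (hr k))
    have hev : ∀ᶠ n : ℕ in atTop,
        |(mol n G x - Q x) - (mol n G y - Q y)| ≤ d * (η + ε) * ‖x - y‖ := by
      filter_upwards [hlarge] with n hn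
      set f : E d → ℝ := fun z => mol n G z - Q z with hf
      have hfd : ContDiff ℝ (⊤ : ℕ∞) f := (contDiff_mol n hG).sub hQ
      have hpd : ∀ z ∈ A, ∀ k, |pd k f z| ≤ η + ε := by
        intro z hz k
        have hbK : Metric.closedBall z (1 / ((n : ℝ) + 1)) ⊆ Metric.cthickening δ A := fun z' hz' =>
          Metric.mem_cthickening_of_dist_le z' z δ A hz ((Metric.mem_closedBall.1 hz').trans hn.1.le)
        have e1 : pd k f z = mol n (G' k) z - pd k Q z := by
          rw [← pd_mol hG (hw k) ((hbK.trans hδK).trans hKO)]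
          unfold pd
          rw [hf, fderiv_fun_sub ((contDiff_mol n hG).differentiable (by simp)).differentiableAt
            (hQ.differentiable (by simp)).differentiableAt]
          rfl
        rw [e1]
        refine abs_mol_sub_le (hG' k) ?_
        filter_upwards [hη k] with z' hz' hb
        have hz'A := hbK (Metric.ball_subset_closedBall hb)
        have h1 := hz' (hδK hz'A)
        have h2 := hrQ k z' hz'A z (Metric.self_subset_cthickening A hz)
          ((Metric.mem_ball.1 hb).trans (hn.2 k))
        calc |G' k z' - pd k Q z| ≤ |G' k z' - pd k Q z'| + |pd k Q z' - pd k Q z| :=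
              abs_sub_le _ _ _
          _ ≤ _ := add_le_add h1 h2.le
      have hder : ∀ z ∈ A, ∀ v : E d, |fderiv ℝ f z v| ≤ d * (η + ε) * ‖v‖ := by
        intro z hz v
        rw [fderiv_apply_eq_sum_pd]
        -- The sign of η + ε is read off from the bound `hpd`, which is empty when d = 0.
        have h0 : 0 ≤ η + ε ∨ d = 0 := by
          rcases Nat.eq_zero_or_pos d with h | h
          · exact Or.inr h
          · exact Or.inl ((abs_nonneg _).trans (hpd z hz ⟨0, h⟩))
        rcases h0 with h0 | h0
        · calc |∑ k, v k * pd k f z| ≤ ∑ k, |v k| * (η + ε) := by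
                refine (Finset.abs_sum_le_sum_abs _ _).trans (Finset.sum_le_sum fun k _ => ?_)
                rw [abs_mul]
                exact mul_le_mul_of_nonneg_left (hpd z hz k) (abs_nonneg _)
            _ = (∑ k, |v k|) * (η + ε) := by rw [Finset.sum_mul]
            _ ≤ (d * ‖v‖) * (η + ε) := mul_le_mul_of_nonneg_right (sum_abs_le_norm v) h0
            _ = _ := by ring
        · subst h0; simp
      have hmv : ‖f x - f y‖ ≤ d * (η + ε) * ‖x - y‖ := by
        have hline : ∀ s ∈ Icc (0 : ℝ) 1, y + s • (x - y) ∈ A := fun s hs =>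
          (convex_segment y x).add_smul_sub_mem (left_mem_segment ℝ y x) (right_mem_segment ℝ y x) hs
        have := norm_image_sub_le_of_norm_deriv_le_segment_01' (f := fun s : ℝ => f (y + s • (x - y)))
          (f' := fun s => ∑ i, (x - y) i * pd i f (y + s • (x - y))) (C := d * (η + ε) * ‖x - y‖)
          (fun s _ => (hasDerivAt_line hfd y (x - y) s).hasDerivWithinAt)
          (fun s hs => by
            rw [← fderiv_apply_eq_sum_pd]
            exact hder _ (hline s ⟨hs.1, hs.2.le⟩) _)
        simpa using this
      exact hmv
    exact le_of_tendsto (((hxc.sub_const _).sub (hyc.sub_const _)).abs) hev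
  have hlim : Tendsto (fun ε : ℝ => d * (η + ε) * ‖x - y‖) (𝓝[>] 0) (𝓝 (d * (η + 0) * ‖x - y‖)) :=
    ((tendsto_nhdsWithin_of_tendsto_nhds tendsto_id).const_add η |>.const_mul _).mul_const _
  rw [add_zero] at hlim
  exact ge_of_tendsto hlim (eventually_mem_nhdsWithin.mono fun ε hε => hbound ε hε)

/-- The zero extension of an `H¹₀` function is weakly differentiable on the whole space. -/
theorem weakDeriv_univ_of_mem_H10 (hΩ : IsOpen Ω) {v : H 1 Ω} (hv : v ∈ H10 Ω) (k : Fin d) :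
    WeakDeriv univ k (ext0 (val v)) (ext0 (D1 k v)) := by
  intro φ hφ
  rw [ext0_mul hΩ.measurableSet, ext0_mul hΩ.measurableSet]
  have hm1 : MemLp (pd k φ) 2 (volume.restrict Ω) := (hφ.memLp_pd k).mono_measure
    (Measure.restrict_mono_set _ (subset_univ _))
  have hm2 : MemLp φ 2 (volume.restrict Ω) := hφ.memLp.mono_measure
    (Measure.restrict_mono_set _ (subset_univ _))
  rw [integral_mul_eq_inner hm1, integral_mul_eq_inner hm2]
  refine H10_induction hΩ (P := fun v => inner ℝ (hm1.toLp _) (val v) =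
    -inner ℝ (hm2.toLp _) (D1 k v)) ?_ ?_ hv
  · exact isClosed_eq (continuous_const.inner continuous_val)
      (continuous_const.inner (continuous_D1 k)).neg
  · intro ψ hψ
    rw [hψ.val_toH, hψ.D1_toH, real_inner_comm, real_inner_comm (hψ.memLp_pd k |>.toLp _),
      ← integral_mul_eq_inner hψ.memLp, ← integral_mul_eq_inner (hψ.memLp_pd k)]
    obtain ⟨D, hD⟩ := hφ.lipschitz
    have h := LipschitzWith.setIntegral_mul_pd hD hψ k
    have e1 : ∫ x in Ω, hm1.toLp _ x * ψ x = ∫ x in Ω, pd k φ x * ψ x :=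
      integral_congr_ae (hm1.coeFn_toLp.mono fun x hx => by simp only [hx])
    have e2 : ∫ x in Ω, hm2.toLp _ x * pd k ψ x = ∫ x in Ω, φ x * pd k ψ x :=
      integral_congr_ae (hm2.coeFn_toLp.mono fun x hx => by simp only [hx])
    rw [e1, e2, h, neg_neg]
    refine integral_congr_ae (Eventually.of_forall fun x => ?_)
    simp only
    rw [lineDeriv_single_eq_pd (hφ.1.differentiable (by simp))]

/-- An `H¹₀` function with bounded gradient has a Lipschitz representative on the whole space. -/
theorem exists_lipschitz_rep (hΩ : IsOpen Ω) (hb : Bornology.IsBounded Ω) {v : H 1 Ω}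
    (hv : v ∈ H10 Ω) {c : ℝ} (hc0 : 0 ≤ c) (hc : ∀ k, ∀ᵐ x, |ext0 (D1 k v) x| ≤ c) :
    ∃ (L : ℝ≥0) (w : E d → ℝ), LipschitzWith L w ∧ EqOn w (ext0 (val v)) (convSet (ext0 (val v))) := by
  set G := ext0 (val v) with hG
  have hGi : LocallyIntegrable G := (integrable_ext0 hΩ.measurableSet hb _).locallyIntegrable
  have hL : LipschitzOnWith (Real.toNNReal (d * c)) G (convSet G) := by
    refine LipschitzOnWith.of_dist_le_mul fun x hx y hy => ?_
    rw [Real.coe_toNNReal _ (by positivity), Real.dist_eq, dist_eq_norm]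
    -- The zero extension has a weak gradient on the whole space, which is convex; so no path inside
    -- Ω has to be found.
    have := abs_sub_sub_le_of_weakDeriv hGi
      (fun k => (integrable_ext0 hΩ.measurableSet hb (D1 k v)).locallyIntegrable)
      (fun k => weakDeriv_univ_of_mem_H10 hΩ hv k) isOpen_univ convex_univ (subset_univ _)
      (Q := fun _ => 0) contDiff_const (η := c)
      (fun k => (hc k).mono fun y hy _ => by simpa [pd] using hy) (mem_univ x) (mem_univ y) hx hy
    simpa using this
  obtain ⟨w, hw, he⟩ := hL.extend_real
  exact ⟨_, w, hw, fun x hx => (he hx).symm⟩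

/-- From a boundary point move in the direction a: strictly above the graph, inside the ball, there
is an open set free of Ω. Slits are thereby excluded. -/
theorem frontier_subset_closure_exterior (hΩ : IsLipschitzDomain Ω) :
    frontier Ω ⊆ closure (closure Ω)ᶜ := by
  intro x hx
  obtain ⟨r, a, L, g, hr, ha, hg, hga, hgr⟩ := hΩ.lipschitz x hx
  have hxn : x ∉ Ω := by
    rw [hΩ.isOpen.frontier_eq] at hx; exact hx.2
  have hxg : g x ≤ inner ℝ a x := by
    by_contra h
    push Not at h
    have : x ∈ Ω ∩ Metric.ball x r := by rw [hgr]; exact ⟨Metric.mem_ball_self hr, h⟩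
    exact hxn this.1
  rw [Metric.mem_closure_iff]
  intro ε hε
  set t := min ε r / 2 with ht
  have ht0 : 0 < t := by positivity
  have htε : t < ε := by have := min_le_left ε r; linarith
  have htr : t < r := by have := min_le_right ε r; linarith
  have hd : dist x (x + t • a) = t := by simp [dist_eq_norm, norm_smul, ha, abs_of_pos ht0]
  refine ⟨x + t • a, ?_, by rw [hd]; exact htε⟩
  intro hcl
  set O : Set (E d) := {y ∈ Metric.ball x r | g y < inner ℝ a y} with hO
  have hOo : IsOpen O := Metric.isOpen_ball.inter (isOpen_lt hg.continuous (by fun_prop))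
  have hmem : x + t • a ∈ O := by
    refine ⟨by rw [Metric.mem_ball, dist_comm, hd]; exact htr, ?_⟩
    rw [hga, inner_add_right, inner_smul_right, real_inner_self_eq_norm_sq, ha]
    linarith
  obtain ⟨y, hyO, hyΩ⟩ := mem_closure_iff.1 hcl O hOo hmem
  have : y ∈ {y ∈ Metric.ball x r | inner ℝ a y < g y} := by rw [← hgr]; exact ⟨hyΩ, hyO.1⟩
  exact lt_asymm this.2 hyO.2

/-- The mesh covers the closure of Ω only; this puts the open elements inside Ω. -/
theorem interior_closure_subset (hΩ : IsLipschitzDomain Ω) : interior (closure Ω) ⊆ Ω := by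
  intro x hx
  by_contra hn
  have hf : x ∈ frontier Ω := by
    rw [hΩ.isOpen.frontier_eq]; exact ⟨interior_subset hx, hn⟩
  have := frontier_subset_closure_exterior hΩ hf
  rw [closure_compl] at this
  exact this hx

/-- In the open exterior w vanishes almost everywhere, hence everywhere; by continuity it vanishes
on the closure of the exterior, which contains the boundary. -/
theorem eq_zero_of_continuous_rep (hΩ : IsLipschitzDomain Ω) {g : L2 Ω} {w : E d → ℝ}
    (hw : Continuous w) (he : w =ᵐ[volume] ext0 g) {x : E d} (hx : x ∉ Ω) : w x = 0 := by
  have hopen : IsOpen (closure Ω)ᶜ := isClosed_closure.isOpen_compl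
  have h1 : EqOn w 0 (closure Ω)ᶜ := by
    refine Measure.eqOn_open_of_ae_eq (μ := volume) ?_ hopen hw.continuousOn continuousOn_const
    rw [Filter.EventuallyEq, ae_restrict_iff' hopen.measurableSet]
    filter_upwards [he] with y hy hyn
    rw [hy, ext0, indicator_of_notMem fun h => hyn (subset_closure h)]; rfl
  have h2 : closure (closure Ω)ᶜ ⊆ {y | w y = 0} :=
    closure_minimal (fun y hy => h1 hy) (isClosed_eq hw continuous_const)
  by_cases hc : x ∈ closure Ω
  · exact h2 (frontier_subset_closure_exterior hΩ (by
      rw [hΩ.isOpen.frontier_eq]; exact ⟨hc, hx⟩))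
  · exact h1 hc

end LipschitzRep
end EnsembleNSE
end


noncomputable section

namespace EnsembleNSE
open MeasureTheory Set Filter Topology
open scoped ContDiff NNReal ENNReal

/-! ### Continuity of `H²` functions up to the boundary -/

section Continuity

variable {d m : ℕ} {Ω : Set (E d)}

/-- The open truncated cone with apex `z`, axis `-a`, opening `κ` and height `R`. -/
def cone (z a : E d) (κ R : ℝ) : Set (E d) := {x | ∃ t ∈ Ioo 0 R, ‖x - z + t • a‖ < κ * t}

theorem isOpen_cone (z a : E d) (κ R : ℝ) : IsOpen (cone z a κ R) := by
  have : cone z a κ R = ⋃ t ∈ Ioo 0 R, {x | ‖x - z + t • a‖ < κ * t} := by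
    ext x; simp [cone, and_assoc]
  rw [this]
  exact isOpen_biUnion fun t _ => isOpen_lt (by fun_prop) continuous_const

theorem convex_cone (z a : E d) (κ R : ℝ) : Convex ℝ (cone z a κ R) := by
  rintro x ⟨s, hs, hx⟩ y ⟨t, ht, hy⟩ p q hp hq hpq
  refine ⟨p * s + q * t, ?_, ?_⟩
  · exact (convex_Ioo 0 R) hs ht hp hq hpq
  · have e : p • x + q • y - z + (p * s + q * t) • a =
        p • (x - z + s • a) + q • (y - z + t • a) := by
      have : z = p • z + q • z := by rw [← add_smul, hpq, one_smul]
      conv_lhs => rw [this]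
      module
    rw [e]
    refine (norm_add_le _ _).trans_lt ?_
    rw [norm_smul, norm_smul, Real.norm_of_nonneg hp, Real.norm_of_nonneg hq]
    rcases hp.eq_or_lt with h | h
    · have : q = 1 := by linarith
      subst h; subst this; simpa using hy
    · have := mul_lt_mul_of_pos_left hx h
      have := mul_le_mul_of_nonneg_left hy.le hq
      linarith

theorem norm_sub_le_of_mem_cone {z a : E d} {κ R : ℝ} (ha : ‖a‖ ≤ 1) (hκ : κ ≤ 1)
    {x y : E d} (hx : x ∈ cone z a κ R) (hy : y ∈ cone z a κ R) : ‖x - y‖ ≤ 4 * R := by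
  have key : ∀ {x : E d}, x ∈ cone z a κ R → ‖x - z‖ ≤ 2 * R := by
    rintro x ⟨t, ht, hx⟩
    have e : x - z = (x - z + t • a) - t • a := by abel
    rw [e]
    refine (norm_sub_le _ _).trans ?_
    rw [norm_smul, Real.norm_of_nonneg ht.1.le]
    nlinarith [ht.1, ht.2, norm_nonneg a]
  have e : x - y = (x - z) - (y - z) := by abel
  rw [e]
  exact (norm_sub_le _ _).trans (by linarith [key hx, key hy])

theorem closedBall_subset_cone {z a : E d} {κ R : ℝ} (hκ0 : 0 < κ) (hR : 0 < R) :
    Metric.closedBall (z - (R / 2) • a) (κ * R / 4) ⊆ cone z a κ R := by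
  intro x hx
  refine ⟨R / 2, ⟨by linarith, by linarith⟩, ?_⟩
  rw [mem_closedBall_iff_norm] at hx
  have e : x - z + (R / 2) • a = x - (z - (R / 2) • a) := by abel
  rw [e]
  have : 0 < κ * R := by positivity
  linarith

/-- Near any point of the closure of a Lipschitz domain, cones of a fixed size with a fixed axis
fit into the domain. -/
theorem exists_cone_subset (hΩ : IsLipschitzDomain Ω) {x₀ : E d} (hx₀ : x₀ ∈ closure Ω) :
    ∃ (a : E d) (κ R₀ ρ : ℝ), ‖a‖ ≤ 1 ∧ 0 < κ ∧ κ ≤ 1 ∧ 0 < R₀ ∧ 0 < ρ ∧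
      ∀ z ∈ Ω ∩ Metric.ball x₀ ρ, ∃ τ₀ > (0 : ℝ), ∀ τ ∈ Ioo 0 τ₀, cone (z + τ • a) a κ R₀ ⊆ Ω := by
  by_cases hx : x₀ ∈ Ω
  · obtain ⟨r, hr, hrΩ⟩ := Metric.isOpen_iff.1 hΩ.isOpen x₀ hx
    -- At an interior point the axis 0 with opening 1 is allowed: the cone is then a ball about z.
    refine ⟨0, 1, r / 2, r / 2, by simp, one_pos, le_rfl, by positivity, by positivity, ?_⟩
    rintro z ⟨_, hz⟩
    refine ⟨1, one_pos, fun τ _ x ⟨t, ht, hxt⟩ => hrΩ ?_⟩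
    simp only [smul_zero, add_zero, one_mul] at hxt
    rw [← dist_eq_norm] at hxt
    rw [Metric.mem_ball] at hz ⊢
    have := dist_triangle x z x₀
    linarith [ht.2]
  · obtain ⟨r, a, L, g, hr, ha, hg, hga, hgr⟩ := hΩ.lipschitz x₀ (by
      rw [hΩ.isOpen.frontier_eq]; exact ⟨hx₀, hx⟩)
    have hL : (0 : ℝ) ≤ L := L.2
    -- A displacement w raises the height by at most ‖w‖ and lowers the graph by at most L‖w‖, so
    -- descending by t > (1 + L)‖w‖ compensates for it. The shift τ is kept below the depth of z
    -- under the graph.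
    have hκ0 : (0 : ℝ) < 1 / (1 + L) := by positivity
    have hκ1 : (1 : ℝ) / (1 + L) ≤ 1 := by rw [div_le_one (by positivity)]; linarith
    refine ⟨a, 1 / (1 + L), r / 8, r / 8, ha.le, hκ0, hκ1, by positivity, by positivity, ?_⟩
    rintro z ⟨hzΩ, hz⟩
    have hzg : inner ℝ a z < g z := by
      have : z ∈ {y ∈ Metric.ball x₀ r | inner ℝ a y < g y} := by
        rw [← hgr]
        exact ⟨hzΩ, Metric.ball_subset_ball (by linarith) hz⟩
      exact this.2
    refine ⟨min (g z - inner ℝ a z) (r / 8), lt_min (by linarith) (by positivity), ?_⟩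
    rintro τ ⟨hτ0, hτ⟩ x ⟨t, ht, hxt⟩
    have hτ1 := hτ.trans_le (min_le_left _ _)
    have hτ2 := hτ.trans_le (min_le_right _ _)
    set w := x - (z + τ • a) + t • a with hw
    have hxe : x = z + w + (τ - t) • a := by rw [hw]; module
    have hwt : (1 + L) * ‖w‖ < t := by
      rw [one_div, inv_mul_eq_div, lt_div_iff₀ (by positivity)] at hxt
      linarith
    have hw0 : 0 ≤ ‖w‖ := norm_nonneg w
    have hwt' : ‖w‖ < t := by nlinarith
    have hmem : x ∈ {y ∈ Metric.ball x₀ r | inner ℝ a y < g y} := by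
      refine ⟨?_, ?_⟩
      · rw [Metric.mem_ball, dist_eq_norm] at hz ⊢
        have e : x - x₀ = (z - x₀) + w + (τ - t) • a := by rw [hxe]; abel
        rw [e]
        refine (norm_add₃_le).trans_lt ?_
        rw [norm_smul, ha, mul_one, Real.norm_eq_abs]
        have : |τ - t| ≤ r / 8 := abs_le.2 ⟨by linarith [ht.2], by linarith [ht.1]⟩
        linarith [ht.2]
      · rw [hxe, hga, inner_add_right, inner_add_right, inner_smul_right,
          real_inner_self_eq_norm_sq, ha]
        have h1 : inner ℝ a w ≤ ‖w‖ := by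
          have := real_inner_le_norm a w
          rwa [ha, one_mul] at this
        have h2 : g z - L * ‖w‖ ≤ g (z + w) := by
          have := hg.dist_le_mul z (z + w)
          rw [Real.dist_eq, dist_eq_norm, sub_add_cancel_left, norm_neg] at this
          linarith [le_abs_self (g z - g (z + w))]
        linarith
    rw [← hgr] at hmem
    exact hmem.1

theorem abs_slope_le (hΩ : MeasurableSet Ω) (u : H 2 Ω) (c : E d) {ρ : ℝ} (hρ : 0 < ρ) (i : Fin d) :
    |slope (Metric.ball c ρ) u i| ≤ (Real.sqrt (volume.real (Metric.ball c ρ)))⁻¹ * ‖u‖ := by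
  set B := Metric.ball c ρ with hB
  set V := volume.real B with hV
  have hfinB : IsFiniteMeasure (volume.restrict B) := ⟨by
    rw [Measure.restrict_apply_univ]; exact measure_ball_lt_top⟩
  have hV0 : 0 < V := ENNReal.toReal_pos (Metric.measure_ball_pos volume c hρ).ne'
    measure_ball_lt_top.ne
  set G := ext0 (D1 i u) with hG
  have hGm : MemLp G 2 (volume.restrict B) := (memLp_ext0 hΩ _).restrict B
  have hnorm : ∫ y in B, G y ^ 2 ≤ ‖u‖ ^ 2 := by
    have h1 : ∫ y in B, G y ^ 2 ≤ ∫ y, G y ^ 2 :=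
      setIntegral_le_integral (memLp_ext0 hΩ _).integrable_sq (Eventually.of_forall fun y => sq_nonneg _)
    have h2 : ∫ y, G y ^ 2 = ‖D1 i u‖ ^ 2 := by
      rw [← real_inner_self_eq_norm_sq, L2.inner_def, ← integral_indicator hΩ]
      congr 1; ext y
      by_cases hy : y ∈ Ω <;> simp [hG, ext0, hy, sq]
    rw [h2] at h1
    exact h1.trans (pow_le_pow_left₀ (norm_nonneg _) (norm_D1_le i u) 2)
  have hcs : |∫ y in B, G y| ≤ Real.sqrt V * ‖u‖ := by
    have h1 : ‖∫ y in B, G y‖ ≤ ∫ y in B, ‖(1 : ℝ)‖ * ‖G y‖ := by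
      refine (norm_integral_le_integral_norm _).trans (le_of_eq ?_)
      simp
    have h2 := integral_mul_norm_le_Lp_mul_Lq (μ := volume.restrict B) Real.HolderConjugate.two_two
      (f := fun _ => (1 : ℝ)) (g := G) (memLp_const 1) (by simpa using hGm)
    refine h1.trans (h2.trans ?_)
    simp only [norm_one, Real.norm_eq_abs, Real.rpow_two, sq_abs, integral_const, one_pow,
      smul_eq_mul, mul_one, measureReal_restrict_apply_univ]
    rw [← Real.sqrt_eq_rpow, ← Real.sqrt_eq_rpow]
    refine mul_le_mul_of_nonneg_left ?_ (Real.sqrt_nonneg _)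
    rw [← Real.sqrt_sq (norm_nonneg u)]
    exact Real.sqrt_le_sqrt hnorm
  rw [slope, ← hV, abs_mul, abs_of_pos (inv_pos.2 hV0)]
  refine (mul_le_mul_of_nonneg_left hcs (inv_pos.2 hV0).le).trans (le_of_eq ?_)
  have hsV : 0 < Real.sqrt V := Real.sqrt_pos.2 hV0
  have hVV : V = Real.sqrt V * Real.sqrt V := (Real.mul_self_sqrt hV0.le).symm
  conv_lhs => rw [hVV, Real.sqrt_mul_self hsV.le]
  field_simp

theorem volume_real_ball (c : E d) {ρ : ℝ} (hρ : 0 < ρ) :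
    volume.real (Metric.ball c ρ) = ρ ^ d * volume.real (Metric.ball (0 : E d) 1) := by
  rw [Measure.real, Measure.addHaar_ball_of_pos _ _ hρ, ENNReal.toReal_mul,
    ENNReal.toReal_ofReal (by positivity), finrank_euclideanSpace_fin]
  rfl

theorem lnorm_ext0_le (hΩ : MeasurableSet Ω) (K : Set (E d)) (g : L2 Ω) : lnorm K (ext0 g) ≤ ‖g‖ := by
  rw [lnorm, ← Real.sqrt_sq (norm_nonneg g)]
  refine Real.sqrt_le_sqrt ?_
  have h1 : ∫ y in K, ext0 g y ^ 2 ≤ ∫ y, ext0 g y ^ 2 :=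
    setIntegral_le_integral (memLp_ext0 hΩ _).integrable_sq (Eventually.of_forall fun y => sq_nonneg _)
  refine h1.trans (le_of_eq ?_)
  rw [← real_inner_self_eq_norm_sq, L2.inner_def, ← integral_indicator hΩ]
  congr 1; ext y
  by_cases hy : y ∈ Ω <;> simp [ext0, hy, sq]

theorem hess_le (hΩ : MeasurableSet Ω) (K : Set (E d)) (u : H 2 Ω) : hess K u ≤ d ^ 2 * ‖u‖ := by
  have : ∀ i j, lnorm K (ext0 (D1 j (DH i u))) ≤ ‖u‖ := fun i j =>
    (lnorm_ext0_le hΩ K _).trans ((norm_D1_le j _).trans (norm_DH_le i u))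
  refine (Finset.sum_le_sum fun i _ => Finset.sum_le_sum fun j _ => this i j).trans (le_of_eq ?_)
  simp; ring

theorem affApprox_sub (B : Set (E d)) (u : H 2 Ω) (x y : E d) :
    affApprox B u x - affApprox B u y = ∑ i, slope B u i * (x i - y i) := by
  simp only [affApprox, mul_sub, Finset.sum_sub_distrib]; ring

/-- The oscillation of an `H²` function over a cone of height `R`. -/
theorem abs_sub_le_of_mem_cone (hd : d ≤ 3) (hΩ : MeasurableSet Ω) (hb : Bornology.IsBounded Ω)
    (u : H 2 Ω) {z a : E d} {κ R : ℝ} (ha : ‖a‖ ≤ 1) (hκ0 : 0 < κ) (hκ : κ ≤ 1) (hR : 0 < R)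
    (hsub : cone z a κ R ⊆ Ω) {x y : E d} (hx : x ∈ cone z a κ R) (hy : y ∈ cone z a κ R)
    (hxc : x ∈ convSet (ext0 (val u))) (hyc : y ∈ convSet (ext0 (val u))) :
    |ext0 (val u) x - ext0 (val u) y| ≤
      (Real.sqrt ((κ * R / 4) ^ d * volume.real (Metric.ball (0 : E d) 1)))⁻¹ *
        (64 * d ^ 2 * R ^ 2 + d * ‖x - y‖) * ‖u‖ := by
  have hρ : 0 < κ * R / 4 := by positivity
  set c := z - (R / 2) • a with hc
  set B := Metric.ball c (κ * R / 4) with hB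
  -- The cone has diameter at most 4R, so the Taylor remainders at x and at y together give 2 ·
  -- 2(4R)² = 64R²; the slopes of the affine function give the part in ‖x − y‖.
  have key : ∀ {x : E d}, x ∈ cone z a κ R → x ∈ convSet (ext0 (val u)) →
      |ext0 (val u) x - affApprox B u x| ≤
        2 * (4 * R) ^ 2 * (Real.sqrt (volume.real B))⁻¹ * hess (cone z a κ R) u := fun hx hxc =>
    abs_sub_affApprox_le hd hΩ hb u (isOpen_cone z a κ R) (convex_cone z a κ R) hsub hρ
      (closedBall_subset_cone hκ0 hR)
      (fun x hx y hy => norm_sub_le_of_mem_cone ha hκ hx hy) hx hxc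
  have h1 := key hx hxc
  have h2 := key hy hyc
  have h3 : |affApprox B u x - affApprox B u y| ≤
      (Real.sqrt (volume.real B))⁻¹ * ‖u‖ * (d * ‖x - y‖) := by
    rw [affApprox_sub]
    calc |∑ i, slope B u i * (x i - y i)| ≤
        ∑ i, (Real.sqrt (volume.real B))⁻¹ * ‖u‖ * |(x - y) i| := by
          refine (Finset.abs_sum_le_sum_abs _ _).trans (Finset.sum_le_sum fun i _ => ?_)
          rw [abs_mul]
          exact mul_le_mul_of_nonneg_right (abs_slope_le hΩ u c hρ i) (abs_nonneg _)
      _ ≤ _ := by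
          rw [← Finset.mul_sum]
          exact mul_le_mul_of_nonneg_left (sum_abs_le_norm _) (by positivity)
  have h4 := hess_le hΩ (cone z a κ R) u
  rw [hB, volume_real_ball c hρ] at h1 h2 h3
  set W := (Real.sqrt ((κ * R / 4) ^ d * volume.real (Metric.ball (0 : E d) 1)))⁻¹ with hW
  have hW0 : 0 ≤ W := by positivity
  have h5 : 2 * (4 * R) ^ 2 * W * hess (cone z a κ R) u ≤
      2 * (4 * R) ^ 2 * W * (d ^ 2 * ‖u‖) := by gcongr
  rw [abs_le] at h1 h2 h3 ⊢
  constructor <;> nlinarith [h1.1, h1.2, h2.1, h2.2, h3.1, h3.2, h5]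

theorem closure_inter_convSet {K : Set (E d)} (hK : IsOpen K) {G : E d → ℝ}
    (hG : LocallyIntegrable G) : closure K ⊆ closure (K ∩ convSet G) := by
  refine closure_minimal ?_ isClosed_closure
  have hdense : Dense (convSet G) := Measure.dense_of_ae (ae_mem_convSet hG)
  exact hdense.open_subset_closure_inter hK

/-- `H²` functions are continuous up to the boundary. -/
theorem exists_tendsto_closure (hd : d ≤ 3) (hΩ : IsLipschitzDomain Ω) (u : H 2 Ω) {x₀ : E d}
    (hx₀ : x₀ ∈ closure Ω) :
    ∃ l : ℝ, Tendsto (ext0 (val u)) (𝓝[Ω ∩ convSet (ext0 (val u))] x₀) (𝓝 l) := by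
  set U := ext0 (val u) with hU
  have hΩm := hΩ.isOpen.measurableSet
  have hUi : LocallyIntegrable U := (integrable_ext0 hΩm hΩ.isBounded _).locallyIntegrable
  have hne : (𝓝[Ω ∩ convSet U] x₀).NeBot :=
    mem_closure_iff_nhdsWithin_neBot.1 (closure_inter_convSet hΩ.isOpen hUi hx₀)
  -- Cauchy criterion with two scales. Over a cone of height R the oscillation is at most a constant
  -- times R^{−d/2}(R² + |x − y|). First R is fixed so that R^{2−d/2} ≤ R^{1/2} is small, then s so
  -- that distances of order s are harmless at that R. Two points close to x₀ are compared through a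
  -- third one, at distance of order s, lying in the cones of both.
  refine cauchy_map_iff_exists_tendsto.1 ?_
  obtain ⟨a, κ, R₀, ρ, ha, hκ0, hκ, hR0, hρ, hcone⟩ := exists_cone_subset hΩ hx₀
  have hcone' : ∀ z ∈ Ω ∩ Metric.ball x₀ ρ, ∀ R ≤ R₀, ∃ τ₀ > (0 : ℝ), ∀ τ ∈ Ioo 0 τ₀,
      cone (z + τ • a) a κ R ⊆ Ω := by
    intro z hz R hR
    obtain ⟨τ₀, h0, h⟩ := hcone z hz
    exact ⟨τ₀, h0, fun τ hτ x ⟨t, ht, hx⟩ => h τ hτ ⟨t, ⟨ht.1, ht.2.trans_le hR⟩, hx⟩⟩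
  set v1 := volume.real (Metric.ball (0 : E d) 1) with hv1
  have hv1p : 0 < v1 := ENNReal.toReal_pos (Metric.measure_ball_pos volume _ one_pos).ne'
    measure_ball_lt_top.ne
  rw [Metric.cauchy_iff]
  refine ⟨hne.map _, fun ε hε => ?_⟩
  -- the large scale
  obtain ⟨R, hR, hRR0, hRε⟩ : ∃ R > 0, R ≤ R₀ ∧
      (Real.sqrt ((κ * R / 4) ^ d * v1))⁻¹ * (64 * d ^ 2 * R ^ 2) * ‖u‖ ≤ ε / 8 := by
    have hlim : Tendsto (fun R : ℝ => (Real.sqrt ((κ / 4) ^ d * v1))⁻¹ * (64 * d ^ 2) * ‖u‖ *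
        Real.sqrt R) (𝓝[>] 0) (𝓝 0) := by
      have : Tendsto (fun R : ℝ => (Real.sqrt ((κ / 4) ^ d * v1))⁻¹ * (64 * d ^ 2) * ‖u‖ *
        Real.sqrt R) (𝓝 0) (𝓝 ((Real.sqrt ((κ / 4) ^ d * v1))⁻¹ * (64 * d ^ 2) * ‖u‖ *
        Real.sqrt 0)) := (continuous_const.mul Real.continuous_sqrt).tendsto 0
      rw [Real.sqrt_zero, mul_zero] at this
      exact this.mono_left nhdsWithin_le_nhds
    obtain ⟨R, ⟨h1, h2⟩, h3⟩ := (((hlim.eventually_le_const (by positivity : (0 : ℝ) < ε / 8)).and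
      (Ioo_mem_nhdsGT (lt_min hR0 one_pos))).and eventually_mem_nhdsWithin).exists
    have hR0' : 0 < R := h3
    have hR1 : R ≤ 1 := h2.2.le.trans (min_le_right _ _)
    refine ⟨R, h3, h2.2.le.trans (min_le_left _ _), le_trans ?_ h1⟩
    have e : (κ * R / 4) ^ d * v1 = (κ / 4) ^ d * v1 * R ^ d := by
      rw [show κ * R / 4 = κ / 4 * R by ring, mul_pow]; ring
    rw [e, Real.sqrt_mul (by positivity), mul_inv]
    have h5 : R ^ 2 * (Real.sqrt (R ^ d))⁻¹ ≤ Real.sqrt R := by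
      have h6 : Real.sqrt (R ^ 3) ≤ Real.sqrt (R ^ d) :=
        Real.sqrt_le_sqrt (pow_le_pow_of_le_one hR0'.le hR1 hd)
      have h7 : Real.sqrt (R ^ 3) = R * Real.sqrt R := by
        rw [show R ^ 3 = R ^ 2 * R by ring, Real.sqrt_mul (sq_nonneg _), Real.sqrt_sq hR0'.le]
      have h8 : 0 < Real.sqrt R := Real.sqrt_pos.2 hR0'
      rw [← div_eq_mul_inv, div_le_iff₀ (Real.sqrt_pos.2 (by positivity))]
      calc R ^ 2 = Real.sqrt R * (R * Real.sqrt R) := by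
            have := Real.mul_self_sqrt hR0'.le
            calc R ^ 2 = R * R := by ring
              _ = R * (Real.sqrt R * Real.sqrt R) := by rw [this]
              _ = _ := by ring
        _ ≤ _ := by rw [← h7]; gcongr
    calc _ = (Real.sqrt ((κ / 4) ^ d * v1))⁻¹ * (64 * d ^ 2) * ‖u‖ *
        (R ^ 2 * (Real.sqrt (R ^ d))⁻¹) := by ring
      _ ≤ _ := by gcongr
  set W := (Real.sqrt ((κ * R / 4) ^ d * v1))⁻¹ with hW
  have hW0 : 0 ≤ W := by positivity
  -- the small scale
  obtain ⟨s, hs, hsR, hsε⟩ : ∃ s > 0, s ≤ R / 2 ∧ W * (d * (3 * s)) * ‖u‖ ≤ ε / 8 := by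
    have hlim : Tendsto (fun s : ℝ => W * (d * (3 * s)) * ‖u‖) (𝓝[>] 0) (𝓝 0) := by
      have : Tendsto (fun s : ℝ => W * (d * (3 * s)) * ‖u‖) (𝓝 0) (𝓝 (W * (d * (3 * 0)) * ‖u‖)) :=
        (by fun_prop : Continuous fun s : ℝ => W * (d * (3 * s)) * ‖u‖).tendsto 0
      simp only [mul_zero, zero_mul] at this
      exact this.mono_left nhdsWithin_le_nhds
    obtain ⟨s, ⟨h1, h2⟩, h3⟩ := (((hlim.eventually_le_const (by positivity : (0 : ℝ) < ε / 8)).and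
      (Ioo_mem_nhdsGT (half_pos hR))).and eventually_mem_nhdsWithin).exists
    exact ⟨s, h3, h2.2.le, h1⟩
  set δ := min ρ (κ * s / 4) with hδ
  have hδ0 : 0 < δ := by positivity
  refine ⟨U '' (Metric.ball x₀ δ ∩ (Ω ∩ convSet U)), ?_, ?_⟩
  · exact image_mem_map (inter_mem (mem_nhdsWithin_of_mem_nhds (Metric.ball_mem_nhds _ hδ0))
      self_mem_nhdsWithin)
  rintro _ ⟨z, ⟨hzb, hzΩ, hzc⟩, rfl⟩ _ ⟨z', ⟨hzb', hzΩ', hzc'⟩, rfl⟩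
  have hzz : ‖z - z'‖ < κ * s := by
    rw [← dist_eq_norm]
    have h1 := Metric.mem_ball.1 hzb
    have h2 := Metric.mem_ball'.1 hzb'
    have h3 : δ ≤ κ * s / 4 := min_le_right _ _
    have h4 := dist_triangle z x₀ z'
    have : 0 < κ * s := by positivity
    linarith
  obtain ⟨τ₀, hτ0, hτ⟩ := hcone' z ⟨hzΩ, Metric.ball_subset_ball (min_le_left _ _) hzb⟩ R hRR0
  obtain ⟨τ₀', hτ0', hτ'⟩ := hcone' z' ⟨hzΩ', Metric.ball_subset_ball (min_le_left _ _) hzb'⟩ R hRR0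
  -- The apex is raised by τ so that z lies inside its own cone; τ ≤ R/4 and s ≤ R/2 keep τ + s
  -- below the height R.
  set τ := min (min τ₀ τ₀') (R / 2) / 2 with hτdef
  have hτp : 0 < τ := by positivity
  have hm1 : min (min τ₀ τ₀') (R / 2) ≤ τ₀ := (min_le_left _ _).trans (min_le_left _ _)
  have hm2 : min (min τ₀ τ₀') (R / 2) ≤ τ₀' := (min_le_left _ _).trans (min_le_right _ _)
  have hm3 : min (min τ₀ τ₀') (R / 2) ≤ R / 2 := min_le_right _ _
  have hc1 := hτ τ ⟨hτp, by linarith⟩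
  have hc2 := hτ' τ ⟨hτp, by linarith⟩
  have hzmem : ∀ z : E d, z ∈ cone (z + τ • a) a κ R := fun z =>
    ⟨τ, ⟨hτp, by linarith⟩, by
      rw [sub_add_cancel_left, neg_add_cancel, norm_zero]; positivity⟩
  -- a common point of the two cones
  have hq1 : z - s • a ∈ cone (z + τ • a) a κ R :=
    ⟨τ + s, ⟨by positivity, by linarith⟩, by
      have : z - s • a - (z + τ • a) + (τ + s) • a = 0 := by module
      rw [this, norm_zero]; positivity⟩
  have hq2 : z - s • a ∈ cone (z' + τ • a) a κ R :=
    ⟨τ + s, ⟨by positivity, by linarith⟩, by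
      have : z - s • a - (z' + τ • a) + (τ + s) • a = z - z' := by module
      rw [this]
      nlinarith⟩
  set O := cone (z + τ • a) a κ R ∩ cone (z' + τ • a) a κ R ∩ Metric.ball (z - s • a) s with hO
  have hOo : IsOpen O := ((isOpen_cone _ _ _ _).inter (isOpen_cone _ _ _ _)).inter Metric.isOpen_ball
  obtain ⟨q, ⟨⟨hqa, hqb⟩, hqs⟩, hqc⟩ : (O ∩ convSet U).Nonempty :=
    (Measure.dense_of_ae (ae_mem_convSet hUi)).inter_open_nonempty O hOo
      ⟨z - s • a, ⟨hq1, hq2⟩, Metric.mem_ball_self hs⟩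
  have hzq : ‖z - q‖ ≤ 2 * s := by
    rw [Metric.mem_ball', dist_eq_norm] at hqs
    have e : z - q = (z - s • a - q) + s • a := by abel
    rw [e]
    refine (norm_add_le _ _).trans ?_
    rw [norm_smul, Real.norm_of_nonneg hs.le]
    nlinarith
  have hzq' : ‖z' - q‖ ≤ 3 * s := by
    have e : z' - q = (z - q) - (z - z') := by abel
    rw [e]
    refine (norm_sub_le _ _).trans ?_
    nlinarith
  have k1 := abs_sub_le_of_mem_cone hd hΩm hΩ.isBounded u ha hκ0 hκ hR hc1 (hzmem z) hqa hzc hqc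
  have k2 := abs_sub_le_of_mem_cone hd hΩm hΩ.isBounded u ha hκ0 hκ hR hc2 (hzmem z') hqb hzc' hqc
  rw [← hv1, ← hW] at k1 k2
  have hu0 := norm_nonneg u
  have k3 : ∀ r : ℝ, r ≤ 3 * s → W * (64 * d ^ 2 * R ^ 2 + d * r) * ‖u‖ ≤ ε / 4 := by
    intro r hr
    have : W * (d * r) * ‖u‖ ≤ W * (d * (3 * s)) * ‖u‖ := by gcongr
    calc _ = W * (64 * d ^ 2 * R ^ 2) * ‖u‖ + W * (d * r) * ‖u‖ := by ring
      _ ≤ _ := by linarith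
  have k4 := k1.trans (k3 _ (by linarith))
  have k5 := k2.trans (k3 _ hzq')
  rw [Real.dist_eq]
  rw [← hU] at k4 k5
  rw [abs_le] at k4 k5
  rw [abs_lt]
  constructor <;> linarith [k4.1, k4.2, k5.1, k5.2]

end Continuity
end EnsembleNSE
end


noncomputable section

namespace EnsembleNSE
open MeasureTheory Set Filter Topology
open scoped ContDiff NNReal ENNReal

/-! ### Barycentric coordinates and Lagrange interpolation on a simplex -/

section Simplex

variable {d : ℕ} {Ω : Set (E d)} {𝒯 : Mesh d} {s t : Finset (E d)}

theorem exists_affineBasis_of_mem (hs : s ∈ elements 𝒯) :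
    ∃ b : AffineBasis s ℝ (E d), ∀ i, b i = i := by
  have hi := 𝒯.indep hs.1
  refine ⟨⟨_, hi, ?_⟩, fun i => rfl⟩
  rw [hi.affineSpan_eq_top_iff_card_eq_finrank_add_one]
  simp [hs.2]

open Classical in
/-- The barycentric coordinate of a simplex belonging to the vertex `v`. -/
def bc (s : Finset (E d)) (v : E d) : E d →ᵃ[ℝ] ℝ :=
  if h : (∃ b : AffineBasis s ℝ (E d), ∀ i, b i = i) ∧ v ∈ s then h.1.choose.coord ⟨v, h.2⟩ else 0

theorem bc_of_notMem {v : E d} (h : v ∉ s) : bc s v = 0 := by simp [bc, h]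

theorem exists_bc_eq (hs : s ∈ elements 𝒯) :
    ∃ b : AffineBasis s ℝ (E d), (∀ i, b i = i) ∧ ∀ i : s, bc s i = b.coord i := by
  have h := exists_affineBasis_of_mem hs
  refine ⟨h.choose, h.choose_spec, fun i => ?_⟩
  rw [bc, dif_pos ⟨h, i.2⟩]

theorem bc_self (hs : s ∈ elements 𝒯) {v : E d} (hv : v ∈ s) : bc s v v = 1 := by
  obtain ⟨b, hb, hc⟩ := exists_bc_eq hs
  have := b.coord_apply_eq ⟨v, hv⟩
  rwa [hb, ← hc] at this

theorem bc_ne (hs : s ∈ elements 𝒯) {v w : E d} (hw : w ∈ s) (h : v ≠ w) :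
    bc s v w = 0 := by
  by_cases hv : v ∈ s
  · obtain ⟨b, hb, hc⟩ := exists_bc_eq hs
    have := b.coord_apply_ne (i := ⟨v, hv⟩) (j := ⟨w, hw⟩) (by simpa using h)
    rwa [hb, ← hc] at this
  · simp [bc_of_notMem hv]

theorem sum_bc (hs : s ∈ elements 𝒯) (x : E d) : ∑ v ∈ s, bc s v x = 1 := by
  obtain ⟨b, hb, hc⟩ := exists_bc_eq hs
  rw [← Finset.sum_coe_sort, ← b.sum_coord_apply_eq_one x]
  exact Finset.sum_congr rfl fun i _ => by rw [hc]

theorem sum_bc_smul (hs : s ∈ elements 𝒯) (x : E d) : ∑ v ∈ s, bc s v x • v = x := by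
  obtain ⟨b, hb, hc⟩ := exists_bc_eq hs
  rw [← Finset.sum_coe_sort s fun v => bc s v x • v]
  conv_rhs => rw [← b.linear_combination_coord_eq_self x]
  exact Finset.sum_congr rfl fun i _ => by rw [hc, hb]

theorem sum_bc_mul (hs : s ∈ elements 𝒯) (x : E d) (i : Fin d) : ∑ v ∈ s, bc s v x * v i = x i := by
  conv_rhs => rw [← sum_bc_smul hs x]
  simp

theorem range_eq_coe {b : s → E d} (hb : ∀ i, b i = i) : range b = (s : Set (E d)) := by
  have : b = ((↑) : s → E d) := funext hb
  rw [this]; exact Subtype.range_coe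

theorem mem_cell_iff (hs : s ∈ elements 𝒯) {x : E d} : x ∈ cell s ↔ ∀ v ∈ s, 0 ≤ bc s v x := by
  obtain ⟨b, hb, hc⟩ := exists_bc_eq hs
  rw [cell, ← range_eq_coe hb, b.convexHull_eq_nonneg_coord]
  simp only [mem_ofPred_eq, ← hc, Subtype.forall]

theorem mem_interior_cell_iff (hs : s ∈ elements 𝒯) {x : E d} :
    x ∈ interior (cell s) ↔ ∀ v ∈ s, 0 < bc s v x := by
  obtain ⟨b, hb, hc⟩ := exists_bc_eq hs
  rw [cell, ← range_eq_coe hb, b.interior_convexHull]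
  simp only [mem_ofPred_eq, ← hc, Subtype.forall]

theorem bc_nonneg (hs : s ∈ elements 𝒯) {x : E d} (hx : x ∈ cell s) (v : E d) : 0 ≤ bc s v x := by
  by_cases hv : v ∈ s
  · exact (mem_cell_iff hs).1 hx v hv
  · simp [bc_of_notMem hv]

theorem bc_le_one (hs : s ∈ elements 𝒯) {x : E d} (hx : x ∈ cell s) (v : E d) : bc s v x ≤ 1 := by
  by_cases hv : v ∈ s
  · rw [← sum_bc hs x]
    exact Finset.single_le_sum (f := fun v => bc s v x) (fun w _ => bc_nonneg hs hx w) hv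
  · simp [bc_of_notMem hv]

theorem eq_zero_of_mem_convexHull {f : E d →ᵃ[ℝ] ℝ} {τ : Set (E d)} (h : ∀ v ∈ τ, f v = 0) {x : E d}
    (hx : x ∈ convexHull ℝ τ) : f x = 0 := by
  have : convexHull ℝ τ ⊆ f ⁻¹' {0} :=
    convexHull_min (fun v hv => h v hv) ((convex_singleton (0 : ℝ)).affine_preimage f)
  exact this hx

theorem mem_convexHull_inter (hs : s ∈ elements 𝒯) (ht : t ∈ elements 𝒯) {x : E d}
    (hxs : x ∈ cell s) (hxt : x ∈ cell t) : x ∈ convexHull ℝ ((s : Set (E d)) ∩ t) := by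
  rw [← 𝒯.convexHull_inter_convexHull hs.1 ht.1]; exact ⟨hxs, hxt⟩

theorem bc_eq_zero_of_mem (hs : s ∈ elements 𝒯) (ht : t ∈ elements 𝒯) {x : E d} (hxs : x ∈ cell s)
    (hxt : x ∈ cell t) {v : E d} (hv : v ∉ t) : bc s v x = 0 :=
  eq_zero_of_mem_convexHull (fun w hw => bc_ne hs hw.1 fun h => hv (by rw [h]; exact hw.2))
    (mem_convexHull_inter hs ht hxs hxt)

/-- On the intersection of two elements the barycentric coordinates agree. -/
theorem bc_eq_bc (hs : s ∈ elements 𝒯) (ht : t ∈ elements 𝒯) {x : E d} (hxs : x ∈ cell s)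
    (hxt : x ∈ cell t) (v : E d) : bc s v x = bc t v x := by
  by_cases hvt : v ∈ t
  · by_cases hvs : v ∈ s
    · have h := eq_zero_of_mem_convexHull (f := bc s v - bc t v) (fun w hw => by
        simp only [AffineMap.coe_sub, Pi.sub_apply]
        by_cases h : v = w
        · subst h; rw [bc_self hs hvs, bc_self ht hvt, sub_self]
        · rw [bc_ne hs hw.1 h, bc_ne ht hw.2 h, sub_self]) (mem_convexHull_inter hs ht hxs hxt)
      simpa [sub_eq_zero] using h
    · rw [bc_eq_zero_of_mem ht hs hxt hxs hvs, bc_of_notMem hvs]; rfl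
  · rw [bc_eq_zero_of_mem hs ht hxs hxt hvt, bc_of_notMem hvt]; rfl

/-- Elements have equally many vertices, so s has a vertex outside t. Its coordinate vanishes on the
common face but is positive inside s. -/
theorem disjoint_interior_cell (hs : s ∈ elements 𝒯) (ht : t ∈ elements 𝒯) (h : s ≠ t) :
    Disjoint (interior (cell s)) (interior (cell t)) := by
  rw [Set.disjoint_left]
  intro x hxs hxt
  obtain ⟨v, hvs, hvt⟩ : ∃ v ∈ s, v ∉ t := by
    by_contra hc
    push Not at hc
    exact h (Finset.eq_of_subset_of_card_le hc (by rw [hs.2, ht.2]))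
  have h1 := bc_eq_zero_of_mem hs ht (interior_subset hxs) (interior_subset hxt) hvt
  exact absurd h1 ((mem_interior_cell_iff hs).1 hxs v hvs).ne'

theorem interior_cell_nonempty (hs : s ∈ elements 𝒯) : (interior (cell s)).Nonempty := by
  obtain ⟨b, hb, hc⟩ := exists_bc_eq hs
  have := b.centroid_mem_interior_convexHull
  rw [range_eq_coe hb] at this
  exact ⟨_, this⟩

theorem convex_cell (s : Finset (E d)) : Convex ℝ (cell s) := convex_convexHull ℝ _

theorem isCompact_cell (s : Finset (E d)) : IsCompact (cell s) :=
  s.finite_toSet.isCompact_convexHull ℝ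

theorem closure_interior_cell (hs : s ∈ elements 𝒯) : closure (interior (cell s)) = cell s := by
  rw [(convex_cell s).closure_interior_eq_closure_of_nonempty_interior (interior_cell_nonempty hs),
    (isCompact_cell s).isClosed.closure_eq]

theorem subset_cell {v : E d} (hv : v ∈ s) : v ∈ cell s := subset_convexHull ℝ _ hv

theorem midpoint_mem_cell {v w : E d} (hv : v ∈ s) (hw : w ∈ s) : midpoint ℝ v w ∈ cell s :=
  (convex_cell s).midpoint_mem (subset_cell hv) (subset_cell hw)

/-- The derivatives of the barycentric coordinates of a shape-regular simplex. -/
theorem abs_linear_bc_le (hs : s ∈ elements 𝒯) {c : E d} {r : ℝ} (hr : 0 < r)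
    (hc : Metric.closedBall c r ⊆ cell s) (v : E d) (k : Fin d) :
    |(bc s v).linear (EuclideanSpace.single k 1)| ≤ 1 / r := by
  set e : E d := EuclideanSpace.single k 1 with he
  have hen : ‖e‖ = 1 := by simp [he]
  have h1 : c + r • e ∈ cell s := hc (by
    rw [mem_closedBall_iff_norm, add_sub_cancel_left, norm_smul, hen, Real.norm_of_nonneg hr.le]
    linarith)
  have h0 : c ∈ cell s := hc (Metric.mem_closedBall_self hr.le)
  have h2 : bc s v (c + r • e) = r * (bc s v).linear e + bc s v c := by
    have := (bc s v).map_vadd c (r • e)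
    rw [vadd_eq_add, add_comm] at this
    rw [this]; simp
  have := bc_nonneg hs h1 v
  have := bc_le_one hs h1 v
  have := bc_nonneg hs h0 v
  have := bc_le_one hs h0 v
  rw [le_div_iff₀ hr, ← abs_of_pos hr, ← abs_mul, abs_le]
  constructor <;> nlinarith

theorem affine_eq (f : E d →ᵃ[ℝ] ℝ) (x : E d) :
    f x = f 0 + ∑ i, f.linear (EuclideanSpace.single i 1) * x i := by
  have h1 : f x = f.linear x + f 0 := by
    have := f.map_vadd 0 x
    simpa using this
  have hx : x = ∑ i, x i • EuclideanSpace.single i (1 : ℝ) := by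
    have := (EuclideanSpace.basisFun (Fin d) ℝ).sum_repr x
    simpa using this.symm
  rw [h1, add_comm]
  congr 1
  conv_lhs => rw [hx]
  simp [map_sum, mul_comm]

theorem contDiff_affine (f : E d →ᵃ[ℝ] ℝ) : ContDiff ℝ (⊤ : ℕ∞) f := by
  have : (f : E d → ℝ) = fun x => f 0 + ∑ i, f.linear (EuclideanSpace.single i 1) * x i :=
    funext (affine_eq f)
  rw [this]
  fun_prop

theorem hasFDerivAt_affine (f : E d →ᵃ[ℝ] ℝ) (x : E d) :
    HasFDerivAt f (LinearMap.toContinuousLinearMap f.linear) x := by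
  have h := (LinearMap.toContinuousLinearMap f.linear).hasFDerivAt (x := x)
  have e : (f : E d → ℝ) = fun y => LinearMap.toContinuousLinearMap f.linear y + f 0 := by
    ext y
    have := f.map_vadd 0 y
    simpa using this
  rw [e]
  exact h.add_const (f 0)

/-- An affine function is a polynomial of degree at most one. -/
theorem exists_poly_affine (f : E d →ᵃ[ℝ] ℝ) : ∃ P : MvPolynomial (Fin d) ℝ,
    P.totalDegree ≤ 1 ∧ ∀ x : E d, f x = MvPolynomial.eval (fun i => x i) P := by
  refine ⟨MvPolynomial.C (f 0) + ∑ i, MvPolynomial.C (f.linear (EuclideanSpace.single i 1)) *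
    MvPolynomial.X i, ?_, fun x => ?_⟩
  · refine (MvPolynomial.totalDegree_add _ _).trans (max_le (by simp) ?_)
    refine MvPolynomial.totalDegree_finsetSum_le fun i _ => ?_
    refine (MvPolynomial.totalDegree_mul _ _).trans ?_
    simp
  · rw [affine_eq f x]; simp

/-- Evaluation at `x` of the piecewise linear interpolant on the simplex `s`. -/
def interp1 (s : Finset (E d)) (x : E d) : (E d → ℝ) →ₗ[ℝ] ℝ where
  toFun f := ∑ v ∈ s, bc s v x * f v
  map_add' f g := by simp [mul_add, Finset.sum_add_distrib]
  map_smul' c f := by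
    simp only [Pi.smul_apply, smul_eq_mul, RingHom.id_apply, Finset.mul_sum]
    exact Finset.sum_congr rfl fun v _ => by ring

/-- Evaluation at `x` of the piecewise quadratic interpolant on the simplex `s`. -/
def interp2 (s : Finset (E d)) (x : E d) : (E d → ℝ) →ₗ[ℝ] ℝ where
  -- This is ∑ λᵥ(2λᵥ − 1)f(v) plus 4λᵥλ_w f at the edge midpoints. The full double sum counts each
  -- edge twice, and its diagonal v = w is the vertex v itself.
  toFun f := ∑ v ∈ s, ∑ w ∈ s, 2 * (bc s v x * bc s w x) * f (midpoint ℝ v w) -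
    ∑ v ∈ s, bc s v x * f v
  map_add' f g := by
    simp only [Pi.add_apply, mul_add, Finset.sum_add_distrib]; ring
  map_smul' c f := by
    simp only [Pi.smul_apply, smul_eq_mul, RingHom.id_apply, mul_sub, Finset.mul_sum]
    congr 1
    · exact Finset.sum_congr rfl fun v _ => Finset.sum_congr rfl fun w _ => by ring
    · exact Finset.sum_congr rfl fun v _ => by ring

theorem interp1_apply (s : Finset (E d)) (x : E d) (f : E d → ℝ) :
    interp1 s x f = ∑ v ∈ s, bc s v x * f v := rfl

theorem interp2_apply (s : Finset (E d)) (x : E d) (f : E d → ℝ) :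
    interp2 s x f = ∑ v ∈ s, ∑ w ∈ s, 2 * (bc s v x * bc s w x) * f (midpoint ℝ v w) -
      ∑ v ∈ s, bc s v x * f v := rfl

theorem interp1_const (hs : s ∈ elements 𝒯) (x : E d) (c : ℝ) : interp1 s x (fun _ => c) = c := by
  rw [interp1_apply, ← Finset.sum_mul, sum_bc hs, one_mul]

theorem interp1_coord (hs : s ∈ elements 𝒯) (x : E d) (i : Fin d) :
    interp1 s x (fun y => y i) = x i := sum_bc_mul hs x i

theorem midpoint_apply_coord (v w : E d) (i : Fin d) :
    (midpoint ℝ v w) i = (v i + w i) / 2 := by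
  rw [midpoint_eq_smul_add]; simp; ring

/-- On products of a function of v and a function of w the double sum factorises; the reproduction
of quadratics reduces to this and to `sum_bc_mul`. -/
theorem sum_sum_bc (s : Finset (E d)) (x : E d) (a b : E d → ℝ) :
    ∑ v ∈ s, ∑ w ∈ s, 2 * (bc s v x * bc s w x) * (a v * b w) =
      2 * ((∑ v ∈ s, bc s v x * a v) * ∑ w ∈ s, bc s w x * b w) := by
  rw [Finset.sum_mul_sum, Finset.mul_sum]
  refine Finset.sum_congr rfl fun v _ => ?_
  rw [Finset.mul_sum]
  exact Finset.sum_congr rfl fun w _ => by ring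

theorem interp2_const (hs : s ∈ elements 𝒯) (x : E d) (c : ℝ) : interp2 s x (fun _ => c) = c := by
  have h := sum_sum_bc s x (fun _ => 1) (fun _ => c)
  simp only [one_mul, mul_one] at h
  rw [interp2_apply, h, sum_bc hs, ← Finset.sum_mul, sum_bc hs]
  ring

theorem interp2_coord (hs : s ∈ elements 𝒯) (x : E d) (i : Fin d) :
    interp2 s x (fun y => y i) = x i := by
  have h1 := sum_sum_bc s x (fun _ => 1) (fun w => w i / 2)
  have h2 := sum_sum_bc s x (fun v => v i / 2) (fun _ => 1)
  have e : ∑ w ∈ s, bc s w x * (w i / 2) = x i / 2 := by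
    rw [← sum_bc_mul hs x i, Finset.sum_div]
    exact Finset.sum_congr rfl fun w _ => by ring
  simp only [mul_one, sum_bc hs, e] at h1 h2
  rw [interp2_apply, sum_bc_mul hs]
  simp only [midpoint_apply_coord, add_div, mul_add, Finset.sum_add_distrib]
  simp only [one_mul] at h1 h2
  rw [h1, h2]; ring

/-- Expand the product at the midpoint. The two mixed terms add up to xᵢxₖ, and the two terms vᵢvₖ/4
and wᵢwₖ/4 produce exactly the sum over vertices that `interp2` subtracts. -/
theorem interp2_coord_mul (hs : s ∈ elements 𝒯) (x : E d) (i k : Fin d) :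
    interp2 s x (fun y => y i * y k) = x i * x k := by
  have h1 := sum_sum_bc s x (fun v => v i * v k / 4) (fun _ => 1)
  have h2 := sum_sum_bc s x (fun v => v i / 2) (fun w => w k / 2)
  have h3 := sum_sum_bc s x (fun v => v k / 2) (fun w => w i / 2)
  have h4 := sum_sum_bc s x (fun _ => 1) (fun v => v i * v k / 4)
  have e : ∀ i, ∑ w ∈ s, bc s w x * (w i / 2) = x i / 2 := fun i => by
    rw [← sum_bc_mul hs x i, Finset.sum_div]
    exact Finset.sum_congr rfl fun w _ => by ring
  have e2 : ∑ w ∈ s, bc s w x * (w i * w k / 4) = (∑ w ∈ s, bc s w x * (w i * w k)) / 4 := by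
    rw [Finset.sum_div]
    exact Finset.sum_congr rfl fun w _ => by ring
  simp only [mul_one, sum_bc hs, e, e2] at h1 h2 h3 h4
  simp only [one_mul] at h4
  have e3 : ∑ v ∈ s, ∑ w ∈ s, 2 * (bc s v x * bc s w x) *
      ((midpoint ℝ v w) i * (midpoint ℝ v w) k) =
      ∑ v ∈ s, ∑ w ∈ s, 2 * (bc s v x * bc s w x) * (v i * v k / 4) +
      ∑ v ∈ s, ∑ w ∈ s, 2 * (bc s v x * bc s w x) * (v i / 2 * (w k / 2)) +
      ∑ v ∈ s, ∑ w ∈ s, 2 * (bc s v x * bc s w x) * (v k / 2 * (w i / 2)) +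
      ∑ v ∈ s, ∑ w ∈ s, 2 * (bc s v x * bc s w x) * (w i * w k / 4) := by
    simp only [← Finset.sum_add_distrib]
    refine Finset.sum_congr rfl fun v _ => Finset.sum_congr rfl fun w _ => ?_
    rw [midpoint_apply_coord, midpoint_apply_coord]; ring
  rw [interp2_apply, e3, h1, h2, h3, h4]
  ring

/-- The linear interpolant is bounded by the nodal values. -/
theorem abs_interp1_le (hs : s ∈ elements 𝒯) {x : E d} (hx : x ∈ cell s) {f : E d → ℝ} {M : ℝ}
    (hM : ∀ v ∈ s, |f v| ≤ M) : |interp1 s x f| ≤ M := by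
  rw [interp1_apply]
  calc |∑ v ∈ s, bc s v x * f v| ≤ ∑ v ∈ s, bc s v x * M := by
        refine (Finset.abs_sum_le_sum_abs _ _).trans (Finset.sum_le_sum fun v hv => ?_)
        rw [abs_mul, abs_of_nonneg (bc_nonneg hs hx v)]
        exact mul_le_mul_of_nonneg_left (hM v hv) (bc_nonneg hs hx v)
    _ = M := by rw [← Finset.sum_mul, sum_bc hs, one_mul]

theorem hasFDerivAt_interp2 (s : Finset (E d)) (f : E d → ℝ) (x : E d) :
    ∃ L : E d →L[ℝ] ℝ, HasFDerivAt (fun y => interp2 s y f) L x ∧ ∀ e : E d,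
      L e = ∑ v ∈ s, ∑ w ∈ s, 2 * (bc s v x * (bc s w).linear e + bc s w x * (bc s v).linear e) *
        f (midpoint ℝ v w) - ∑ v ∈ s, (bc s v).linear e * f v := by
  have h1 : ∀ v w : E d, HasFDerivAt (fun y => 2 * (bc s v y * bc s w y) * f (midpoint ℝ v w))
      ((2 * f (midpoint ℝ v w)) • (bc s v x • LinearMap.toContinuousLinearMap (bc s w).linear +
        bc s w x • LinearMap.toContinuousLinearMap (bc s v).linear)) x := by
    intro v w
    have := (((hasFDerivAt_affine (bc s v) x).mul (hasFDerivAt_affine (bc s w) x)).const_mul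
      (2 * f (midpoint ℝ v w)))
    refine this.congr_of_eventuallyEq (Eventually.of_forall fun y => ?_)
    simp only [Pi.mul_apply]; ring
  have h2 : ∀ v : E d, HasFDerivAt (fun y => bc s v y * f v)
      (f v • LinearMap.toContinuousLinearMap (bc s v).linear) x := fun v =>
    (hasFDerivAt_affine (bc s v) x).mul_const (f v)
  refine ⟨_, (HasFDerivAt.fun_sum fun v _ => HasFDerivAt.fun_sum fun w _ => h1 v w).sub
    (HasFDerivAt.fun_sum fun v _ => h2 v), fun e => ?_⟩
  simp only [sub_apply, sum_apply,
    smul_apply, add_apply, smul_eq_mul,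
    LinearMap.coe_toContinuousLinearMap']
  congr 1
  · exact Finset.sum_congr rfl fun v _ => Finset.sum_congr rfl fun w _ => by ring
  · exact Finset.sum_congr rfl fun v _ => by ring

theorem differentiable_interp2 (s : Finset (E d)) (f : E d → ℝ) :
    Differentiable ℝ fun y => interp2 s y f := fun x =>
  (hasFDerivAt_interp2 s f x).choose_spec.1.differentiableAt

/-- The derivatives of the quadratic interpolant are bounded by the nodal values. -/
theorem abs_pd_interp2_le (hs : s ∈ elements 𝒯) {x : E d} (hx : x ∈ cell s) {f : E d → ℝ} {M g : ℝ}
    (hM : ∀ v ∈ s, |f v| ≤ M) (hM2 : ∀ v ∈ s, ∀ w ∈ s, |f (midpoint ℝ v w)| ≤ M) {k : Fin d}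
    (hg : ∀ v, |(bc s v).linear (EuclideanSpace.single k 1)| ≤ g) (hM0 : 0 ≤ M) :
    |pd k (fun y => interp2 s y f) x| ≤ 5 * ((d : ℝ) + 1) ^ 2 * (g * M) := by
  obtain ⟨L, hL, hLe⟩ := hasFDerivAt_interp2 s f x
  have hg0 : 0 ≤ g := (abs_nonneg _).trans (hg 0)
  rw [pd, hL.fderiv, hLe]
  set e : E d := EuclideanSpace.single k 1
  have hcard : (s.card : ℝ) = d + 1 := by rw [hs.2]; push_cast; ring
  have t1 : |∑ v ∈ s, ∑ w ∈ s, 2 * (bc s v x * (bc s w).linear e + bc s w x * (bc s v).linear e) *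
        f (midpoint ℝ v w)| ≤ ((d : ℝ) + 1) ^ 2 * (4 * (g * M)) := by
    refine (Finset.abs_sum_le_sum_abs _ _).trans ?_
    have : ∀ v ∈ s, |∑ w ∈ s, 2 * (bc s v x * (bc s w).linear e + bc s w x * (bc s v).linear e) *
        f (midpoint ℝ v w)| ≤ ((d : ℝ) + 1) * (4 * (g * M)) := by
      intro v hv
      refine (Finset.abs_sum_le_sum_abs _ _).trans ?_
      rw [← hcard, ← nsmul_eq_mul]
      refine Finset.sum_le_card_nsmul _ _ _ fun w hw => ?_
      have hb : ∀ v w, |bc s v x * (bc s w).linear e| ≤ g := fun v w => by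
        rw [abs_mul, abs_of_nonneg (bc_nonneg hs hx v)]
        calc _ ≤ 1 * g := mul_le_mul (bc_le_one hs hx v) (hg w) (abs_nonneg _) zero_le_one
          _ = g := one_mul g
      rw [abs_mul, abs_mul, abs_two]
      have h1 : |bc s v x * (bc s w).linear e + bc s w x * (bc s v).linear e| ≤ g + g :=
        (abs_add_le _ _).trans (add_le_add (hb v w) (hb w v))
      calc _ ≤ 2 * (g + g) * M := by
            gcongr
            exact hM2 v hv w hw
        _ = _ := by ring
    calc _ ≤ s.card • (((d : ℝ) + 1) * (4 * (g * M))) := Finset.sum_le_card_nsmul _ _ _ this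
      _ = _ := by rw [nsmul_eq_mul, hcard]; ring
  have t2 : |∑ v ∈ s, (bc s v).linear e * f v| ≤ ((d : ℝ) + 1) * (g * M) := by
    refine (Finset.abs_sum_le_sum_abs _ _).trans ?_
    rw [← hcard, ← nsmul_eq_mul]
    refine Finset.sum_le_card_nsmul _ _ _ fun v hv => ?_
    rw [abs_mul]
    exact mul_le_mul (hg v) (hM v hv) (abs_nonneg _) hg0
  refine (abs_sub _ _).trans ((add_le_add t1 t2).trans ?_)
  have hd0 : (0 : ℝ) ≤ d := Nat.cast_nonneg d
  have : 0 ≤ g * M := by positivity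
  nlinarith [mul_nonneg hd0 this, mul_nonneg (mul_nonneg hd0 hd0) this]

/-- The quadratic interpolant is a polynomial of degree at most two. -/
theorem exists_poly_interp2 (s : Finset (E d)) (f : E d → ℝ) : ∃ P : MvPolynomial (Fin d) ℝ,
    P.totalDegree ≤ 2 ∧ ∀ x : E d, interp2 s x f = MvPolynomial.eval (fun i => x i) P := by
  choose P hP hPe using fun v => exists_poly_affine (bc s v)
  refine ⟨∑ v ∈ s, ∑ w ∈ s, MvPolynomial.C (2 * f (midpoint ℝ v w)) * (P v * P w) -
    ∑ v ∈ s, MvPolynomial.C (f v) * P v, ?_, fun x => ?_⟩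
  · refine (MvPolynomial.totalDegree_sub _ _).trans (max_le ?_ ?_)
    · refine MvPolynomial.totalDegree_finsetSum_le fun v _ =>
        MvPolynomial.totalDegree_finsetSum_le fun w _ => ?_
      refine (MvPolynomial.totalDegree_mul _ _).trans ?_
      have := MvPolynomial.totalDegree_mul (P v) (P w)
      have := hP v
      have := hP w
      simp only [MvPolynomial.totalDegree_C]
      omega
    · refine MvPolynomial.totalDegree_finsetSum_le fun v _ => ?_
      refine (MvPolynomial.totalDegree_mul _ _).trans ?_
      have := hP v
      simp only [MvPolynomial.totalDegree_C]
      omega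
  · rw [interp2_apply]
    simp only [hPe, map_sub, map_sum, map_mul, MvPolynomial.eval_C]
    congr 1
    · exact Finset.sum_congr rfl fun v _ => Finset.sum_congr rfl fun w _ => by ring
    · exact Finset.sum_congr rfl fun v _ => by ring

theorem exists_poly_interp1 (s : Finset (E d)) (f : E d → ℝ) : ∃ P : MvPolynomial (Fin d) ℝ,
    P.totalDegree ≤ 1 ∧ ∀ x : E d, interp1 s x f = MvPolynomial.eval (fun i => x i) P := by
  choose P hP hPe using fun v => exists_poly_affine (bc s v)
  refine ⟨∑ v ∈ s, MvPolynomial.C (f v) * P v, ?_, fun x => ?_⟩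
  · refine MvPolynomial.totalDegree_finsetSum_le fun v _ => ?_
    refine (MvPolynomial.totalDegree_mul _ _).trans ?_
    have := hP v
    simp only [MvPolynomial.totalDegree_C]
    omega
  · rw [interp1_apply]
    simp only [hPe, map_sum, map_mul, MvPolynomial.eval_C]
    exact Finset.sum_congr rfl fun v _ => by ring

end Simplex
end EnsembleNSE
end


noncomputable section

namespace EnsembleNSE
open MeasureTheory Set Filter Topology
open scoped ContDiff NNReal ENNReal

/-! ### Continuous piecewise polynomial interpolants -/

/-- A function that is Lipschitz on every set of a finite closed cover is Lipschitz. -/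
theorem lipschitzWith_of_finite_cover {F ι : Type*} [NormedAddCommGroup F] [NormedSpace ℝ F]
    [Finite ι] {A : ι → Set F} (hA : ∀ i, IsClosed (A i)) (hc : ∀ x, ∃ i, x ∈ A i) {f : F → ℝ}
    {L : ℝ≥0} (hf : ∀ i, LipschitzOnWith L f (A i)) : LipschitzWith L f := by
  have hcont : Continuous f :=
    (locallyFinite_of_finite A).continuous (iUnion_eq_univ_iff.2 hc) hA fun i => (hf i).continuousOn
  refine LipschitzWith.of_le_add_mul L fun y x => ?_
  set γ : ℝ → F := fun s => x + s • (y - x) with hγ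
  have hγc : Continuous γ := by fun_prop
  have hdist : ∀ s z : ℝ, dist (γ z) (γ s) = |z - s| * dist y x := by
    intro s z
    rw [dist_eq_norm, dist_eq_norm, ← Real.norm_eq_abs, ← norm_smul, hγ]
    congr 1
    simp only [sub_smul]; abel
  have key := image_le_of_liminf_slope_right_le_deriv_boundary (f := fun s => f (γ s))
    (a := 0) (b := 1) (B := fun s => f x + s * (L * dist y x)) (B' := fun _ => L * dist y x)
    (hcont.comp hγc).continuousOn (by simp [hγ]) (by fun_prop)
    (fun s _ => by
      simpa using (((hasDerivAt_id s).mul_const (L * dist y x)).const_add (f x)).hasDerivWithinAt)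
    (fun s hs r hr => by
      -- With finitely many pieces, one of them is met arbitrarily close to the right of s, and
      -- being closed it contains γ s as well. Along those times the difference quotient obeys the
      -- Lipschitz bound, and a bound on the lower right derivative suffices.
      have : ∃ i, ∃ᶠ z in 𝓝[>] s, γ z ∈ A i := by
        by_contra hcon
        push Not at hcon
        have hall := eventually_all.2 hcon
        obtain ⟨z, hz⟩ := hall.exists
        obtain ⟨i, hi⟩ := hc (γ z)
        exact hz i hi
      obtain ⟨i, hi⟩ := this
      have hs' : γ s ∈ A i := by
        have h1 : ∃ᶠ z in 𝓝 s, γ z ∈ A i := hi.filter_mono nhdsWithin_le_nhds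
        have h2 : s ∈ closure (γ ⁻¹' A i) := mem_closure_iff_frequently.2 h1
        rwa [((hA i).preimage hγc).closure_eq] at h2
      refine (hi.and_eventually self_mem_nhdsWithin).mono fun z hz => lt_of_le_of_lt ?_ hr
      have hz0 : 0 < z - s := sub_pos.2 hz.2
      rw [slope_def_field, div_le_iff₀ hz0]
      have := (hf i).le_add_mul hz.1 hs'
      rw [hdist, abs_of_pos hz0] at this
      simp only [sub_le_iff_le_add]
      linarith only [this])
  have h1 := key (right_mem_Icc.2 zero_le_one)
  simpa [hγ] using h1

section Glue

variable {d : ℕ} {Ω : Set (E d)} {𝒯 : Mesh d} {s t : Finset (E d)}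

theorem interp1_eq_interp1 (hs : s ∈ elements 𝒯) (ht : t ∈ elements 𝒯) {x : E d} (hxs : x ∈ cell s)
    (hxt : x ∈ cell t) (f : E d → ℝ) : interp1 s x f = interp1 t x f := by
  classical
  rw [interp1_apply, interp1_apply,
    Finset.sum_subset (Finset.subset_union_left (s₁ := s) (s₂ := t)),
    Finset.sum_subset (Finset.subset_union_right (s₁ := s) (s₂ := t))]
  · exact Finset.sum_congr rfl fun v _ => by rw [bc_eq_bc hs ht hxs hxt]
  · intro v _ hv; simp [bc_of_notMem hv]
  · intro v _ hv; simp [bc_of_notMem hv]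

theorem interp2_eq_interp2 (hs : s ∈ elements 𝒯) (ht : t ∈ elements 𝒯) {x : E d} (hxs : x ∈ cell s)
    (hxt : x ∈ cell t) (f : E d → ℝ) : interp2 s x f = interp2 t x f := by
  classical
  have h : ∀ s t : Finset (E d), ∑ v ∈ s, ∑ w ∈ s, 2 * (bc s v x * bc s w x) * f (midpoint ℝ v w) =
      ∑ v ∈ s ∪ t, ∑ w ∈ s ∪ t, 2 * (bc s v x * bc s w x) * f (midpoint ℝ v w) := by
    intro s t
    rw [Finset.sum_subset (Finset.subset_union_left (s₁ := s) (s₂ := t))]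
    · refine Finset.sum_congr rfl fun v _ => ?_
      refine Finset.sum_subset Finset.subset_union_left fun w _ hw => ?_
      simp [bc_of_notMem hw]
    · intro v _ hv; simp [bc_of_notMem hv]
  have h1 := interp1_eq_interp1 hs ht hxs hxt f
  rw [interp1_apply, interp1_apply] at h1
  rw [interp2_apply, interp2_apply, h1, h s t, h t s, Finset.union_comm t s]
  congr 1
  exact Finset.sum_congr rfl fun v _ => Finset.sum_congr rfl fun w _ => by
    rw [bc_eq_bc hs ht hxs hxt, bc_eq_bc hs ht hxs hxt]

open Classical in
/-- The function equal to `I s` on each element `s`, and to zero outside the mesh. -/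
def glue (𝒯 : Mesh d) (I : Finset (E d) → E d → ℝ) (x : E d) : ℝ :=
  if h : ∃ s ∈ elements 𝒯, x ∈ cell s then I h.choose x else 0

theorem glue_eq {I : Finset (E d) → E d → ℝ}
    (hI : ∀ s ∈ elements 𝒯, ∀ t ∈ elements 𝒯, ∀ x ∈ cell s, x ∈ cell t → I s x = I t x)
    (hs : s ∈ elements 𝒯) {x : E d} (hx : x ∈ cell s) : glue 𝒯 I x = I s x := by
  have h : ∃ s ∈ elements 𝒯, x ∈ cell s := ⟨s, hs, hx⟩
  rw [glue, dif_pos h]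
  exact hI _ h.choose_spec.1 _ hs _ h.choose_spec.2 hx

/-- The piecewise linear interpolant. -/
def pl (𝒯 : Mesh d) (f : E d → ℝ) : E d → ℝ := glue 𝒯 fun s x => interp1 s x f

/-- The piecewise quadratic interpolant. -/
def pq (𝒯 : Mesh d) (f : E d → ℝ) : E d → ℝ := glue 𝒯 fun s x => interp2 s x f

theorem pl_eq (hs : s ∈ elements 𝒯) {x : E d} (hx : x ∈ cell s) (f : E d → ℝ) :
    pl 𝒯 f x = interp1 s x f :=
  glue_eq (I := fun s x => interp1 s x f)
    (fun _ hs _ ht _ hxs hxt => interp1_eq_interp1 hs ht hxs hxt f) hs hx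

theorem pq_eq (hs : s ∈ elements 𝒯) {x : E d} (hx : x ∈ cell s) (f : E d → ℝ) :
    pq 𝒯 f x = interp2 s x f :=
  glue_eq (I := fun s x => interp2 s x f)
    (fun _ hs _ ht _ hxs hxt => interp2_eq_interp2 hs ht hxs hxt f) hs hx

theorem contDiff_interp1 (s : Finset (E d)) (f : E d → ℝ) :
    ContDiff ℝ (⊤ : ℕ∞) fun y => interp1 s y f := by
  have := fun v => contDiff_affine (bc s v)
  simp only [interp1_apply]
  fun_prop

theorem contDiff_interp2 (s : Finset (E d)) (f : E d → ℝ) :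
    ContDiff ℝ (⊤ : ℕ∞) fun y => interp2 s y f := by
  have := fun v => contDiff_affine (bc s v)
  simp only [interp2_apply]
  fun_prop

theorem continuousOn_pl (h𝒯 : IsTriangulation Ω 𝒯) (f : E d → ℝ) :
    ContinuousOn (pl 𝒯 f) (closure Ω) := by
  have := (elements_finite h𝒯).to_subtype
  rw [← h𝒯.covers, biUnion_eq_iUnion]
  refine (locallyFinite_of_finite _).continuousOn_iUnion (fun s => (isCompact_cell _).isClosed)
    fun s => ?_
  exact (contDiff_interp1 s f).continuous.continuousOn.congr fun x hx => pl_eq s.2 hx f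

theorem isPiecewisePoly_pl (h𝒯 : IsTriangulation Ω 𝒯) (f : E d → ℝ) :
    IsPiecewisePoly Ω 𝒯 1 (pl 𝒯 f) := by
  refine ⟨continuousOn_pl h𝒯 f, fun s hs => ?_⟩
  obtain ⟨P, hP, he⟩ := exists_poly_interp1 s f
  exact ⟨P, hP, fun x hx => (pl_eq hs hx f).trans (he x)⟩

/-- The quadratic interpolant of a function that vanishes outside `Ω` does so too. -/
theorem pq_eq_zero (hΩ : IsLipschitzDomain Ω) (h𝒯 : IsTriangulation Ω 𝒯) {f : E d → ℝ}
    (hf : ∀ x ∉ Ω, f x = 0) {x : E d} (hx : x ∉ Ω) : pq 𝒯 f x = 0 := by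
  by_cases hex : ∃ s ∈ elements 𝒯, x ∈ cell s
  swap
  · rw [pq, glue, dif_neg hex]
  obtain ⟨s, hs, hxs⟩ := hex
  -- Let x lie outside Ω, in the relative interior of a face. If the midpoint z of two vertices of
  -- that face were in Ω, so would be a point z' slightly moved towards x, which lies in the same
  -- open face. The mesh looks alike near all points of an open face, so the elements would fill a
  -- neighbourhood of x as they do of z', and x would be interior to the closure of Ω, hence in Ω.
  have key : ∀ v ∈ s, ∀ w ∈ s, 0 < bc s v x → 0 < bc s w x → f (midpoint ℝ v w) = 0 := by
    intro v hv w hw hvx hwx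
    by_contra hne
    have hz : midpoint ℝ v w ∈ Ω := by
      by_contra hzΩ
      exact hne (hf _ hzΩ)
    set z := midpoint ℝ v w with hzdef
    have hzs : z ∈ cell s := midpoint_mem_cell hv hw
    obtain ⟨ε, hε, hεΩ⟩ : ∃ ε ∈ Ioo (0 : ℝ) 1, AffineMap.lineMap z x ε ∈ Ω := by
      have hc : Tendsto (fun ε : ℝ => AffineMap.lineMap z x ε) (𝓝[>] 0) (𝓝 z) := by
        have : Continuous fun ε : ℝ => (AffineMap.lineMap z x ε : E d) := AffineMap.lineMap_continuous
        simpa using (this.tendsto 0).mono_left nhdsWithin_le_nhds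
      have h1 := hc.eventually (hΩ.isOpen.mem_nhds hz)
      have h2 : ∀ᶠ ε : ℝ in 𝓝[>] 0, ε ∈ Ioo (0 : ℝ) 1 := Ioo_mem_nhdsGT zero_lt_one
      obtain ⟨ε, h⟩ := (h2.and h1).exists
      exact ⟨ε, h⟩
    set z' : E d := AffineMap.lineMap z x ε with hz'
    have hbz' : ∀ p, bc s p z' = (1 - ε) * bc s p z + ε * bc s p x := by
      intro p
      rw [hz', AffineMap.apply_lineMap, AffineMap.lineMap_apply_ring]
    have hz's : z' ∈ cell s := (convex_cell s).lineMap_mem hzs hxs ⟨hε.1.le, hε.2.le⟩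
    have hpos : ∀ p, 0 < bc s p x → 0 < bc s p z' := by
      intro p hp
      have := bc_nonneg hs hzs p
      rw [hbz']
      have := mul_nonneg (sub_nonneg.2 hε.2.le) this
      have := mul_pos hε.1 hp
      linarith
    have hzero : ∀ p, bc s p x = 0 → bc s p z' = 0 := by
      intro p hp
      have hpz : bc s p z = 0 := by
        have h1 : bc s p v = 0 := bc_ne hs hv fun h => by rw [h] at hp; exact hvx.ne' hp
        have h2 : bc s p w = 0 := bc_ne hs hw fun h => by rw [h] at hp; exact hwx.ne' hp
        rw [hzdef, AffineMap.map_midpoint, h1, h2, midpoint_self]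
      rw [hbz', hpz, hp]; ring
    -- Every vertex carrying x also carries z'. If z' ∈ t, these vertices all belong to t, and so
    -- does their convex combination x.
    have hxt : ∀ t ∈ elements 𝒯, z' ∈ cell t → x ∈ cell t := by
      intro t ht hzt
      have hsup : ∀ p, p ∉ t → bc s p x = 0 := by
        intro p hp
        by_contra h
        have h0 := bc_eq_zero_of_mem hs ht hz's hzt hp
        exact (hpos p (lt_of_le_of_ne (bc_nonneg hs hxs p) (Ne.symm h))).ne' h0
      classical
      rw [← sum_bc_smul hs x, ← Finset.sum_filter_add_sum_filter_not s (· ∈ t)]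
      have e0 : ∑ p ∈ s with p ∉ t, bc s p x • p = 0 :=
        Finset.sum_eq_zero fun p hp => by
          rw [hsup p (Finset.mem_filter.1 hp).2, zero_smul]
      rw [e0, add_zero]
      refine (convex_cell t).sum_mem (fun p _ => bc_nonneg hs hxs p) ?_
        fun p hp => subset_cell (Finset.mem_filter.1 hp).2
      rw [← sum_bc hs x, ← Finset.sum_filter_add_sum_filter_not s (· ∈ t)]
      rw [Finset.sum_eq_zero (s := s.filter (· ∉ t)) fun p hp => hsup p (Finset.mem_filter.1 hp).2,
        add_zero]
    have hadd : Tendsto (fun e : E d => z' + e) (𝓝 0) (𝓝 z') :=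
      Continuous.tendsto' (by fun_prop) _ _ (add_zero z')
    have hev1 : ∀ᶠ e : E d in 𝓝 0, z' + e ∈ Ω := by
      exact hadd.eventually (hΩ.isOpen.mem_nhds hεΩ)
    have hfin := elements_finite h𝒯
    have hev2 : ∀ᶠ e : E d in 𝓝 0, ∀ t ∈ elements 𝒯, z' + e ∈ cell t → z' ∈ cell t := by
      rw [eventually_all_finite hfin]
      intro t ht
      by_cases hzt : z' ∈ cell t
      · exact Eventually.of_forall fun _ _ => hzt
      filter_upwards [hadd.eventually ((isCompact_cell t).isClosed.isOpen_compl.mem_nhds hzt)]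
        with e he h
      exact absurd h he
    have hev3 : ∀ᶠ e : E d in 𝓝 0, ∀ t ∈ elements 𝒯, ∀ p ∈ t, 0 < bc t p x → 0 < bc t p (x + e) := by
      rw [eventually_all_finite hfin]
      intro t ht
      rw [Finset.eventually_all]
      intro p hp
      by_cases h : 0 < bc t p x
      · have hc : Continuous fun e : E d => bc t p (x + e) :=
          (contDiff_affine (bc t p)).continuous.comp (by fun_prop)
        have := hc.tendsto 0
        rw [add_zero] at this
        filter_upwards [this.eventually (lt_mem_nhds h)] with e he _ using he
      · exact Eventually.of_forall fun _ h' => absurd h' h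
    -- The perturbed point z' + e lies in an element t that contains both z' and x. Coordinates
    -- positive at x stay positive at x + e; those zero at x are zero at z' too, so they change by
    -- the same linear amount, which is nonnegative because z' + e ∈ t.
    have hx' : ∀ᶠ e : E d in 𝓝 0, x + e ∈ closure Ω := by
      filter_upwards [hev1, hev2, hev3] with e h1 h2 h3
      obtain ⟨t, ht, hte⟩ := exists_mem_cell h𝒯 (subset_closure h1)
      have hzt := h2 t ht hte
      have hxt' := hxt t ht hzt
      refine cell_subset_closure h𝒯 ht ((mem_cell_iff ht).2 fun p hp => ?_)
      rcases (bc_nonneg ht hxt' p).lt_or_eq with hlt | heq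
      · exact (h3 t ht p hp hlt).le
      · have e1 : bc t p z' = 0 := by
          rw [← bc_eq_bc hs ht hz's hzt]
          exact hzero p (by rw [bc_eq_bc hs ht hxs hxt', ← heq])
        have e2 : ∀ y : E d, bc t p (y + e) = (bc t p).linear e + bc t p y := fun y => by
          have := (bc t p).map_vadd y e
          rwa [vadd_eq_add, add_comm] at this
        have := bc_nonneg ht hte p
        rw [e2, e1, add_zero] at this
        rw [e2, ← heq, add_zero]; exact this
    refine hx (interior_closure_subset hΩ (mem_interior_iff_mem_nhds.2 ?_))
    have h4 : Tendsto (fun y : E d => y - x) (𝓝 x) (𝓝 0) :=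
      Continuous.tendsto' (by fun_prop) _ _ (sub_self x)
    filter_upwards [h4.eventually hx'] with y hy
    simpa using hy
  have key' : ∀ v ∈ s, ∀ w ∈ s, bc s v x * bc s w x * f (midpoint ℝ v w) = 0 := by
    intro v hv w hw
    rcases (bc_nonneg hs hxs v).lt_or_eq with h1 | h1
    · rcases (bc_nonneg hs hxs w).lt_or_eq with h2 | h2
      · rw [key v hv w hw h1 h2, mul_zero]
      · rw [← h2]; ring
    · rw [← h1]; ring
  rw [pq_eq hs hxs, interp2_apply, Finset.sum_eq_zero, Finset.sum_eq_zero, sub_zero]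
  · intro v hv
    have := key' v hv v hv
    rw [midpoint_self, mul_assoc] at this
    rcases mul_eq_zero.1 this with h | h
    · rw [h, zero_mul]
    · exact h
  · intro v hv
    refine Finset.sum_eq_zero fun w hw => ?_
    rw [mul_assoc, key' v hv w hw, mul_zero]

theorem exists_lipschitzOnWith_of_contDiff {K : Set (E d)} (hK : IsCompact K) (hKc : Convex ℝ K)
    {f : E d → ℝ} (hf : ContDiff ℝ (⊤ : ℕ∞) f) : ∃ L : ℝ≥0, LipschitzOnWith L f K := by
  obtain ⟨C, hC⟩ := hK.exists_bound_of_continuousOn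
    (hf.continuous_fderiv (by simp)).continuousOn
  refine ⟨C.toNNReal, hKc.lipschitzOnWith_of_nnnorm_fderiv_le
    (fun x _ => (hf.differentiable (by simp)) x) fun x hx => ?_⟩
  rw [← NNReal.coe_le_coe, coe_nnnorm]
  exact (hC x hx).trans (Real.le_coe_toNNReal C)

/-- The closed cover consists of the elements, where the function is polynomial, and of the
complement of Ω, where it is zero by `pq_eq_zero`. -/
theorem exists_lipschitzWith_pq (hΩ : IsLipschitzDomain Ω) (h𝒯 : IsTriangulation Ω 𝒯)
    {f : E d → ℝ} (hf : ∀ x ∉ Ω, f x = 0) : ∃ L : ℝ≥0, LipschitzWith L (pq 𝒯 f) := by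
  have hfin := (elements_finite h𝒯).to_subtype
  have := Fintype.ofFinite (elements 𝒯)
  choose L hL using fun s : elements 𝒯 => exists_lipschitzOnWith_of_contDiff
    (isCompact_cell (s : Finset (E d))) (convex_cell _) (contDiff_interp2 (s : Finset (E d)) f)
  refine ⟨∑ s, L s, lipschitzWith_of_finite_cover (ι := Option (elements 𝒯))
    (A := fun o => o.elim Ωᶜ fun s => cell s) ?_ ?_ ?_⟩
  · rintro (_ | s)
    · exact hΩ.isOpen.isClosed_compl
    · exact (isCompact_cell _).isClosed
  · intro x
    by_cases hx : x ∈ Ω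
    · obtain ⟨s, hs, hxs⟩ := exists_mem_cell h𝒯 (subset_closure hx)
      exact ⟨some ⟨s, hs⟩, hxs⟩
    · exact ⟨none, hx⟩
  · rintro (_ | s)
    · refine LipschitzOnWith.of_dist_le_mul fun x hx y hy => ?_
      rw [pq_eq_zero hΩ h𝒯 hf hx, pq_eq_zero hΩ h𝒯 hf hy, dist_self]
      positivity
    · refine LipschitzOnWith.of_dist_le_mul fun x hx y hy => ?_
      rw [pq_eq s.2 hx, pq_eq s.2 hy]
      refine ((hL s).dist_le_mul x hx y hy).trans ?_
      gcongr
      exact Finset.single_le_sum (f := L) (fun _ _ => zero_le) (Finset.mem_univ s)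

theorem isPiecewisePoly_pq (hΩ : IsLipschitzDomain Ω) (h𝒯 : IsTriangulation Ω 𝒯) {f : E d → ℝ}
    (hf : ∀ x ∉ Ω, f x = 0) : IsPiecewisePoly Ω 𝒯 2 (pq 𝒯 f) := by
  obtain ⟨L, hL⟩ := exists_lipschitzWith_pq hΩ h𝒯 hf
  refine ⟨hL.continuous.continuousOn, fun s hs => ?_⟩
  obtain ⟨P, hP, he⟩ := exists_poly_interp2 s f
  exact ⟨P, hP, fun x hx => (pq_eq hs hx f).trans (he x)⟩

end Glue
end EnsembleNSE
end


noncomputable section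

namespace EnsembleNSE
open MeasureTheory Set Filter Topology
open scoped ContDiff NNReal ENNReal

/-! ### Lipschitz functions vanishing outside `Ω` belong to `H₀¹(Ω)` -/

section Lipschitz

variable {d m : ℕ} {Ω : Set (E d)}

/-- Density by duality: only zero is orthogonal to all test functions. -/
theorem exists_isTest_norm_sub_lt (hΩ : IsOpen Ω) (g : L2 Ω) {ε : ℝ} (hε : 0 < ε) :
    ∃ (φ : E d → ℝ) (hφ : IsTest Ω φ), ‖g - hφ.memLp.toLp φ‖ < ε := by
  set K : Submodule ℝ (L2 Ω) := (testSubmodule Ω).map (valₗ 1 Ω) with hK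
  have htop : K.topologicalClosure = ⊤ := by
    rw [Submodule.topologicalClosure_eq_top_iff, Submodule.eq_bot_iff]
    intro q hq
    refine eq_zero_of_forall_isTest hΩ fun φ hφ => ?_
    rw [integral_mul_eq_inner hφ.memLp]
    refine Submodule.inner_right_of_mem_orthogonal (K := K) ?_ hq
    rw [← hφ.val_toH]
    exact Submodule.mem_map_of_mem ((mem_testSubmodule_iff hΩ).2 ⟨φ, hφ, rfl⟩)
  have hg : g ∈ closure (K : Set (L2 Ω)) := by
    rw [← Submodule.topologicalClosure_coe, htop]; trivial
  obtain ⟨q, hq, hlt⟩ := Metric.mem_closure_iff.1 hg ε hε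
  obtain ⟨v, hv, rfl⟩ := hq
  obtain ⟨φ, hφ, rfl⟩ := (mem_testSubmodule_iff hΩ).1 hv
  refine ⟨φ, hφ, ?_⟩
  rw [← hφ.val_toH, ← dist_eq_norm]
  exact hlt

/-- `H₀¹(Ω)` is closed under `L²` limits of sequences with bounded gradients. -/
theorem mem_H10_of_bounded (hΩ : IsOpen Ω) {v : H 1 Ω} {C : ℝ} (hC : 0 ≤ C)
    (h : ∀ ε > (0 : ℝ), ∃ w ∈ H10 Ω, (∀ k, ‖D1 k w‖ ≤ C) ∧ ‖val (v - w)‖ ≤ ε) : v ∈ H10 Ω := by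
  have hcl : IsClosed (H10 Ω : Set (H 1 Ω)) := by
    rw [H10_eq_closure]; exact Submodule.isClosed_topologicalClosure _
  have : CompleteSpace (H10 Ω) := hcl.completeSpace_coe
  rw [← Submodule.orthogonal_orthogonal (H10 Ω), Submodule.mem_orthogonal]
  intro ξ hξ
  -- As a closed subspace, H₀¹ is its own double orthogonal complement. For ξ orthogonal to it, (ξ,
  -- v) = (ξ, v − w). Each ∂ₖξ is replaced by a test function at a cost controlled by the bounded
  -- gradients, and the derivative of v − w is then moved onto that test function, leaving only the
  -- small L² norm of v − w.
  have key : ∀ ε > (0 : ℝ), |inner ℝ ξ v| ≤ ε * (1 + d * (‖v‖ + C)) := by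
    intro ε hε
    choose ψ hψ hψε using fun k => exists_isTest_norm_sub_lt hΩ (D1 k ξ) hε
    set M : ℝ := ‖val ξ‖ + ∑ k, ‖((hψ k).memLp_pd k).toLp (pd k (ψ k))‖ with hM
    have hM0 : 0 ≤ M := by positivity
    obtain ⟨w, hw, hwC, hwε⟩ := h (ε / (M + 1)) (by positivity)
    have e1 : inner ℝ ξ v = inner ℝ ξ (v - w) := by
      rw [inner_sub_right, Submodule.inner_left_of_mem_orthogonal hw hξ, sub_zero]
    have e2 : ∀ k, inner ℝ (D1 k ξ) (D1 k (v - w)) =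
        inner ℝ (D1 k ξ - (hψ k).memLp.toLp (ψ k)) (D1 k (v - w)) -
          inner ℝ (((hψ k).memLp_pd k).toLp (pd k (ψ k))) (val (v - w)) := by
      intro k
      rw [isWeakPartial_iff.1 (isWeakPartial_val_D1 k (v - w)) (ψ k) (hψ k), inner_sub_left]
      ring
    have e3 : ∀ k, ‖D1 k (v - w)‖ ≤ ‖v‖ + C := by
      intro k
      have : D1 k (v - w) = D1 k v - D1 k w := rfl
      rw [this]
      exact (norm_sub_le _ _).trans (add_le_add (norm_D1_le k v) (hwC k))
    have e4 : ∀ k, |inner ℝ (D1 k ξ) (D1 k (v - w))| ≤ ε * (‖v‖ + C) +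
        ‖((hψ k).memLp_pd k).toLp (pd k (ψ k))‖ * (ε / (M + 1)) := by
      intro k
      rw [e2 k]
      refine (abs_sub _ _).trans (add_le_add ?_ ?_)
      · exact (abs_real_inner_le_norm _ _).trans
          (mul_le_mul (hψε k).le (e3 k) (norm_nonneg _) hε.le)
      · exact (abs_real_inner_le_norm _ _).trans (mul_le_mul_of_nonneg_left hwε (norm_nonneg _))
    rw [e1, inner_H1]
    calc |inner ℝ (val ξ) (val (v - w)) + ∑ k, inner ℝ (D1 k ξ) (D1 k (v - w))|
        ≤ ‖val ξ‖ * (ε / (M + 1)) + ∑ k : Fin d, (ε * (‖v‖ + C) +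
          ‖((hψ k).memLp_pd k).toLp (pd k (ψ k))‖ * (ε / (M + 1))) := by
          refine (abs_add_le _ _).trans (add_le_add ?_ ?_)
          · exact (abs_real_inner_le_norm _ _).trans (mul_le_mul_of_nonneg_left hwε (norm_nonneg _))
          · exact (Finset.abs_sum_le_sum_abs _ _).trans (Finset.sum_le_sum fun k _ => e4 k)
      _ = M * (ε / (M + 1)) + d * (ε * (‖v‖ + C)) := by
          rw [Finset.sum_add_distrib]
          generalize ε / (M + 1) = c
          rw [hM, add_mul, Finset.sum_mul, Finset.sum_const, Finset.card_univ, Fintype.card_fin, nsmul_eq_mul]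
          ring
      _ ≤ ε + d * (ε * (‖v‖ + C)) := by
          gcongr
          rw [mul_div_assoc', div_le_iff₀ (by positivity)]
          nlinarith
      _ = _ := by ring
  have hA : 0 < 1 + (d : ℝ) * (‖v‖ + C) := by positivity
  have h0 : |inner ℝ ξ v| ≤ 0 := by
    refine le_of_forall_pos_le_add fun δ hδ => ?_
    have := key (δ / (1 + d * (‖v‖ + C))) (by positivity)
    rw [div_mul_cancel₀ _ hA.ne'] at this
    linarith
  exact abs_eq_zero.1 (le_antisymm h0 (abs_nonneg _))

/-- Soft thresholding does not increase distances, so shrinking W keeps its Lipschitz constant. -/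
theorem abs_shrink_sub_le {δ : ℝ} (hδ : 0 ≤ δ) (a b : ℝ) :
    |(a - max (-δ) (min δ a)) - (b - max (-δ) (min δ b))| ≤ |a - b| := by
  simp only [max_def, min_def]
  split_ifs <;> rw [abs_le] <;> constructor <;> cases abs_cases (a - b) <;> linarith

theorem abs_sub_shrink_le {δ : ℝ} (hδ : 0 ≤ δ) (a : ℝ) : |max (-δ) (min δ a)| ≤ δ := by
  rw [abs_le]
  exact ⟨le_max_left _ _, max_le (by linarith) (min_le_left _ _)⟩

theorem shrink_eq_zero {δ a : ℝ} (h : |a| ≤ δ) : a - max (-δ) (min δ a) = 0 := by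
  rw [abs_le] at h
  rw [min_eq_right h.2, max_eq_right h.1, sub_self]

theorem LipschitzWith.weakDeriv {f : E d → ℝ} {C : ℝ≥0} (hf : LipschitzWith C f) (k : Fin d) :
    WeakDeriv univ k f fun x => lineDeriv ℝ f x (EuclideanSpace.single k 1) := fun φ hφ => by
  simpa using LipschitzWith.setIntegral_mul_pd hf hφ k

theorem abs_lineDeriv_single_le {f : E d → ℝ} {C : ℝ≥0} (hf : LipschitzWith C f) (k : Fin d)
    (x : E d) : |lineDeriv ℝ f x (EuclideanSpace.single k 1)| ≤ C := by
  have := norm_lineDeriv_le_of_lipschitz ℝ hf (x₀ := x) (v := EuclideanSpace.single k 1)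
  simpa using this

/-- Test functions approximating a Lipschitz function that vanishes outside `Ω`. -/
theorem exists_isTest_of_lipschitz (hb : Bornology.IsBounded Ω) {W : E d → ℝ} {L : ℝ≥0}
    (hW : LipschitzWith L W) (h0 : ∀ x ∉ Ω, W x = 0) {ε : ℝ} (hε : 0 < ε) :
    ∃ φ : E d → ℝ, IsTest Ω φ ∧ (∀ x, |W x - φ x| ≤ ε) ∧ ∀ k x, |pd k φ x| ≤ L := by
  set δ := ε / 2 with hδ
  have hδ0 : 0 < δ := by positivity
  -- Thresholding creates room at the boundary: V vanishes wherever |W| ≤ δ. A radius over which W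
  -- varies by at most δ/2 keeps the support of the mollification in {|W| ≥ δ/2}, a closed subset of
  -- the bounded set Ω.
  set V : E d → ℝ := fun x => W x - max (-δ) (min δ (W x)) with hV
  have hVL : LipschitzWith L V := LipschitzWith.of_dist_le_mul fun x y =>
    (abs_shrink_sub_le hδ0.le (W x) (W y)).trans (hW.dist_le_mul x y)
  obtain ⟨n, hn⟩ : ∃ n : ℕ, (L : ℝ) * (1 / ((n : ℝ) + 1)) ≤ δ / 2 := by
    have : Tendsto (fun n : ℕ => (L : ℝ) * (1 / ((n : ℝ) + 1))) atTop (𝓝 (L * 0)) :=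
      tendsto_one_div_add_atTop_nhds_zero_nat.const_mul _
    rw [mul_zero] at this
    obtain ⟨n, hn⟩ := (this.eventually (gt_mem_nhds (half_pos hδ0))).exists
    exact ⟨n, hn.le⟩
  have hclose : ∀ {F : E d → ℝ}, LipschitzWith L F → ∀ x, ∀ y ∈ Metric.ball x (1 / ((n : ℝ) + 1)),
      |F y - F x| ≤ δ / 2 := by
    intro F hF x y hy
    refine (hF.dist_le_mul y x).trans (le_trans ?_ hn)
    exact mul_le_mul_of_nonneg_left (Metric.mem_ball.1 hy).le L.2
  have hVl : LocallyIntegrable V := hVL.continuous.locallyIntegrable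
  have hsub : Function.support (mol n V) ⊆ {x | δ / 2 ≤ |W x|} := by
    intro x hx
    by_contra hlt
    rw [mem_ofPred_eq, not_le] at hlt
    refine hx (abs_eq_zero.1 (le_antisymm (abs_mol_le (Eventually.of_forall fun y hy => ?_))
      (abs_nonneg _)))
    have h1 := hclose hW x y hy
    have h2 : |W y| ≤ δ := by
      have := abs_sub_abs_le_abs_sub (W y) (W x)
      linarith
    simp only [hV, shrink_eq_zero h2, abs_zero, le_refl]
  have hclosed : IsClosed {x | δ / 2 ≤ |W x|} :=
    isClosed_le continuous_const hW.continuous.abs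
  have hsubΩ : {x | δ / 2 ≤ |W x|} ⊆ Ω := by
    intro x hx
    by_contra hxΩ
    rw [mem_ofPred_eq, h0 x hxΩ, abs_zero] at hx
    linarith
  have hts : tsupport (mol n V) ⊆ {x | δ / 2 ≤ |W x|} := closure_minimal hsub hclosed
  refine ⟨mol n V, ⟨contDiff_mol n hVl, ?_, hts.trans hsubΩ⟩, fun x => ?_, fun k x => ?_⟩
  · exact Metric.isCompact_of_isClosed_isBounded (isClosed_tsupport _)
      (hb.subset (hts.trans hsubΩ))
  · have h1 : |mol n V x - V x| ≤ δ / 2 := abs_mol_sub_le hVl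
      (Eventually.of_forall fun y hy => hclose hVL x y hy)
    have h2 : |W x - V x| ≤ δ := by
      have : W x - V x = max (-δ) (min δ (W x)) := by simp only [hV]; ring
      rw [this]; exact abs_sub_shrink_le hδ0.le _
    have h3 : W x - mol n V x = (W x - V x) - (mol n V x - V x) := by ring
    rw [h3]
    refine (abs_sub _ _).trans ?_
    linarith
  · rw [pd_mol hVl (LipschitzWith.weakDeriv hVL k) (subset_univ _)]
    exact abs_mol_le (Eventually.of_forall fun y _ => abs_lineDeriv_single_le hVL k y)

/-- Test functions converge to W uniformly with gradients bounded by L, so `mem_H10_of_bounded`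
applies. No regularity of the boundary enters, only the vanishing of W outside Ω. -/
theorem exists_H10_of_lipschitz (hΩ : IsOpen Ω) (hb : Bornology.IsBounded Ω) {W : E d → ℝ}
    {L : ℝ≥0} (hW : LipschitzWith L W) (h0 : ∀ x ∉ Ω, W x = 0) :
    ∃ v ∈ H10 Ω, (val v : E d → ℝ) =ᵐ[volume.restrict Ω] W ∧
      ∀ k, (D1 k v : E d → ℝ) =ᵐ[volume.restrict Ω]
        fun x => lineDeriv ℝ W x (EuclideanSpace.single k 1) := by
  have : IsFiniteMeasure (volume.restrict Ω) := ⟨by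
    rw [Measure.restrict_apply_univ]; exact hb.measure_lt_top⟩
  have hcs : HasCompactSupport W := by
    refine HasCompactSupport.of_support_subset_isCompact hb.isCompact_closure fun x hx => ?_
    by_contra hxΩ
    exact hx (h0 x fun h => hxΩ (subset_closure h))
  have hm : MemLp W 2 (volume.restrict Ω) :=
    (hW.continuous.memLp_of_hasCompactSupport hcs).restrict Ω
  have hm' : ∀ k : Fin d, MemLp (fun x => lineDeriv ℝ W x (EuclideanSpace.single k 1)) 2
      (volume.restrict Ω) := fun k =>
    MemLp.of_bound (aestronglyMeasurable_lineDeriv hW.continuous _) L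
      (Eventually.of_forall fun x => abs_lineDeriv_single_le hW k x)
  have hwp : ∀ i, IsWeakPartial Ω i (hm.toLp W) ((hm' i).toLp _) := by
    intro i φ hφ
    have key := LipschitzWith.setIntegral_mul_pd hW hφ i
    rw [← (integral_congr_ae (hm.coeFn_toLp.mono fun x hx => by simp only [hx]) :
      ∫ x in Ω, hm.toLp W x * pd i φ x = _)] at key
    rw [key]
    congr 1
    exact (integral_congr_ae ((hm' i).coeFn_toLp.mono fun x hx => by simp only [hx])).symm
  refine ⟨mkH1 _ _ hwp, ?_, ?_, fun k => ?_⟩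
  · set A : ℝ := (measureUnivNNReal (volume.restrict Ω) : ℝ) ^ (2 : ℝ≥0∞).toReal⁻¹ with hA
    have hA0 : 0 ≤ A := by positivity
    refine mem_H10_of_bounded hΩ (C := A * L) (by positivity) fun ε hε => ?_
    obtain ⟨φ, hφ, h1, h2⟩ := exists_isTest_of_lipschitz hb hW h0 (ε := ε / (A + 1)) (by positivity)
    refine ⟨hφ.toH, hφ.toH_mem, fun k => ?_, ?_⟩
    · rw [hφ.D1_toH]
      refine Lp.norm_le_of_ae_bound L.2 ?_
      filter_upwards [(hφ.memLp_pd k).coeFn_toLp] with x hx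
      rw [hx]; exact h2 k x
    · have e : val (mkH1 _ _ hwp - hφ.toH) = hm.toLp W - hφ.memLp.toLp φ := by
        have h3 : val (mkH1 _ _ hwp - hφ.toH) = val (mkH1 _ _ hwp) - val hφ.toH := rfl
        rw [h3, hφ.val_toH, val_mkH1]
      rw [e]
      calc _ ≤ A * (ε / (A + 1)) := by
            refine Lp.norm_le_of_ae_bound (by positivity) ?_
            filter_upwards [hφ.memLp.coeFn_toLp, hm.coeFn_toLp,
              Lp.coeFn_sub (hm.toLp W) (hφ.memLp.toLp φ)] with x hx hx' hx''
            rw [hx'', Pi.sub_apply, hx, hx']; exact h1 x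
        _ ≤ ε := by
            rw [mul_div_assoc', div_le_iff₀ (by positivity)]
            nlinarith
  · rw [val_mkH1]; exact hm.coeFn_toLp
  · rw [D1_mkH1]; exact (hm' k).coeFn_toLp

end Lipschitz
end EnsembleNSE
end


noncomputable section

namespace EnsembleNSE
open MeasureTheory Set Filter Topology
open scoped ContDiff NNReal ENNReal

/-! ### From elements to the domain; approximation of the pressure -/

section Cells

variable {d : ℕ} {Ω : Set (E d)} {𝒯 : Mesh d} {s : Finset (E d)}

theorem interior_cell_subset (hΩ : IsLipschitzDomain Ω) (h𝒯 : IsTriangulation Ω 𝒯)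
    (hs : s ∈ elements 𝒯) : interior (cell s) ⊆ Ω :=
  (interior_mono (cell_subset_closure h𝒯 hs)).trans (interior_closure_subset hΩ)

/-- The boundary of a convex set is null, and there are finitely many elements. -/
theorem ae_exists_mem_interior_cell (h𝒯 : IsTriangulation Ω 𝒯) :
    ∀ᵐ x, x ∈ Ω → ∃ s ∈ elements 𝒯, x ∈ interior (cell s) := by
  have h : ∀ᵐ x, ∀ s ∈ elements 𝒯, x ∉ frontier (cell s) := by
    rw [ae_ball_iff (elements_finite h𝒯).countable]
    intro s _
    exact measure_eq_zero_iff_ae_notMem.1 ((convex_cell s).addHaar_frontier volume)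
  filter_upwards [h] with x hx hxΩ
  obtain ⟨s, hs, hxs⟩ := exists_mem_cell h𝒯 (subset_closure hxΩ)
  refine ⟨s, hs, ?_⟩
  by_contra hn
  exact hx s hs ⟨subset_closure hxs, hn⟩

theorem norm_sq_eq_sum_cells (hΩ : IsLipschitzDomain Ω) (h𝒯 : IsTriangulation Ω 𝒯) (g : L2 Ω) :
    ‖g‖ ^ 2 = ∑ s ∈ (elements_finite h𝒯).toFinset, lnorm (interior (cell s)) (ext0 g) ^ 2 := by
  have h_int : Integrable fun x => ext0 g x ^ 2 :=
    (memLp_ext0 hΩ.isOpen.measurableSet g).integrable_sq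
  have h1 : ‖g‖ ^ 2 = ∫ x in Ω, ext0 g x ^ 2 := by
    rw [← real_inner_self_eq_norm_sq, L2.inner_def]
    refine setIntegral_congr_fun hΩ.isOpen.measurableSet fun x hx => ?_
    simp [ext0, hx, sq]
  have h2 : (Ω : Set (E d)) =ᵐ[volume] ⋃ s ∈ (elements_finite h𝒯).toFinset, interior (cell s) := by
    filter_upwards [ae_exists_mem_interior_cell h𝒯] with x hx
    refine propext ⟨fun hxΩ => ?_, fun h => ?_⟩
    · obtain ⟨s, hs, hxs⟩ := hx hxΩ
      exact mem_biUnion ((elements_finite h𝒯).mem_toFinset.2 hs) hxs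
    · obtain ⟨s, hs, hxs⟩ := mem_iUnion₂.1 h
      exact interior_cell_subset hΩ h𝒯 ((elements_finite h𝒯).mem_toFinset.1 hs) hxs
  rw [h1, setIntegral_congr_set h2, integral_biUnion_finset _
    (fun s _ => isOpen_interior.measurableSet) ?_ fun s _ => h_int.integrableOn]
  · exact Finset.sum_congr rfl fun s _ => (sq_lnorm _ _).symm
  · intro s hs t ht hst
    exact disjoint_interior_cell ((elements_finite h𝒯).mem_toFinset.1 hs)
      ((elements_finite h𝒯).mem_toFinset.1 ht) hst

/-- The element lies in a ball of radius its diameter. Half the radius of shape regularity is used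
for the inner ball so that even the closed ball lies in the open element. -/
theorem volume_real_interior_cell_le (hd : 0 < d) (hs : s ∈ elements 𝒯) {σ : ℝ} (hσ : 0 < σ)
    (c : E d) : volume.real (interior (cell s)) ≤
      (2 / σ) ^ d * volume.real (Metric.ball c (σ * Metric.diam (cell s) / 2)) := by
  have hD := diam_cell_pos hd hs
  obtain ⟨a, ha⟩ := interior_cell_nonempty hs
  have h1 : interior (cell s) ⊆ Metric.closedBall a (Metric.diam (cell s)) := fun x hx =>
    Metric.dist_le_diam_of_mem (isBounded_cell s) (interior_subset hx) (interior_subset ha)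
  have h2 : volume.real (Metric.closedBall a (Metric.diam (cell s))) =
      Metric.diam (cell s) ^ d * volume.real (Metric.ball (0 : E d) 1) := by
    have : Nonempty (Fin d) := ⟨⟨0, hd⟩⟩
    have : Nontrivial (E d) := inferInstance
    rw [← volume_real_ball a hD, measureReal_def, measureReal_def,
      Measure.addHaar_closedBall_eq_addHaar_ball]
  refine (measureReal_mono h1 measure_closedBall_lt_top.ne).trans (le_of_eq ?_)
  rw [h2, volume_real_ball c (by positivity), ← mul_assoc, ← mul_pow]
  congr 2
  field_simp

/-- Turns pointwise bounds on elements into a global L² bound. Squaring and integrating over an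
element multiplies by its volume, which shape regularity compares with that of the inner ball, so
the factor 1/V disappears. Cauchy–Schwarz over the index set then permits summation over elements.
-/
theorem norm_le_of_cells (hd : 0 < d) (hΩ : IsLipschitzDomain Ω) (h𝒯 : IsTriangulation Ω 𝒯)
    {σ : ℝ} (hσ : 0 < σ) (hreg : IsShapeRegular σ 𝒯) {ι : Type*} [Fintype ι] {g : L2 Ω}
    {G : ι → L2 Ω} {κ N : ℝ} (hκ : 0 ≤ κ) (hN : 0 ≤ N) (hGN : ∀ i, ‖G i‖ ≤ N)
    (h : ∀ s ∈ elements 𝒯, ∀ c, Metric.closedBall c (σ * Metric.diam (cell s)) ⊆ cell s →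
      ∀ᵐ x, x ∈ interior (cell s) → |ext0 g x| ≤ κ * (2 * Metric.diam (cell s) ^ 2 *
        (Real.sqrt (volume.real (Metric.ball c (σ * Metric.diam (cell s) / 2))))⁻¹ *
        ∑ i, lnorm (interior (cell s)) (ext0 (G i)))) :
    ‖g‖ ≤ 2 * κ * Real.sqrt ((2 / σ) ^ d) * Fintype.card ι * meshSize 𝒯 ^ 2 * N := by
  have hΩm := hΩ.isOpen.measurableSet
  have hm : 0 < meshSize 𝒯 := meshSize_pos hd hΩ.isConnected.nonempty h𝒯
  set A : ℝ := κ ^ 2 * (4 * meshSize 𝒯 ^ 4 * (2 / σ) ^ d * Fintype.card ι) with hA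
  have hA0 : 0 ≤ A := by positivity
  have hcell : ∀ s ∈ (elements_finite h𝒯).toFinset, lnorm (interior (cell s)) (ext0 g) ^ 2 ≤
      A * ∑ i, lnorm (interior (cell s)) (ext0 (G i)) ^ 2 := by
    intro s hs'
    have hs := (elements_finite h𝒯).mem_toFinset.1 hs'
    obtain ⟨c, hc⟩ := hreg s hs
    have hD := diam_cell_pos hd hs
    have hDm := diam_cell_le_meshSize h𝒯 hs
    set D := Metric.diam (cell s)
    set K := interior (cell s) with hK
    set V := volume.real (Metric.ball c (σ * D / 2)) with hV
    have hV0 : 0 < V := by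
      rw [hV, measureReal_def]
      exact ENNReal.toReal_pos (Metric.measure_ball_pos volume c (by positivity)).ne'
        measure_ball_lt_top.ne
    set S := ∑ i, lnorm K (ext0 (G i)) with hS
    have hKfin : volume K ≠ ⊤ :=
      ((isBounded_cell s).subset interior_subset).measure_lt_top.ne
    have h1 : lnorm K (ext0 g) ^ 2 ≤ (κ * (2 * D ^ 2 * (Real.sqrt V)⁻¹ * S)) ^ 2 * volume.real K := by
      rw [sq_lnorm]
      have : ∫ x in K, ext0 g x ^ 2 ≤ ∫ _ in K, (κ * (2 * D ^ 2 * (Real.sqrt V)⁻¹ * S)) ^ 2 := by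
        refine setIntegral_mono_on_ae (memLp_ext0 hΩm g).integrable_sq.integrableOn
          (integrableOn_const hKfin) isOpen_interior.measurableSet ?_
        filter_upwards [h s hs c hc] with x hx hxK
        exact sq_le_sq' (neg_le_of_abs_le (hx hxK)) (le_of_abs_le (hx hxK))
      rwa [setIntegral_const, smul_eq_mul, mul_comm] at this
    have h2 : volume.real K ≤ (2 / σ) ^ d * V := volume_real_interior_cell_le hd hs hσ c
    have h3 : S ^ 2 ≤ Fintype.card ι * ∑ i, lnorm K (ext0 (G i)) ^ 2 := by
      have := sq_sum_le_card_mul_sum_sq (s := Finset.univ) (f := fun i => lnorm K (ext0 (G i)))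
      simpa using this
    have h4 : ((Real.sqrt V)⁻¹) ^ 2 = V⁻¹ := by rw [inv_pow, Real.sq_sqrt hV0.le]
    have h5 : D ^ 4 ≤ meshSize 𝒯 ^ 4 := pow_le_pow_left₀ hD.le hDm 4
    calc lnorm K (ext0 g) ^ 2
        ≤ (κ * (2 * D ^ 2 * (Real.sqrt V)⁻¹ * S)) ^ 2 * ((2 / σ) ^ d * V) :=
          h1.trans (mul_le_mul_of_nonneg_left h2 (sq_nonneg _))
      _ = κ ^ 2 * (4 * D ^ 4 * (2 / σ) ^ d) * S ^ 2 * (V * ((Real.sqrt V)⁻¹) ^ 2) := by ring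
      _ = κ ^ 2 * (4 * D ^ 4 * (2 / σ) ^ d) * S ^ 2 := by
          rw [h4, mul_inv_cancel₀ hV0.ne', mul_one]
      _ ≤ κ ^ 2 * (4 * meshSize 𝒯 ^ 4 * (2 / σ) ^ d) *
          (Fintype.card ι * ∑ i, lnorm K (ext0 (G i)) ^ 2) := by gcongr
      _ = _ := by rw [hA]; ring
  have hsq : ‖g‖ ^ 2 ≤ A * (Fintype.card ι * N ^ 2) := by
    rw [norm_sq_eq_sum_cells hΩ h𝒯 g]
    calc _ ≤ ∑ s ∈ (elements_finite h𝒯).toFinset,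
          A * ∑ i, lnorm (interior (cell s)) (ext0 (G i)) ^ 2 := Finset.sum_le_sum hcell
      _ = A * ∑ i, ‖G i‖ ^ 2 := by
          rw [← Finset.mul_sum, Finset.sum_comm]
          congr 1
          exact Finset.sum_congr rfl fun i _ => (norm_sq_eq_sum_cells hΩ h𝒯 (G i)).symm
      _ ≤ A * ∑ _i : ι, N ^ 2 := by
          gcongr with i
          exact hGN i
      _ = _ := by simp
  refine abs_le_of_sq_le_sq' (hsq.trans (le_of_eq ?_)) (by positivity) |>.2
  rw [hA]
  have : Real.sqrt ((2 / σ) ^ d) ^ 2 = (2 / σ) ^ d := Real.sq_sqrt (by positivity)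
  calc _ = κ ^ 2 * (4 * meshSize 𝒯 ^ 4 * Real.sqrt ((2 / σ) ^ d) ^ 2 * Fintype.card ι) *
        (Fintype.card ι * N ^ 2) := by rw [this]
    _ = _ := by ring

/-- The averaged Taylor polynomial on an element. -/
theorem abs_sub_affApprox_cell_le (hd : 0 < d) (hd3 : d ≤ 3) (hΩ : IsLipschitzDomain Ω)
    (h𝒯 : IsTriangulation Ω 𝒯) {σ : ℝ} (hσ : 0 < σ) (u : H 2 Ω) (hs : s ∈ elements 𝒯) {c : E d}
    (hc : Metric.closedBall c (σ * Metric.diam (cell s)) ⊆ cell s) {x : E d}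
    (hx : x ∈ interior (cell s)) (hxc : x ∈ convSet (ext0 (val u))) :
    |ext0 (val u) x - affApprox (Metric.ball c (σ * Metric.diam (cell s) / 2)) u x| ≤
      2 * Metric.diam (cell s) ^ 2 *
        (Real.sqrt (volume.real (Metric.ball c (σ * Metric.diam (cell s) / 2))))⁻¹ *
        hess (interior (cell s)) u := by
  have hD := diam_cell_pos hd hs
  have hpos : 0 < σ * Metric.diam (cell s) := by positivity
  refine abs_sub_affApprox_le hd3 hΩ.isOpen.measurableSet hΩ.isBounded u isOpen_interior
    (convex_cell s).interior (interior_cell_subset hΩ h𝒯 hs) (by positivity) ?_ ?_ hx hxc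
  · refine (Metric.closedBall_subset_ball (half_lt_self hpos)).trans ?_
    exact interior_maximal (Metric.ball_subset_closedBall.trans hc) Metric.isOpen_ball
  · intro x hx y hy
    rw [← dist_eq_norm]
    exact Metric.dist_le_diam_of_mem (isBounded_cell s) (interior_subset hx) (interior_subset hy)

theorem hess_eq_sum (K : Set (E d)) (u : H 2 Ω) :
    hess K u = ∑ ij : Fin d × Fin d, lnorm K (ext0 (D1 ij.2 (DH ij.1 u))) := by
  rw [Fintype.sum_prod_type]; rfl

theorem interp1_affApprox (hs : s ∈ elements 𝒯) (B : Set (E d)) (u : H 2 Ω) (x : E d) :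
    interp1 s x (affApprox B u) = affApprox B u x := by
  have e : affApprox B u = (fun _ => (volume.real B)⁻¹ *
      (∫ y in B, (ext0 (val u) y - ∑ i, y i * ext0 (D1 i u) y))) +
      ∑ i, slope B u i • (fun y : E d => y i) := by
    ext y
    simp [affApprox, Finset.sum_apply]
  rw [e, map_add, map_sum, interp1_const hs]
  simp only [map_smul, interp1_coord hs]
  simp [Finset.sum_apply]

theorem memLp_of_continuousOn_closure (hΩ : IsOpen Ω) (hb : Bornology.IsBounded Ω) {f : E d → ℝ}
    (hf : ContinuousOn f (closure Ω)) : MemLp f 2 (volume.restrict Ω) := by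
  have : IsFiniteMeasure (volume.restrict Ω) := ⟨by
    rw [Measure.restrict_apply_univ]; exact hb.measure_lt_top⟩
  obtain ⟨C, hC⟩ := hb.isCompact_closure.exists_bound_of_continuousOn hf
  refine MemLp.of_bound ((hf.mono subset_closure).aestronglyMeasurable hΩ.measurableSet) C ?_
  filter_upwards [ae_restrict_mem hΩ.measurableSet] with x hx using hC x (subset_closure hx)

/-- Linear interpolation of the boundary-continuous values of p. It reproduces the affine Taylor
polynomial a, so the error is p − a minus the interpolant of p − a; each is bounded by the Taylor
remainder, whence κ = 2. -/
theorem exists_pressure_approx (hd : 0 < d) (hd3 : d ≤ 3) (hΩ : IsLipschitzDomain Ω)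
    (h𝒯 : IsTriangulation Ω 𝒯) {σ : ℝ} (hσ : 0 < σ) (hreg : IsShapeRegular σ 𝒯) (p : H 2 Ω) :
    ∃ q ∈ FE Ω 𝒯 1, ‖val p - q‖ ≤
      2 * 2 * Real.sqrt ((2 / σ) ^ d) * Fintype.card (Fin d × Fin d) * meshSize 𝒯 ^ 2 * ‖p‖ := by
  have hΩm := hΩ.isOpen.measurableSet
  have hloc : LocallyIntegrable (ext0 (val p)) :=
    (integrable_ext0 hΩm hΩ.isBounded _).locallyIntegrable
  have hex : ∀ x₀, ∃ l : ℝ, x₀ ∈ closure Ω →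
      Tendsto (ext0 (val p)) (𝓝[Ω ∩ convSet (ext0 (val p))] x₀) (𝓝 l) := by
    intro x₀
    by_cases hx : x₀ ∈ closure Ω
    · obtain ⟨l, hl⟩ := exists_tendsto_closure hd3 hΩ p hx
      exact ⟨l, fun _ => hl⟩
    · exact ⟨0, fun h => absurd h hx⟩
  choose f hf using hex
  have hm := memLp_of_continuousOn_closure hΩ.isOpen hΩ.isBounded (continuousOn_pl h𝒯 f)
  refine ⟨hm.toLp _, ⟨_, isPiecewisePoly_pl h𝒯 f, hm.coeFn_toLp⟩, ?_⟩
  refine norm_le_of_cells hd hΩ h𝒯 hσ hreg (G := fun ij : Fin d × Fin d => D1 ij.2 (DH ij.1 p))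
    zero_le_two (norm_nonneg _) (fun ij => (norm_D1_le _ _).trans (norm_DH_le _ _)) ?_
  intro s hs c hc
  rw [← hess_eq_sum]
  set η := 2 * Metric.diam (cell s) ^ 2 *
    (Real.sqrt (volume.real (Metric.ball c (σ * Metric.diam (cell s) / 2))))⁻¹ *
      hess (interior (cell s)) p with hη
  set a := affApprox (Metric.ball c (σ * Metric.diam (cell s) / 2)) p with ha
  have hac : Continuous a := by rw [ha]; unfold affApprox; fun_prop
  -- The nodal value is a limit from all of Ω, in particular from within this element, and so
  -- inherits the bound that holds at the points of convergence there.
  have hnode : ∀ v ∈ s, |(f - a) v| ≤ η := by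
    intro v hv
    have hvc : v ∈ cell s := subset_cell hv
    have h1 := hf v (cell_subset_closure h𝒯 hs hvc)
    have h2 : Tendsto (ext0 (val p)) (𝓝[interior (cell s) ∩ convSet (ext0 (val p))] v)
        (𝓝 (f v)) :=
      h1.mono_left (nhdsWithin_mono _ (inter_subset_inter_left _ (interior_cell_subset hΩ h𝒯 hs)))
    have h3 : (𝓝[interior (cell s) ∩ convSet (ext0 (val p))] v).NeBot := by
      rw [← mem_closure_iff_nhdsWithin_neBot]
      refine closure_inter_convSet isOpen_interior hloc ?_
      rwa [closure_interior_cell hs]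
    have h4 : Tendsto (fun x => |ext0 (val p) x - a x|)
        (𝓝[interior (cell s) ∩ convSet (ext0 (val p))] v) (𝓝 |f v - a v|) :=
      (h2.sub (hac.tendsto v |>.mono_left nhdsWithin_le_nhds)).abs
    refine le_of_tendsto h4 ?_
    filter_upwards [self_mem_nhdsWithin] with x hx
    exact abs_sub_affApprox_cell_le hd hd3 hΩ h𝒯 hσ p hs hc hx.1 hx.2
  have hsub := Lp.coeFn_sub (val p) (hm.toLp (pl 𝒯 f))
  have hq := hm.coeFn_toLp
  rw [Filter.EventuallyEq, ae_restrict_iff' hΩm] at hsub hq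
  filter_upwards [ae_mem_convSet hloc, hsub, hq] with x hxc h1 h2 hx
  have hxΩ := interior_cell_subset hΩ h𝒯 hs hx
  have hxs := interior_subset hx
  have e1 : ext0 (val p - hm.toLp (pl 𝒯 f)) x = ext0 (val p) x - pl 𝒯 f x := by
    simp only [ext0, indicator_of_mem hxΩ]
    rw [h1 hxΩ, Pi.sub_apply, h2 hxΩ]
  have e2 : pl 𝒯 f x = interp1 s x (f - a) + a x := by
    rw [pl_eq hs hxs, map_sub, interp1_affApprox hs]; ring
  have b1 := abs_sub_affApprox_cell_le hd hd3 hΩ h𝒯 hσ p hs hc hx hxc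
  have b2 := abs_interp1_le hs hxs hnode
  rw [e1, e2]
  have e3 : ext0 (val p) x - (interp1 s x (f - a) + a x) =
    (ext0 (val p) x - a x) - interp1 s x (f - a) := by ring
  rw [e3]
  refine (abs_sub _ _).trans ?_
  linarith

end Cells
end EnsembleNSE
end


noncomputable section

namespace EnsembleNSE
open MeasureTheory Set Filter Topology
open scoped ContDiff NNReal ENNReal

/-! ### Approximation of the velocity -/

section Velocity

variable {d : ℕ} {Ω : Set (E d)} {𝒯 : Mesh d} {s : Finset (E d)}

/-- The quadratic polynomial with gradient `a + S x`. -/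
def quad (a : Fin d → ℝ) (S : Fin d → Fin d → ℝ) : E d → ℝ :=
  ∑ k, a k • (fun y : E d => y k) + ∑ k, ∑ i, (S k i / 2) • fun y : E d => y i * y k

theorem quad_apply (a : Fin d → ℝ) (S : Fin d → Fin d → ℝ) (x : E d) :
    quad a S x = ∑ k, a k * x k + ∑ k, ∑ i, S k i / 2 * (x i * x k) := by
  simp [quad, Finset.sum_apply]

theorem contDiff_quad (a : Fin d → ℝ) (S : Fin d → Fin d → ℝ) :
    ContDiff ℝ (⊤ : ℕ∞) (quad a S) := by
  have : quad a S = fun x => ∑ k, a k * x k + ∑ k, ∑ i, S k i / 2 * (x i * x k) :=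
    funext (quad_apply a S)
  rw [this]; fun_prop

theorem pd_quad (a : Fin d → ℝ) {S : Fin d → Fin d → ℝ} (hS : ∀ i k, S i k = S k i) (l : Fin d)
    (x : E d) : pd l (quad a S) x = a l + ∑ i, S l i * x i := by
  have hc : ∀ k : Fin d, HasFDerivAt (fun y : E d => y k) (EuclideanSpace.proj k : E d →L[ℝ] ℝ) x :=
    fun k => (EuclideanSpace.proj k : E d →L[ℝ] ℝ).hasFDerivAt
  have h := (HasFDerivAt.fun_sum (u := Finset.univ) fun k _ => (hc k).const_mul (a k)).add
    (HasFDerivAt.fun_sum (u := Finset.univ) fun k _ => HasFDerivAt.fun_sum (u := Finset.univ)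
      fun i _ => ((hc i).mul (hc k)).const_mul (S k i / 2))
  have e : quad a S = fun x => ∑ k, a k * x k + ∑ k, ∑ i, S k i / 2 * (x i * x k) :=
    funext (quad_apply a S)
  rw [pd, e]
  refine (congrArg (fun l' : E d →L[ℝ] ℝ => l' (EuclideanSpace.single l 1)) h.fderiv).trans ?_
  have hp : ∀ k : Fin d, (EuclideanSpace.proj k : E d →L[ℝ] ℝ) (EuclideanSpace.single l 1) =
      if k = l then 1 else 0 := fun k => by simp [PiLp.single_apply]
  simp only [add_apply, sum_apply, smul_apply, smul_eq_mul, hp, mul_add, Finset.sum_add_distrib,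
    mul_ite, mul_one, mul_zero]
  simp only [Finset.sum_ite_eq', Finset.mem_univ, if_true, Finset.sum_ite_irrel,
    Finset.sum_const_zero]
  rw [← Finset.sum_add_distrib]
  congr 1
  refine Finset.sum_congr rfl fun i _ => ?_
  rw [hS i l]; ring

theorem interp2_quad (hs : s ∈ elements 𝒯) (a : Fin d → ℝ) (S : Fin d → Fin d → ℝ) (x : E d) :
    interp2 s x (quad a S) = quad a S x := by
  rw [quad_apply, quad, map_add, map_sum, map_sum]
  simp only [map_sum, map_smul, smul_eq_mul, interp2_coord hs, interp2_coord_mul hs]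

/-- The quadratic polynomial whose derivatives are the averaged Taylor polynomials of the
derivatives of `u`. -/
theorem exists_quad (B : Set (E d)) (u : H 3 Ω) :
    ∃ (a : Fin d → ℝ) (S : Fin d → Fin d → ℝ), ∀ k x, pd k (quad a S) x = affApprox B (DH k u) x :=
  -- The quadratic part comes from the averaged second derivatives; their symmetry makes its
  -- gradient equal to the prescribed affine fields.
  ⟨_, fun k i => slope B (DH k u) i, fun k x => pd_quad _ (fun i k => by
    simp only [slope, D1_DH_comm i k u]) k x⟩

/-- The bound for the Taylor remainder of the derivatives of `u` on an element. -/
def rem (σ : ℝ) (s : Finset (E d)) (c : E d) (u : H 3 Ω) : ℝ :=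
  2 * Metric.diam (cell s) ^ 2 *
    (Real.sqrt (volume.real (Metric.ball c (σ * Metric.diam (cell s) / 2))))⁻¹ *
    ∑ ijk : Fin d × Fin d × Fin d, lnorm (interior (cell s)) (ext0 (D1 ijk.2.2 (DH ijk.2.1 (DH ijk.1 u))))

theorem rem_nonneg (σ : ℝ) (s : Finset (E d)) (c : E d) (u : H 3 Ω) : 0 ≤ rem σ s c u :=
  mul_nonneg (by positivity) (Finset.sum_nonneg fun _ _ => lnorm_nonneg _ _)

theorem ae_abs_sub_le_rem (hd : 0 < d) (hd3 : d ≤ 3) (hΩ : IsLipschitzDomain Ω)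
    (h𝒯 : IsTriangulation Ω 𝒯) {σ : ℝ} (hσ : 0 < σ) (u : H 3 Ω) (hs : s ∈ elements 𝒯) {c : E d}
    (hc : Metric.closedBall c (σ * Metric.diam (cell s)) ⊆ cell s) (k : Fin d) :
    ∀ᵐ x, x ∈ interior (cell s) → |ext0 (D1 k u) x -
      affApprox (Metric.ball c (σ * Metric.diam (cell s) / 2)) (DH k u) x| ≤ rem σ s c u := by
  have hloc : LocallyIntegrable (ext0 (val (DH k u))) :=
    (integrable_ext0 hΩ.isOpen.measurableSet hΩ.isBounded _).locallyIntegrable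
  filter_upwards [ae_mem_convSet hloc] with x hxc hx
  have h := abs_sub_affApprox_cell_le hd hd3 hΩ h𝒯 hσ (DH k u) hs hc hx hxc
  rw [val_DH] at h
  refine h.trans (mul_le_mul_of_nonneg_left ?_ (by positivity))
  rw [hess_eq_sum, Fintype.sum_prod_type (f := fun ijk : Fin d × Fin d × Fin d =>
    lnorm (interior (cell s)) (ext0 (D1 ijk.2.2 (DH ijk.2.1 (DH ijk.1 u)))))]
  exact Finset.single_le_sum (f := fun k => ∑ ij : Fin d × Fin d,
    lnorm (interior (cell s)) (ext0 (D1 ij.2 (DH ij.1 (DH k u)))))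
    (fun _ _ => Finset.sum_nonneg fun _ _ => lnorm_nonneg _ _) (Finset.mem_univ k)

/-- Derivatives of an H³ function are bounded on each element, by an affine function plus a
remainder. The constant may depend on the mesh: it is used only to know that u has a Lipschitz
representative. -/
theorem exists_ae_bound_D1 (hd : 0 < d) (hd3 : d ≤ 3) (hΩ : IsLipschitzDomain Ω)
    (h𝒯 : IsTriangulation Ω 𝒯) {σ : ℝ} (hσ : 0 < σ) (hreg : IsShapeRegular σ 𝒯) (u : H 3 Ω) :
    ∃ C : ℝ, 0 ≤ C ∧ ∀ k, ∀ᵐ x, |ext0 (D1 k u) x| ≤ C := by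
  have hcell : ∀ (s : elements 𝒯) (k : Fin d), ∃ C : ℝ, 0 ≤ C ∧
      ∀ᵐ x, x ∈ interior (cell (s : Finset (E d))) → |ext0 (D1 k u) x| ≤ C := by
    rintro ⟨s, hs⟩ k
    obtain ⟨c, hc⟩ := hreg s hs
    set a := affApprox (Metric.ball c (σ * Metric.diam (cell s) / 2)) (DH k u) with ha
    have hac : Continuous a := by rw [ha]; unfold affApprox; fun_prop
    obtain ⟨M, hM⟩ := (isCompact_cell s).exists_bound_of_continuousOn hac.continuousOn
    refine ⟨rem σ s c u + |M|, add_nonneg (rem_nonneg _ _ _ _) (abs_nonneg M), ?_⟩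
    filter_upwards [ae_abs_sub_le_rem hd hd3 hΩ h𝒯 hσ u hs hc k] with x hx hxs
    have h1 := hx hxs
    have h2 : |a x| ≤ M := hM x (interior_subset hxs)
    have e : ext0 (D1 k u) x = (ext0 (D1 k u) x - a x) + a x := by ring
    rw [e]
    exact (abs_add_le _ _).trans (add_le_add h1 (h2.trans (le_abs_self M)))
  choose C hC0 hC using hcell
  have := (elements_finite h𝒯).to_subtype
  have := Fintype.ofFinite (elements 𝒯)
  refine ⟨∑ s, ∑ k, C s k, Finset.sum_nonneg fun s _ => Finset.sum_nonneg fun k _ => hC0 s k,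
    fun k => ?_⟩
  have hall : ∀ᵐ x, ∀ s : elements 𝒯, x ∈ interior (cell (s : Finset (E d))) →
      |ext0 (D1 k u) x| ≤ C s k := ae_all_iff.2 fun s => hC s k
  filter_upwards [hall, ae_exists_mem_interior_cell h𝒯] with x h1 h2
  by_cases hx : x ∈ Ω
  · obtain ⟨s, hs, hxs⟩ := h2 hx
    refine (h1 ⟨s, hs⟩ hxs).trans ?_
    refine (Finset.single_le_sum (f := fun k => C ⟨s, hs⟩ k) (fun k _ => hC0 _ k)
      (Finset.mem_univ k)).trans ?_
    exact Finset.single_le_sum (f := fun s => ∑ k, C s k)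
      (fun s _ => Finset.sum_nonneg fun k _ => hC0 s k) (Finset.mem_univ _)
  · rw [ext0, indicator_of_notMem hx, abs_zero]
    exact Finset.sum_nonneg fun s _ => Finset.sum_nonneg fun k _ => hC0 s k

/-- The continuous representative of a function in `H³(Ω) ∩ H₀¹(Ω)`. -/
theorem exists_lipschitz_rep_of_H3 (hd : 0 < d) (hd3 : d ≤ 3) (hΩ : IsLipschitzDomain Ω)
    (h𝒯 : IsTriangulation Ω 𝒯) {σ : ℝ} (hσ : 0 < σ) (hreg : IsShapeRegular σ 𝒯) (u : H 3 Ω)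
    (hu : toH1 u ∈ H10 Ω) : ∃ w : E d → ℝ, Continuous w ∧ (∀ x ∉ Ω, w x = 0) ∧
      EqOn w (ext0 (val u)) (convSet (ext0 (val u))) := by
  obtain ⟨C, hC0, hC⟩ := exists_ae_bound_D1 hd hd3 hΩ h𝒯 hσ hreg u
  obtain ⟨L, w, hw, he⟩ := exists_lipschitz_rep hΩ.isOpen hΩ.isBounded hu hC0 (fun k => by
    rw [D1_toH1]; exact hC k)
  rw [val_toH1] at he
  refine ⟨w, hw.continuous, fun x hx => eq_zero_of_continuous_rep (g := val u) hΩ hw.continuous ?_ hx, he⟩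
  have hloc : LocallyIntegrable (ext0 (val u)) :=
    (integrable_ext0 hΩ.isOpen.measurableSet hΩ.isBounded _).locallyIntegrable
  filter_upwards [ae_mem_convSet hloc] with x hx using he hx

/-- The weak gradient of u − Q is at most `rem` on the open element, which is convex, so u − Q is
Lipschitz there. Continuity of w carries the bound to the closed element, where the nodes lie. -/
theorem abs_osc_sub_quad_le (hd : 0 < d) (hd3 : d ≤ 3) (hΩ : IsLipschitzDomain Ω)
    (h𝒯 : IsTriangulation Ω 𝒯) {σ : ℝ} (hσ : 0 < σ) (u : H 3 Ω) {w : E d → ℝ} (hw : Continuous w)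
    (he : EqOn w (ext0 (val u)) (convSet (ext0 (val u)))) (hs : s ∈ elements 𝒯) {c : E d}
    (hc : Metric.closedBall c (σ * Metric.diam (cell s)) ⊆ cell s) {Q : E d → ℝ}
    (hQ : ContDiff ℝ (⊤ : ℕ∞) Q) (hpd : ∀ k x, pd k Q x =
      affApprox (Metric.ball c (σ * Metric.diam (cell s) / 2)) (DH k u) x) {x y : E d}
    (hx : x ∈ cell s) (hy : y ∈ cell s) :
    |(w x - Q x) - (w y - Q y)| ≤ d * rem σ s c u * Metric.diam (cell s) := by
  have hΩm := hΩ.isOpen.measurableSet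
  have hloc : ∀ g : L2 Ω, LocallyIntegrable (ext0 g) := fun g =>
    (integrable_ext0 hΩm hΩ.isBounded _).locallyIntegrable
  set A := interior (cell s) ∩ convSet (ext0 (val u)) with hA
  have hcl : cell s ⊆ closure A := by
    have := closure_inter_convSet (K := interior (cell s)) isOpen_interior (hloc (val u))
    rwa [closure_interior_cell hs] at this
  have hpt : (x, y) ∈ closure (A ×ˢ A) := by
    rw [closure_prod_eq]; exact ⟨hcl hx, hcl hy⟩
  have hclosed : IsClosed {z : E d × E d | |(w z.1 - Q z.1) - (w z.2 - Q z.2)| ≤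
      d * rem σ s c u * Metric.diam (cell s)} := by
    have := hQ.continuous
    exact isClosed_le (by fun_prop) continuous_const
  refine closure_minimal ?_ hclosed hpt
  rintro ⟨x, y⟩ ⟨⟨hxK, hxc⟩, ⟨hyK, hyc⟩⟩
  have h := abs_sub_sub_le_of_weakDeriv (O := Ω) (K := interior (cell s)) (G := ext0 (val u))
    (Q := Q) (G' := fun k => ext0 (D1 k u)) (hloc _) (fun k => hloc _)
    (fun k => (isWeakPartial_val_D1 k u).weakDeriv hΩm) isOpen_interior (convex_cell s).interior
    (interior_cell_subset hΩ h𝒯 hs) hQ (η := rem σ s c u) (fun k => by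
      simp only [hpd]
      exact ae_abs_sub_le_rem hd hd3 hΩ h𝒯 hσ u hs hc k) hxK hyK hxc hyc
  simp only [mem_ofPred_eq]
  rw [he hxc, he hyc]
  refine h.trans (mul_le_mul_of_nonneg_left ?_ (mul_nonneg (Nat.cast_nonneg d) (rem_nonneg _ _ _ _)))
  rw [← dist_eq_norm]
  exact Metric.dist_le_diam_of_mem (isBounded_cell s) (interior_subset hxK) (interior_subset hyK)

/-- Quadratic interpolation of the continuous representative. On an element, ∂ₖ(u − I u) = ∂ₖ(u − Q)
− ∂ₖI(u − Q − C₀). The first term is at most `rem`. In the second the nodal values are at most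
d·`rem`·diam and the barycentric slopes at most 1/(σ diam), so the diameters cancel and leave 5(d +
1)²d/σ. -/
theorem exists_velocity_approx (hd : 0 < d) (hd3 : d ≤ 3) (hΩ : IsLipschitzDomain Ω)
    (h𝒯 : IsTriangulation Ω 𝒯) {σ : ℝ} (hσ : 0 < σ) (hreg : IsShapeRegular σ 𝒯) (u : H 3 Ω)
    (hu : toH1 u ∈ H10 Ω) : ∃ v ∈ H10 Ω, val v ∈ FE Ω 𝒯 2 ∧ ∀ k, ‖D1 k u - D1 k v‖ ≤
      2 * (1 + 5 * ((d : ℝ) + 1) ^ 2 * d / σ) * Real.sqrt ((2 / σ) ^ d) *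
        Fintype.card (Fin d × Fin d × Fin d) * meshSize 𝒯 ^ 2 * ‖u‖ := by
  have hΩm := hΩ.isOpen.measurableSet
  obtain ⟨w, hw, hw0, he⟩ := exists_lipschitz_rep_of_H3 hd hd3 hΩ h𝒯 hσ hreg u hu
  obtain ⟨L, hL⟩ := exists_lipschitzWith_pq hΩ h𝒯 hw0
  obtain ⟨v, hv, hval, hD⟩ := exists_H10_of_lipschitz hΩ.isOpen hΩ.isBounded hL
    fun x hx => pq_eq_zero hΩ h𝒯 hw0 hx
  refine ⟨v, hv, ⟨_, isPiecewisePoly_pq hΩ h𝒯 hw0, hval⟩, fun k => ?_⟩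
  refine norm_le_of_cells hd hΩ h𝒯 hσ hreg
    (G := fun ijk : Fin d × Fin d × Fin d => D1 ijk.2.2 (DH ijk.2.1 (DH ijk.1 u)))
    (by positivity) (norm_nonneg _)
    (fun ijk => (norm_D1_le _ _).trans ((norm_DH_le _ _).trans (norm_DH_le _ _))) ?_
  intro s hs c hc
  have hDpos := diam_cell_pos hd hs
  obtain ⟨a, S, hpd⟩ := exists_quad (Metric.ball c (σ * Metric.diam (cell s) / 2)) u
  set Q := quad a S with hQ
  have hQs : ContDiff ℝ (⊤ : ℕ∞) Q := contDiff_quad a S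
  obtain ⟨x₀, hx₀⟩ := interior_cell_nonempty hs
  -- Only the gradient of Q is matched to u; subtracting the value at one point makes the remainder,
  -- rather than just its oscillation, small at the nodes.
  set C₀ : ℝ := w x₀ - Q x₀ with hC₀
  set f : E d → ℝ := w - Q - fun _ => C₀ with hf
  have hfb : ∀ y ∈ cell s, |f y| ≤ d * rem σ s c u * Metric.diam (cell s) := fun y hy =>
    abs_osc_sub_quad_le hd hd3 hΩ h𝒯 hσ u hw he hs hc hQs hpd hy (interior_subset hx₀)
  have hrem := rem_nonneg σ s c u
  have hb : ∀ x ∈ cell s, |pd k (fun y => interp2 s y f) x| ≤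
      5 * ((d : ℝ) + 1) ^ 2 * d / σ * rem σ s c u := by
    intro x hx
    have h1 := abs_pd_interp2_le hs hx (f := f) (fun v hv => hfb v (subset_cell hv))
      (fun v hv w hw => hfb _ (midpoint_mem_cell hv hw))
      (fun v => abs_linear_bc_le hs (by positivity) hc v k) (by positivity)
    refine h1.trans (le_of_eq ?_)
    field_simp
  have hWeq : ∀ x ∈ interior (cell s), lineDeriv ℝ (pq 𝒯 w) x (EuclideanSpace.single k 1) =
      pd k (fun y => interp2 s y f) x + pd k Q x := by
    intro x hx
    have heq : pq 𝒯 w =ᶠ[𝓝 x] fun y => interp2 s y f + Q y + C₀ := by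
      filter_upwards [isOpen_interior.mem_nhds hx] with y hy
      rw [pq_eq hs (interior_subset hy), hf, map_sub, map_sub, interp2_quad hs, interp2_const hs]
      ring
    have hdiff : HasFDerivAt (fun y => interp2 s y f + Q y + C₀)
        (fderiv ℝ (fun y => interp2 s y f) x + fderiv ℝ Q x) x :=
      ((differentiable_interp2 s f x).hasFDerivAt.add
        ((hQs.differentiable (by simp)) x).hasFDerivAt).add_const C₀
    rw [heq.lineDeriv_eq, hdiff.differentiableAt.lineDeriv_eq_fderiv, hdiff.fderiv]
    rfl
  have hsub := Lp.coeFn_sub (D1 k u) (D1 k v)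
  have hDk := hD k
  rw [Filter.EventuallyEq, ae_restrict_iff' hΩm] at hsub hDk
  filter_upwards [ae_abs_sub_le_rem hd hd3 hΩ h𝒯 hσ u hs hc k, hsub, hDk] with x h1 h2 h3 hx
  have hxΩ := interior_cell_subset hΩ h𝒯 hs hx
  have e1 : ext0 (D1 k u - D1 k v) x =
      (ext0 (D1 k u) x - pd k Q x) - pd k (fun y => interp2 s y f) x := by
    simp only [ext0, indicator_of_mem hxΩ]
    rw [h2 hxΩ, Pi.sub_apply, h3 hxΩ, hWeq x hx]
    ring
  have h4 := h1 hx
  rw [← hpd] at h4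
  rw [e1]
  refine (abs_sub _ _).trans ((add_le_add h4 (hb x (interior_subset hx))).trans (le_of_eq ?_))
  rw [rem]; ring

/-- The approximation property of the Taylor–Hood spaces. -/
theorem exists_approxBound (hd : d = 2 ∨ d = 3) (hΩ : IsLipschitzDomain Ω) {σ : ℝ} (hσ : 0 < σ) :
    ∃ CA, 0 ≤ CA ∧ ApproxBound Ω σ CA := by
  have hd0 : 0 < d := by omega
  have hd3 : d ≤ 3 := by omega
  set c₁ : ℝ := 2 * 2 * Real.sqrt ((2 / σ) ^ d) * Fintype.card (Fin d × Fin d) with hc₁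
  set c₂ : ℝ := 2 * (1 + 5 * ((d : ℝ) + 1) ^ 2 * d / σ) * Real.sqrt ((2 / σ) ^ d) *
    Fintype.card (Fin d × Fin d × Fin d) with hc₂
  have h₁ : 0 ≤ c₁ := by positivity
  have h₂ : 0 ≤ c₂ := by positivity
  refine ⟨c₁ + d * c₂, by positivity, fun 𝒯 h𝒯 hreg => ⟨fun u hu => ?_, fun p => ?_⟩⟩
  · choose v hv hFE hb using fun i => exists_velocity_approx hd0 hd3 hΩ h𝒯 hσ hreg (u i) (hu i)
    refine ⟨WithLp.toLp 2 v, ⟨hv, hFE⟩, ?_⟩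
    have hcomp : ∀ i k, ‖D1 k ((toHV1 u - WithLp.toLp 2 v) i)‖ ≤ c₂ * meshSize 𝒯 ^ 2 * ‖u‖ := by
      intro i k
      have e : D1 k ((toHV1 u - WithLp.toLp 2 v) i) = D1 k (toH1 (u i)) - D1 k (v i) := rfl
      rw [e, D1_toH1]
      refine (hb i k).trans ?_
      gcongr
      exact PiLp.norm_apply_le u i
    have hsq : ‖grad (toHV1 u - WithLp.toLp 2 v)‖ ^ 2 ≤ (d * (c₂ * meshSize 𝒯 ^ 2 * ‖u‖)) ^ 2 := by
      rw [norm_sq_grad]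
      calc _ ≤ ∑ _i : Fin d, ∑ _k : Fin d, (c₂ * meshSize 𝒯 ^ 2 * ‖u‖) ^ 2 := by
            refine Finset.sum_le_sum fun i _ => Finset.sum_le_sum fun k _ => ?_
            exact pow_le_pow_left₀ (norm_nonneg _) (hcomp i k) 2
        _ = _ := by simp; ring
    have h3 := (abs_le_of_sq_le_sq' hsq (by positivity)).2
    refine h3.trans ?_
    have : 0 ≤ c₁ * meshSize 𝒯 ^ 2 * ‖u‖ := by positivity
    linarith
  · obtain ⟨q, hq, hb⟩ := exists_pressure_approx hd0 hd3 hΩ h𝒯 hσ hreg p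
    refine ⟨q, hq, hb.trans ?_⟩
    have : 0 ≤ d * c₂ * meshSize 𝒯 ^ 2 * ‖p‖ := by positivity
    linarith

end Velocity
end EnsembleNSE
end

/-! ### The error estimate for the ensemble. -/

open EnsembleNSE
theorem corollary1 {d : ℕ} (hd : d = 2 ∨ d = 3) (Ω : Set (E d)) (hΩ : IsLipschitzDomain Ω)
    (σ Cinv : ℝ) (hσ : 0 < σ) (hCinv : 0 < Cinv) :
    ∃ Ce : ℝ, 0 < Ce ∧
      ∀ (β : ℝ), 0 < β → ∀ (J : ℕ) (ν T : ℝ), 0 < ν → 0 < T →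
      ∀ (u ut : Fin J → ℝ → HV 3 Ω) (p : Fin J → ℝ → H 2 Ω) (f : Fin J → ℝ → L2V Ω),
      (∀ j, IsNSESolution Ω ν T (u j) (ut j) (p j) (f j)) →
      ∀ M : ℝ, ∃ C : ℝ, 0 < C ∧
        ∀ (𝒯 : Mesh d), IsTriangulation Ω 𝒯 → IsShapeRegular σ 𝒯 →
          InverseInequality Ω 𝒯 Cinv → LBB Ω 𝒯 β →
        ∀ (NT : ℕ) (Δt : ℝ), 0 < Δt → (NT : ℝ) * Δt = T →
          (∀ j, discreteNormSq Δt NT (p j) ≤ M) →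
        ∀ (uh : Fin J → ℕ → HV 1 Ω) (ph : Fin J → ℕ → L2 Ω),
          IsDiscreteSolution Ω 𝒯 ν Δt NT f uh ph →
          (∀ j, ∀ n, 2 ≤ n → n + 1 ≤ NT →
            Ce * (Δt / (ν * meshSize 𝒯)) * ‖grad (fluct uh j n)‖ ^ 2 ≤ 1) →
        ∀ (j : Fin J) (N : ℕ), 2 < N → N ≤ NT →
          energy ν Δt (err Δt (u j) (uh j)) N
            + 1 / 4 * ∑ n ∈ Finset.Ico 2 N,
                ‖valV (err Δt (u j) (uh j) (n + 1) - (3 : ℝ) • err Δt (u j) (uh j) n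
                  + (3 : ℝ) • err Δt (u j) (uh j) (n - 1) - err Δt (u j) (uh j) (n - 2))‖ ^ 2
          ≤ C * (meshSize 𝒯 ^ 4 + Δt ^ 4 + energy ν Δt (err Δt (u j) (uh j)) 2) := by
  have hd0 : 0 < d := by rcases hd with rfl | rfl <;> norm_num
  obtain ⟨Ct, hCt0, hCt, K, hK, hKb⟩ := exists_bstarBound hd hΩ.isOpen hΩ.isBounded
  obtain ⟨CP, hCP, hPoin⟩ := exists_poincare_vector hd hΩ.isOpen hΩ.isBounded
  obtain ⟨CA, hCA, hA⟩ := exists_approxBound hd hΩ hσ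
  -- C_e is fixed before β, ν and the data appear; K comes from trilinear estimates on Ω alone.
  refine ⟨12 * K ^ 2 * Cinv, by positivity, ?_⟩
  intro β hβ J ν T hν hT u ut p f hsol M
  choose C hC0 hC using fun j => exists_error_constant (M := M) hd0 hΩ.isOpen hΩ.isConnected.nonempty
    hΩ.isBounded hA hCA hCt0 hCt hK hKb hCP hPoin hCinv hβ hν hT (hsol j)
  -- The members decouple once the fluctuation is regarded as given, so each has its own constant.
  -- The sum dominates them all, and the 1 keeps it positive for an empty ensemble.
  refine ⟨1 + ∑ j, C j, by
    have := Finset.sum_nonneg fun j (_ : j ∈ Finset.univ) => (hC0 j).le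
    linarith, ?_⟩
  intro 𝒯 h𝒯 hreg hinv hLBB NT Δt hΔ hNT hp uh ph hdisc hCFL j N hN2 hNN
  have hmem : ∀ i, ∀ n, 2 ≤ n → n + 1 ≤ NT → extrap (uh i) n ∈ Xhsub Ω 𝒯 := fun i n _ hn =>
    ext3_mem (hdisc.mem_Xh i n (by omega)) (hdisc.mem_Xh i (n - 1) (by omega))
      (hdisc.mem_Xh i (n - 2) (by omega))
  have hfl : ∀ n, 2 ≤ n → n + 1 ≤ NT → fluct uh j n ∈ Xsub Ω := fun n hn hn1 =>
    Xhsub_le (sub_mem (hmem j n hn hn1) (Submodule.smul_mem _ _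
      (Submodule.sum_mem _ fun i _ => hmem i n hn hn1)))
  -- The remaining members enter the scheme for member j only through its fluctuation, on which the
  -- time step condition is imposed.
  have hmean : ∀ n, mean uh n = extrap (uh j) n - fluct uh j n := fun n => by
    simp only [fluct]; abel
  have key := hC j 𝒯 h𝒯 hreg hinv hLBB NT Δt hΔ hNT (hp j) (uh j) (fluct uh j) (ph j)
    (hdisc.mem_Xh j) (hdisc.mem_Qh j) hfl
    (fun n hn hn1 v hv => by
      rw [← hmean]
      exact hdisc.momentum j n hn hn1 v hv)
    (hdisc.incompressible j) (hCFL j) N hN2 hNN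
  refine key.trans (mul_le_mul_of_nonneg_right ?_ ?_)
  · have := Finset.single_le_sum (f := C) (fun i _ => (hC0 i).le) (Finset.mem_univ j)
    linarith
  · have h1 : 0 ≤ energy ν Δt (err Δt (u j) (uh j)) 2 := by
      rw [energy_eq_en3]
      exact en3_nonneg hν.le hΔ.le _ _ _
    positivity
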